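/- Let $M$ be one of the Dynkin diagrams $\mathrm A_n$ ($n\ge1$), $\mathrm D_n$ ($n\ge4$), $\mathrm E_6$, $\mathrm E_7$, $\mathrm E_8$, let $W=W(M)$ be its Weyl (Coxeter) group, $\Phi$ its root system with simple roots $\alpha_i$, normalized by $(\alpha,\alpha)=2$, and $\Phi^+$ the positive roots; $r_\alpha$ denotes the reflection in $\alpha$. $W$ acts on sets of mutually orthogonal positive roots: $wX$ consists of the positive roots among $\pm w\beta$, $\beta\in X$ (that is, $W$ acts by conjugation on the corresponding sets of commuting reflections). A set $X$ of mutually orthogonal positive roots is *admissible* if, whenever $\beta_1,\beta_2,\beta_3\in X$ are distinct and $\alpha\in\Phi$ satisfies $|(\alpha,\beta_i)|=1$ for $i=1,2,3$, the positive root among $\pm r_\alpha r_{\beta_1}r_{\beta_2}r_{\beta_3}\alpha$ lies in $X$. The $W$-orbit $\mathcal B$ of an admissible set is ordered by: $X<Y$ if and only if there are $\beta\in X\setminus Y$ and $\gamma\in Y\setminus X$, of minimal height in $X\setminus Y$ and $Y\setminus X$ respectively, with $\mathrm{ht}(\beta)<\mathrm{ht}(\gamma)$. Let $B_0$ be the highest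 element of $\mathcal B$, $C_{\mathcal B}$ the set of nodes $i$ of $M$ with $\alpha_i$ orthogonal to every element of $B_0$, and $W(C_{\mathcal B})$ the subgroup of $W$ generated by the $r_{\alpha_i}$, $i\in C_{\mathcal B}$. Write $k!!=1\cdot3\cdots(2k-1)$. **(i)** There are finitely many $W$-orbits $\mathcal B$ of admissible sets (including the orbit $\{\emptyset\}$), and $$\sum_{\mathcal B}|\mathcal B|^2\,|W(C_{\mathcal B})|=\begin{cases}(n+1)!!&M=\mathrm A_n,\\(2^n+1)\,n!!-(2^{n-1}+1)\,n!&M=\mathrm D_n,\\1440585&M=\mathrm E_6,\\139613625&M=\mathrm E_7,\\53328069225&M=\mathrm E_8.\end{cases}$$ **(ii)** The $W$-orbits $\mathcal B$ of nonempty admissible sets are exactly those in the following table. There is one orbit for each line and each value of $t$, except that the first line for $\mathrm D_n$ stands for two distinct orbits when $n=2t$, which are conjugate by an outer automorphism of $W$. Distinct lines, and distinct values of $t$ within a line, give distinct orbits. Here $1\le t\le (n+1)/2$ for $\mathrm A_n$ and $1\le t\le n/2$ for $\mathrm D_n$. Each orbit has a highest element, and the entries hold for every $X\in\mathcal B$.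 $$\begin{array}{c|cccc}M&|X|&X^\perp\cap\Phi&C_{\mathcal B}&N_W(X)/C_W(X)\\\hline \mathrm A_n&t&\mathrm A_{n-2t}&\mathrm A_{n-2t}&\Sigma_t\\ \mathrm D_n&t&\mathrm A_1^t\mathrm D_{n-2t}&\mathrm A_1\mathrm D_{n-2t}&\Sigma_t\\ \mathrm D_n&2t&\mathrm D_{n-2t}&\mathrm A_{n-2t-1}&W(\mathrm B_t)^*\\ \mathrm E_6&1&\mathrm A_5&\mathrm A_5&\Sigma_1\\ \mathrm E_6&2&\mathrm A_3&\mathrm A_2&\Sigma_2\\ \mathrm E_6&4&\emptyset&\emptyset&\Sigma_4\\ \mathrm E_7&1&\mathrm D_6&\mathrm D_6&\Sigma_1\\ \mathrm E_7&2&\mathrm A_1\mathrm D_4&\mathrm A_1\mathrm A_3&\Sigma_2\\ \mathrm E_7&3&\mathrm D_4&\mathrm A_2&\Sigma_3\\ \mathrm E_7&4&\mathrm A_1^3&\mathrm A_1&\Sigma_4\\ \mathrm E_7&7&\emptyset&\emptyset&\mathrm L(3,2)\\ \mathrm E_8&1&\mathrm E_7&\mathrm E_7&\Sigma_1\\ \mathrm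 E_8&2&\mathrm D_6&\mathrm A_5&\Sigma_2\\ \mathrm E_8&4&\mathrm D_4&\mathrm A_2&\Sigma_4\\ \mathrm E_8&8&\emptyset&\emptyset&2^3\mathrm L(3,2)\end{array}$$ The third and fourth columns give the Cartan type of the root system $X^\perp\cap\Phi$ and of the subdiagram of $M$ on $C_{\mathcal B}$; $\mathrm A_{-1},\mathrm A_0,\mathrm D_0,\mathrm D_1$ are empty, $\mathrm D_2=\mathrm A_1\mathrm A_1$, $\mathrm D_3=\mathrm A_3$. The last column gives the isomorphism type of the quotient of the stabilizer $N_W(X)$ of $X$ by the centralizer $C_W(X)$ of the reflections with roots in $X$; $\Sigma_t$ is the symmetric group, $W(\mathrm B_t)^*$ is $W(\mathrm B_t)$ if $t<n/2$ and $W(\mathrm D_t)$ if $t=n/2$, $\mathrm L(3,2)=\mathrm{PSL}_3(\mathbb F_2)$, and $2^3\mathrm L(3,2)$ is the affine group $\mathrm{AGL}_3(\mathbb F_2)$. Moreover $C_W(X)$ is the semidirect product of the elementary abelian group of order $2^{|X|}$ generated by the reflections with roots in $X$ and the subgroup $W(X^\perp\cap\Phi)$ generated by the reflections with roots in $X^\perp\cap\Phi$.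 -/

import Mathlib

/-!
Weyl groups, roots and admissible sets, for a Cartan matrix `C` indexed by the nodes `ι`.  Vectors
of `ι → ℤ` are elements of the root lattice, written in the basis of simple roots
`α_i = Pi.single i 1`.
-/

namespace ADE

/-- `W(J)`: the subgroup generated by the simple reflections
`r_i : x ↦ x - (∑ j, C i j * x j) • α_i` for the nodes `i ∈ J`. -/
def parabolicSubgroup {ι : Type} [Fintype ι] [DecidableEq ι] (C : Matrix ι ι ℤ) (J : Set ι) :
    Subgroup ((ι → ℤ) ≃ₗ[ℤ] (ι → ℤ)) :=
  Subgroup.closure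
    {w | ∃ i ∈ J, ∀ x : ι → ℤ, w x = x - (C.mulVec x i) • (Pi.single i 1 : ι → ℤ)}

/-- The group `W` generated by all simple reflections. -/
def weylGroup {ι : Type} [Fintype ι] [DecidableEq ι] (C : Matrix ι ι ℤ) :
    Subgroup ((ι → ℤ) ≃ₗ[ℤ] (ι → ℤ)) :=
  parabolicSubgroup C Set.univ

/-- The invariant form of a symmetric Cartan matrix: `(α_i, α_j) = C i j`. -/
def form {ι : Type} [Fintype ι] (C : Matrix ι ι ℤ) (x y : ι → ℤ) : ℤ :=
  x ⬝ᵥ C.mulVec y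

/-- The root system `Φ`: the images of the simple roots under `W`. -/
def roots {ι : Type} [Fintype ι] [DecidableEq ι] (C : Matrix ι ι ℤ) : Set (ι → ℤ) :=
  {β | ∃ w ∈ weylGroup C, ∃ i : ι, β = w (Pi.single i 1)}

/-- The positive roots `Φ⁺`: the roots with nonnegative coefficients on the simple roots. -/
def posRoots {ι : Type} [Fintype ι] [DecidableEq ι] (C : Matrix ι ι ℤ) : Set (ι → ℤ) :=
  {β | β ∈ roots C ∧ ∀ i, 0 ≤ β i}

/-- The reflection `r_β`, for a root `β` (so that `(β, β) = 2`). -/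
def refl {ι : Type} [Fintype ι] (C : Matrix ι ι ℤ) (β x : ι → ℤ) : ι → ℤ :=
  x - form C x β • β

/-- `X` is a set of mutually orthogonal positive roots. -/
def IsOrthogonalSet {ι : Type} [Fintype ι] [DecidableEq ι] (C : Matrix ι ι ℤ)
    (X : Set (ι → ℤ)) : Prop :=
  X ⊆ posRoots C ∧ ∀ β ∈ X, ∀ γ ∈ X, β ≠ γ → form C β γ = 0

/-- Admissible sets of mutually orthogonal positive roots. -/
def IsAdmissible {ι : Type} [Fintype ι] [DecidableEq ι] (C : Matrix ι ι ℤ)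
    (X : Set (ι → ℤ)) : Prop :=
  IsOrthogonalSet C X ∧
    ∀ β₁ ∈ X, ∀ β₂ ∈ X, ∀ β₃ ∈ X, β₁ ≠ β₂ → β₁ ≠ β₃ → β₂ ≠ β₃ →
      ∀ α ∈ roots C, |form C α β₁| = 1 → |form C α β₂| = 1 → |form C α β₃| = 1 →
        ∀ γ ∈ posRoots C,
          (γ = refl C α (refl C β₁ (refl C β₂ (refl C β₃ α))) ∨
            γ = -refl C α (refl C β₁ (refl C β₂ (refl C β₃ α)))) → γ ∈ X

/-- The action on sets of positive roots: replace `β` by the positive root of `±wβ`. -/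
def act {ι : Type} [Fintype ι] [DecidableEq ι] (C : Matrix ι ι ℤ)
    (w : (ι → ℤ) ≃ₗ[ℤ] (ι → ℤ)) (X : Set (ι → ℤ)) : Set (ι → ℤ) :=
  {γ | γ ∈ posRoots C ∧ ∃ β ∈ X, γ = w β ∨ γ = -w β}

/-- The `W`-orbit of a set of positive roots. -/
def orbit {ι : Type} [Fintype ι] [DecidableEq ι] (C : Matrix ι ι ℤ) (X : Set (ι → ℤ)) :
    Set (Set (ι → ℤ)) :=
  {Y | ∃ w ∈ weylGroup C, Y = act C w X}

/-- The `W`-orbits of admissible sets, including the orbit of the empty set. -/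
def admissibleOrbits {ι : Type} [Fintype ι] [DecidableEq ι] (C : Matrix ι ι ℤ) :
    Set (Set (Set (ι → ℤ))) :=
  {O | ∃ X, IsAdmissible C X ∧ O = orbit C X}

/-- The `W`-orbits of nonempty admissible sets. -/
def nonemptyAdmissibleOrbits {ι : Type} [Fintype ι] [DecidableEq ι] (C : Matrix ι ι ℤ) :
    Set (Set (Set (ι → ℤ))) :=
  {O | ∃ X, IsAdmissible C X ∧ X.Nonempty ∧ O = orbit C X}

/-- The height of a root. -/
def height {ι : Type} [Fintype ι] (β : ι → ℤ) : ℤ := ∑ i, β i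

/-- The ordering of an orbit of admissible sets: `X < Y` if there are `β ∈ X \ Y` and `γ ∈ Y \ X`,
of minimal height in these differences, such that `height β < height γ`. -/
def SetLT {ι : Type} [Fintype ι] (X Y : Set (ι → ℤ)) : Prop :=
  ∃ β ∈ X \ Y, ∃ γ ∈ Y \ X, (∀ β' ∈ X \ Y, height β ≤ height β') ∧
    (∀ γ' ∈ Y \ X, height γ ≤ height γ') ∧ height β < height γ

/-- `B` is the highest element of the orbit `O`. -/
def IsHighest {ι : Type} [Fintype ι] (O : Set (Set (ι → ℤ))) (B : Set (ι → ℤ)) : Prop :=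
  B ∈ O ∧ ∀ X ∈ O, X ≠ B → SetLT X B

/-- `C_O`: the nodes whose simple root is orthogonal to the highest element of the orbit `O`. -/
def orbitNodes {ι : Type} [Fintype ι] [DecidableEq ι] (C : Matrix ι ι ℤ)
    (O : Set (Set (ι → ℤ))) : Set ι :=
  {i | ∃ B, IsHighest O B ∧ ∀ β ∈ B, form C (Pi.single i 1) β = 0}

/-- The sum of `|O|² |W(C_O)|` over the `W`-orbits `O` of admissible sets. -/
noncomputable def orbitSum {ι : Type} [Fintype ι] [DecidableEq ι] (C : Matrix ι ι ℤ) : ℕ :=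
  ∑ᶠ O ∈ admissibleOrbits C, O.ncard ^ 2 * Nat.card (parabolicSubgroup C (orbitNodes C O))

/-- `X^⊥ ∩ Φ`. -/
def perpRoots {ι : Type} [Fintype ι] [DecidableEq ι] (C : Matrix ι ι ℤ) (X : Set (ι → ℤ)) :
    Set (ι → ℤ) :=
  {γ | γ ∈ roots C ∧ ∀ β ∈ X, form C γ β = 0}

/-- The set `R` of roots is a root system with Cartan matrix `P`: it is the image of the root
system of `P` under an isometric embedding of root lattices. -/
def HasCartanType {ι κ : Type} [Fintype ι] [Fintype κ] [DecidableEq κ]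
    (C : Matrix ι ι ℤ) (R : Set (ι → ℤ)) (P : Matrix κ κ ℤ) : Prop :=
  ∃ F : (κ → ℤ) →ₗ[ℤ] (ι → ℤ), Function.Injective F ∧
    (∀ x y, form C (F x) (F y) = form P x y) ∧ R = F '' roots P

/-- The set `J` of nodes, with the Cartan matrix induced by `C`, has Cartan matrix `D`. -/
def NodesHaveType {ι κ : Type} (C : Matrix ι ι ℤ) (J : Set ι) (D : Matrix κ κ ℤ) : Prop :=
  ∃ e : κ ≃ J, C.submatrix (fun k => (e k : ι)) (fun k => (e k : ι)) = D

/-- The reflections of `W` whose roots lie in `X`. -/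
def reflections {ι : Type} [Fintype ι] [DecidableEq ι] (C : Matrix ι ι ℤ) (X : Set (ι → ℤ)) :
    Set (weylGroup C) :=
  {w | ∃ β ∈ X, ∀ x, (w : (ι → ℤ) ≃ₗ[ℤ] (ι → ℤ)) x = refl C β x}

/-- `N_W(X)`: the stabilizer in `W` of `X`, that is, of the corresponding set of reflections under
conjugation. -/
def normW {ι : Type} [Fintype ι] [DecidableEq ι] (C : Matrix ι ι ℤ) (X : Set (ι → ℤ)) :
    Subgroup (weylGroup C) :=
  Subgroup.normalizer (reflections C X)

/-- `C_W(X)`: the centralizer in `W` of the set of reflections corresponding to `X`. -/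
def centW {ι : Type} [Fintype ι] [DecidableEq ι] (C : Matrix ι ι ℤ) (X : Set (ι → ℤ)) :
    Subgroup (weylGroup C) :=
  Subgroup.centralizer (reflections C X)

instance centW_normal {ι : Type} [Fintype ι] [DecidableEq ι] (C : Matrix ι ι ℤ)
    (X : Set (ι → ℤ)) : ((centW C X).subgroupOf (normW C X)).Normal :=
  Subgroup.normal_subgroupOf_centralizer_normalizer (reflections C X)

/-- `C_W(X)` is the semidirect product of the subgroup generated by the reflections with roots in
`X`, which is elementary abelian of order `2 ^ |X|`, and the subgroup `W(X^⊥ ∩ Φ)` generated by the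
reflections with roots in `X^⊥ ∩ Φ`. -/
def CentralizerSplits {ι : Type} [Fintype ι] [DecidableEq ι] (C : Matrix ι ι ℤ)
    (X : Set (ι → ℤ)) : Prop :=
  let K : Subgroup (weylGroup C) := Subgroup.closure (reflections C X)
  let L : Subgroup (weylGroup C) := Subgroup.closure (reflections C (perpRoots C X))
  K ≤ centW C X ∧ L ≤ centW C X ∧
    (K.subgroupOf (centW C X)).Normal ∧
    (K.subgroupOf (centW C X)).IsComplement' (L.subgroupOf (centW C X)) ∧
    (∀ g ∈ K, g * g = 1) ∧ Nat.card K = 2 ^ X.ncard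

/-- The orbit `O` is as described by a line of the table: its members `X` have size `k`,
`X^⊥ ∩ Φ` has type `P`, the type of `C_O` is `D`, and `N_W(X) / C_W(X)` is isomorphic to `G`. -/
structure IsTableLine {ι κ₁ κ₂ : Type} [Fintype ι] [DecidableEq ι] [Fintype κ₁] [DecidableEq κ₁]
    (C : Matrix ι ι ℤ) (O : Set (Set (ι → ℤ))) (k : ℕ) (P : Matrix κ₁ κ₁ ℤ) (D : Matrix κ₂ κ₂ ℤ)
    (G : Type) [Group G] : Prop where
  highest : ∃ B, IsHighest O B
  card : ∀ X ∈ O, X.ncard = k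
  perp : ∀ X ∈ O, HasCartanType C (perpRoots C X) P
  centralizer : ∀ X ∈ O, CentralizerSplits C X
  nodes : NodesHaveType C (orbitNodes C O) D
  quotient : ∀ X ∈ O, Nonempty ((normW C X ⧸ (centW C X).subgroupOf (normW C X)) ≃* G)

/-- Two orbits are conjugate by an outer automorphism of `W`. -/
def OuterConjugate {ι : Type} [Fintype ι] [DecidableEq ι] (C : Matrix ι ι ℤ)
    (O O' : Set (Set (ι → ℤ))) : Prop :=
  ∃ φ : MulAut (weylGroup C), φ ∉ (MulAut.conj : weylGroup C →* MulAut (weylGroup C)).range ∧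
    (fun X => φ '' reflections C X) '' O = (fun X => reflections C X) '' O'

/-- The disjoint union of two Cartan types. -/
def sumType {κ₁ κ₂ : Type} (P : Matrix κ₁ κ₁ ℤ) (Q : Matrix κ₂ κ₂ ℤ) :
    Matrix (κ₁ ⊕ κ₂) (κ₁ ⊕ κ₂) ℤ :=
  Matrix.fromBlocks P 0 0 Q

/-- The type `A₁ᵗ`. -/
def typeA1Pow (t : ℕ) : Matrix (Fin t) (Fin t) ℤ := Matrix.diagonal fun _ => 2

/-- The type `Dₖ` as it occurs in the table, for all `k ≥ 0`.  The roots `±ε_i ± ε_j` with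
`i < j ≤ k` form the empty system if `k = 0, 1`, so `D₁` has no nodes; `D₂` is `A₁A₁` and `D₃` is
`A₃`. -/
def typeD (k : ℕ) : Matrix {_i : Fin k // k ≠ 1} {_i : Fin k // k ≠ 1} ℤ :=
  (CartanMatrix.D k).submatrix Subtype.val Subtype.val

/-- `k!! = 1 · 3 ⋯ (2k - 1)`, the product of the first `k` odd numbers. -/
def oddFactorial (k : ℕ) : ℕ := ∏ i ∈ Finset.range k, (2 * i + 1)

end ADE

set_option linter.unusedSectionVars false

namespace ADE

open CartanMatrix

/-! Everything rests on one fact about simply laced types: the root lattice is even and positive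
definite, and the roots are exactly its vectors of norm 2 (`mem_roots_iff`). Questions about roots,
reflections and orbits thus become questions about integral vectors and isometries, treated
uniformly for matrices satisfying `IsSL`.

Admissibility has an equivalent form that is visibly invariant under isometries. If a root `α` has
inner product `±1` with three members of an orthogonal set, then `2α - Σ (α, βᵢ) βᵢ` again has norm
2, and up to sign it lies in the set exactly when a fourth member has inner product `±1` with `α`.
This is `isAdmissible_of_exists_fourth` and `IsAdmissible.exists_fourth`.

An element of `C_W(X)` changes signs of members of `X`; once the signs are cancelled by reflections
in `X`, it fixes `X` pointwise. A pointwise stabilizer is generated by the reflections it contains: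
for one dominant vector this follows from the exchange condition, and a set is replaced by a single
generic integral combination of its members (`mem_reflSubgroup_of_fix`). This gives
`centralizerSplits`, and with orbit counting `card_weylGroup_eq`: the order of `W` is the product of
the orbit size, `|N/C|`, `2^|X|` and the order of the Weyl group of `X^⊥ ∩ Φ`. A line of the table
therefore determines the size of its orbit and its term in the sum. The highest element is
recognized by a height threshold (`isHighest_of_height`): all its members reach the threshold, and
every other member of the orbit contains a root below it.

In types A and D one works in coordinates, where `W` is the group of permutations, or of signed
permutations with an even number of sign changes. In type A every orthogonal set is a matching of
coordinates and is admissible. In type D an admissible set is either a matching with signs or a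
union of pairs `e_p ± e_q`, mixtures being excluded by `IsAdmissible.neg_mem_D`. The product of the
signs of a matching is an invariant only if no coordinate is spare, hence the two orbits for `n =
2t`. The highest set is unique because the height bounds are inequalities between coordinates whose
sums force equality throughout. The sums reduce to `Σ n!² / (4ᵗ t!² (n - 2t)!)`, which satisfies a
telescoping recurrence (`sum_matchTerm`).

In types E the 120 positive roots of `E₈` are tabulated, with those of `E₆` and `E₇` as initial
segments, and finite checks are evaluated on decimal codes. For the classification, a conjugate of
the given set is made to contain prescribed roots one at a time (`IsRootTable.step`), while further
roots are forced by the closure condition. The highest elements come from an exhaustive search among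
orthogonal sets of high roots (`IsRootTable.highest`). The quotients `N/C` are full symmetric groups
because transpositions are products of two reflections. The two exceptions are the set of seven
roots in `E₇`, to which the zero vector is adjoined, and the set of eight in `E₈`. These are indexed
by the points of `𝔽₂³`: modulo 2 every induced permutation is affine, every shear is induced, and
shears generate the linear or affine group (`quotient_seven`, `quotient_eight`). The orders of the
groups `W(E_n)` come from the orbit of one root, whose size is the number of positive roots. -/

/-- The automorphisms of the root lattice. -/
abbrev LatticeAut (ι : Type) := (ι → ℤ) ≃ₗ[ℤ] (ι → ℤ)

/-! ### Even positive definite lattices and their roots -/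

section General

variable {ι : Type} [Fintype ι]

section FormAlgebra

variable (C : Matrix ι ι ℤ)

theorem form_add_left (x y z : ι → ℤ) : form C (x + y) z = form C x z + form C y z := by
  simp [form, add_dotProduct]

theorem form_add_right (x y z : ι → ℤ) : form C x (y + z) = form C x y + form C x z := by
  simp [form, Matrix.mulVec_add, dotProduct_add]

theorem form_neg_left (x y : ι → ℤ) : form C (-x) y = -form C x y := by
  simp [form]

theorem form_neg_right (x y : ι → ℤ) : form C x (-y) = -form C x y := by
  simp [form, Matrix.mulVec_neg]

theorem form_sub_left (x y z : ι → ℤ) : form C (x - y) z = form C x z - form C y z := by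
  rw [sub_eq_add_neg, form_add_left, form_neg_left, sub_eq_add_neg]

theorem form_sub_right (x y z : ι → ℤ) : form C x (y - z) = form C x y - form C x z := by
  rw [sub_eq_add_neg, form_add_right, form_neg_right, sub_eq_add_neg]

theorem form_smul_left (a : ℤ) (x y : ι → ℤ) : form C (a • x) y = a * form C x y := by
  unfold form
  rw [smul_dotProduct, smul_eq_mul]

theorem form_smul_right (a : ℤ) (x y : ι → ℤ) : form C x (a • y) = a * form C x y := by
  unfold form
  rw [Matrix.mulVec_smul, dotProduct_smul, smul_eq_mul]

@[simp] theorem form_zero_right (x : ι → ℤ) : form C x 0 = 0 := by simp [form]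

theorem form_sum_left {κ : Type*} (s : Finset κ) (f : κ → ι → ℤ) (y : ι → ℤ) :
    form C (∑ k ∈ s, f k) y = ∑ k ∈ s, form C (f k) y := by
  simp [form, sum_dotProduct]

theorem form_sum_right {κ : Type*} (s : Finset κ) (f : κ → ι → ℤ) (x : ι → ℤ) :
    form C x (∑ k ∈ s, f k) = ∑ k ∈ s, form C x (f k) := by
  classical
  induction s using Finset.induction_on with
  | empty => simp
  | insert a s ha ih => rw [Finset.sum_insert ha, Finset.sum_insert ha, form_add_right, ih]

theorem form_comm {C : Matrix ι ι ℤ} (hC : C.IsSymm) (x y : ι → ℤ) :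
    form C x y = form C y x := by
  unfold form
  rw [Matrix.dotProduct_mulVec, ← Matrix.mulVec_transpose, hC.eq, dotProduct_comm]

variable [DecidableEq ι]

theorem form_single_left (i : ι) (x : ι → ℤ) : form C (Pi.single i 1) x = C.mulVec x i := by
  simp [form]

theorem form_single_single (i j : ι) : form C (Pi.single i 1) (Pi.single j 1) = C i j := by
  simp [form]

theorem eq_sum_single (x : ι → ℤ) : x = ∑ i, x i • (Pi.single i 1 : ι → ℤ) := by
  conv_lhs => rw [← Finset.univ_sum_single x]
  exact Finset.sum_congr rfl fun i _ => by rw [← Pi.single_smul]; simp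

theorem form_eq_sum (x y : ι → ℤ) : form C x y = ∑ i, x i * form C (Pi.single i 1) y := by
  conv_lhs => rw [eq_sum_single x]
  rw [form_sum_left]
  exact Finset.sum_congr rfl fun i _ => form_smul_left C _ _ _

end FormAlgebra

/-- A symmetric Cartan matrix with positive definite form. -/
structure IsSL (C : Matrix ι ι ℤ) : Prop where
  symm : C.IsSymm
  diag : ∀ i, C i i = 2
  offDiag : ∀ i j, i ≠ j → C i j ≤ 0
  pos : ∀ x, x ≠ 0 → 0 < form C x x

variable {C : Matrix ι ι ℤ}

namespace IsSL

theorem comm (hC : IsSL C) (x y : ι → ℤ) : form C x y = form C y x := form_comm hC.symm x y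

theorem nonneg (hC : IsSL C) (x : ι → ℤ) : 0 ≤ form C x x := by
  by_cases h : x = 0
  · simp [h]
  · exact (hC.pos x h).le

theorem eq_zero (hC : IsSL C) {x : ι → ℤ} (h : form C x x = 0) : x = 0 := by
  by_contra h'
  exact absurd (hC.pos x h') (by omega)

theorem form_add_self (hC : IsSL C) (x y : ι → ℤ) :
    form C (x + y) (x + y) = form C x x + 2 * form C x y + form C y y := by
  rw [form_add_left, form_add_right, form_add_right, hC.comm y x]; ring

theorem form_sub_self (hC : IsSL C) (x y : ι → ℤ) :
    form C (x - y) (x - y) = form C x x - 2 * form C x y + form C y y := by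
  rw [form_sub_left, form_sub_right, form_sub_right, hC.comm y x]; ring

variable [DecidableEq ι]

/-- Modulo 2 the norm is additive, since the cross term is doubled, and a multiple `a αᵢ` has norm
`2a²`. -/
theorem even (hC : IsSL C) (x : ι → ℤ) : Even (form C x x) := by
  rw [eq_sum_single x]
  refine Finset.sum_induction _ (fun v => Even (form C v v)) ?_ (by simp) ?_
  · intro a b ha hb
    rw [hC.form_add_self]
    exact (ha.add (even_two_mul _)).add hb
  · intro i _
    rw [form_smul_left, form_smul_right, form_single_single, hC.diag]
    exact ⟨x i * x i, by ring⟩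

theorem norm_single (hC : IsSL C) (i : ι) :
    form C (Pi.single i 1) (Pi.single i 1) = 2 := by
  rw [form_single_single, hC.diag]

theorem two_le (hC : IsSL C) {x : ι → ℤ} (h : x ≠ 0) : 2 ≤ form C x x := by
  have := hC.pos x h
  obtain ⟨k, hk⟩ := hC.even x
  omega

/-- Split `x = p - q` into positive and negative parts. They have disjoint supports, so only
off-diagonal entries enter `(p, q)`, which is therefore at most 0. If both parts were nonzero, the
norm of `x` would be at least `2 + 2`. -/
theorem nonneg_or_nonpos (hC : IsSL C) {x : ι → ℤ} (h : form C x x = 2) :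
    (∀ i, 0 ≤ x i) ∨ (∀ i, x i ≤ 0) := by
  set p : ι → ℤ := fun i => max (x i) 0 with hp
  set q : ι → ℤ := fun i => max (-x i) 0 with hq
  have hx : x = p - q := by
    funext i; simp only [hp, hq, Pi.sub_apply]; omega
  have hpq : form C p q ≤ 0 := by
    unfold form
    simp only [dotProduct, Matrix.mulVec, Finset.mul_sum]
    refine Finset.sum_nonpos fun i _ => Finset.sum_nonpos fun j _ => ?_
    have hpi : 0 ≤ p i := le_max_right _ _
    have hqj : 0 ≤ q j := le_max_right _ _
    by_cases hij : i = j
    · subst hij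
      rcases le_total (x i) 0 with h0 | h0
      · have : p i = 0 := by simp [hp, h0]
        simp [this]
      · have : q i = 0 := by simp [hq, h0]
        simp [this]
    · exact mul_nonpos_of_nonneg_of_nonpos hpi
        (mul_nonpos_of_nonpos_of_nonneg (hC.offDiag i j hij) hqj)
  rw [hx, hC.form_sub_self] at h
  by_cases hp0 : p = 0
  · right
    intro i
    have := congrFun hp0 i
    simp only [hp, Pi.zero_apply] at this
    omega
  by_cases hq0 : q = 0
  · left
    intro i
    have := congrFun hq0 i
    simp only [hq, Pi.zero_apply] at this
    omega
  have h1 := hC.two_le hp0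
  have h2 := hC.two_le hq0
  omega

theorem abs_le (hC : IsSL C) {x y : ι → ℤ} (hx : form C x x = 2) (hy : form C y y = 2) :
    |form C x y| ≤ 2 := by
  have h1 := hC.nonneg (x + y)
  have h2 := hC.nonneg (x - y)
  rw [hC.form_add_self] at h1
  rw [hC.form_sub_self] at h2
  rw [_root_.abs_le]
  constructor <;> omega

theorem eq_of_form_eq_two (hC : IsSL C) {x y : ι → ℤ} (hx : form C x x = 2)
    (hy : form C y y = 2) (h : form C x y = 2) : x = y := by
  apply sub_eq_zero.mp
  apply hC.eq_zero
  rw [hC.form_sub_self]; omega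

theorem eq_neg_of_form_eq_neg_two (hC : IsSL C) {x y : ι → ℤ} (hx : form C x x = 2)
    (hy : form C y y = 2) (h : form C x y = -2) : x = -y := by
  apply eq_neg_of_add_eq_zero_left
  apply hC.eq_zero
  rw [hC.form_add_self]; omega

end IsSL

theorem refl_apply (C : Matrix ι ι ℤ) (β x : ι → ℤ) : refl C β x = x - form C x β • β := rfl

theorem refl_refl {β : ι → ℤ} (hβ : form C β β = 2) (x : ι → ℤ) :
    refl C β (refl C β x) = x := by
  simp only [refl_apply, form_sub_left, form_smul_left, hβ]
  module

/-- The reflection in a vector of norm `2` as a linear automorphism. -/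
def reflE (C : Matrix ι ι ℤ) (β : ι → ℤ) (hβ : form C β β = 2) : LatticeAut ι where
  toFun := refl C β
  invFun := refl C β
  map_add' x y := by simp only [refl_apply, form_add_left]; module
  map_smul' a x := by simp only [refl_apply, form_smul_left, RingHom.id_apply]; module
  left_inv := refl_refl hβ
  right_inv := refl_refl hβ

@[simp] theorem reflE_apply (β : ι → ℤ) (hβ : form C β β = 2) (x : ι → ℤ) :
    reflE C β hβ x = x - form C x β • β := rfl

theorem reflE_mul_self (β : ι → ℤ) (hβ : form C β β = 2) :
    reflE C β hβ * reflE C β hβ = 1 := by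
  ext1 x
  exact refl_refl hβ x

theorem reflE_self (β : ι → ℤ) (hβ : form C β β = 2) : reflE C β hβ β = -β := by
  rw [reflE_apply, hβ]; module

theorem reflE_of_orth {β : ι → ℤ} (hβ : form C β β = 2) {x : ι → ℤ} (h : form C x β = 0) :
    reflE C β hβ x = x := by
  rw [reflE_apply, h]; module

/-- The automorphisms of the lattice that preserve the form. -/
def isometries (C : Matrix ι ι ℤ) : Subgroup (LatticeAut ι) where
  carrier := {g | ∀ x y, form C (g x) (g y) = form C x y}
  one_mem' _ _ := rfl
  mul_mem' {a b} ha hb x y := (ha (b x) (b y)).trans (hb x y)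
  inv_mem' {a} ha x y := by
    have := ha (a⁻¹ x) (a⁻¹ y)
    rw [← this]
    change form C ((a * a⁻¹) x) ((a * a⁻¹) y) = _
    simp

theorem mem_isometries {g : LatticeAut ι} :
    g ∈ isometries C ↔ ∀ x y, form C (g x) (g y) = form C x y := Iff.rfl

theorem inv_apply_self' (g : LatticeAut ι) (x : ι → ℤ) : g⁻¹ (g x) = x := by
  change (g⁻¹ * g) x = x
  simp

theorem apply_inv_self' (g : LatticeAut ι) (x : ι → ℤ) : g (g⁻¹ x) = x := by
  change (g * g⁻¹) x = x
  simp

theorem form_inv_left {g : LatticeAut ι} (hg : g ∈ isometries C) (x y : ι → ℤ) :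
    form C (g⁻¹ x) y = form C x (g y) := by
  rw [← hg (g⁻¹ x) y, apply_inv_self']

theorem reflE_mem_isometries (hC : IsSL C) (β : ι → ℤ) (hβ : form C β β = 2) :
    reflE C β hβ ∈ isometries C := by
  intro x y
  simp only [reflE_apply, form_sub_left, form_sub_right, form_smul_left, form_smul_right, hβ,
    hC.comm β y]
  ring

theorem conj_reflE {g : LatticeAut ι} (hg : g ∈ isometries C) (β : ι → ℤ)
    (hβ : form C β β = 2) :
    g * reflE C β hβ * g⁻¹ = reflE C (g β) (by rw [hg, hβ]) := by
  ext1 x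
  change g (reflE C β hβ (g⁻¹ x)) = _
  rw [reflE_apply, reflE_apply, map_sub, map_smul, apply_inv_self', form_inv_left hg]

variable [DecidableEq ι]

theorem generator_eq_reflE (hC : IsSL C) {i : ι} {w : LatticeAut ι}
    (hw : ∀ x : ι → ℤ, w x = x - (C.mulVec x i) • (Pi.single i 1 : ι → ℤ)) :
    w = reflE C (Pi.single i 1) (hC.norm_single i) := by
  ext1 x
  rw [hw, reflE_apply, hC.comm, form_single_left]

theorem parabolicSubgroup_eq (hC : IsSL C) (J : Set ι) :
    parabolicSubgroup C J =
      Subgroup.closure ((fun i => reflE C (Pi.single i 1) (hC.norm_single i)) '' J) := by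
  unfold parabolicSubgroup
  congr 1
  ext w
  constructor
  · rintro ⟨i, hi, hw⟩
    exact ⟨i, hi, (generator_eq_reflE hC hw).symm⟩
  · rintro ⟨i, hi, rfl⟩
    exact ⟨i, hi, fun x => by rw [reflE_apply, hC.comm, form_single_left]⟩

theorem simple_mem_weylGroup (hC : IsSL C) (i : ι) :
    reflE C (Pi.single i 1) (hC.norm_single i) ∈ weylGroup C := by
  rw [weylGroup, parabolicSubgroup_eq hC]
  exact Subgroup.subset_closure ⟨i, trivial, rfl⟩

theorem weylGroup_le_isometries (hC : IsSL C) : weylGroup C ≤ isometries C := by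
  rw [weylGroup, parabolicSubgroup_eq hC, Subgroup.closure_le]
  rintro _ ⟨i, -, rfl⟩
  exact reflE_mem_isometries hC _ _

theorem norm_of_mem_roots (hC : IsSL C) {β : ι → ℤ} (h : β ∈ roots C) : form C β β = 2 := by
  obtain ⟨w, hw, i, rfl⟩ := h
  rw [weylGroup_le_isometries hC hw, hC.norm_single]

theorem single_mem_roots (i : ι) : (Pi.single i 1 : ι → ℤ) ∈ roots C :=
  ⟨1, one_mem _, i, rfl⟩

theorem apply_mem_roots {w : LatticeAut ι} (hw : w ∈ weylGroup C) {β : ι → ℤ}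
    (h : β ∈ roots C) : w β ∈ roots C := by
  obtain ⟨u, hu, i, rfl⟩ := h
  exact ⟨w * u, mul_mem hw hu, i, rfl⟩

theorem reflE_mem_weylGroup_of_mem_roots (hC : IsSL C) {β : ι → ℤ} (h : β ∈ roots C)
    (hβ : form C β β = 2) : reflE C β hβ ∈ weylGroup C := by
  obtain ⟨w, hw, i, rfl⟩ := h
  have := conj_reflE (weylGroup_le_isometries hC hw) (Pi.single i 1) (hC.norm_single i)
  rw [← this]
  exact mul_mem (mul_mem hw (simple_mem_weylGroup hC i)) (inv_mem hw)

theorem height_sub (x y : ι → ℤ) : height (x - y) = height x - height y := by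
  simp [height]

theorem height_neg (x : ι → ℤ) : height (-x) = -height x := by
  simp [height]

theorem height_smul (a : ℤ) (x : ι → ℤ) : height (a • x) = a * height x := by
  simp [height, Finset.mul_sum]

theorem height_single (i : ι) : height (Pi.single i 1 : ι → ℤ) = 1 := by
  simp [height]

/-- Since `(x, x) = Σ xᵢ (αᵢ, x)` is positive, some node has both `xᵢ` and `(αᵢ, x)` positive.
Either `x` is that simple root, or its reflection `x - αᵢ` has smaller height and still nonnegative
coefficients. -/
theorem mem_roots_of_nonneg (hC : IsSL C) (n : ℕ) : ∀ x : ι → ℤ, form C x x = 2 →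
    (∀ i, 0 ≤ x i) → height x ≤ n → x ∈ roots C := by
  induction n with
  | zero =>
    intro x hx h0 hh
    have : ∀ i ∈ Finset.univ, x i = 0 := by
      refine (Finset.sum_eq_zero_iff_of_nonneg fun i _ => h0 i).mp ?_
      have h1 : 0 ≤ height x := Finset.sum_nonneg fun i _ => h0 i
      unfold height at *
      push_cast at hh
      omega
    have hx0 : x = 0 := funext fun i => this i (Finset.mem_univ i)
    simp [hx0] at hx
  | succ n ih =>
    intro x hx h0 hh
    have hsum := form_eq_sum C x x
    obtain ⟨i, -, hi⟩ : ∃ i ∈ Finset.univ, 0 < x i * form C (Pi.single i 1) x := by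
      apply Finset.exists_lt_of_sum_lt
      rw [← hsum, hx]; simp
    have hfi : 0 < form C (Pi.single i 1) x := by
      by_contra h
      have := mul_nonpos_of_nonneg_of_nonpos (h0 i) (not_lt.mp h)
      omega
    have hxi : 0 < x i := by
      rcases (h0 i).lt_or_eq with h | h
      · exact h
      · rw [← h] at hi; simp at hi
    have hle := abs_le.mp (hC.abs_le (hC.norm_single i) hx)
    rcases (show form C (Pi.single i 1) x = 1 ∨ form C (Pi.single i 1) x = 2 by omega) with h | h
    · have hr : reflE C (Pi.single i 1) (hC.norm_single i) x = x - Pi.single i 1 := by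
        rw [reflE_apply, hC.comm, h]; module
      have hmem : x - Pi.single i 1 ∈ roots C := by
        apply ih
        · rw [← hr, reflE_mem_isometries hC _ _, hx]
        · intro j
          by_cases hj : j = i
          · subst hj; simp; omega
          · simp [hj, h0 j]
        · rw [height_sub, height_single]; push_cast at hh; omega
      have h2 := apply_mem_roots (simple_mem_weylGroup hC i) hmem
      rwa [← hr, ← LinearEquiv.mul_apply, reflE_mul_self] at h2
    · rw [← hC.eq_of_form_eq_two (hC.norm_single i) hx h]
      exact single_mem_roots i

theorem neg_mem_roots (hC : IsSL C) {β : ι → ℤ} (h : β ∈ roots C) : -β ∈ roots C := by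
  have hβ := norm_of_mem_roots hC h
  rw [← reflE_self β hβ]
  exact apply_mem_roots (reflE_mem_weylGroup_of_mem_roots hC h hβ) h

/-- Replaces the definition of roots as an orbit by an equation, so that isometries outside `W` also
act on the root system and new roots can be exhibited by computing a norm. -/
theorem mem_roots_iff (hC : IsSL C) {β : ι → ℤ} : β ∈ roots C ↔ form C β β = 2 := by
  refine ⟨norm_of_mem_roots hC, fun h => ?_⟩
  rcases hC.nonneg_or_nonpos h with h0 | h0
  · exact mem_roots_of_nonneg hC (height β).toNat β h h0 (Int.self_le_toNat _)
  · rw [← neg_neg β]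
    refine neg_mem_roots hC (mem_roots_of_nonneg hC (height (-β)).toNat _ ?_ ?_
      (Int.self_le_toNat _))
    · rw [form_neg_left, form_neg_right, h]; rfl
    · intro i; simpa using h0 i

theorem reflE_mem_weylGroup (hC : IsSL C) (β : ι → ℤ) (hβ : form C β β = 2) :
    reflE C β hβ ∈ weylGroup C :=
  reflE_mem_weylGroup_of_mem_roots hC ((mem_roots_iff hC).mpr hβ) hβ

theorem height_ne_zero (hC : IsSL C) {β : ι → ℤ} (h : form C β β = 2) : height β ≠ 0 := by
  intro hh
  have key : ∀ x : ι → ℤ, (∀ i, 0 ≤ x i) → height x = 0 → x = 0 := fun x hx h0 =>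
    funext fun i => (Finset.sum_eq_zero_iff_of_nonneg fun i _ => hx i).mp h0 i (Finset.mem_univ i)
  rcases hC.nonneg_or_nonpos h with h0 | h0
  · rw [key β h0 hh] at h; simp at h
  · have := key (-β) (fun i => by simpa using h0 i) (by rw [height_neg, hh]; rfl)
    rw [neg_eq_zero] at this
    rw [this] at h; simp at h

/-- Because the coefficients of a root have one sign, the sign of the height alone decides
positivity. -/
theorem mem_posRoots_iff (hC : IsSL C) {β : ι → ℤ} :
    β ∈ posRoots C ↔ form C β β = 2 ∧ 0 < height β := by
  constructor
  · rintro ⟨h, h0⟩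
    have h2 := (mem_roots_iff hC).mp h
    have : 0 ≤ height β := Finset.sum_nonneg fun i _ => h0 i
    exact ⟨h2, lt_of_le_of_ne this (height_ne_zero hC h2).symm⟩
  · rintro ⟨h, hh⟩
    refine ⟨(mem_roots_iff hC).mpr h, ?_⟩
    rcases hC.nonneg_or_nonpos h with h0 | h0
    · exact h0
    · have : height β ≤ 0 := Finset.sum_nonpos fun i _ => h0 i
      omega

theorem pos_or_neg_mem (hC : IsSL C) {β : ι → ℤ} (h : form C β β = 2) :
    β ∈ posRoots C ∨ -β ∈ posRoots C := by
  rcases lt_trichotomy (height β) 0 with h0 | h0 | h0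
  · right
    rw [mem_posRoots_iff hC, form_neg_left, form_neg_right, height_neg]
    constructor <;> omega
  · exact absurd h0 (height_ne_zero hC h)
  · exact Or.inl ((mem_posRoots_iff hC).mpr ⟨h, h0⟩)

theorem neg_notMem_posRoots (hC : IsSL C) {β : ι → ℤ} (h : β ∈ posRoots C) :
    -β ∉ posRoots C := by
  rw [mem_posRoots_iff hC] at *
  rw [height_neg]; omega

theorem norm_of_mem_posRoots (hC : IsSL C) {β : ι → ℤ} (h : β ∈ posRoots C) : form C β β = 2 :=
  ((mem_posRoots_iff hC).mp h).1

theorem eq_of_eq_or_eq_neg (hC : IsSL C) {β γ : ι → ℤ} (hβ : β ∈ posRoots C)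
    (hγ : γ ∈ posRoots C) (h : β = γ ∨ β = -γ) : β = γ := by
  rcases h with h | h
  · exact h
  · rw [h] at hβ
    exact absurd hβ (neg_notMem_posRoots hC hγ)

theorem single_mem_posRoots (hC : IsSL C) (i : ι) : (Pi.single i 1 : ι → ℤ) ∈ posRoots C := by
  rw [mem_posRoots_iff hC, height_single]
  exact ⟨hC.norm_single i, one_pos⟩

theorem mulVec_injective (hC : IsSL C) : Function.Injective C.mulVec := by
  intro x y h
  apply sub_eq_zero.mp
  apply hC.eq_zero
  unfold form
  rw [Matrix.mulVec_sub, h, sub_self, dotProduct_zero]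

/-- A vector is determined by its inner products with the simple roots, and for roots these lie
between -2 and 2. -/
theorem roots_finite (hC : IsSL C) : (roots C).Finite := by
  refine Set.Finite.of_injOn (f := C.mulVec) (t := Set.Icc (fun _ => -2) (fun _ => 2)) ?_
    (mulVec_injective hC).injOn (Set.finite_Icc _ _)
  intro x hx
  have h := fun i => abs_le.mp (hC.abs_le (hC.norm_single i) ((mem_roots_iff hC).mp hx))
  simp only [form_single_left] at h
  exact ⟨fun i => (h i).1, fun i => (h i).2⟩

theorem posRoots_finite (hC : IsSL C) : (posRoots C).Finite :=
  (roots_finite hC).subset fun _ h => h.1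

theorem ext_single {g h : LatticeAut ι}
    (hgh : ∀ i, g (Pi.single i 1) = h (Pi.single i 1)) : g = h := by
  ext1 x
  rw [eq_sum_single x, map_sum, map_sum]
  exact Finset.sum_congr rfl fun i _ => by rw [map_smul, map_smul, hgh]

theorem isometries_finite (hC : IsSL C) : (isometries C : Set (LatticeAut ι)).Finite := by
  refine Set.Finite.of_injOn (f := fun g i => g (Pi.single i 1))
    (t := Set.pi Set.univ fun _ : ι => roots C) ?_ ?_
    (Set.Finite.pi fun _ => roots_finite hC)
  · intro g hg i _
    rw [mem_roots_iff hC, hg, hC.norm_single]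
  · intro g _ h _ hgh
    exact ext_single fun i => congrFun hgh i

end General

/-! ### Pointwise stabilizers are generated by reflections -/

section Fixer

variable {ι : Type} [Fintype ι] [DecidableEq ι] {C : Matrix ι ι ℤ}

/-- The simple reflection at the node `i`. -/
def simpleE (hC : IsSL C) (i : ι) : LatticeAut ι :=
  reflE C (Pi.single i 1) (hC.norm_single i)

theorem simpleE_mem (hC : IsSL C) (i : ι) : simpleE hC i ∈ weylGroup C := simple_mem_weylGroup hC i

/-- A positive root other than `αᵢ` has a positive coefficient at another node, and the reflection
at `i` leaves that coefficient unchanged. -/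
theorem simpleE_mem_posRoots (hC : IsSL C) {i : ι} {β : ι → ℤ} (hβ : β ∈ posRoots C)
    (h : β ≠ Pi.single i 1) : simpleE hC i β ∈ posRoots C := by
  have hn := norm_of_mem_posRoots hC hβ
  have hr : simpleE hC i β ∈ roots C := apply_mem_roots (simpleE_mem hC i) hβ.1
  refine ⟨hr, ?_⟩
  obtain ⟨j, hji, hj⟩ : ∃ j, j ≠ i ∧ 0 < β j := by
    by_contra! hcon
    have hz : β = β i • (Pi.single i 1 : ι → ℤ) := by
      funext j
      by_cases hj : j = i
      · subst hj; simp
      · have := hcon j hj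
        have := hβ.2 j
        simp [hj]; omega
    rw [hz, form_smul_left, form_smul_right, hC.norm_single] at hn
    have h1 : β i = 1 := by
      have := hβ.2 i
      nlinarith
    rw [h1, one_smul] at hz
    exact h hz
  rcases hC.nonneg_or_nonpos ((mem_roots_iff hC).mp hr) with h0 | h0
  · exact h0
  · have := h0 j
    simp [simpleE, reflE_apply, hji] at this
    omega

/-- The product of the simple reflections at the nodes of a list. -/
def wordE (hC : IsSL C) (l : List ι) : LatticeAut ι := (l.map (simpleE hC)).prod

theorem wordE_mem (hC : IsSL C) (l : List ι) : wordE hC l ∈ weylGroup C := by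
  apply Subgroup.list_prod_mem
  intro x hx
  obtain ⟨i, -, rfl⟩ := List.mem_map.mp hx
  exact simpleE_mem hC i

theorem exists_word (hC : IsSL C) {w : LatticeAut ι} (hw : w ∈ weylGroup C) :
    ∃ l, wordE hC l = w := by
  rw [weylGroup, parabolicSubgroup_eq hC] at hw
  induction hw using Subgroup.closure_induction with
  | mem x hx =>
    obtain ⟨i, -, rfl⟩ := hx
    exact ⟨[i], by simp [wordE, simpleE]⟩
  | one => exact ⟨[], by simp [wordE]⟩
  | mul x y _ _ hx hy =>
    obtain ⟨l, rfl⟩ := hx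
    obtain ⟨m, rfl⟩ := hy
    exact ⟨l ++ m, by simp [wordE]⟩
  | inv x _ hx =>
    obtain ⟨l, rfl⟩ := hx
    refine ⟨l.reverse, ?_⟩
    simp only [wordE, List.map_reverse, List.prod_inv_reverse, List.map_map]
    congr 3

/-- Letting the letters act on `αᵢ` from right to left, at some letter `j` the image turns from
positive to negative. Just before, it is `αⱼ`; so the reflection at `i`, conjugated by the remaining
part of the word, is the letter `j`, and the two cancel. -/
theorem exchange (hC : IsSL C) (l : List ι) (i : ι)
    (h : -(wordE hC l (Pi.single i 1)) ∈ posRoots C) :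
    ∃ l', l'.length + 1 = l.length ∧ wordE hC l * simpleE hC i = wordE hC l' := by
  induction l with
  | nil =>
    exact absurd h (neg_notMem_posRoots hC (by simpa [wordE] using single_mem_posRoots hC i))
  | cons j t ih =>
    have hcons : wordE hC (j :: t) = simpleE hC j * wordE hC t := by simp [wordE]
    have hnorm : form C (wordE hC t (Pi.single i 1)) (wordE hC t (Pi.single i 1)) = 2 := by
      rw [weylGroup_le_isometries hC (wordE_mem hC t), hC.norm_single]
    rcases pos_or_neg_mem hC hnorm with hp | hp
    · have heq : wordE hC t (Pi.single i 1) = Pi.single j 1 := by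
        by_contra hne
        have := simpleE_mem_posRoots hC hp hne
        rw [hcons] at h
        exact neg_notMem_posRoots hC this h
      refine ⟨t, by simp, ?_⟩
      have hconj := conj_reflE (weylGroup_le_isometries hC (wordE_mem hC t)) (Pi.single i 1)
        (hC.norm_single i)
      have h2 : wordE hC t * simpleE hC i * (wordE hC t)⁻¹ = simpleE hC j := by
        unfold simpleE
        rw [hconj]
        ext1 x
        simp only [reflE_apply, heq]
      have h3 : simpleE hC j * simpleE hC j = 1 := reflE_mul_self _ _
      rw [hcons, mul_assoc, ← h2]
      rw [← h2] at h3
      calc _ = (wordE hC t * simpleE hC i * (wordE hC t)⁻¹) *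
            (wordE hC t * simpleE hC i * (wordE hC t)⁻¹) * wordE hC t := by group
        _ = _ := by rw [h3, one_mul]
    · obtain ⟨l', hl, he⟩ := ih hp
      exact ⟨j :: l', by simp [hl], by rw [hcons, mul_assoc, he]; simp [wordE]⟩

/-- If a word ends with `i` and its product keeps `αᵢ` positive, then the word without its last
letter makes `αᵢ` negative. The exchange condition then yields a word for the same element that is
two letters shorter. -/
theorem eq_one_of_maps_pos (hC : IsSL C) {w : LatticeAut ι} (hw : w ∈ weylGroup C)
    (h : ∀ i, w (Pi.single i 1) ∈ posRoots C) : w = 1 := by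
  obtain ⟨l, hl⟩ := exists_word hC hw
  induction hn : l.length using Nat.strong_induction_on generalizing l with
  | _ n ih =>
    rcases List.eq_nil_or_concat l with rfl | ⟨t, i, rfl⟩
    · rw [← hl]; simp [wordE]
    · have hsplit : wordE hC (t ++ [i]) = wordE hC t * simpleE hC i := by simp [wordE]
      rw [List.concat_eq_append] at *
      have h1 : -(wordE hC t (Pi.single i 1)) ∈ posRoots C := by
        have := h i
        rw [← hl, hsplit, LinearEquiv.mul_apply] at this
        unfold simpleE at this
        rwa [reflE_self, map_neg] at this
      obtain ⟨l', hl', he⟩ := exchange hC t i h1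
      refine ih l'.length ?_ l' (by rw [← he, ← hsplit, hl]) rfl
      simp at hn; omega

/-- The positive roots made negative by `g`. -/
def inversions (C : Matrix ι ι ℤ) (g : LatticeAut ι) : Set (ι → ℤ) :=
  {β | β ∈ posRoots C ∧ -(g β) ∈ posRoots C}

theorem inversions_finite (hC : IsSL C) (g : LatticeAut ι) : (inversions C g).Finite :=
  (posRoots_finite hC).subset fun _ h => h.1

/-- The reflection at `i` injects the inversions of the product into those of `g` and misses `αᵢ`,
which is itself an inversion of `g`. -/
theorem inversions_mul_simpleE (hC : IsSL C) {g : LatticeAut ι} {i : ι}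
    (h : -(g (Pi.single i 1)) ∈ posRoots C) :
    (inversions C (g * simpleE hC i)).ncard < (inversions C g).ncard := by
  have hss : ∀ x, simpleE hC i (simpleE hC i x) = x := fun x => by
    rw [← LinearEquiv.mul_apply]; unfold simpleE; rw [reflE_mul_self]; rfl
  have key : simpleE hC i '' inversions C (g * simpleE hC i) ⊆
      inversions C g \ {Pi.single i 1} := by
    rintro _ ⟨β, ⟨hβ, hβ'⟩, rfl⟩
    have hne : β ≠ Pi.single i 1 := by
      rintro rfl
      rw [LinearEquiv.mul_apply] at hβ'
      unfold simpleE at hβ'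
      rw [reflE_self, map_neg, neg_neg] at hβ'
      exact neg_notMem_posRoots hC hβ' h
    refine ⟨⟨simpleE_mem_posRoots hC hβ hne, hβ'⟩, ?_⟩
    intro heq
    have h2 : β = -Pi.single i 1 := by
      rw [← hss β, Set.mem_singleton_iff.mp heq]
      unfold simpleE
      rw [reflE_self]
    rw [h2] at hβ
    exact neg_notMem_posRoots hC (single_mem_posRoots hC i) hβ
  rw [← Set.ncard_image_of_injective _ (simpleE hC i).injective]
  refine (Set.ncard_le_ncard key ((inversions_finite hC g).subset Set.sdiff_subset)).trans_lt ?_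
  exact Set.ncard_sdiff_singleton_lt_of_mem ⟨single_mem_posRoots hC i, h⟩ (inversions_finite hC g)

/-- If `w` fixes a dominant `v` and `w αᵢ` is negative, then `(αᵢ, v) = (w αᵢ, v) ≤ 0`, hence it
vanishes and the reflection at `i` fixes `v` as well. Multiplying `w` by it lowers the number of
inversions. -/
theorem stabilizer_dominant (hC : IsSL C) {v : ι → ℤ}
    (hv : ∀ i, 0 ≤ form C (Pi.single i 1) v) {w : LatticeAut ι} (hw : w ∈ weylGroup C)
    (hwv : w v = v) : w ∈ parabolicSubgroup C {i | form C (Pi.single i 1) v = 0} := by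
  induction hn : (inversions C w).ncard using Nat.strong_induction_on generalizing w with
  | _ n ih =>
    have hiso := weylGroup_le_isometries hC hw
    by_cases hall : ∀ i, w (Pi.single i 1) ∈ posRoots C
    · rw [eq_one_of_maps_pos hC hw hall]; exact one_mem _
    · push Not at hall
      obtain ⟨i, hi⟩ := hall
      have hneg : -(w (Pi.single i 1)) ∈ posRoots C :=
        (pos_or_neg_mem hC (by rw [hiso, hC.norm_single])).resolve_left hi
      have hle : form C (w (Pi.single i 1)) v ≤ 0 := by
        have h1 : 0 ≤ form C (-(w (Pi.single i 1))) v := by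
          rw [form_eq_sum]
          exact Finset.sum_nonneg fun j _ => mul_nonneg (hneg.2 j) (hv j)
        rw [form_neg_left] at h1; omega
      have h0 : form C (Pi.single i 1) v = 0 := by
        have : form C (w (Pi.single i 1)) (w v) = form C (Pi.single i 1) v := hiso _ _
        rw [hwv] at this
        have := hv i
        omega
      have hfix : simpleE hC i v = v := reflE_of_orth _ (by rw [hC.comm, h0])
      have hmem : simpleE hC i ∈ parabolicSubgroup C {i | form C (Pi.single i 1) v = 0} := by
        rw [parabolicSubgroup_eq hC]
        exact Subgroup.subset_closure ⟨i, h0, rfl⟩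
      have hrec := ih _ (hn ▸ inversions_mul_simpleE hC hneg) (mul_mem hw (simpleE_mem hC i))
        (by rw [LinearEquiv.mul_apply, hfix, hwv]) rfl
      have h3 : simpleE hC i * simpleE hC i = 1 := reflE_mul_self _ _
      have : w = w * simpleE hC i * simpleE hC i := by rw [mul_assoc, h3, mul_one]
      rw [this]
      exact mul_mem hrec hmem

theorem weylGroup_finite (hC : IsSL C) : Finite (weylGroup C) :=
  ((isometries_finite hC).subset (weylGroup_le_isometries hC)).to_subtype

/-- Take the conjugate of greatest height: a simple reflection changes the height by minus the inner
product with that simple root. -/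
theorem exists_dominant (hC : IsSL C) (v : ι → ℤ) :
    ∃ u ∈ weylGroup C, ∀ i, 0 ≤ form C (Pi.single i 1) (u v) := by
  have := weylGroup_finite hC
  obtain ⟨u, hu⟩ := Finite.exists_max fun u : weylGroup C => height (u.1 v)
  refine ⟨u.1, u.2, fun i => ?_⟩
  have h := hu ⟨simpleE hC i * u.1, mul_mem (simpleE_mem hC i) u.2⟩
  change height (simpleE hC i (u.1 v)) ≤ _ at h
  unfold simpleE at h
  rw [reflE_apply, height_sub, height_smul, height_single, hC.comm] at h
  omega

/-- The subgroup generated by the reflections in the vectors of norm `2` of `R`. -/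
def reflSubgroup (C : Matrix ι ι ℤ) (R : Set (ι → ℤ)) : Subgroup (LatticeAut ι) :=
  Subgroup.closure {w | ∃ β ∈ R, ∃ h : form C β β = 2, w = reflE C β h}

theorem reflE_mem_reflSubgroup {R : Set (ι → ℤ)} {β : ι → ℤ} (hβ : β ∈ R) (h : form C β β = 2) :
    reflE C β h ∈ reflSubgroup C R :=
  Subgroup.subset_closure ⟨β, hβ, h, rfl⟩

theorem reflSubgroup_le_weylGroup (hC : IsSL C) (R : Set (ι → ℤ)) :
    reflSubgroup C R ≤ weylGroup C := by
  unfold reflSubgroup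
  rw [Subgroup.closure_le]
  rintro _ ⟨β, _, h, rfl⟩
  exact reflE_mem_weylGroup hC β h

/-- Conjugate `v` to a dominant vector, and carry the simple reflections that generate its
stabilizer back to reflections in roots orthogonal to `v`. -/
theorem mem_reflSubgroup_of_fix_vec (hC : IsSL C) {v : ι → ℤ} {w : LatticeAut ι}
    (hw : w ∈ weylGroup C) (hwv : w v = v) : w ∈ reflSubgroup C {β | form C β v = 0} := by
  obtain ⟨u, hu, hdom⟩ := exists_dominant hC v
  have hui := weylGroup_le_isometries hC hu
  have h1 := stabilizer_dominant hC hdom (mul_mem (mul_mem hu hw) (inv_mem hu))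
    (by simp only [LinearEquiv.mul_apply, inv_apply_self', hwv])
  have h2 : ∀ x ∈ parabolicSubgroup C {i | form C (Pi.single i 1) (u v) = 0},
      u⁻¹ * x * u ∈ reflSubgroup C {β | form C β v = 0} := by
    intro x hx
    rw [parabolicSubgroup_eq hC] at hx
    induction hx using Subgroup.closure_induction with
    | mem x hx =>
      obtain ⟨i, hi, rfl⟩ := hx
      have := conj_reflE (inv_mem hui) (Pi.single i 1) (hC.norm_single i)
      rw [inv_inv] at this
      simp only
      rw [this]
      refine reflE_mem_reflSubgroup ?_ _
      rw [Set.mem_ofPred_eq, form_inv_left hui]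
      exact hi
    | one => simp
    | mul x y _ _ hx hy =>
      have := mul_mem hx hy
      rwa [show u⁻¹ * x * u * (u⁻¹ * y * u) = u⁻¹ * (x * y) * u by group] at this
    | inv x _ hx =>
      have := inv_mem hx
      rwa [show (u⁻¹ * x * u)⁻¹ = u⁻¹ * x⁻¹ * u by group] at this
  have h3 := h2 _ h1
  rwa [show u⁻¹ * (u * w * u⁻¹) * u = w by group] at h3

theorem reflSubgroup_mono {R S : Set (ι → ℤ)} (h : ∀ β ∈ R, form C β β = 2 → β ∈ S) :
    reflSubgroup C R ≤ reflSubgroup C S := by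
  unfold reflSubgroup
  rw [Subgroup.closure_le]
  rintro _ ⟨β, hβ, hn, rfl⟩
  exact reflE_mem_reflSubgroup (h β hβ hn) hn

/-- Uniqueness of the expansion in base 5 with digits from -2 to 2. -/
theorem coeff_eq_zero_of_sum_pow {t : ℕ} (f : ℕ → ℤ) (hf : ∀ k < t, |f k| ≤ 2)
    (h : ∑ k ∈ Finset.range t, 5 ^ k * f k = 0) : ∀ k < t, f k = 0 := by
  induction t generalizing f with
  | zero => simp
  | succ t ih =>
    rw [Finset.sum_range_succ'] at h
    have h1 : ∑ k ∈ Finset.range t, (5 : ℤ) ^ (k + 1) * f (k + 1) =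
        5 * ∑ k ∈ Finset.range t, 5 ^ k * f (k + 1) := by
      rw [Finset.mul_sum]; exact Finset.sum_congr rfl fun k _ => by ring
    rw [h1] at h
    have h0 := abs_le.mp (hf 0 (Nat.succ_pos t))
    simp only [pow_zero, one_mul] at h
    have h00 : f 0 = 0 := by omega
    intro k hk
    cases k with
    | zero => exact h00
    | succ k =>
      exact ih (fun k => f (k + 1)) (fun k hk => hf (k + 1) (by omega)) (by omega) k (by omega)

/-- Weight the members of `X` by distinct powers of 5. Inner products of roots lie between -2 and 2,
so a root orthogonal to the weighted sum is orthogonal to every member, and the case of one vector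
applies. -/
theorem mem_reflSubgroup_of_fix (hC : IsSL C) {X : Set (ι → ℤ)} (hX : X.Finite)
    (hXr : ∀ β ∈ X, form C β β = 2)
    {w : LatticeAut ι} (hw : w ∈ weylGroup C) (hwX : ∀ β ∈ X, w β = β) :
    w ∈ reflSubgroup C (perpRoots C X) := by
  obtain ⟨l, hl⟩ : ∃ l : List (ι → ℤ), ∀ x, x ∈ l ↔ x ∈ X :=
    ⟨hX.toFinset.toList, fun x => by simp⟩
  set b : ℕ → ι → ℤ := fun k => l.getD k 0 with hb
  set v : ι → ℤ := ∑ k ∈ Finset.range l.length, (5 : ℤ) ^ k • b k with hv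
  have hbX : ∀ k < l.length, b k ∈ X := fun k hk => by
    rw [← hl]; simp only [hb]; rw [List.getD_eq_getElem _ _ hk]; exact List.getElem_mem hk
  have hwv : w v = v := by
    rw [hv, map_sum]
    refine Finset.sum_congr rfl fun k hk => ?_
    rw [map_smul, hwX _ (hbX k (Finset.mem_range.mp hk))]
  refine reflSubgroup_mono ?_ (mem_reflSubgroup_of_fix_vec hC hw hwv)
  intro β hβ hn
  refine ⟨(mem_roots_iff hC).mpr hn, ?_⟩
  have hz : ∑ k ∈ Finset.range l.length, 5 ^ k * form C β (b k) = 0 := by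
    rw [← hβ.out, hv, form_sum_right]
    exact Finset.sum_congr rfl fun k _ => (form_smul_right C _ _ _).symm
  have := coeff_eq_zero_of_sum_pow (fun k => form C β (b k))
    (fun k hk => hC.abs_le hn (hXr _ (hbX k hk))) hz
  intro γ hγ
  obtain ⟨k, hk, rfl⟩ := List.getElem_of_mem ((hl γ).mpr hγ)
  have := this k hk
  simp only [hb] at this
  rwa [List.getD_eq_getElem _ _ hk] at this

end Fixer

/-! ### The action on sets of positive roots and on reflections -/

section Action

variable {ι : Type} [Fintype ι] [DecidableEq ι] {C : Matrix ι ι ℤ}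

theorem act_subset (g : LatticeAut ι) (X : Set (ι → ℤ)) : act C g X ⊆ posRoots C :=
  fun _ h => h.1

theorem norm_apply {g : LatticeAut ι} (hg : g ∈ isometries C) {β : ι → ℤ}
    (hβ : form C β β = 2) : form C (g β) (g β) = 2 := by rw [hg, hβ]

theorem exists_mem_act (hC : IsSL C) {g : LatticeAut ι} (hg : g ∈ isometries C)
    {X : Set (ι → ℤ)} (hX : X ⊆ posRoots C) {β : ι → ℤ} (hβ : β ∈ X) :
    ∃ γ ∈ act C g X, γ = g β ∨ γ = -g β := by
  rcases pos_or_neg_mem hC (norm_apply hg (norm_of_mem_posRoots hC (hX hβ))) with h | h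
  · exact ⟨g β, ⟨h, β, hβ, Or.inl rfl⟩, Or.inl rfl⟩
  · exact ⟨-g β, ⟨h, β, hβ, Or.inr rfl⟩, Or.inr rfl⟩

theorem act_mul (hC : IsSL C) (g : LatticeAut ι) {h : LatticeAut ι}
    (hh : h ∈ isometries C) {X : Set (ι → ℤ)} (hX : X ⊆ posRoots C) :
    act C (g * h) X = act C g (act C h X) := by
  ext γ
  constructor
  · rintro ⟨hγ, β, hβ, hor⟩
    obtain ⟨δ, hδ, hδ'⟩ := exists_mem_act hC hh hX hβ
    refine ⟨hγ, δ, hδ, ?_⟩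
    simp only [LinearEquiv.mul_apply] at hor
    rcases hδ' with rfl | rfl <;> simpa [or_comm] using hor
  · rintro ⟨hγ, δ, ⟨-, β, hβ, hor⟩, hor'⟩
    refine ⟨hγ, β, hβ, ?_⟩
    simp only [LinearEquiv.mul_apply]
    rcases hor with rfl | rfl <;> simpa [or_comm] using hor'

theorem act_one (hC : IsSL C) {X : Set (ι → ℤ)} (hX : X ⊆ posRoots C) : act C 1 X = X := by
  ext γ
  constructor
  · rintro ⟨hγ, β, hβ, hor⟩
    rw [eq_of_eq_or_eq_neg hC hγ (hX hβ) hor]; exact hβ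
  · exact fun h => ⟨hX h, γ, h, Or.inl rfl⟩

theorem act_inv_act (hC : IsSL C) {g : LatticeAut ι} (hg : g ∈ isometries C)
    {X : Set (ι → ℤ)} (hX : X ⊆ posRoots C) : act C g⁻¹ (act C g X) = X := by
  rw [← act_mul hC _ hg hX, inv_mul_cancel, act_one hC hX]

theorem act_act_inv (hC : IsSL C) {g : LatticeAut ι} (hg : g ∈ isometries C)
    {X : Set (ι → ℤ)} (hX : X ⊆ posRoots C) : act C g (act C g⁻¹ X) = X := by
  rw [← act_mul hC _ (inv_mem hg) hX, mul_inv_cancel, act_one hC hX]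

theorem act_empty (g : LatticeAut ι) : act C g ∅ = ∅ := by
  ext γ; simp [act]

theorem ncard_act (hC : IsSL C) {g : LatticeAut ι} (hg : g ∈ isometries C)
    {X : Set (ι → ℤ)} (hX : X ⊆ posRoots C) : (act C g X).ncard = X.ncard := by
  symm
  choose f hf hf' using fun (β : ι → ℤ) (hβ : β ∈ X) => exists_mem_act hC hg hX hβ
  refine Set.ncard_congr f hf ?_ ?_
  · intro a b ha hb hab
    refine eq_of_eq_or_eq_neg hC (hX ha) (hX hb) ?_
    have h1 := hf' a ha
    rw [hab] at h1
    rcases h1 with h1 | h1 <;> rcases hf' b hb with h2 | h2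
    · exact Or.inl (g.injective (h1.symm.trans h2))
    · right; apply g.injective; rw [map_neg]; exact h1.symm.trans h2
    · right; apply g.injective; rw [map_neg, ← h2, h1, neg_neg]
    · exact Or.inl (g.injective (neg_injective (h1.symm.trans h2)))
  · rintro γ ⟨hγ, β, hβ, hor⟩
    refine ⟨β, hβ, eq_of_eq_or_eq_neg hC (hf β hβ).1 hγ ?_⟩
    rcases hor with rfl | rfl <;> rcases hf' β hβ with h2 | h2 <;> simp [h2]

theorem subset_posRoots_of_mem_orbit {X Y : Set (ι → ℤ)} (h : Y ∈ orbit C X) :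
    Y ⊆ posRoots C := by
  obtain ⟨w, -, rfl⟩ := h
  exact act_subset w X

theorem mem_orbit_self (hC : IsSL C) {X : Set (ι → ℤ)} (hX : X ⊆ posRoots C) : X ∈ orbit C X :=
  ⟨1, one_mem _, (act_one hC hX).symm⟩

theorem orbit_eq_of_mem (hC : IsSL C) {X Y : Set (ι → ℤ)} (hX : X ⊆ posRoots C)
    (h : Y ∈ orbit C X) : orbit C Y = orbit C X := by
  obtain ⟨w, hw, rfl⟩ := h
  have hwi := weylGroup_le_isometries hC hw
  ext Z
  constructor
  · rintro ⟨u, hu, rfl⟩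
    exact ⟨u * w, mul_mem hu hw, (act_mul hC u hwi hX).symm⟩
  · rintro ⟨u, hu, rfl⟩
    refine ⟨u * w⁻¹, mul_mem hu (inv_mem hw), ?_⟩
    rw [act_mul hC _ (inv_mem hwi) (act_subset _ _), act_inv_act hC hwi hX]

theorem isOrthogonalSet_act (hC : IsSL C) {g : LatticeAut ι} (hg : g ∈ isometries C)
    {X : Set (ι → ℤ)} (hX : IsOrthogonalSet C X) : IsOrthogonalSet C (act C g X) := by
  refine ⟨act_subset g X, ?_⟩
  rintro γ ⟨hγ, β, hβ, hor⟩ δ ⟨hδ, β', hβ', hor'⟩ hne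
  have hne' : β ≠ β' := by
    rintro rfl
    apply hne
    refine eq_of_eq_or_eq_neg hC hγ hδ ?_
    rcases hor with rfl | rfl <;> rcases hor' with rfl | rfl <;> simp
  have h0 := hX.2 β hβ β' hβ' hne'
  rcases hor with rfl | rfl <;> rcases hor' with rfl | rfl <;>
    simp [form_neg_left, form_neg_right, hg _ _, h0]

theorem conj_mem_weylGroup (hC : IsSL C) {g : LatticeAut ι} (hg : g ∈ isometries C)
    {w : LatticeAut ι} (hw : w ∈ weylGroup C) : g * w * g⁻¹ ∈ weylGroup C := by
  obtain ⟨l, rfl⟩ := exists_word hC hw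
  induction l with
  | nil => simp [wordE]
  | cons i l ih =>
    have h1 : g * simpleE hC i * g⁻¹ ∈ weylGroup C := by
      unfold simpleE
      rw [conj_reflE hg]
      exact reflE_mem_weylGroup hC _ _
    have h2 := mul_mem h1 (ih (wordE_mem hC l))
    rwa [show g * simpleE hC i * g⁻¹ * (g * wordE hC l * g⁻¹) =
      g * wordE hC (i :: l) * g⁻¹ by simp only [wordE, List.map_cons, List.prod_cons]; group] at h2

/-- Conjugation by an isometry of the root lattice, as an automorphism of the Weyl group. -/
def conjW (hC : IsSL C) (g : LatticeAut ι) (hg : g ∈ isometries C) :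
    MulAut (weylGroup C) where
  toFun w := ⟨g * w.1 * g⁻¹, conj_mem_weylGroup hC hg w.2⟩
  invFun w := ⟨g⁻¹ * w.1 * g⁻¹⁻¹, conj_mem_weylGroup hC (inv_mem hg) w.2⟩
  left_inv w := by ext1; simp only; group
  right_inv w := by ext1; simp only; group
  map_mul' u v := by ext1; simp only [Subgroup.coe_mul]; group

/-- The reflection in a vector of norm `2` as an element of the Weyl group. -/
def reflW (hC : IsSL C) (β : ι → ℤ) (hβ : form C β β = 2) : weylGroup C :=
  ⟨reflE C β hβ, reflE_mem_weylGroup hC β hβ⟩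

theorem mem_reflections_iff (hC : IsSL C) {X : Set (ι → ℤ)} (hX : ∀ β ∈ X, form C β β = 2)
    {w : weylGroup C} : w ∈ reflections C X ↔ ∃ β ∈ X, ∃ h, w = reflW hC β h := by
  constructor
  · rintro ⟨β, hβ, hw⟩
    refine ⟨β, hβ, hX β hβ, ?_⟩
    ext1; ext1 x
    exact hw x
  · rintro ⟨β, hβ, h, rfl⟩
    exact ⟨β, hβ, fun x => rfl⟩

theorem reflE_eq_iff (hC : IsSL C) {β γ : ι → ℤ} (hβ : form C β β = 2) (hγ : form C γ γ = 2) :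
    reflE C β hβ = reflE C γ hγ ↔ β = γ ∨ β = -γ := by
  constructor
  · intro h
    have h1 : reflE C γ hγ β = -β := by rw [← h, reflE_self]
    rw [reflE_apply] at h1
    have h2 : form C (β - form C β γ • γ) γ = form C (-β) γ := by rw [h1]
    have h3 : form C (β - form C β γ • γ) β = form C (-β) β := by rw [h1]
    rw [form_sub_left, form_smul_left, form_neg_left, hC.comm γ β, hβ] at h3
    -- Comparing inner products with `β` gives `2 - (β, γ)² = -2`.
    have h4 : form C β γ = 2 ∨ form C β γ = -2 := by
      have : (form C β γ - 2) * (form C β γ + 2) = 0 := by linarith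
      rcases mul_eq_zero.mp this with h | h <;> omega
    rcases h4 with h4 | h4
    · exact Or.inl (hC.eq_of_form_eq_two hβ hγ h4)
    · exact Or.inr (hC.eq_neg_of_form_eq_neg_two hβ hγ h4)
  · rintro (rfl | rfl)
    · rfl
    · ext1 x
      simp only [reflE_apply, form_neg_right]
      module

/-- Links the two descriptions of the action: moving the roots is conjugating the reflections. It
holds for all isometries of the lattice, which the outer automorphisms need. -/
theorem reflections_act (hC : IsSL C) {g : LatticeAut ι} (hg : g ∈ isometries C)
    {X : Set (ι → ℤ)} (hX : X ⊆ posRoots C) :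
    reflections C (act C g X) = conjW hC g hg '' reflections C X := by
  have hX2 : ∀ β ∈ X, form C β β = 2 := fun β hβ => norm_of_mem_posRoots hC (hX hβ)
  have hconj : ∀ β hβ, conjW hC g hg (reflW hC β hβ) = reflW hC (g β) (norm_apply hg hβ) := by
    intro β hβ
    ext1
    exact conj_reflE hg β hβ
  ext w
  rw [mem_reflections_iff hC fun β hβ => norm_of_mem_posRoots hC (act_subset g X hβ)]
  constructor
  · rintro ⟨γ, ⟨hγ, β, hβ, hor⟩, h, rfl⟩
    refine ⟨reflW hC β (hX2 β hβ), (mem_reflections_iff hC hX2).mpr ⟨β, hβ, _, rfl⟩, ?_⟩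
    rw [hconj]
    ext1
    exact ((reflE_eq_iff hC h (norm_apply hg (hX2 β hβ))).mpr hor).symm
  · rintro ⟨u, hu, rfl⟩
    obtain ⟨β, hβ, h, rfl⟩ := (mem_reflections_iff hC hX2).mp hu
    obtain ⟨γ, hγ, hor⟩ := exists_mem_act hC hg hX hβ
    refine ⟨γ, hγ, norm_of_mem_posRoots hC hγ.1, ?_⟩
    rw [hconj]
    ext1
    exact ((reflE_eq_iff hC (norm_of_mem_posRoots hC hγ.1) (norm_apply hg h)).mpr hor).symm

theorem reflections_injective (hC : IsSL C) {X Y : Set (ι → ℤ)} (hX : X ⊆ posRoots C)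
    (hY : Y ⊆ posRoots C) (h : reflections C X = reflections C Y) : X = Y := by
  have key : ∀ {X Y : Set (ι → ℤ)}, X ⊆ posRoots C → Y ⊆ posRoots C →
      reflections C X = reflections C Y → X ⊆ Y := by
    intro X Y hX hY h β hβ
    have hY2 : ∀ β ∈ Y, form C β β = 2 := fun β hβ => norm_of_mem_posRoots hC (hY hβ)
    have hX2 : ∀ β ∈ X, form C β β = 2 := fun β hβ => norm_of_mem_posRoots hC (hX hβ)
    have h1 : reflW hC β (hX2 β hβ) ∈ reflections C Y := by
      rw [← h, mem_reflections_iff hC hX2]; exact ⟨β, hβ, _, rfl⟩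
    obtain ⟨γ, hγ, h2, h3⟩ := (mem_reflections_iff hC hY2).mp h1
    rw [eq_of_eq_or_eq_neg hC (hX hβ) (hY hγ)
      ((reflE_eq_iff hC (hX2 β hβ) h2).mp (congrArg Subtype.val h3))]
    exact hγ
  exact (key hX hY h).antisymm (key hY hX h.symm)

theorem mem_normW_iff (hC : IsSL C) {X : Set (ι → ℤ)} (hX : X ⊆ posRoots C) {w : weylGroup C} :
    w ∈ normW C X ↔ act C w.1 X = X := by
  have hw := weylGroup_le_isometries hC w.2
  have h1 : ∀ s : Set (weylGroup C), (MulAut.conj w) '' s = conjW hC w.1 hw '' s := fun s => rfl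
  unfold normW
  rw [Subgroup.mem_normalizer_iff_conj_image_eq, h1, ← reflections_act hC hw hX]
  exact ⟨fun h => reflections_injective hC (act_subset _ _) hX h, fun h => by rw [h]⟩

/-- Conjugating the reflection in `β` by `w` gives the reflection in `w β`, and two reflections
agree exactly when their roots agree up to sign. -/
theorem mem_centW_iff (hC : IsSL C) {X : Set (ι → ℤ)} (hX : ∀ β ∈ X, form C β β = 2)
    {w : weylGroup C} : w ∈ centW C X ↔ ∀ β ∈ X, w.1 β = β ∨ w.1 β = -β := by
  have hw := weylGroup_le_isometries hC w.2
  unfold centW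
  rw [Subgroup.mem_centralizer_iff]
  constructor
  · intro h β hβ
    have h1 := h (reflW hC β (hX β hβ)) ((mem_reflections_iff hC hX).mpr ⟨β, hβ, _, rfl⟩)
    have h2 : w.1 * reflE C β (hX β hβ) * w.1⁻¹ = reflE C β (hX β hβ) :=
      mul_inv_eq_of_eq_mul (congrArg Subtype.val h1).symm
    rw [conj_reflE hw] at h2
    exact (reflE_eq_iff hC _ _).mp h2
  · intro h u hu
    obtain ⟨β, hβ, h2, rfl⟩ := (mem_reflections_iff hC hX).mp hu
    have h3 := (reflE_eq_iff hC (norm_apply hw h2) h2).mpr (h β hβ)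
    rw [← conj_reflE hw β h2] at h3
    ext1
    exact (eq_mul_of_mul_inv_eq h3).symm

theorem centW_le_normW (X : Set (ι → ℤ)) : centW C X ≤ normW C X :=
  Subgroup.centralizer_le_normalizer _

end Action

/-! ### The structure of the centralizer -/

section Splitting

variable {ι : Type} [Fintype ι] [DecidableEq ι] {C : Matrix ι ι ℤ}

theorem sub_mem_span_of_mem_reflSubgroup {X : Set (ι → ℤ)} {g : LatticeAut ι}
    (hg : g ∈ reflSubgroup C X) : ∀ x, g x - x ∈ Submodule.span ℤ X := by
  induction hg using Subgroup.closure_induction with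
  | mem g hg =>
    obtain ⟨β, hβ, h, rfl⟩ := hg
    intro x
    rw [reflE_apply, sub_sub_cancel_left]
    exact neg_mem (Submodule.smul_mem _ _ (Submodule.subset_span hβ))
  | one => simp
  | mul a b _ _ ha hb =>
    intro x
    have := add_mem (ha (b x)) (hb x)
    rwa [sub_add_sub_cancel] at this
  | inv a _ ha =>
    intro x
    have := neg_mem (ha (a⁻¹ x))
    rwa [apply_inv_self', neg_sub] at this

theorem form_eq_zero_of_mem_span {X : Set (ι → ℤ)} {x : ι → ℤ} (h : ∀ β ∈ X, form C x β = 0)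
    {y : ι → ℤ} (hy : y ∈ Submodule.span ℤ X) : form C x y = 0 := by
  induction hy using Submodule.span_induction with
  | mem y hy => exact h y hy
  | zero => simp
  | add a b _ _ ha hb => rw [form_add_right, ha, hb, add_zero]
  | smul a b _ hb => rw [form_smul_right, hb, mul_zero]

/-- The displacement `g x - x` is orthogonal to `X`, because `g` fixes `X`, and lies in the span of
`X`; hence its norm is 0. -/
theorem eq_one_of_fix_of_sub_mem_span (hC : IsSL C) {X : Set (ι → ℤ)}
    {g : LatticeAut ι} (hg : g ∈ isometries C) (hfix : ∀ β ∈ X, g β = β)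
    (hs : ∀ x, g x - x ∈ Submodule.span ℤ X) : g = 1 := by
  ext1 x
  have h : ∀ β ∈ X, form C (g x - x) β = 0 := by
    intro β hβ
    rw [form_sub_left]
    nth_rewrite 1 [← hfix β hβ]
    rw [hg, sub_self]
  have := form_eq_zero_of_mem_span h (hs x)
  exact sub_eq_zero.mp (hC.eq_zero this)

theorem fix_of_mem_reflSubgroup {R : Set (ι → ℤ)} {β : ι → ℤ} (hR : ∀ γ ∈ R, form C β γ = 0)
    {g : LatticeAut ι} (hg : g ∈ reflSubgroup C R) : g β = β := by
  induction hg using Subgroup.closure_induction with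
  | mem g hg =>
    obtain ⟨γ, hγ, h, rfl⟩ := hg
    exact reflE_of_orth h (hR γ hγ)
  | one => rfl
  | mul a b _ _ ha hb => rw [LinearEquiv.mul_apply, hb, ha]
  | inv a _ ha => nth_rewrite 1 [← ha]; rw [inv_apply_self']

theorem mem_closure_reflections_iff (hC : IsSL C) {X : Set (ι → ℤ)}
    (hX : ∀ β ∈ X, form C β β = 2) {w : weylGroup C} :
    w ∈ Subgroup.closure (reflections C X) ↔ w.1 ∈ reflSubgroup C X := by
  have h1 : reflSubgroup C X =
      (Subgroup.closure (reflections C X)).map (weylGroup C).subtype := by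
    rw [MonoidHom.map_closure]
    unfold reflSubgroup
    congr 1
    ext g
    constructor
    · rintro ⟨β, hβ, h, rfl⟩
      exact ⟨reflW hC β h, (mem_reflections_iff hC hX).mpr ⟨β, hβ, h, rfl⟩, rfl⟩
    · rintro ⟨u, hu, rfl⟩
      obtain ⟨β, hβ, h, rfl⟩ := (mem_reflections_iff hC hX).mp hu
      exact ⟨β, hβ, h, rfl⟩
  rw [h1]
  constructor
  · exact fun h => ⟨w, h, rfl⟩
  · rintro ⟨u, hu, h⟩
    rwa [← Subtype.ext h]

theorem IsOrthogonalSet.norm (hC : IsSL C) {X : Set (ι → ℤ)} (hX : IsOrthogonalSet C X) :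
    ∀ β ∈ X, form C β β = 2 := fun _ hβ => norm_of_mem_posRoots hC (hX.1 hβ)

theorem IsOrthogonalSet.finite (hC : IsSL C) {X : Set (ι → ℤ)} (hX : IsOrthogonalSet C X) :
    X.Finite := (posRoots_finite hC).subset hX.1

theorem sign_of_mem_reflSubgroup {X : Set (ι → ℤ)}
    (hX : ∀ β ∈ X, ∀ γ ∈ X, β ≠ γ → form C β γ = 0) {g : LatticeAut ι}
    (hg : g ∈ reflSubgroup C X) : ∀ β ∈ X, g β = β ∨ g β = -β := by
  induction hg using Subgroup.closure_induction with
  | mem g hg =>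
    obtain ⟨γ, hγ, h, rfl⟩ := hg
    intro β hβ
    by_cases hne : β = γ
    · subst hne
      exact Or.inr (reflE_self β h)
    · exact Or.inl (reflE_of_orth h (hX β hβ γ hγ hne))
  | one => exact fun β _ => Or.inl rfl
  | mul a b _ _ ha hb =>
    intro β hβ
    rw [LinearEquiv.mul_apply]
    rcases hb β hβ with h | h <;> rcases ha β hβ with h' | h' <;> simp [h, h']
  | inv a _ ha =>
    intro β hβ
    rcases ha β hβ with h | h
    · left; nth_rewrite 1 [← h]; rw [inv_apply_self']
    · right
      have : a (-β) = β := by rw [map_neg, h, neg_neg]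
      nth_rewrite 1 [← this]; rw [inv_apply_self']

theorem exists_mem_reflSubgroup_sign (hC : IsSL C) {X : Set (ι → ℤ)} (hX : IsOrthogonalSet C X)
    {Y : Set (ι → ℤ)} (hY : Y ⊆ X) : ∃ k ∈ reflSubgroup C X,
      (∀ β ∈ Y, k β = -β) ∧ ∀ β ∈ X, β ∉ Y → k β = β := by
  have hfin : Y.Finite := (hX.finite hC).subset hY
  induction Y, hfin using Set.Finite.induction_on with
  | empty => exact ⟨1, one_mem _, by simp, fun _ _ _ => rfl⟩
  | @insert a s ha hs ih =>
    obtain ⟨k, hk, h1, h2⟩ := ih ((Set.subset_insert _ _).trans hY)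
    have haX : a ∈ X := hY (Set.mem_insert _ _)
    have hsX : s ⊆ X := (Set.subset_insert _ _).trans hY
    refine ⟨k * reflE C a (hX.norm hC a haX), mul_mem hk (reflE_mem_reflSubgroup haX _), ?_, ?_⟩
    · intro β hβ
      rw [LinearEquiv.mul_apply]
      rcases hβ with rfl | hβ
      · rw [reflE_self, map_neg, h2 β haX ha]
      · rw [reflE_of_orth _ (hX.2 β (hsX hβ) a haX (fun h => ha (h ▸ hβ))), h1 β hβ]
    · intro β hβ hne
      rw [Set.mem_insert_iff, not_or] at hne
      rw [LinearEquiv.mul_apply, reflE_of_orth _ (hX.2 β hβ a haX hne.1), h2 β hβ hne.2]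

theorem reflSubgroup_le_isometries (hC : IsSL C) (R : Set (ι → ℤ)) :
    reflSubgroup C R ≤ isometries C :=
  (reflSubgroup_le_weylGroup hC R).trans (weylGroup_le_isometries hC)

theorem eq_of_mem_reflSubgroup_of_eqOn (hC : IsSL C) {X : Set (ι → ℤ)} {g h : LatticeAut ι}
    (hg : g ∈ reflSubgroup C X) (hh : h ∈ reflSubgroup C X) (hgh : ∀ β ∈ X, g β = h β) :
    g = h := by
  have hm := mul_mem (inv_mem hh) hg
  have := eq_one_of_fix_of_sub_mem_span hC (reflSubgroup_le_isometries hC X hm)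
    (fun β hβ => by rw [LinearEquiv.mul_apply, hgh β hβ, inv_apply_self'])
    (sub_mem_span_of_mem_reflSubgroup hm)
  exact (inv_mul_eq_one.mp this).symm

theorem neg_ne_self_of_norm {β : ι → ℤ} (h : form C β β = 2) : -β ≠ β := by
  intro hβ
  have : β = 0 := self_eq_neg.mp hβ.symm
  simp [this] at h

/-- An element of the group is determined by the set of members of `X` that it negates, and every
subset occurs. -/
theorem card_reflSubgroup_orthogonal (hC : IsSL C) {X : Set (ι → ℤ)} (hX : IsOrthogonalSet C X) :
    Nat.card (reflSubgroup C X) = 2 ^ X.ncard := by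
  have hXf := hX.finite hC
  rw [← Set.ncard_powerset X hXf, ← Nat.card_coe_set_eq]
  refine Nat.card_congr (Equiv.ofBijective
    (fun k => (⟨{β | β ∈ X ∧ k.1 β = -β}, fun _ h => h.1⟩ : 𝒫 X)) ⟨?_, ?_⟩)
  · intro k k' h
    ext1
    refine eq_of_mem_reflSubgroup_of_eqOn hC k.2 k'.2 fun β hβ => ?_
    have h1 : (β ∈ X ∧ k.1 β = -β) ↔ (β ∈ X ∧ k'.1 β = -β) := by
      have := congrArg Subtype.val h
      exact Set.ext_iff.mp this β
    have hne := neg_ne_self_of_norm (hX.norm hC β hβ)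
    rcases sign_of_mem_reflSubgroup hX.2 k.2 β hβ with h2 | h2 <;>
      rcases sign_of_mem_reflSubgroup hX.2 k'.2 β hβ with h3 | h3
    · rw [h2, h3]
    · rw [(h1.mpr ⟨hβ, h3⟩).2, h3]
    · rw [(h1.mp ⟨hβ, h2⟩).2, h2]
    · rw [h2, h3]
  · rintro ⟨Y, hY⟩
    obtain ⟨k, hk, h1, h2⟩ := exists_mem_reflSubgroup_sign hC hX hY
    refine ⟨⟨k, hk⟩, ?_⟩
    ext β
    constructor
    · rintro ⟨hβ, h3⟩
      by_contra hc
      rw [h2 β hβ hc] at h3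
      exact neg_ne_self_of_norm (hX.norm hC β hβ) h3.symm
    · exact fun h => ⟨hY h, h1 β h⟩

theorem norm_of_mem_perpRoots (hC : IsSL C) {X : Set (ι → ℤ)} :
    ∀ β ∈ perpRoots C X, form C β β = 2 := fun _ hβ => (mem_roots_iff hC).mp hβ.1

/-- Multiplying an element of the centralizer by the reflections in the members it negates leaves an
element fixing `X` pointwise, which lies in the second factor. The factors meet trivially: a common
element fixes `X` and moves every vector by an element of the span of `X`. -/
theorem centralizerSplits (hC : IsSL C) {X : Set (ι → ℤ)} (hX : IsOrthogonalSet C X) :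
    CentralizerSplits C X := by
  have hXn := hX.norm hC
  have hPn := norm_of_mem_perpRoots hC (X := X)
  unfold CentralizerSplits
  intro K L
  have hK : ∀ w : weylGroup C, w ∈ K ↔ w.1 ∈ reflSubgroup C X :=
    fun w => mem_closure_reflections_iff hC hXn
  have hL : ∀ w : weylGroup C, w ∈ L ↔ w.1 ∈ reflSubgroup C (perpRoots C X) :=
    fun w => mem_closure_reflections_iff hC hPn
  have hLfix : ∀ w ∈ L, ∀ β ∈ X, w.1 β = β := fun w hw β hβ =>
    fix_of_mem_reflSubgroup (fun γ hγ => by rw [hC.comm]; exact hγ.2 β hβ) ((hL w).mp hw)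
  have hKc : K ≤ centW C X := fun w hw =>
    (mem_centW_iff hC hXn).mpr (sign_of_mem_reflSubgroup hX.2 ((hK w).mp hw))
  have hLc : L ≤ centW C X := fun w hw =>
    (mem_centW_iff hC hXn).mpr fun β hβ => Or.inl (hLfix w hw β hβ)
  have hcomm : ∀ u ∈ centW C X, ∀ w ∈ K, u * w * u⁻¹ = w := by
    intro u hu w hw
    have : u ∈ Subgroup.centralizer (K : Set (weylGroup C)) := by
      rw [Subgroup.centralizer_closure]; exact hu
    rw [Subgroup.mem_centralizer_iff] at this
    exact mul_inv_eq_of_eq_mul (this w hw).symm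
  refine ⟨hKc, hLc, ⟨?_⟩, ?_, ?_, ?_⟩
  · intro w hw u
    rw [Subgroup.mem_subgroupOf] at hw ⊢
    have := hcomm u.1 u.2 w.1 hw
    simpa only [Subgroup.coe_mul, Subgroup.coe_inv, this] using hw
  · apply Subgroup.isComplement'_of_disjoint_and_mul_eq_univ
    · rw [Subgroup.disjoint_def]
      intro w hwK hwL
      rw [Subgroup.mem_subgroupOf] at hwK hwL
      ext1; ext1
      exact eq_one_of_fix_of_sub_mem_span hC (weylGroup_le_isometries hC w.1.2) (hLfix _ hwL)
        (sub_mem_span_of_mem_reflSubgroup ((hK _).mp hwK))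
    · rw [Set.eq_univ_iff_forall]
      intro w
      have hw := (mem_centW_iff hC hXn).mp w.2
      obtain ⟨k, hk, h1, h2⟩ := exists_mem_reflSubgroup_sign hC hX
        (Y := {β | β ∈ X ∧ w.1.1 β = -β}) fun _ h => h.1
      have hkW : k ∈ weylGroup C := reflSubgroup_le_weylGroup hC _ hk
      have hkK : (⟨k, hkW⟩ : weylGroup C) ∈ K := (hK _).mpr hk
      have hfix : ∀ β ∈ X, (k⁻¹ * w.1.1) β = β := by
        intro β hβ
        rw [LinearEquiv.mul_apply]
        have key : w.1.1 β = k β := by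
          by_cases hc : w.1.1 β = -β
          · rw [hc, h1 β ⟨hβ, hc⟩]
          · rw [(hw β hβ).resolve_right hc, h2 β hβ fun h => hc h.2]
        rw [key, inv_apply_self']
      have hmem := mem_reflSubgroup_of_fix hC (hX.finite hC) hXn
        (mul_mem (inv_mem hkW) w.1.2) hfix
      have hLm : (⟨k, hkW⟩⁻¹ * w.1 : weylGroup C) ∈ L := (hL _).mpr hmem
      refine ⟨⟨⟨k, hkW⟩, hKc hkK⟩, hkK, ⟨⟨k, hkW⟩⁻¹ * w.1, hLc hLm⟩, Subgroup.mem_subgroupOf.mpr hLm, ?_⟩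
      ext1
      exact mul_inv_cancel_left (⟨k, hkW⟩ : weylGroup C) w.1
  · intro w hw
    have hw' := (hK w).mp hw
    ext1
    refine eq_of_mem_reflSubgroup_of_eqOn hC (mul_mem hw' hw') (one_mem _) fun β hβ => ?_
    change w.1 (w.1 β) = β
    rcases sign_of_mem_reflSubgroup hX.2 hw' β hβ with h | h
    · rw [h, h]
    · rw [h, map_neg, h, neg_neg]
  · rw [← card_reflSubgroup_orthogonal hC hX]
    refine Nat.card_congr ⟨fun w => ⟨w.1.1, (hK _).mp w.2⟩,
      fun w => ⟨⟨w.1, reflSubgroup_le_weylGroup hC _ w.2⟩, (hK _).mpr w.2⟩, fun _ => rfl,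
      fun _ => rfl⟩

end Splitting

/-! ### Admissibility in terms of a fourth root -/

section Admissible

variable {ι : Type} [Fintype ι] [DecidableEq ι] {C : Matrix ι ι ℤ}

theorem refl_refl_refl_refl (hC : IsSL C) {α β₁ β₂ β₃ : ι → ℤ} (hα : form C α α = 2)
    (h12 : form C β₁ β₂ = 0) (h13 : form C β₁ β₃ = 0) (h23 : form C β₂ β₃ = 0)
    (h1 : |form C α β₁| = 1) (h2 : |form C α β₂| = 1) (h3 : |form C α β₃| = 1) :
    refl C α (refl C β₁ (refl C β₂ (refl C β₃ α))) =
      (2 : ℤ) • α - form C α β₁ • β₁ - form C α β₂ • β₂ - form C α β₃ • β₃ := by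
  have q : ∀ {a : ℤ}, |a| = 1 → a * a = 1 := fun {a} h => by
    rw [← abs_mul_abs_self, h]; rfl
  have e3 : refl C β₃ α = α - form C α β₃ • β₃ := rfl
  have e2 : refl C β₂ (refl C β₃ α) = α - form C α β₃ • β₃ - form C α β₂ • β₂ := by
    rw [e3, refl_apply, form_sub_left, form_smul_left, hC.comm β₃, h23]
    simp
  have e1 : refl C β₁ (refl C β₂ (refl C β₃ α)) =
      α - form C α β₃ • β₃ - form C α β₂ • β₂ - form C α β₁ • β₁ := by
    rw [e2, refl_apply, form_sub_left, form_sub_left, form_smul_left, form_smul_left,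
      hC.comm β₃, hC.comm β₂, h12, h13]
    simp
  have e0 : form C (α - form C α β₃ • β₃ - form C α β₂ • β₂ - form C α β₁ • β₁) α = -1 := by
    simp only [form_sub_left, form_smul_left, hα, hC.comm β₁ α, hC.comm β₂ α, hC.comm β₃ α]
    rw [q h1, q h2, q h3]; rfl
  rw [e1, refl_apply, e0]
  module

/-- The closure condition of an admissible set in explicit form. -/
theorem isAdmissible_iff (hC : IsSL C) {X : Set (ι → ℤ)} : IsAdmissible C X ↔
    IsOrthogonalSet C X ∧ ∀ β₁ ∈ X, ∀ β₂ ∈ X, ∀ β₃ ∈ X, β₁ ≠ β₂ → β₁ ≠ β₃ → β₂ ≠ β₃ →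
      ∀ α, form C α α = 2 → |form C α β₁| = 1 → |form C α β₂| = 1 → |form C α β₃| = 1 →
      ∀ γ ∈ posRoots C,
        (γ = (2 : ℤ) • α - form C α β₁ • β₁ - form C α β₂ • β₂ - form C α β₃ • β₃ ∨
          γ = -((2 : ℤ) • α - form C α β₁ • β₁ - form C α β₂ • β₂ - form C α β₃ • β₃)) →
        γ ∈ X := by
  refine and_congr_right fun hX => ?_
  refine forall₂_congr fun β₁ hβ₁ => forall₂_congr fun β₂ hβ₂ => forall₂_congr fun β₃ hβ₃ =>
    forall₃_congr fun h12 h13 h23 => forall_congr' fun α => ?_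
  constructor
  · intro h hα h1 h2 h3 γ hγ hor
    refine h ((mem_roots_iff hC).mpr hα) h1 h2 h3 γ hγ ?_
    rwa [refl_refl_refl_refl hC hα (hX.2 _ hβ₁ _ hβ₂ h12) (hX.2 _ hβ₁ _ hβ₃ h13)
      (hX.2 _ hβ₂ _ hβ₃ h23) h1 h2 h3]
  · intro h hα h1 h2 h3 γ hγ hor
    have hα := (mem_roots_iff hC).mp hα
    refine h hα h1 h2 h3 γ hγ ?_
    rwa [refl_refl_refl_refl hC hα (hX.2 _ hβ₁ _ hβ₂ h12) (hX.2 _ hβ₁ _ hβ₃ h13)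
      (hX.2 _ hβ₂ _ hβ₃ h23) h1 h2 h3] at hor

theorem sq_eq_one_of_abs {a : ℤ} (h : |a| = 1) : a * a = 1 := by
  rw [← abs_mul_abs_self, h]; rfl

/-- When four orthogonal roots have inner product `±1` with `α`, the vector `2α - Σ (α, βᵢ) βᵢ` has
norm `8 - 16 + 8 = 0`. So the root that the closure condition asks for is the fourth one, up to
sign. -/
theorem isAdmissible_of_exists_fourth (hC : IsSL C) {X : Set (ι → ℤ)} (hX : IsOrthogonalSet C X)
    (h : ∀ β₁ ∈ X, ∀ β₂ ∈ X, ∀ β₃ ∈ X, β₁ ≠ β₂ → β₁ ≠ β₃ → β₂ ≠ β₃ →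
      ∀ α, form C α α = 2 → |form C α β₁| = 1 → |form C α β₂| = 1 → |form C α β₃| = 1 →
      ∃ β₄ ∈ X, β₄ ≠ β₁ ∧ β₄ ≠ β₂ ∧ β₄ ≠ β₃ ∧ |form C α β₄| = 1) : IsAdmissible C X := by
  rw [isAdmissible_iff hC]
  refine ⟨hX, ?_⟩
  intro β₁ m1 β₂ m2 β₃ m3 h12 h13 h23 α hα h1 h2 h3 γ hγ hor
  obtain ⟨β₄, m4, h41, h42, h43, h4⟩ := h β₁ m1 β₂ m2 β₃ m3 h12 h13 h23 α hα h1 h2 h3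
  have hz : (2 : ℤ) • α - form C α β₁ • β₁ - form C α β₂ • β₂ - form C α β₃ • β₃ -
      form C α β₄ • β₄ = 0 := by
    apply hC.eq_zero
    simp only [form_sub_left, form_sub_right, form_smul_left, form_smul_right, hα,
      hX.norm hC _ m1, hX.norm hC _ m2, hX.norm hC _ m3, hX.norm hC _ m4,
      hX.2 _ m1 _ m2 h12, hX.2 _ m2 _ m1 h12.symm, hX.2 _ m1 _ m3 h13, hX.2 _ m3 _ m1 h13.symm,
      hX.2 _ m2 _ m3 h23, hX.2 _ m3 _ m2 h23.symm, hX.2 _ m4 _ m1 h41, hX.2 _ m1 _ m4 h41.symm,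
      hX.2 _ m4 _ m2 h42, hX.2 _ m2 _ m4 h42.symm, hX.2 _ m4 _ m3 h43, hX.2 _ m3 _ m4 h43.symm,
      hC.comm β₁ α, hC.comm β₂ α, hC.comm β₃ α, hC.comm β₄ α]
    linarith [sq_eq_one_of_abs h1, sq_eq_one_of_abs h2, sq_eq_one_of_abs h3, sq_eq_one_of_abs h4]
  rw [sub_eq_zero.mp hz] at hor
  have : γ = β₄ := by
    refine eq_of_eq_or_eq_neg hC hγ (hX.1 m4) ?_
    rcases (abs_eq (by norm_num : (0 : ℤ) ≤ 1)).mp h4 with h | h <;> rw [h] at hor <;>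
      simpa [or_comm] using hor
  rw [this]; exact m4

theorem norm_closure (hC : IsSL C) {X : Set (ι → ℤ)} (hX : IsOrthogonalSet C X)
    {α β₁ β₂ β₃ : ι → ℤ} (m1 : β₁ ∈ X) (m2 : β₂ ∈ X) (m3 : β₃ ∈ X) (h12 : β₁ ≠ β₂)
    (h13 : β₁ ≠ β₃) (h23 : β₂ ≠ β₃) (hα : form C α α = 2)
    (h1 : |form C α β₁| = 1) (h2 : |form C α β₂| = 1) (h3 : |form C α β₃| = 1) :
    form C ((2 : ℤ) • α - form C α β₁ • β₁ - form C α β₂ • β₂ - form C α β₃ • β₃)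
      ((2 : ℤ) • α - form C α β₁ • β₁ - form C α β₂ • β₂ - form C α β₃ • β₃) = 2 := by
  simp only [form_sub_left, form_sub_right, form_smul_left, form_smul_right, hα,
    hX.norm hC _ m1, hX.norm hC _ m2, hX.norm hC _ m3,
    hX.2 _ m1 _ m2 h12, hX.2 _ m2 _ m1 h12.symm, hX.2 _ m1 _ m3 h13, hX.2 _ m3 _ m1 h13.symm,
    hX.2 _ m2 _ m3 h23, hX.2 _ m3 _ m2 h23.symm,
    hC.comm β₁ α, hC.comm β₂ α, hC.comm β₃ α]
  linarith [sq_eq_one_of_abs h1, sq_eq_one_of_abs h2, sq_eq_one_of_abs h3]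

/-- The vector `2α - Σ (α, βᵢ) βᵢ` over three roots has norm 2, inner product 1 with `α`, and is
orthogonal to the three; up to sign it is the required root. -/
theorem IsAdmissible.exists_fourth (hC : IsSL C) {X : Set (ι → ℤ)} (hX : IsAdmissible C X)
    {α β₁ β₂ β₃ : ι → ℤ} (m1 : β₁ ∈ X) (m2 : β₂ ∈ X) (m3 : β₃ ∈ X) (h12 : β₁ ≠ β₂)
    (h13 : β₁ ≠ β₃) (h23 : β₂ ≠ β₃) (hα : form C α α = 2)
    (h1 : |form C α β₁| = 1) (h2 : |form C α β₂| = 1) (h3 : |form C α β₃| = 1) :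
    ∃ β₄ ∈ X, β₄ ≠ β₁ ∧ β₄ ≠ β₂ ∧ β₄ ≠ β₃ ∧ |form C α β₄| = 1 := by
  have hX' := (isAdmissible_iff hC).mp hX
  have hO := hX.1
  have hn := norm_closure hC hO m1 m2 m3 h12 h13 h23 hα h1 h2 h3
  set δ := (2 : ℤ) • α - form C α β₁ • β₁ - form C α β₂ • β₂ - form C α β₃ • β₃ with hδ
  obtain ⟨γ, hγ, hor⟩ : ∃ γ ∈ posRoots C, γ = δ ∨ γ = -δ := by
    rcases pos_or_neg_mem hC hn with h | h
    · exact ⟨δ, h, Or.inl rfl⟩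
    · exact ⟨-δ, h, Or.inr rfl⟩
  have hmem := hX'.2 β₁ m1 β₂ m2 β₃ m3 h12 h13 h23 α hα h1 h2 h3 γ hγ hor
  have hα' : form C α δ = 1 := by
    rw [hδ]
    simp only [form_sub_right, form_smul_right, hα]
    linarith [sq_eq_one_of_abs h1, sq_eq_one_of_abs h2, sq_eq_one_of_abs h3]
  have key : ∀ β, (β = β₁ ∨ β = β₂ ∨ β = β₃) → form C β δ = 0 := by
    rw [hδ]
    simp only [form_sub_right, form_smul_right]
    rintro β (rfl | rfl | rfl)
    · rw [hO.norm hC _ m1, hO.2 _ m1 _ m2 h12, hO.2 _ m1 _ m3 h13, hC.comm β]; ring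
    · rw [hO.norm hC _ m2, hO.2 _ m2 _ m1 h12.symm, hO.2 _ m2 _ m3 h23, hC.comm β]; ring
    · rw [hO.norm hC _ m3, hO.2 _ m3 _ m1 h13.symm, hO.2 _ m3 _ m2 h23.symm, hC.comm β]; ring
  have hne : ∀ β, (β = β₁ ∨ β = β₂ ∨ β = β₃) → γ ≠ β := by
    rintro β hβ rfl
    have h2 := hO.norm hC γ hmem
    have h4 := key γ hβ
    have h5 : |form C γ δ| = 2 := by
      rcases hor with h6 | h6
      · rw [← h6, h2]; rfl
      · rw [← neg_eq_iff_eq_neg.mpr h6, form_neg_right, h2]; rfl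
    rw [h4] at h5
    simp at h5
  refine ⟨γ, hmem, hne _ (Or.inl rfl), hne _ (Or.inr (Or.inl rfl)),
    hne _ (Or.inr (Or.inr rfl)), ?_⟩
  rcases hor with h | h <;> rw [h]
  · rw [hα']; rfl
  · rw [form_neg_right, hα']; rfl

/-- The criterion with a fourth root involves only absolute values of inner products, so it is
carried over by any isometry. -/
theorem isAdmissible_act (hC : IsSL C) {g : LatticeAut ι} (hg : g ∈ isometries C)
    {X : Set (ι → ℤ)} (hX : IsAdmissible C X) : IsAdmissible C (act C g X) := by
  have hXo := hX.1
  have hp : ∀ γ ∈ act C g X, ∃ β ∈ X, γ = g β ∨ γ = -g β := fun γ h => h.2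
  have hf : ∀ (α β γ : ι → ℤ), (γ = g β ∨ γ = -g β) → |form C α γ| = |form C (g⁻¹ α) β| := by
    rintro α β γ (rfl | rfl)
    · rw [form_inv_left hg]
    · rw [form_neg_right, abs_neg, form_inv_left hg]
  refine isAdmissible_of_exists_fourth hC (isOrthogonalSet_act hC hg hXo) ?_
  intro γ₁ m1 γ₂ m2 γ₃ m3 h12 h13 h23 α hα h1 h2 h3
  obtain ⟨β₁, n1, e1⟩ := hp γ₁ m1
  obtain ⟨β₂, n2, e2⟩ := hp γ₂ m2
  obtain ⟨β₃, n3, e3⟩ := hp γ₃ m3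
  have hne : ∀ {γ γ' β β'}, γ ∈ act C g X → γ' ∈ act C g X → (γ = g β ∨ γ = -g β) →
      (γ' = g β' ∨ γ' = -g β') → γ ≠ γ' → β ≠ β' := by
    rintro γ γ' β _ hγ hγ' h h' hne rfl
    refine hne (eq_of_eq_or_eq_neg hC hγ.1 hγ'.1 ?_)
    rcases h with rfl | rfl <;> rcases h' with rfl | rfl <;> simp
  rw [hf α β₁ γ₁ e1] at h1
  rw [hf α β₂ γ₂ e2] at h2
  rw [hf α β₃ γ₃ e3] at h3
  obtain ⟨β₄, n4, k1, k2, k3, k4⟩ := hX.exists_fourth hC n1 n2 n3 (hne m1 m2 e1 e2 h12)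
    (hne m1 m3 e1 e3 h13) (hne m2 m3 e2 e3 h23) (norm_apply (inv_mem hg) hα) h1 h2 h3
  obtain ⟨γ₄, m4, e4⟩ := exists_mem_act hC hg hXo.1 n4
  have hne2 : ∀ {γ β}, (γ = g β ∨ γ = -g β) → β ∈ X → β₄ ≠ β → γ₄ ≠ γ := by
    rintro γ β h hβ hne rfl
    refine hne (eq_of_eq_or_eq_neg hC (hXo.1 n4) (hXo.1 hβ) ?_)
    rcases h with h | h <;> rcases e4 with e | e
    · exact Or.inl (g.injective (e.symm.trans h))
    · right; apply g.injective; rw [map_neg, ← h, e, neg_neg]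
    · right; apply g.injective; rw [map_neg]; exact e.symm.trans h
    · exact Or.inl (g.injective (neg_injective (e.symm.trans h)))
  exact ⟨γ₄, m4, hne2 e1 n1 k1, hne2 e2 n2 k2, hne2 e3 n3 k3, by rw [hf α β₄ γ₄ e4, k4]⟩

theorem isAdmissible_of_mem_orbit (hC : IsSL C) {X Y : Set (ι → ℤ)} (hX : IsAdmissible C X)
    (h : Y ∈ orbit C X) : IsAdmissible C Y := by
  obtain ⟨w, hw, rfl⟩ := h
  exact isAdmissible_act hC (weylGroup_le_isometries hC hw) hX

theorem isAdmissible_empty (hC : IsSL C) : IsAdmissible C (∅ : Set (ι → ℤ)) :=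
  isAdmissible_of_exists_fourth hC ⟨Set.empty_subset _, by simp⟩ (by simp)

theorem admissibleOrbits_finite (hC : IsSL C) : (admissibleOrbits C).Finite := by
  refine ((posRoots_finite hC).finite_subsets.finite_subsets).subset ?_
  rintro O ⟨X, -, rfl⟩ Y hY
  exact subset_posRoots_of_mem_orbit hY

end Admissible

/-! ### Moving one root while others stay fixed -/

section Linking

variable {ι : Type} [Fintype ι] [DecidableEq ι] {C : Matrix ι ι ℤ}

/-- Two roots are linked over `S` if they are equal up to sign, or have inner product `±1`, or both
have inner product `±1` with a third root orthogonal to `S`. -/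
def Linked (C : Matrix ι ι ℤ) (S : Set (ι → ℤ)) (γ γ' : ι → ℤ) : Prop :=
  γ = γ' ∨ γ = -γ' ∨ |form C γ γ'| = 1 ∨
    ∃ δ, form C δ δ = 2 ∧ (∀ β ∈ S, form C δ β = 0) ∧ |form C γ δ| = 1 ∧ |form C δ γ'| = 1

/-- One of `γ - γ'` and `γ + γ'` has norm 2; its reflection exchanges the two roots up to sign and
fixes everything orthogonal to both. -/
theorem exists_conj_of_abs_form_eq_one (hC : IsSL C) {γ γ' : ι → ℤ} (hγ : form C γ γ = 2)
    (hγ' : form C γ' γ' = 2) (h : |form C γ γ'| = 1) : ∃ w ∈ weylGroup C,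
      (∀ β, form C γ β = 0 → form C γ' β = 0 → w β = β) ∧ (w γ = γ' ∨ w γ = -γ') := by
  rcases (abs_eq (by norm_num : (0 : ℤ) ≤ 1)).mp h with h | h
  · have hn : form C (γ - γ') (γ - γ') = 2 := by rw [hC.form_sub_self]; omega
    refine ⟨_, reflE_mem_weylGroup hC _ hn, fun β h1 h2 => reflE_of_orth _ ?_, Or.inl ?_⟩
    · rw [hC.comm, form_sub_left, h1, h2, sub_zero]
    · rw [reflE_apply, form_sub_right, hγ, h]; module
  · have hn : form C (γ + γ') (γ + γ') = 2 := by rw [hC.form_add_self]; omega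
    refine ⟨_, reflE_mem_weylGroup hC _ hn, fun β h1 h2 => reflE_of_orth _ ?_, Or.inr ?_⟩
    · rw [hC.comm, form_add_left, h1, h2, add_zero]
    · rw [reflE_apply, form_add_right, hγ, h]; module

theorem Linked.exists_conj (hC : IsSL C) {S : Set (ι → ℤ)} {γ γ' : ι → ℤ}
    (h : Linked C S γ γ') (hγ : form C γ γ = 2) (hγ' : form C γ' γ' = 2)
    (hS : ∀ β ∈ S, form C γ β = 0) (hS' : ∀ β ∈ S, form C γ' β = 0) :
    ∃ w ∈ weylGroup C, (∀ β ∈ S, w β = β) ∧ (w γ = γ' ∨ w γ = -γ') := by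
  rcases h with h | h | h | ⟨δ, hδ, hδS, h1, h2⟩
  · exact ⟨1, one_mem _, fun _ _ => rfl, Or.inl h⟩
  · exact ⟨1, one_mem _, fun _ _ => rfl, Or.inr h⟩
  · obtain ⟨w, hw, h1, h2⟩ := exists_conj_of_abs_form_eq_one hC hγ hγ' h
    exact ⟨w, hw, fun β hβ => h1 β (hS β hβ) (hS' β hβ), h2⟩
  · obtain ⟨w, hw, k1, k2⟩ := exists_conj_of_abs_form_eq_one hC hγ hδ h1
    obtain ⟨u, hu, l1, l2⟩ := exists_conj_of_abs_form_eq_one hC hδ hγ' h2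
    refine ⟨u * w, mul_mem hu hw, fun β hβ => ?_, ?_⟩
    · rw [LinearEquiv.mul_apply, k1 β (hS β hβ) (hδS β hβ), l1 β (hδS β hβ) (hS' β hβ)]
    · rw [LinearEquiv.mul_apply]
      rcases k2 with k | k <;> rcases l2 with l | l <;> simp [k, l]

theorem exists_mem_orbit_of_linked (hC : IsSL C) {X S : Set (ι → ℤ)} (hX : X ⊆ posRoots C)
    (hSX : S ⊆ X) {γ γ' : ι → ℤ} (hγ : γ ∈ X) (hγ' : γ' ∈ posRoots C)
    (h : Linked C S γ γ') (hS : ∀ β ∈ S, form C γ β = 0) (hS' : ∀ β ∈ S, form C γ' β = 0) :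
    ∃ w ∈ weylGroup C, (∀ β ∈ S, w β = β) ∧ (w γ = γ' ∨ w γ = -γ') ∧
      insert γ' S ⊆ act C w X := by
  obtain ⟨w, hw, h1, h2⟩ := h.exists_conj hC (norm_of_mem_posRoots hC (hX hγ))
    (norm_of_mem_posRoots hC hγ') hS hS'
  refine ⟨w, hw, h1, h2, ?_⟩
  rintro β (rfl | hβ)
  · refine ⟨hγ', γ, hγ, ?_⟩
    rcases h2 with h2 | h2 <;> simp [h2]
  · exact ⟨hX (hSX hβ), β, hSX hβ, Or.inl (h1 β hβ).symm⟩

end Linking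

/-! ### Recognizing the highest element -/

section Highest

variable {ι : Type} [Fintype ι] [DecidableEq ι] {C : Matrix ι ι ℤ}

theorem SetLT.not_symm {X Y : Set (ι → ℤ)} (h : SetLT X Y) : ¬ SetLT Y X := by
  obtain ⟨β, hβ, γ, hγ, h1, h2, h3⟩ := h
  rintro ⟨γ', hγ', β', hβ', k1, k2, k3⟩
  have a := h1 β' hβ'
  have b := h2 γ' hγ'
  have c := k1 γ hγ
  have d := k2 β hβ
  omega

theorem IsHighest.unique {O : Set (Set (ι → ℤ))} {B B' : Set (ι → ℤ)} (h : IsHighest O B)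
    (h' : IsHighest O B') : B' = B := by
  by_contra hne
  exact (h.2 B' h'.1 hne).not_symm (h'.2 B h.1 (Ne.symm hne))

/-- The root of `X` below the threshold is outside `B`, so the minimum over `X \ B` is below the
threshold, and the minimum over `B \ X` is not. The latter difference is nonempty because `X` and
`B` have the same number of elements. -/
theorem isHighest_of_height (hC : IsSL C) {B : Set (ι → ℤ)} (hB : B ⊆ posRoots C) (h₀ : ℤ)
    (hlow : ∀ β ∈ B, h₀ ≤ height β)
    (hhigh : ∀ X ∈ orbit C B, X ≠ B → ∃ β ∈ X, height β < h₀) : IsHighest (orbit C B) B := by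
  refine ⟨mem_orbit_self hC hB, fun X hX hne => ?_⟩
  have hXp := subset_posRoots_of_mem_orbit hX
  have hXf := (posRoots_finite hC).subset hXp
  have hBf := (posRoots_finite hC).subset hB
  have hcard : X.ncard = B.ncard := by
    obtain ⟨w, hw, rfl⟩ := hX
    exact ncard_act hC (weylGroup_le_isometries hC hw) hB
  obtain ⟨β₀, hβ₀, hlt⟩ := hhigh X hX hne
  have hβ₀' : β₀ ∈ X \ B := ⟨hβ₀, fun h => by have := hlow β₀ h; omega⟩
  have hne2 : (B \ X).Nonempty := by
    rw [Set.nonempty_iff_ne_empty]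
    intro h
    have hsub : B ⊆ X := Set.sdiff_eq_empty.mp h
    exact hne (Set.eq_of_subset_of_ncard_le hsub hcard.le hXf).symm
  obtain ⟨β, hβ, hmin⟩ := Set.exists_min_image (X \ B) height (hXf.subset Set.sdiff_subset)
    ⟨β₀, hβ₀'⟩
  obtain ⟨γ, hγ, hmin'⟩ := Set.exists_min_image (B \ X) height (hBf.subset Set.sdiff_subset) hne2
  refine ⟨β, hβ, γ, hγ, hmin, hmin', ?_⟩
  have h1 := hmin β₀ hβ₀'
  have h2 := hlow γ hγ.1
  omega

theorem orbitNodes_eq {O : Set (Set (ι → ℤ))} {B : Set (ι → ℤ)} (h : IsHighest O B) :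
    orbitNodes C O = {i | ∀ β ∈ B, form C (Pi.single i 1) β = 0} := by
  ext i
  constructor
  · rintro ⟨B', hB', h'⟩
    rw [h.unique hB'] at h'
    exact h'
  · exact fun h' => ⟨B, h, h'⟩

theorem NodesHaveType.of_injective {κ : Type} {J : Set ι} {D : Matrix κ κ ℤ} (f : κ → ι)
    (hf : Function.Injective f) (hJ : Set.range f = J) (hD : ∀ k l, C (f k) (f l) = D k l) :
    NodesHaveType C J D := by
  subst hJ
  refine ⟨Equiv.ofInjective f hf, ?_⟩
  ext k l
  simp [hD]

end Highest

/-! ### Isomorphisms described by relations -/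

section QuotientGroups

variable {W : Type*} [Group W]

/-- A multiplicative relation between a subgroup `N` and a group `G` that is total on both sides
identifies the quotient of `N` by its kernel with `G`. -/
theorem quotient_mulEquiv_of_rel {N K : Subgroup W} [(K.subgroupOf N).Normal] {G : Type*} [Group G]
    (R : W → G → Prop) (tot : ∀ n ∈ N, ∃ g, R n g) (surj : ∀ g, ∃ n ∈ N, R n g)
    (mul : ∀ n ∈ N, ∀ m ∈ N, ∀ g h, R n g → R m h → R (n * m) (g * h))
    (uniq : ∀ n ∈ N, ∀ g h, R n g → R n h → g = h) (ker : ∀ n ∈ N, R n 1 ↔ n ∈ K) :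
    Nonempty ((N ⧸ K.subgroupOf N) ≃* G) := by
  choose f hf using fun n : N => tot n.1 n.2
  let F : N →* G := MonoidHom.mk' f fun a b =>
    uniq _ (a * b).2 _ _ (hf (a * b)) (mul _ a.2 _ b.2 _ _ (hf a) (hf b))
  have hsurj : Function.Surjective F := fun g => by
    obtain ⟨n, hn, hg⟩ := surj g
    exact ⟨⟨n, hn⟩, uniq n hn _ _ (hf ⟨n, hn⟩) hg⟩
  have hker : K.subgroupOf N = F.ker := by
    ext n
    rw [Subgroup.mem_subgroupOf, ← ker n.1 n.2, MonoidHom.mem_ker]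
    constructor
    · exact fun h => uniq n.1 n.2 _ _ (hf n) h
    · intro h
      have := hf n
      rwa [show f n = 1 from h] at this
  exact ⟨(QuotientGroup.quotientMulEquivOfEq hker).trans
    (QuotientGroup.quotientKerEquivOfSurjective F hsurj)⟩

theorem mulEquiv_of_rel {H G : Type*} [Group H] [Group G] (R : H → G → Prop)
    (tot : ∀ n, ∃ g, R n g) (surj : ∀ g, ∃ n, R n g)
    (mul : ∀ n m g h, R n g → R m h → R (n * m) (g * h))
    (uniq : ∀ n g h, R n g → R n h → g = h) (uniq' : ∀ n m g, R n g → R m g → n = m) :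
    Nonempty (H ≃* G) := by
  choose f hf using tot
  let F : H →* G := MonoidHom.mk' f fun a b =>
    uniq _ _ _ (hf (a * b)) (mul _ _ _ _ (hf a) (hf b))
  refine ⟨MulEquiv.ofBijective F ⟨fun a b hab => ?_, fun g => ?_⟩⟩
  · have h := hf a
    rw [show f a = f b from hab] at h
    exact uniq' _ _ _ h (hf b)
  · obtain ⟨n, hn⟩ := surj g
    exact ⟨n, uniq _ _ _ (hf n) hn⟩

theorem card_eq_of_rel {H G : Type*} (R : H → G → Prop)
    (tot : ∀ n, ∃ g, R n g) (surj : ∀ g, ∃ n, R n g)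
    (uniq : ∀ n g h, R n g → R n h → g = h) (uniq' : ∀ n m g, R n g → R m g → n = m) :
    Nat.card H = Nat.card G := by
  choose f hf using tot
  refine Nat.card_congr (Equiv.ofBijective f ⟨fun a b hab => ?_, fun g => ?_⟩)
  · have h := hf a
    rw [hab] at h
    exact uniq' _ _ _ h (hf b)
  · obtain ⟨n, hn⟩ := surj g
    exact ⟨n, uniq _ _ _ (hf n) hn⟩

theorem mem_normalizer_image (φ : MulAut W) (S : Set W) {n : W} :
    φ n ∈ Subgroup.normalizer (φ '' S) ↔ n ∈ Subgroup.normalizer S := by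
  rw [Subgroup.mem_set_normalizer_iff, Subgroup.mem_set_normalizer_iff]
  have h1 : ∀ x, φ x ∈ φ '' S ↔ x ∈ S := fun x => φ.injective.mem_set_image
  constructor
  · intro h x
    rw [← h1, h, ← map_mul, ← map_inv, ← map_mul, h1]
  · intro h x
    obtain ⟨y, rfl⟩ := φ.surjective x
    rw [h1, h, ← map_mul, ← map_inv, ← map_mul, h1]

theorem mem_centralizer_image (φ : MulAut W) (S : Set W) {n : W} :
    φ n ∈ Subgroup.centralizer (φ '' S) ↔ n ∈ Subgroup.centralizer S := by
  rw [Subgroup.mem_centralizer_iff, Subgroup.mem_centralizer_iff]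
  constructor
  · intro h x hx
    apply φ.injective
    rw [map_mul, map_mul]
    exact h _ ⟨x, hx, rfl⟩
  · rintro h _ ⟨x, hx, rfl⟩
    rw [← map_mul, h x hx, map_mul]

end QuotientGroups

/-! ### Transport along isometries and Cartan types of subsystems -/

section Transport

variable {ι : Type} [Fintype ι] [DecidableEq ι] {C : Matrix ι ι ℤ}

/-- The group `N_W(X) / C_W(X)`. -/
abbrev QuotientNC (C : Matrix ι ι ℤ) (X : Set (ι → ℤ)) : Type :=
  normW C X ⧸ (centW C X).subgroupOf (normW C X)

/-- Conjugation by `g` carries the normalizer and the centralizer of `X` to those of its image, so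
one representative of each orbit suffices. -/
theorem quotientNC_act (hC : IsSL C) {g : LatticeAut ι} (hg : g ∈ isometries C)
    {X : Set (ι → ℤ)} (hX : X ⊆ posRoots C) {G : Type} [Group G]
    (h : Nonempty (QuotientNC C X ≃* G)) : Nonempty (QuotientNC C (act C g X) ≃* G) := by
  obtain ⟨e⟩ := h
  set φ := conjW hC g hg
  have hN : ∀ n, φ n ∈ normW C (act C g X) ↔ n ∈ normW C X := fun n => by
    unfold normW
    rw [reflections_act hC hg hX, mem_normalizer_image]
  have hK : ∀ n, φ n ∈ centW C (act C g X) ↔ n ∈ centW C X := fun n => by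
    unfold centW
    rw [reflections_act hC hg hX, mem_centralizer_image]
  suffices hq : Nonempty (QuotientNC C (act C g X) ≃* QuotientNC C X) by
    obtain ⟨e'⟩ := hq
    exact ⟨e'.trans e⟩
  refine quotient_mulEquiv_of_rel (N := normW C (act C g X)) (K := centW C (act C g X))
    (G := QuotientNC C X)
    (fun n q => ∃ m : normW C X, φ m.1 = n ∧ q = QuotientGroup.mk m) ?_ ?_ ?_ ?_ ?_
  · intro n hn
    obtain ⟨m, rfl⟩ := φ.surjective n
    exact ⟨_, ⟨m, (hN m).mp hn⟩, rfl, rfl⟩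
  · intro q
    obtain ⟨m, rfl⟩ := QuotientGroup.mk_surjective q
    exact ⟨φ m.1, (hN _).mpr m.2, m, rfl, rfl⟩
  · rintro _ - _ - _ _ ⟨m, rfl, rfl⟩ ⟨m', rfl, rfl⟩
    exact ⟨m * m', by simp, rfl⟩
  · rintro _ - _ _ ⟨m, rfl, rfl⟩ ⟨m', h, rfl⟩
    rw [Subtype.ext (φ.injective h)]
  · rintro n hn
    constructor
    · rintro ⟨m, rfl, h⟩
      rw [hK]
      have := (QuotientGroup.eq_one_iff m).mp h.symm
      exact Subgroup.mem_subgroupOf.mp this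
    · intro h
      obtain ⟨m, rfl⟩ := φ.surjective n
      refine ⟨⟨m, (hN m).mp hn⟩, rfl, ?_⟩
      exact ((QuotientGroup.eq_one_iff _).mpr (Subgroup.mem_subgroupOf.mpr ((hK m).mp h))).symm

theorem perpRoots_act (hC : IsSL C) {g : LatticeAut ι} (hg : g ∈ isometries C)
    {X : Set (ι → ℤ)} (hX : X ⊆ posRoots C) : perpRoots C (act C g X) = g '' perpRoots C X := by
  ext γ
  constructor
  · rintro ⟨h1, h2⟩
    refine ⟨g⁻¹ γ, ⟨?_, fun β hβ => ?_⟩, apply_inv_self' g γ⟩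
    · rw [mem_roots_iff hC] at *
      exact norm_apply (inv_mem hg) h1
    · rw [form_inv_left hg]
      obtain ⟨δ, hδ, hor⟩ := exists_mem_act hC hg hX hβ
      have := h2 δ hδ
      rcases hor with rfl | rfl
      · exact this
      · rwa [form_neg_right, neg_eq_zero] at this
  · rintro ⟨γ, ⟨h1, h2⟩, rfl⟩
    refine ⟨?_, ?_⟩
    · rw [mem_roots_iff hC] at *
      exact norm_apply hg h1
    · rintro δ ⟨-, β, hβ, rfl | rfl⟩
      · rw [hg, h2 β hβ]
      · rw [form_neg_right, hg, h2 β hβ, neg_zero]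

theorem hasCartanType_act (hC : IsSL C) {g : LatticeAut ι} (hg : g ∈ isometries C)
    {X : Set (ι → ℤ)} (hX : X ⊆ posRoots C) {κ : Type} [Fintype κ] [DecidableEq κ]
    {P : Matrix κ κ ℤ} (h : HasCartanType C (perpRoots C X) P) :
    HasCartanType C (perpRoots C (act C g X)) P := by
  obtain ⟨F, h1, h2, h3⟩ := h
  refine ⟨g.toLinearMap ∘ₗ F, g.injective.comp h1, fun x y => ?_, ?_⟩
  · rw [← h2]; exact hg _ _
  · rw [perpRoots_act hC hg hX, h3, Set.image_image]
    rfl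

/-- The linear map with given values on the simple roots. -/
def latticeMap {κ M : Type*} [Fintype κ] [AddCommGroup M] (γ : κ → M) : (κ → ℤ) →ₗ[ℤ] M :=
  Fintype.linearCombination ℤ γ

theorem latticeMap_apply {κ M : Type*} [Fintype κ] [AddCommGroup M] (γ : κ → M) (x : κ → ℤ) :
    latticeMap γ x = ∑ k, x k • γ k := rfl

theorem latticeMap_single {κ M : Type*} [Fintype κ] [DecidableEq κ] [AddCommGroup M] (γ : κ → M)
    (k : κ) : latticeMap γ (Pi.single k 1) = γ k := by
  simp [latticeMap]

theorem form_latticeMap {κ : Type} [Fintype κ] [DecidableEq κ] {P : Matrix κ κ ℤ}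
    (γ : κ → ι → ℤ) (h : ∀ k l, form C (γ k) (γ l) = P k l) (x y : κ → ℤ) :
    form C (latticeMap γ x) (latticeMap γ y) = form P x y := by
  rw [latticeMap_apply, latticeMap_apply, form_sum_left]
  simp only [form_sum_right, form_smul_left, form_smul_right, h]
  simp only [form, dotProduct, Matrix.mulVec, Finset.mul_sum]
  exact Finset.sum_congr rfl fun k _ => Finset.sum_congr rfl fun l _ => by ring

theorem injective_of_isometry {κ : Type} [Fintype κ] {P : Matrix κ κ ℤ} (hP : IsSL P)
    {F : (κ → ℤ) →ₗ[ℤ] (ι → ℤ)} (h : ∀ x y, form C (F x) (F y) = form P x y) :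
    Function.Injective F := by
  rw [injective_iff_map_eq_zero]
  intro x hx
  apply hP.eq_zero
  rw [← h, hx]; simp

/-- Roots are vectors of norm 2 in both lattices, so once the orthogonal roots lie in the integral
span of the family, the isometric embedding matches the two root systems. -/
theorem hasCartanType_of_family (hC : IsSL C) {X : Set (ι → ℤ)} {κ : Type} [Fintype κ]
    [DecidableEq κ] {P : Matrix κ κ ℤ} (hP : IsSL P) (γ : κ → ι → ℤ)
    (h : ∀ k l, form C (γ k) (γ l) = P k l) (hX : ∀ k, ∀ β ∈ X, form C (γ k) β = 0)
    (hspan : ∀ δ ∈ perpRoots C X, δ ∈ Submodule.span ℤ (Set.range γ)) :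
    HasCartanType C (perpRoots C X) P := by
  have hiso := form_latticeMap γ h
  refine ⟨latticeMap γ, injective_of_isometry hP hiso, hiso, ?_⟩
  ext δ
  constructor
  · intro hδ
    obtain ⟨x, rfl⟩ := (Submodule.mem_span_range_iff_exists_fun ℤ).mp (hspan δ hδ)
    refine ⟨x, ?_, rfl⟩
    rw [mem_roots_iff hP, ← hiso]
    exact (mem_roots_iff hC).mp hδ.1
  · rintro ⟨x, hx, rfl⟩
    refine ⟨?_, fun β hβ => ?_⟩
    · rw [mem_roots_iff hC, hiso]
      exact (mem_roots_iff hP).mp hx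
    · rw [latticeMap_apply, form_sum_left]
      exact Finset.sum_eq_zero fun k _ => by rw [form_smul_left, hX k β hβ, mul_zero]

/-- A principal submatrix is the Gram matrix of some of the simple roots, so positive definiteness
is inherited. -/
theorem IsSL.of_injective {κ : Type} [Fintype κ] [DecidableEq κ] (hC : IsSL C) (f : κ → ι)
    (hf : Function.Injective f) {P : Matrix κ κ ℤ} (hP : ∀ k l, C (f k) (f l) = P k l) :
    IsSL P where
  symm := by
    ext k l
    rw [Matrix.transpose_apply, ← hP, ← hP]
    exact hC.symm.apply _ _
  diag k := by rw [← hP, hC.diag]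
  offDiag k l h := by rw [← hP]; exact hC.offDiag _ _ (hf.ne h)
  pos x hx := by
    have h : ∀ k l, form C (Pi.single (f k) 1) (Pi.single (f l) 1) = P k l := fun k l => by
      rw [form_single_single, hP]
    rw [← form_latticeMap (C := C) (fun k => Pi.single (f k) 1) h]
    apply hC.pos
    contrapose! hx
    funext k
    have h1 := congrFun hx (f k)
    rw [latticeMap_apply, Finset.sum_apply, Finset.sum_eq_single k] at h1
    · simpa using h1
    · intro l _ hl
      simp [hf.ne hl.symm]
    · simp

/-- A generating set of reflections, contained in the image of a root system and containing the
image of its simple roots, generates a copy of the Weyl group of the root system. -/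
theorem card_reflSubgroup_eq (hC : IsSL C) {κ : Type} [Fintype κ]
    [DecidableEq κ] {P : Matrix κ κ ℤ} (hP : IsSL P) {F : (κ → ℤ) →ₗ[ℤ] (ι → ℤ)}
    (h : ∀ x y, form C (F x) (F y) = form P x y) {R : Set (ι → ℤ)} (hR : R ⊆ Set.range F)
    (hR' : ∀ k, F (Pi.single k 1) ∈ R) :
    Nat.card (reflSubgroup C R) = Nat.card (weylGroup P) := by
  have hinj := injective_of_isometry hP h
  have hrefl : ∀ y (hy : form P y y = 2) (hy' : form C (F y) (F y) = 2) x,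
      reflE C (F y) hy' (F x) = F (reflE P y hy x) := fun y hy hy' x => by
    rw [reflE_apply, reflE_apply, map_sub, map_smul, h]
  refine card_eq_of_rel (fun g w => ∀ x, g.1 (F x) = F (w.1 x)) ?_ ?_ ?_ ?_
  · rintro ⟨g, hg⟩
    induction hg using Subgroup.closure_induction with
    | mem g hg =>
      obtain ⟨β, hβ, hn, rfl⟩ := hg
      obtain ⟨y, rfl⟩ := hR hβ
      have hy : form P y y = 2 := by rw [← h, hn]
      exact ⟨⟨reflE P y hy, reflE_mem_weylGroup hP y hy⟩, fun x => hrefl y hy hn x⟩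
    | one => exact ⟨1, fun x => rfl⟩
    | mul a b _ _ ha hb =>
      obtain ⟨u, hu⟩ := ha
      obtain ⟨v, hv⟩ := hb
      refine ⟨u * v, fun x => ?_⟩
      have h1 := hu (v.1 x)
      have h2 := hv x
      simp only at h1 h2
      simp only [LinearEquiv.mul_apply, Subgroup.coe_mul, h2, h1]
    | inv a _ ha =>
      obtain ⟨u, hu⟩ := ha
      refine ⟨u⁻¹, fun x => ?_⟩
      have h1 := hu (u.1⁻¹ x)
      simp only [apply_inv_self'] at h1
      simp only [Subgroup.coe_inv, ← h1, inv_apply_self']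
  · rintro ⟨w, hw⟩
    obtain ⟨l, rfl⟩ := exists_word hP hw
    induction l with
    | nil => exact ⟨1, fun x => rfl⟩
    | cons i l ih =>
      obtain ⟨g, hg⟩ := ih (wordE_mem hP l)
      have hn : form C (F (Pi.single i 1)) (F (Pi.single i 1)) = 2 := by rw [h, hP.norm_single]
      refine ⟨⟨reflE C _ hn, reflE_mem_reflSubgroup (hR' i) hn⟩ * g, fun x => ?_⟩
      have h1 := hg x
      simp only at h1
      simp only [Subgroup.coe_mul, LinearEquiv.mul_apply, h1]
      exact hrefl _ (hP.norm_single i) hn _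
  · intro g u v hu hv
    ext1; ext1 x
    exact hinj ((hu x).symm.trans (hv x))
  · intro g g' u hg hg'
    ext1
    -- An element of the group generated by the reflections in `R` is determined by its values on
    -- `R`, and `R` lies in the image of `F`.
    refine eq_of_mem_reflSubgroup_of_eqOn hC g.2 g'.2 fun β hβ => ?_
    obtain ⟨y, rfl⟩ := hR hβ
    rw [hg, hg']

theorem card_reflSubgroup_of_hasCartanType (hC : IsSL C) {κ : Type} [Fintype κ]
    [DecidableEq κ] {P : Matrix κ κ ℤ} (hP : IsSL P) {R : Set (ι → ℤ)}
    (h : HasCartanType C R P) : Nat.card (reflSubgroup C R) = Nat.card (weylGroup P) := by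
  obtain ⟨F, -, h2, rfl⟩ := h
  refine card_reflSubgroup_eq hC hP h2 ?_ fun k => ⟨_, single_mem_roots k, rfl⟩
  rintro _ ⟨x, -, rfl⟩
  exact ⟨x, rfl⟩

theorem card_parabolicSubgroup (hC : IsSL C) {κ : Type} [Fintype κ] [DecidableEq κ]
    {D : Matrix κ κ ℤ} {J : Set ι} (h : NodesHaveType C J D) :
    Nat.card (parabolicSubgroup C J) = Nat.card (weylGroup D) := by
  obtain ⟨e, he⟩ := h
  have he' : ∀ k l, C (e k) (e l) = D k l := fun k l => by rw [← he]; rfl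
  have hinj : Function.Injective fun k => (e k : ι) := Subtype.val_injective.comp e.injective
  have hD : IsSL D := hC.of_injective (fun k => (e k : ι)) hinj he'
  have h1 : parabolicSubgroup C J = reflSubgroup C ((fun i => (Pi.single i 1 : ι → ℤ)) '' J) := by
    rw [parabolicSubgroup_eq hC]
    unfold reflSubgroup
    congr 1
    ext w
    constructor
    · rintro ⟨i, hi, rfl⟩
      exact ⟨_, ⟨i, hi, rfl⟩, hC.norm_single i, rfl⟩
    · rintro ⟨_, ⟨i, hi, rfl⟩, hn, rfl⟩
      exact ⟨i, hi, rfl⟩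
  rw [h1]
  refine card_reflSubgroup_eq hC hD
    (F := latticeMap fun k => (Pi.single (e k : ι) 1 : ι → ℤ)) ?_ ?_ ?_
  · exact form_latticeMap _ fun k l => by rw [form_single_single, he']
  · rintro _ ⟨i, hi, rfl⟩
    refine ⟨Pi.single (e.symm ⟨i, hi⟩) 1, ?_⟩
    rw [latticeMap_single]; simp
  · intro k
    rw [latticeMap_single]
    exact ⟨e k, (e k).2, rfl⟩

end Transport

/-! ### Orbit sizes and their contributions to the sum -/

section Counting

variable {ι : Type} [Fintype ι] [DecidableEq ι] {C : Matrix ι ι ℤ}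

theorem ncard_orbit (hC : IsSL C) {X : Set (ι → ℤ)} (hX : X ⊆ posRoots C) :
    (orbit C X).ncard = (normW C X).index := by
  rw [Subgroup.index, ← Nat.card_coe_set_eq]
  symm
  have hstab : ∀ a b : weylGroup C, a⁻¹ * b ∈ normW C X ↔ act C a.1 X = act C b.1 X := by
    intro a b
    have ha := weylGroup_le_isometries hC a.2
    have hb := weylGroup_le_isometries hC b.2
    rw [mem_normW_iff hC hX]
    simp only [Subgroup.coe_mul, Subgroup.coe_inv]
    rw [act_mul hC _ hb hX]
    constructor
    · intro h
      rw [← act_act_inv hC ha (act_subset b.1 X), h]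
    · intro h
      rw [← h, act_inv_act hC ha hX]
  refine card_eq_of_rel (H := weylGroup C ⧸ normW C X)
    (fun q Y => ∃ w : weylGroup C, q = QuotientGroup.mk w ∧ Y.1 = act C w.1 X) ?_ ?_ ?_ ?_
  · intro q
    obtain ⟨w, rfl⟩ := QuotientGroup.mk_surjective q
    exact ⟨⟨act C w.1 X, w.1, w.2, rfl⟩, w, rfl, rfl⟩
  · rintro ⟨Y, w, hw, rfl⟩
    exact ⟨_, ⟨w, hw⟩, rfl, rfl⟩
  · rintro _ ⟨Y, hY⟩ ⟨Z, hZ⟩ ⟨w, rfl, h⟩ ⟨u, h', h''⟩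
    ext1
    rw [h, h'']
    exact (hstab _ _).mp (QuotientGroup.eq.mp h')
  · rintro _ _ ⟨Y, hY⟩ ⟨w, rfl, h⟩ ⟨u, rfl, h'⟩
    rw [QuotientGroup.eq, hstab, ← h, ← h']

/-- The chain `C_W(X) ≤ N_W(X) ≤ W`, with the index of `N_W(X)` equal to the orbit size and the
order of `C_W(X)` given by its splitting. It gives orbit sizes when the order of `W` is known, and
for the exceptional types also the order of `W` itself. -/
theorem card_weylGroup_eq (hC : IsSL C) {X : Set (ι → ℤ)} (hX : IsOrthogonalSet C X)
    {κ : Type} [Fintype κ] [DecidableEq κ] {P : Matrix κ κ ℤ} (hP : IsSL P)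
    (h : HasCartanType C (perpRoots C X) P) {G : Type} [Group G]
    (hG : Nonempty (QuotientNC C X ≃* G)) :
    Nat.card (weylGroup C) =
      (orbit C X).ncard * (Nat.card G * (2 ^ X.ncard * Nat.card (weylGroup P))) := by
  obtain ⟨e⟩ := hG
  obtain ⟨-, hL, -, hcomp, -, hK⟩ := centralizerSplits hC hX
  rw [ncard_orbit hC hX.1, ← Nat.card_congr e.toEquiv, ← hK,
    ← card_reflSubgroup_of_hasCartanType hC hP h]
  have h1 := hcomp.card_mul_card
  have h2 : ∀ {A B : Subgroup (weylGroup C)}, A ≤ B → Nat.card (A.subgroupOf B) = Nat.card A :=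
    fun h => Nat.card_congr (Subgroup.subgroupOfEquivOfLe h).toEquiv
  obtain ⟨hK', -⟩ := centralizerSplits hC hX
  rw [h2 hK', h2 hL] at h1
  have h3 : Nat.card (Subgroup.closure (reflections C (perpRoots C X))) =
      Nat.card (reflSubgroup C (perpRoots C X)) :=
    Nat.card_congr ⟨fun w => ⟨w.1.1, (mem_closure_reflections_iff hC
      (norm_of_mem_perpRoots hC)).mp w.2⟩,
      fun w => ⟨⟨w.1, reflSubgroup_le_weylGroup hC _ w.2⟩,
        (mem_closure_reflections_iff hC (norm_of_mem_perpRoots hC)).mpr w.2⟩,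
      fun _ => rfl, fun _ => rfl⟩
  rw [← h3, h1, ← h2 (centW_le_normW X), ← Subgroup.card_eq_card_quotient_mul_card_subgroup,
    mul_comm, Subgroup.card_mul_index]

theorem isTableLine_of_rep (hC : IsSL C) {B : Set (ι → ℤ)} (hB : IsOrthogonalSet C B) {k : ℕ}
    (hk : B.ncard = k) (h₀ : ℤ) (hlow : ∀ β ∈ B, h₀ ≤ height β)
    (hhigh : ∀ X ∈ orbit C B, X ≠ B → ∃ β ∈ X, height β < h₀)
    {κ₁ κ₂ : Type} [Fintype κ₁] [DecidableEq κ₁] [Fintype κ₂] [DecidableEq κ₂]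
    {P : Matrix κ₁ κ₁ ℤ} {D : Matrix κ₂ κ₂ ℤ} {G : Type} [Group G]
    (hP : HasCartanType C (perpRoots C B) P)
    (hD : NodesHaveType C {i | ∀ β ∈ B, form C (Pi.single i 1) β = 0} D)
    (hG : Nonempty (QuotientNC C B ≃* G)) : IsTableLine C (orbit C B) k P D G := by
  have hhi := isHighest_of_height hC hB.1 h₀ hlow hhigh
  refine ⟨⟨B, hhi⟩, ?_, ?_, ?_, by rwa [orbitNodes_eq hhi], ?_⟩
  · rintro _ ⟨w, hw, rfl⟩
    rw [ncard_act hC (weylGroup_le_isometries hC hw) hB.1, hk]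
  · rintro _ ⟨w, hw, rfl⟩
    exact hasCartanType_act hC (weylGroup_le_isometries hC hw) hB.1 hP
  · rintro _ ⟨w, hw, rfl⟩
    exact centralizerSplits hC (isOrthogonalSet_act hC (weylGroup_le_isometries hC hw) hB)
  · rintro _ ⟨w, hw, rfl⟩
    exact quotientNC_act hC (weylGroup_le_isometries hC hw) hB.1 hG

/-- The contribution of an orbit to `orbitSum`. -/
noncomputable def orbitTerm (C : Matrix ι ι ℤ) (O : Set (Set (ι → ℤ))) : ℕ :=
  O.ncard ^ 2 * Nat.card (parabolicSubgroup C (orbitNodes C O))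

/-- The contribution of an orbit given by a line of the table. -/
theorem IsTableLine.orbitTerm_eq (hC : IsSL C) {B : Set (ι → ℤ)} (hB : IsOrthogonalSet C B) {k : ℕ}
    {κ₁ κ₂ : Type} [Fintype κ₁] [DecidableEq κ₁] [Fintype κ₂] [DecidableEq κ₂]
    {P : Matrix κ₁ κ₁ ℤ} {D : Matrix κ₂ κ₂ ℤ} {G : Type} [Group G] (hP : IsSL P)
    (h : IsTableLine C (orbit C B) k P D G) :
    ∃ m : ℕ, m * (Nat.card G * (2 ^ k * Nat.card (weylGroup P))) = Nat.card (weylGroup C) ∧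
      (orbit C B).ncard = m ∧
      orbitTerm C (orbit C B) = m ^ 2 * Nat.card (weylGroup D) := by
  have hBm := mem_orbit_self hC hB.1
  refine ⟨_, ?_, rfl, ?_⟩
  · rw [← h.card B hBm]
    exact (card_weylGroup_eq hC hB hP (h.perp B hBm) (h.quotient B hBm)).symm
  · rw [orbitTerm, card_parabolicSubgroup hC h.nodes]

theorem orbit_empty : orbit C (∅ : Set (ι → ℤ)) = {∅} := by
  ext X
  constructor
  · rintro ⟨w, -, rfl⟩
    exact act_empty w
  · rintro rfl
    exact ⟨1, one_mem _, (act_empty 1).symm⟩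

theorem orbitTerm_empty : orbitTerm C (orbit C (∅ : Set (ι → ℤ))) = Nat.card (weylGroup C) := by
  have h : IsHighest (orbit C (∅ : Set (ι → ℤ))) ∅ := by
    rw [orbit_empty]
    exact ⟨rfl, fun X hX hne => absurd hX hne⟩
  rw [orbitTerm, orbitNodes_eq h, orbit_empty]
  simp [weylGroup]

theorem admissibleOrbits_eq (hC : IsSL C) : admissibleOrbits C =
    insert (orbit C ∅) (nonemptyAdmissibleOrbits C) := by
  ext O
  constructor
  · rintro ⟨X, hX, rfl⟩
    rcases X.eq_empty_or_nonempty with rfl | hne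
    · exact Or.inl rfl
    · exact Or.inr ⟨X, hX, hne, rfl⟩
  · rintro (rfl | ⟨X, hX, -, rfl⟩)
    · exact ⟨∅, isAdmissible_empty hC, rfl⟩
    · exact ⟨X, hX, rfl⟩

theorem orbitSum_eq (hC : IsSL C) (s : Finset (Set (Set (ι → ℤ))))
    (hs : nonemptyAdmissibleOrbits C = s) :
    orbitSum C = Nat.card (weylGroup C) + ∑ O ∈ s, orbitTerm C O := by
  classical
  have hnot : orbit C (∅ : Set (ι → ℤ)) ∉ s := by
    intro h
    rw [← Finset.mem_coe, ← hs] at h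
    obtain ⟨X, hX, ⟨β, hβ⟩, hO⟩ := h
    have : X ∈ orbit C (∅ : Set (ι → ℤ)) := by
      rw [hO]; exact mem_orbit_self hC hX.1.1
    rw [orbit_empty, Set.mem_singleton_iff] at this
    rw [this] at hβ
    exact hβ
  have h1 : admissibleOrbits C = ↑(insert (orbit C (∅ : Set (ι → ℤ))) s) := by
    rw [admissibleOrbits_eq hC, hs, Finset.coe_insert]
  unfold orbitSum
  rw [h1]
  change (∑ᶠ O ∈ (↑(insert (orbit C (∅ : Set (ι → ℤ))) s) : Set _), orbitTerm C O) = _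
  rw [finsum_mem_coe_finset, Finset.sum_insert hnot, orbitTerm_empty]

end Counting

/-! ### Permutations of a family of roots induced by the Weyl group -/

section InducedPermutations

variable {ι : Type} [Fintype ι] [DecidableEq ι] {C : Matrix ι ι ℤ} {κ : Type}

/-- `w` permutes the roots `b k` up to sign, according to `π`. -/
def Induces (b : κ → ι → ℤ) (w : LatticeAut ι) (π : Equiv.Perm κ) : Prop :=
  ∀ k, w (b k) = b (π k) ∨ w (b k) = -b (π k)

theorem Induces.mul {b : κ → ι → ℤ} {w u : LatticeAut ι} {π ρ : Equiv.Perm κ}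
    (h : Induces b w π) (h' : Induces b u ρ) : Induces b (w * u) (π * ρ) := by
  intro k
  rw [LinearEquiv.mul_apply, Equiv.Perm.mul_apply]
  rcases h' k with h1 | h1 <;> rcases h (ρ k) with h2 | h2 <;> simp [h1, h2]

theorem induces_one (b : κ → ι → ℤ) : Induces b 1 1 := fun _ => Or.inl rfl

theorem Induces.inv {b : κ → ι → ℤ} {w : LatticeAut ι} {π : Equiv.Perm κ}
    (h : Induces b w π) : Induces b w⁻¹ π⁻¹ := by
  intro k
  have h1 := h (π⁻¹ k)
  rw [← Equiv.Perm.mul_apply, mul_inv_cancel, Equiv.Perm.one_apply] at h1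
  rcases h1 with h1 | h1
  · left; rw [← h1, inv_apply_self']
  · right
    have : b k = -w (b (π⁻¹ k)) := by rw [h1, neg_neg]
    rw [this, map_neg, inv_apply_self']

theorem Induces.unique (hC : IsSL C) {b : κ → ι → ℤ} (hb : Function.Injective b)
    (hpos : ∀ k, b k ∈ posRoots C) {w : LatticeAut ι} {π ρ : Equiv.Perm κ}
    (h : Induces b w π) (h' : Induces b w ρ) : π = ρ := by
  ext1 k
  apply hb
  refine eq_of_eq_or_eq_neg hC (hpos _) (hpos _) ?_
  rcases h k with h1 | h1 <;> rcases h' k with h2 | h2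
  · exact Or.inl (h1.symm.trans h2)
  · exact Or.inr (h1.symm.trans h2)
  · right; rw [← h2, h1, neg_neg]
  · left; exact neg_injective (h1.symm.trans h2)

variable [Finite κ]

theorem exists_induces (hC : IsSL C) {b : κ → ι → ℤ} (hb : Function.Injective b)
    (hpos : ∀ k, b k ∈ posRoots C) {w : LatticeAut ι} (hw : w ∈ isometries C)
    (h : act C w (Set.range b) = Set.range b) : ∃ π : Equiv.Perm κ, Induces b w π := by
  have hX : Set.range b ⊆ posRoots C := by rintro _ ⟨k, rfl⟩; exact hpos k
  have h1 : ∀ k, ∃ l, w (b k) = b l ∨ w (b k) = -b l := by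
    intro k
    obtain ⟨γ, hγ, hor⟩ := exists_mem_act hC hw hX ⟨k, rfl⟩
    rw [h] at hγ
    obtain ⟨l, rfl⟩ := hγ
    refine ⟨l, ?_⟩
    rcases hor with h | h <;> simp [h]
  choose f hf using h1
  have hinj : Function.Injective f := by
    intro k l hkl
    apply hb
    refine eq_of_eq_or_eq_neg hC (hpos _) (hpos _) ?_
    have h1 := hf k
    have h2 := hf l
    rw [hkl] at h1
    rcases h1 with h1 | h1 <;> rcases h2 with h2 | h2
    · exact Or.inl (w.injective (h1.trans h2.symm))
    · right; apply w.injective; rw [map_neg, h2, h1, neg_neg]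
    · right; apply w.injective; rw [map_neg, h2, h1]
    · exact Or.inl (w.injective (h1.trans h2.symm))
  exact ⟨Equiv.ofBijective f (Finite.injective_iff_bijective.mp hinj), hf⟩

theorem act_range_of_induces (hC : IsSL C) {b : κ → ι → ℤ} (hpos : ∀ k, b k ∈ posRoots C)
    {w : LatticeAut ι} {π : Equiv.Perm κ} (h : Induces b w π) :
    act C w (Set.range b) = Set.range b := by
  ext γ
  constructor
  · rintro ⟨hγ, _, ⟨k, rfl⟩, hor⟩
    refine ⟨π k, (eq_of_eq_or_eq_neg hC hγ (hpos _) ?_).symm⟩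
    rcases h k with h1 | h1 <;> rw [h1] at hor <;> simpa [or_comm] using hor
  · rintro ⟨k, rfl⟩
    refine ⟨hpos k, b (π⁻¹ k), ⟨_, rfl⟩, ?_⟩
    have h1 := h (π⁻¹ k)
    rw [← Equiv.Perm.mul_apply, mul_inv_cancel, Equiv.Perm.one_apply] at h1
    rcases h1 with h1 | h1 <;> rw [h1] <;> simp

/-- `N_W(X) / C_W(X)` is the group of permutations of `X` induced by `W`. -/
theorem quotientNC_of_perm (hC : IsSL C) {b : κ → ι → ℤ} (hb : Function.Injective b)
    (hpos : ∀ k, b k ∈ posRoots C) {G : Type} [Group G] (p : G →* Equiv.Perm κ)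
    (hp : Function.Injective p)
    (tot : ∀ w ∈ weylGroup C, ∀ π : Equiv.Perm κ, Induces b w π → ∃ g, p g = π)
    (surj : ∀ g, ∃ w ∈ weylGroup C, Induces b w (p g)) :
    Nonempty (QuotientNC C (Set.range b) ≃* G) := by
  have hX : Set.range b ⊆ posRoots C := by rintro _ ⟨k, rfl⟩; exact hpos k
  refine quotient_mulEquiv_of_rel (fun n g => Induces b n.1 (p g)) ?_ ?_ ?_ ?_ ?_
  · intro n hn
    rw [mem_normW_iff hC hX] at hn
    obtain ⟨π, hπ⟩ := exists_induces hC hb hpos (weylGroup_le_isometries hC n.2) hn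
    obtain ⟨g, rfl⟩ := tot n.1 n.2 π hπ
    exact ⟨g, hπ⟩
  · intro g
    obtain ⟨w, hw, h⟩ := surj g
    exact ⟨⟨w, hw⟩, (mem_normW_iff hC hX).mpr (act_range_of_induces hC hpos h), h⟩
  · intro n _ m _ g h hg hh
    rw [map_mul]
    exact hg.mul hh
  · intro n _ g h hg hh
    exact hp (hg.unique hC hb hpos hh)
  · intro n hn
    rw [mem_centW_iff hC fun β hβ => norm_of_mem_posRoots hC (hX hβ), map_one]
    exact ⟨by rintro h _ ⟨k, rfl⟩; exact h k, fun h k => h _ ⟨k, rfl⟩⟩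

theorem quotientNC_perm_of_swaps [DecidableEq κ] (hC : IsSL C) {b : κ → ι → ℤ}
    (hb : Function.Injective b) (hpos : ∀ k, b k ∈ posRoots C)
    (h : ∀ i j, i ≠ j → ∃ w ∈ weylGroup C, Induces b w (Equiv.swap i j)) :
    Nonempty (QuotientNC C (Set.range b) ≃* Equiv.Perm κ) := by
  refine quotientNC_of_perm hC hb hpos (MonoidHom.id _) Function.injective_id
    (fun w _ π _ => ⟨π, rfl⟩) fun g => ?_
  induction g using Equiv.Perm.swap_induction_on with
  | one => exact ⟨1, one_mem _, induces_one b⟩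
  | swap_mul f x y hxy ih =>
    obtain ⟨w, hw, h1⟩ := h x y hxy
    obtain ⟨u, hu, h2⟩ := ih
    exact ⟨w * u, mul_mem hw hu, h1.mul h2⟩

/-- Two roots `γ`, `δ` with `γ + δ = b i - b j` give an element of `W` that exchanges `b i` and
`b j`. -/
theorem exists_induces_swap [DecidableEq κ] (hC : IsSL C) {b : κ → ι → ℤ}
    {i j : κ} (γ δ : ι → ℤ) (hγ : form C γ γ = 2) (hδ : form C δ δ = 2) (hγδ : form C γ δ = 0)
    (hsum : γ + δ = b i - b j) (hi : form C γ (b i) = 1) (hi' : form C δ (b i) = 1)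
    (ho : ∀ k, k ≠ i → k ≠ j → form C γ (b k) = 0 ∧ form C δ (b k) = 0) :
    ∃ w ∈ weylGroup C, Induces b w (Equiv.swap i j) := by
  refine ⟨reflE C γ hγ * reflE C δ hδ,
    mul_mem (reflE_mem_weylGroup hC _ _) (reflE_mem_weylGroup hC _ _), fun k => Or.inl ?_⟩
  rw [LinearEquiv.mul_apply]
  have hj : b j = b i - (γ + δ) := by rw [hsum]; abel
  by_cases h1 : k = i
  · subst h1
    rw [Equiv.swap_apply_left, reflE_apply, reflE_apply, form_sub_left, form_smul_left,
      hC.comm δ γ, hC.comm (b k) δ, hC.comm (b k) γ, hi, hi', hγδ, hj]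
    module
  by_cases h2 : k = j
  · subst h2
    have e1 : form C (b k) δ = -1 := by
      rw [hC.comm, hj, form_sub_right, form_add_right, hi', hC.comm δ γ, hγδ, hδ]; norm_num
    have e2 : form C (b k) γ = -1 := by
      rw [hC.comm, hj, form_sub_right, form_add_right, hi, hγδ, hγ]; norm_num
    rw [Equiv.swap_apply_right, reflE_apply, reflE_apply, form_sub_left, form_smul_left,
      hC.comm δ γ, e1, e2, hγδ, hj]
    module
  · rw [Equiv.swap_apply_of_ne_of_ne h1 h2, reflE_of_orth hδ (by rw [hC.comm]; exact (ho k h1 h2).2),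
      reflE_of_orth hγ (by rw [hC.comm]; exact (ho k h1 h2).1)]

end InducedPermutations

/-! ### Orders of Weyl groups of reducible types -/

section Orders

variable {ι : Type} [Fintype ι] [DecidableEq ι] {C : Matrix ι ι ℤ}

theorem card_weylGroup_of_equiv (hC : IsSL C) {κ : Type} [Fintype κ] [DecidableEq κ]
    {D : Matrix κ κ ℤ} (e : κ ≃ ι) (h : ∀ k l, C (e k) (e l) = D k l) :
    Nat.card (weylGroup D) = Nat.card (weylGroup C) :=
  (card_parabolicSubgroup hC (NodesHaveType.of_injective e e.injective (by simp) h)).symm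

theorem card_weylGroup_of_isEmpty [IsEmpty ι] (C : Matrix ι ι ℤ) : Nat.card (weylGroup C) = 1 := by
  have : Subsingleton (LatticeAut ι) :=
    ⟨fun f g => by ext1 x; exact Subsingleton.elim _ _⟩
  exact Nat.card_of_subsingleton 1

theorem isSL_typeA1Pow (t : ℕ) : IsSL (typeA1Pow t) where
  symm := Matrix.isSymm_diagonal _
  diag i := by simp [typeA1Pow]
  offDiag i j h := by simp [typeA1Pow, h]
  pos x hx := by
    have h : form (typeA1Pow t) x x = ∑ i, 2 * (x i * x i) := by
      simp only [form, typeA1Pow, dotProduct, Matrix.mulVec_diagonal]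
      exact Finset.sum_congr rfl fun i _ => by ring
    rw [h]
    obtain ⟨i, hi⟩ := Function.ne_iff.mp hx
    refine Finset.sum_pos' (fun j _ => by nlinarith [mul_self_nonneg (x j)])
      ⟨i, Finset.mem_univ i, ?_⟩
    have := mul_self_pos.mpr hi
    linarith

theorem weylGroup_eq_reflSubgroup (hC : IsSL C) :
    weylGroup C = reflSubgroup C (Set.range fun i => (Pi.single i 1 : ι → ℤ)) := by
  rw [weylGroup, parabolicSubgroup_eq hC]
  unfold reflSubgroup
  congr 1
  ext w
  constructor
  · rintro ⟨i, -, rfl⟩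
    exact ⟨_, ⟨i, rfl⟩, hC.norm_single i, rfl⟩
  · rintro ⟨_, ⟨i, rfl⟩, hn, rfl⟩
    exact ⟨i, trivial, rfl⟩

theorem single_one_injective : Function.Injective fun i => (Pi.single i 1 : ι → ℤ) := by
  intro i j h
  by_contra hne
  have := congrFun h i
  simp [hne] at this

theorem card_weylGroup_typeA1Pow (t : ℕ) : Nat.card (weylGroup (typeA1Pow t)) = 2 ^ t := by
  have hC := isSL_typeA1Pow t
  have hX : IsOrthogonalSet (typeA1Pow t) (Set.range fun i => (Pi.single i 1 : Fin t → ℤ)) := by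
    constructor
    · rintro _ ⟨i, rfl⟩
      exact single_mem_posRoots hC i
    · rintro _ ⟨i, rfl⟩ _ ⟨j, rfl⟩ h
      have hij : i ≠ j := fun h' => h (by rw [h'])
      rw [form_single_single]
      simp [typeA1Pow, hij]
  rw [weylGroup_eq_reflSubgroup hC, card_reflSubgroup_orthogonal hC hX, ← Set.image_univ,
    Set.ncard_image_of_injective _ single_one_injective, Set.ncard_univ]
  simp

variable {κ : Type} [Fintype κ] [DecidableEq κ]

theorem form_sumType (P : Matrix ι ι ℤ) (Q : Matrix κ κ ℤ) (x y : ι ⊕ κ → ℤ) :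
    form (sumType P Q) x y =
      form P (x ∘ Sum.inl) (y ∘ Sum.inl) + form Q (x ∘ Sum.inr) (y ∘ Sum.inr) := by
  simp [form, sumType, dotProduct, Matrix.mulVec, Matrix.fromBlocks]

theorem isSL_sumType {P : Matrix ι ι ℤ} {Q : Matrix κ κ ℤ} (hP : IsSL P) (hQ : IsSL Q) :
    IsSL (sumType P Q) where
  symm := by
    unfold sumType
    rw [Matrix.IsSymm, Matrix.fromBlocks_transpose, hP.symm.eq, hQ.symm.eq]
    simp
  diag := by
    rintro (i | i)
    · exact hP.diag i
    · exact hQ.diag i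
  offDiag := by
    rintro (i | i) (j | j) h
    · exact hP.offDiag i j fun h' => h (by rw [h'])
    · exact le_rfl
    · exact le_rfl
    · exact hQ.offDiag i j fun h' => h (by rw [h'])
  pos x hx := by
    rw [form_sumType]
    have h1 := hP.nonneg (x ∘ Sum.inl)
    have h2 := hQ.nonneg (x ∘ Sum.inr)
    by_contra hcon
    have e1 := hP.eq_zero (show form P (x ∘ Sum.inl) (x ∘ Sum.inl) = 0 by omega)
    have e2 := hQ.eq_zero (show form Q (x ∘ Sum.inr) (x ∘ Sum.inr) = 0 by omega)
    apply hx
    funext k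
    rcases k with k | k
    · exact congrFun e1 k
    · exact congrFun e2 k

/-- Each simple reflection of the sum acts on one block only. Words therefore act blockwise, and a
pair of words is realized by their concatenation. -/
theorem card_weylGroup_sumType {P : Matrix ι ι ℤ} {Q : Matrix κ κ ℤ} (hP : IsSL P)
    (hQ : IsSL Q) : Nat.card (weylGroup (sumType P Q)) =
      Nat.card (weylGroup P) * Nat.card (weylGroup Q) := by
  have hS := isSL_sumType hP hQ
  have hl : ∀ (i : ι) (x : ι ⊕ κ → ℤ), simpleE hS (Sum.inl i) x =
      Sum.elim (simpleE hP i (x ∘ Sum.inl)) (x ∘ Sum.inr) := by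
    intro i x
    simp only [simpleE, reflE_apply, form_sumType]
    have e1 : (Pi.single (Sum.inl i) 1 : ι ⊕ κ → ℤ) ∘ Sum.inl = Pi.single i 1 := by
      ext j; simp [Pi.single_apply]
    have e2 : (Pi.single (Sum.inl i) 1 : ι ⊕ κ → ℤ) ∘ Sum.inr = 0 := by
      ext j; simp
    rw [e1, e2, form_zero_right, add_zero]
    funext k
    rcases k with k | k
    · simp [Pi.single_apply]
    · simp
  have hr : ∀ (i : κ) (x : ι ⊕ κ → ℤ), simpleE hS (Sum.inr i) x =
      Sum.elim (x ∘ Sum.inl) (simpleE hQ i (x ∘ Sum.inr)) := by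
    intro i x
    simp only [simpleE, reflE_apply, form_sumType]
    have e1 : (Pi.single (Sum.inr i) 1 : ι ⊕ κ → ℤ) ∘ Sum.inr = Pi.single i 1 := by
      ext j; simp [Pi.single_apply]
    have e2 : (Pi.single (Sum.inr i) 1 : ι ⊕ κ → ℤ) ∘ Sum.inl = 0 := by
      ext j; simp
    rw [e1, e2, form_zero_right, zero_add]
    funext k
    rcases k with k | k
    · simp
    · simp [Pi.single_apply]
  rw [← Nat.card_prod]
  refine card_eq_of_rel (fun w q => ∀ x, w.1 x =
    Sum.elim (q.1.1 (x ∘ Sum.inl)) (q.2.1 (x ∘ Sum.inr))) ?_ ?_ ?_ ?_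
  · rintro ⟨w, hw⟩
    obtain ⟨l, rfl⟩ := exists_word hS hw
    induction l with
    | nil =>
      refine ⟨1, fun x => ?_⟩
      simp [wordE]
    | cons i l ih =>
      obtain ⟨⟨u, v⟩, h⟩ := ih (wordE_mem hS l)
      simp only at h
      rcases i with i | i
      · refine ⟨(⟨simpleE hP i, simpleE_mem hP i⟩ * u, v), fun x => ?_⟩
        have : wordE hS (Sum.inl i :: l) x = simpleE hS (Sum.inl i) (wordE hS l x) := by
          simp [wordE]
        simp only [this, hl, h]
        simp
      · refine ⟨(u, ⟨simpleE hQ i, simpleE_mem hQ i⟩ * v), fun x => ?_⟩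
        have : wordE hS (Sum.inr i :: l) x = simpleE hS (Sum.inr i) (wordE hS l x) := by
          simp [wordE]
        simp only [this, hr, h]
        simp
  · rintro ⟨⟨u, hu⟩, ⟨v, hv⟩⟩
    obtain ⟨l, rfl⟩ := exists_word hP hu
    obtain ⟨m, rfl⟩ := exists_word hQ hv
    refine ⟨⟨wordE hS (l.map Sum.inl ++ m.map Sum.inr), wordE_mem hS _⟩, fun x => ?_⟩
    simp only
    induction l with
    | nil =>
      simp only [List.map_nil, List.nil_append]
      induction m with
      | nil => simp [wordE]
      | cons i m ih =>
        have e1 : wordE hS (List.map Sum.inr (i :: m)) x =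
            simpleE hS (Sum.inr i) (wordE hS (List.map Sum.inr m) x) := by
          simp [wordE]
        have e2 : wordE hQ (i :: m) = simpleE hQ i * wordE hQ m := by simp [wordE]
        rw [e1, hr, ih (wordE_mem hQ m), e2]
        simp
    | cons i l ih =>
      have e1 : wordE hS (List.map Sum.inl (i :: l) ++ List.map Sum.inr m) x =
          simpleE hS (Sum.inl i) (wordE hS (List.map Sum.inl l ++ List.map Sum.inr m) x) := by
        simp [wordE]
      have e2 : wordE hP (i :: l) = simpleE hP i * wordE hP l := by simp [wordE]
      rw [e1, hl, ih (wordE_mem hP l), e2]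
      simp
  · rintro w ⟨u, v⟩ ⟨u', v'⟩ h h'
    have key : ∀ x y, u.1 x = u'.1 x ∧ v.1 y = v'.1 y := by
      intro x y
      have := (h (Sum.elim x y)).symm.trans (h' (Sum.elim x y))
      simp only [Sum.elim_comp_inl, Sum.elim_comp_inr] at this
      exact ⟨by simpa using congrArg (· ∘ Sum.inl) this, by simpa using congrArg (· ∘ Sum.inr) this⟩
    refine Prod.ext (Subtype.ext ?_) (Subtype.ext ?_)
    · ext1 x; exact (key x 0).1
    · ext1 y; exact (key 0 y).2
  · intro w w' q h h'
    ext1; ext1 x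
    rw [h, h']

end Orders

/-! ### Realizations by integral vectors and descent by simple roots -/

section Gram

variable {ι : Type} [Fintype ι] [DecidableEq ι] {C : Matrix ι ι ℤ}

theorem dotProduct_latticeMap {m : Type} [Fintype m] {a : ι → m → ℤ} {c : ℤ}
    (h : ∀ i j, a i ⬝ᵥ a j = c * C i j) (x y : ι → ℤ) :
    latticeMap a x ⬝ᵥ latticeMap a y = c * form C x y := by
  rw [latticeMap_apply, latticeMap_apply, sum_dotProduct]
  simp only [dotProduct_sum, smul_dotProduct, dotProduct_smul, h, smul_eq_mul]
  simp only [form, dotProduct, Matrix.mulVec, Finset.mul_sum]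
  exact Finset.sum_congr rfl fun k _ => Finset.sum_congr rfl fun l _ => by ring

/-- Positive definiteness comes from the standard dot product, once the simple roots are realized by
independent vectors. The factor `c` allows scaled vectors, so that half-integral coordinates can be
avoided. -/
theorem isSL_of_gram {m : Type} [Fintype m] {a : ι → m → ℤ} {c : ℤ} (hc : 0 < c)
    (h : ∀ i j, a i ⬝ᵥ a j = c * C i j) (hinj : ∀ x, latticeMap a x = 0 → x = 0)
    (diag : ∀ i, C i i = 2) (offDiag : ∀ i j, i ≠ j → C i j ≤ 0) : IsSL C where
  symm := by
    ext i j
    rw [Matrix.transpose_apply]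
    have h1 := h i j
    rw [dotProduct_comm, h j i] at h1
    exact mul_left_cancel₀ hc.ne' h1
  diag := diag
  offDiag := offDiag
  pos x hx := by
    have h1 := dotProduct_latticeMap h x x
    have h2 : 0 < latticeMap a x ⬝ᵥ latticeMap a x := by
      have hne : latticeMap a x ≠ 0 := fun h0 => hx (hinj x h0)
      obtain ⟨k, hk⟩ := Function.ne_iff.mp hne
      exact Finset.sum_pos' (fun j _ => mul_self_nonneg _)
        ⟨k, Finset.mem_univ k, mul_self_pos.mpr hk⟩
    rw [h1] at h2
    exact (mul_pos_iff_of_pos_left hc).mp h2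

/-- Positive roots are thus reached from simple roots by adding one simple root at a time, each
addition being seen from an inner product -1; this is what makes a table of roots verifiable. -/
theorem exists_simple_descent (hC : IsSL C) {β : ι → ℤ} (hβ : β ∈ posRoots C) :
    ∃ k, β = Pi.single k 1 ∨
      (β - Pi.single k 1 ∈ posRoots C ∧ form C (Pi.single k 1) (β - Pi.single k 1) = -1) := by
  have hn := norm_of_mem_posRoots hC hβ
  have hsum := form_eq_sum C β β
  obtain ⟨k, -, hk⟩ : ∃ k ∈ Finset.univ, 0 < β k * form C (Pi.single k 1) β := by
    apply Finset.exists_lt_of_sum_lt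
    rw [← hsum, hn]; simp
  refine ⟨k, ?_⟩
  have hpos : 0 < form C (Pi.single k 1) β := by
    by_contra h
    have := mul_nonpos_of_nonneg_of_nonpos (hβ.2 k) (not_lt.mp h)
    omega
  have hle := abs_le.mp (hC.abs_le (hC.norm_single k) hn)
  by_cases he : β = Pi.single k 1
  · exact Or.inl he
  right
  have h1 : form C (Pi.single k 1) β = 1 := by
    rcases (show form C (Pi.single k 1) β = 1 ∨ form C (Pi.single k 1) β = 2 by omega) with h | h
    · exact h
    · exact absurd (hC.eq_of_form_eq_two (hC.norm_single k) hn h).symm he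
  have h2 := simpleE_mem_posRoots hC hβ he
  have h3 : simpleE hC k β = β - Pi.single k 1 := by
    rw [simpleE, reflE_apply, hC.comm, h1, one_smul]
  rw [h3] at h2
  refine ⟨h2, ?_⟩
  rw [form_sub_right, h1, hC.norm_single]; rfl

end Gram

/-! ### Decimal codes for the roots of types E -/

section RootTable

/-- The positive roots of `E₈`, the `t`-th decimal digit being the coefficient of the `t`-th simple
root; the first `36` and `63` are the positive roots of `E₆` and `E₇`. -/
def rootCodes : List ℕ := [
  100000, 10000, 1000, 100, 10, 1, 110000, 11000, 1100, 1010, 101, 111000, 11100, 11010, 1110,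
  1101, 111100, 111010, 11110, 11101, 1111, 111110, 12110, 111101, 11111, 112110, 111111, 12111,
  122110, 112111, 12211, 122111, 112211, 122211, 123211, 123221, 1000000, 1100000, 1110000,
  1111000, 1111100, 1111010, 1111110, 1111101, 1112110, 1111111, 1122110, 1112111, 1222110,
  1122111, 1112211, 1222111, 1122211, 1222211, 1123211, 1223211, 1123221, 1233211, 1223221,
  1233221, 1234221, 1234321, 1234322, 10000000, 11000000, 11100000, 11110000, 11111000,
  11111100, 11111010, 11111110, 11111101, 11112110, 11111111, 11122110, 11112111, 11222110,
  11122111, 11112211, 12222110, 11222111, 11122211, 12222111, 11222211, 11123211, 12222211,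
  11223211, 11123221, 12223211, 11233211, 11223221, 12233211, 12223221, 11233221, 12333211,
  12233221, 11234221, 12333221, 12234221, 11234321, 12334221, 12234321, 11234322, 12344221,
  12334321, 12234322, 12344321, 12334322, 12345321, 12344322, 12345331, 12345322, 12345422,
  12345332, 12345432, 12346432, 12356432, 12456432, 13456432, 23456432]

/-- The `t`-th decimal digit. -/
def digit (c t : ℕ) : ℕ := c / 10 ^ t % 10

/-- The code of the `i`-th root. -/
def rootCode (i : ℕ) : ℕ := rootCodes.getD i 0

/-- The positive part of the inner product of two vectors given by their digits. -/
def ipPos (c d : ℕ) : ℕ :=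
  2 * (digit c 0 * digit d 0 + digit c 1 * digit d 1 + digit c 2 * digit d 2 +
    digit c 3 * digit d 3 + digit c 4 * digit d 4 + digit c 5 * digit d 5 +
    digit c 6 * digit d 6 + digit c 7 * digit d 7)

/-- The negative part of the inner product of two vectors given by their digits. -/
def ipNeg (c d : ℕ) : ℕ :=
  digit c 0 * digit d 2 + digit c 2 * digit d 0 + digit c 1 * digit d 3 + digit c 3 * digit d 1 +
    digit c 2 * digit d 3 + digit c 3 * digit d 2 + digit c 3 * digit d 4 +
    digit c 4 * digit d 3 + digit c 4 * digit d 5 + digit c 5 * digit d 4 +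
    digit c 5 * digit d 6 + digit c 6 * digit d 5 + digit c 6 * digit d 7 + digit c 7 * digit d 6

/-- Whether the `i`-th and the `j`-th root are orthogonal. -/
def orthB (i j : ℕ) : Bool :=
  Nat.beq (ipPos (rootCode i) (rootCode j)) (ipNeg (rootCode i) (rootCode j))

theorem length_rootCodes : rootCodes.length = 120 := by decide +kernel

/-- The vector with the given digits. -/
def codeVec (n c : ℕ) : Fin n → ℤ := fun t => digit c t

/-- The `i`-th root of the table. -/
def eRoot (n i : ℕ) : Fin n → ℤ := codeVec n (rootCode i)

/-- The Cartan matrix of `E₈` and its submatrices of types `E₆` and `E₇`. -/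
def cartanE (n : ℕ) (h : n ≤ 8) : Matrix (Fin n) (Fin n) ℤ :=
  E₈.submatrix (Fin.castLE h) (Fin.castLE h)

theorem cartanE_six : cartanE 6 (by norm_num) = E₆ := by decide +kernel
theorem cartanE_seven : cartanE 7 (by norm_num) = E₇ := by decide +kernel
theorem cartanE_eight : cartanE 8 le_rfl = E₈ := by decide +kernel

/-- Twice the simple roots of `E₈` in orthonormal coordinates. -/
def gramE : Fin 8 → Fin 8 → ℤ :=
  ![![1, -1, -1, -1, -1, -1, -1, 1], ![2, 2, 0, 0, 0, 0, 0, 0], ![-2, 2, 0, 0, 0, 0, 0, 0],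
    ![0, -2, 2, 0, 0, 0, 0, 0], ![0, 0, -2, 2, 0, 0, 0, 0], ![0, 0, 0, -2, 2, 0, 0, 0],
    ![0, 0, 0, 0, -2, 2, 0, 0], ![0, 0, 0, 0, 0, -2, 2, 0]]

theorem isSL_E₈ : IsSL E₈ := by
  refine isSL_of_gram (a := gramE) (c := 4) (by norm_num) ?_ ?_ E₈_diag
    E₈_off_diag_nonpos
  · decide +kernel
  · intro x hx
    have h := fun i => congrFun hx i
    simp only [latticeMap_apply, Finset.sum_apply, Fin.sum_univ_eight, gramE, Pi.smul_apply] at h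
    have h0 := h 0
    have h1 := h 1
    have h2 := h 2
    have h3 := h 3
    have h4 := h 4
    have h5 := h 5
    have h6 := h 6
    have h7 := h 7
    simp at h0 h1 h2 h3 h4 h5 h6 h7
    -- Only the first vector has a nonzero last coordinate. With its coefficient gone, the remaining
    -- equations can be solved.
    have e0 : x 0 = 0 := by omega
    funext i
    fin_cases i <;> simp <;> omega

theorem isSL_cartanE (n : ℕ) (h : n ≤ 8) : IsSL (cartanE n h) :=
  isSL_E₈.of_injective (Fin.castLE h) (Fin.castLE_injective h) fun _ _ => rfl

theorem form_E₈ (x y : Fin 8 → ℤ) : form E₈ x y =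
    2 * (x 0 * y 0 + x 1 * y 1 + x 2 * y 2 + x 3 * y 3 + x 4 * y 4 + x 5 * y 5 + x 6 * y 6 +
      x 7 * y 7) - (x 0 * y 2 + x 2 * y 0 + x 1 * y 3 + x 3 * y 1 + x 2 * y 3 + x 3 * y 2 +
      x 3 * y 4 + x 4 * y 3 + x 4 * y 5 + x 5 * y 4 + x 5 * y 6 + x 6 * y 5 + x 6 * y 7 +
      x 7 * y 6) := by
  simp [form, dotProduct, Matrix.mulVec, Fin.sum_univ_eight, E₈]
  ring

theorem latticeMap_castLE {n m : ℕ} (h : n ≤ m) (x : Fin n → ℤ) (t : Fin m) :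
    latticeMap (fun i => (Pi.single (Fin.castLE h i) 1 : Fin m → ℤ)) x t =
      if ht : (t : ℕ) < n then x ⟨t, ht⟩ else 0 := by
  rw [latticeMap_apply, Finset.sum_apply]
  split_ifs with ht
  · rw [Finset.sum_eq_single ⟨t, ht⟩]
    · simp
    · intro i _ hi
      have : t ≠ Fin.castLE h i := fun h' => hi (Fin.ext (congrArg Fin.val h').symm)
      simp [Pi.single_eq_of_ne this]
    · simp
  · refine Finset.sum_eq_zero fun i _ => ?_
    have : t ≠ Fin.castLE h i := fun h' => ht (by rw [h']; exact i.2)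
    simp [Pi.single_eq_of_ne this]

/-- The positive and negative parts of the inner product are natural numbers, so later checks
compare naturals and need no integer arithmetic. -/
theorem form_codeVec_eight (c d : ℕ) :
    form E₈ (codeVec 8 c) (codeVec 8 d) = (ipPos c d : ℤ) - ipNeg c d := by
  rw [form_E₈]
  simp only [codeVec, ipPos, ipNeg]
  push_cast
  rfl

/-- The lattices of rank 6 and 7 embed in the lattice of `E₈` as the vectors whose further digits
vanish, so a single formula serves all three types. -/
theorem form_codeVec {n : ℕ} (h : n ≤ 8) {c d : ℕ} (hc : ∀ t, n ≤ t → t < 8 → digit c t = 0)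
    (hd : ∀ t, n ≤ t → t < 8 → digit d t = 0) :
    form (cartanE n h) (codeVec n c) (codeVec n d) = (ipPos c d : ℤ) - ipNeg c d := by
  have key : ∀ e : ℕ, (∀ t, n ≤ t → t < 8 → digit e t = 0) →
      latticeMap (fun i => (Pi.single (Fin.castLE h i) 1 : Fin 8 → ℤ)) (codeVec n e) =
        codeVec 8 e := by
    intro e he
    funext t
    rw [latticeMap_castLE]
    split_ifs with ht
    · rfl
    · exact (Nat.cast_eq_zero.mpr (he t (not_lt.mp ht) t.2)).symm
  rw [← form_codeVec_eight, ← key c hc, ← key d hd]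
  refine (form_latticeMap _ (fun k l => ?_) _ _).symm
  rw [form_single_single]
  rfl

end RootTable

/-! ### Verifying the table, and adding prescribed roots to admissible sets -/

section Table

/-- The sum of the decimal digits. -/
def digitSum (c : ℕ) : ℕ :=
  digit c 0 + digit c 1 + digit c 2 + digit c 3 + digit c 4 + digit c 5 + digit c 6 + digit c 7

/-- The first `N` entries of the table are closed under addition of the first `n` simple roots. -/
structure IsRootTable (n N : ℕ) : Prop where
  le : n ≤ 8
  le' : N ≤ 120
  digit_eq_zero : ∀ i < N, ∀ t < 8, n ≤ t → digit (rootCode i) t = 0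
  norm : ∀ i < N, ipPos (rootCode i) (rootCode i) = ipNeg (rootCode i) (rootCode i) + 2
  simple : ∀ k < n, ∃ j < N, ∀ t < 8, digit (rootCode j) t = if t = k then 1 else 0
  add : ∀ i < N, ∀ k < n,
    Nat.beq (ipNeg (10 ^ k) (rootCode i)) (ipPos (10 ^ k) (rootCode i) + 1) = true →
    ∃ j < N, rootCode j = rootCode i + 10 ^ k ∧
      ∀ t < 8, digit (rootCode j) t = digit (rootCode i) t + if t = k then 1 else 0

theorem table_six : IsRootTable 6 36 := by constructor <;> decide +kernel
theorem table_seven : IsRootTable 7 63 := by constructor <;> decide +kernel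
theorem table_eight : IsRootTable 8 120 := by constructor <;> decide +kernel

theorem rootCode_eq_digits : ∀ i < 120, rootCode i =
    digit (rootCode i) 0 + digit (rootCode i) 1 * 10 + digit (rootCode i) 2 * 100 +
      digit (rootCode i) 3 * 1000 + digit (rootCode i) 4 * 10000 + digit (rootCode i) 5 * 100000 +
      digit (rootCode i) 6 * 1000000 + digit (rootCode i) 7 * 10000000 := by decide +kernel

theorem nodup_rootCodes : rootCodes.Nodup := by decide +kernel

theorem rootCode_injective {i j : ℕ} (hi : i < 120) (hj : j < 120) (h : rootCode i = rootCode j) :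
    i = j := by
  rw [← length_rootCodes] at hi hj
  unfold rootCode at h
  rw [List.getD_eq_getElem _ _ hi, List.getD_eq_getElem _ _ hj] at h
  exact (nodup_rootCodes.getElem_inj_iff).mp h

theorem codeVec_ten_pow {n : ℕ} (h : n ≤ 8) (k : Fin n) :
    codeVec n (10 ^ (k : ℕ)) = Pi.single k 1 := by
  have key : ∀ a < 8, ∀ t < 8, digit (10 ^ a) t = if t = a then 1 else 0 := by decide
  funext t
  rw [codeVec, key k (k.2.trans_le h) t (t.2.trans_le h), Pi.single_apply]
  simp [Fin.ext_iff]

theorem digit_ten_pow {n : ℕ} (h : n ≤ 8) (k : Fin n) (t : ℕ) (ht : n ≤ t) (ht' : t < 8) :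
    digit (10 ^ (k : ℕ)) t = 0 := by
  have key : ∀ a < 8, ∀ t < 8, digit (10 ^ a) t = if t = a then 1 else 0 := by decide
  rw [key k (k.2.trans_le h) t ht', if_neg]
  have := k.2
  omega

variable {n N : ℕ}

namespace IsRootTable

theorem isSL (T : IsRootTable n N) : IsSL (cartanE n T.le) := isSL_cartanE n T.le

theorem form_eq (T : IsRootTable n N) {i j : ℕ} (hi : i < N) (hj : j < N) :
    form (cartanE n T.le) (eRoot n i) (eRoot n j) =
      (ipPos (rootCode i) (rootCode j) : ℤ) - ipNeg (rootCode i) (rootCode j) :=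
  form_codeVec T.le (fun t h h' => T.digit_eq_zero i hi t h' h)
    (fun t h h' => T.digit_eq_zero j hj t h' h)

theorem form_single_eq (T : IsRootTable n N) (k : Fin n) {j : ℕ} (hj : j < N) :
    form (cartanE n T.le) (Pi.single k 1) (eRoot n j) =
      (ipPos (10 ^ (k : ℕ)) (rootCode j) : ℤ) - ipNeg (10 ^ (k : ℕ)) (rootCode j) := by
  rw [← codeVec_ten_pow T.le k]
  exact form_codeVec T.le (digit_ten_pow T.le k) (fun t h h' => T.digit_eq_zero j hj t h' h)

theorem form_self (T : IsRootTable n N) {i : ℕ} (hi : i < N) :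
    form (cartanE n T.le) (eRoot n i) (eRoot n i) = 2 := by
  rw [T.form_eq hi hi, T.norm i hi]; push_cast; ring

theorem mem (T : IsRootTable n N) {i : ℕ} (hi : i < N) : eRoot n i ∈ posRoots (cartanE n T.le) :=
  ⟨(mem_roots_iff T.isSL).mpr (T.form_self hi), fun _ => Nat.cast_nonneg _⟩

theorem height_eq (T : IsRootTable n N) {i : ℕ} (hi : i < N) :
    height (eRoot n i) = digitSum (rootCode i) := by
  have hn := T.le
  have hd := T.digit_eq_zero i hi
  have h : height (eRoot n i) = ∑ t ∈ Finset.range n, (digit (rootCode i) t : ℤ) :=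
    Fin.sum_univ_eq_sum_range (fun t => (digit (rootCode i) t : ℤ)) n
  have h8 : ∑ t ∈ Finset.range n, (digit (rootCode i) t : ℤ) =
      ∑ t ∈ Finset.range 8, (digit (rootCode i) t : ℤ) := by
    refine Finset.sum_subset (fun x hx => ?_) fun t ht ht' => ?_
    · simp only [Finset.mem_range] at hx ⊢; omega
    · simp only [Finset.mem_range] at ht ht'
      rw [hd t ht (by omega), Nat.cast_zero]
  rw [h, h8]
  simp only [Finset.sum_range_succ, Finset.sum_range_zero, digitSum]
  push_cast; ring

/-- Induction on the height: removing a simple root leads to a root of the table, and the table is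
closed under adding a simple root that has inner product -1. -/
theorem exists_index (T : IsRootTable n N) {β : Fin n → ℤ}
    (hβ : β ∈ posRoots (cartanE n T.le)) : ∃ i < N, β = eRoot n i := by
  obtain ⟨m, hm⟩ : ∃ m : ℕ, height β ≤ m :=
    ⟨(height β).toNat, Int.self_le_toNat _⟩
  induction m generalizing β with
  | zero =>
    have := ((mem_posRoots_iff T.isSL).mp hβ).2
    exact absurd hm (by push_cast; omega)
  | succ m ih =>
    obtain ⟨k, rfl | ⟨h1, h2⟩⟩ := exists_simple_descent T.isSL hβ
    · obtain ⟨j, hj, h⟩ := T.simple k k.2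
      refine ⟨j, hj, ?_⟩
      funext t
      have := h t (t.2.trans_le T.le)
      rw [eRoot, codeVec, this, Pi.single_apply]
      simp [Fin.ext_iff]
    · obtain ⟨i, hi, he⟩ := ih h1 (by
        rw [height_sub, height_single]; push_cast at hm; omega)
      rw [he, T.form_single_eq k hi] at h2
      obtain ⟨j, hj, -, h⟩ := T.add i hi k k.2 (by rw [Nat.beq_eq]; omega)
      refine ⟨j, hj, ?_⟩
      rw [sub_eq_iff_eq_add.mp he]
      funext t
      have := h t (t.2.trans_le T.le)
      rw [Pi.add_apply, eRoot, eRoot, codeVec, codeVec, this, Pi.single_apply]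
      simp [Fin.ext_iff]

theorem injective (T : IsRootTable n N) {i j : ℕ} (hi : i < N) (hj : j < N)
    (h : eRoot n i = eRoot n j) : i = j := by
  have h1 := T.le'
  refine rootCode_injective (by omega) (by omega) ?_
  have hd : ∀ t < 8, digit (rootCode i) t = digit (rootCode j) t := by
    intro t ht
    by_cases hn : t < n
    · have := congrFun h ⟨t, hn⟩
      exact Int.natCast_inj.mp this
    · rw [T.digit_eq_zero i hi t ht (by omega), T.digit_eq_zero j hj t ht (by omega)]
  rw [rootCode_eq_digits i (by omega), rootCode_eq_digits j (by omega)]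
  simp only [hd 0 (by norm_num), hd 1 (by norm_num), hd 2 (by norm_num), hd 3 (by norm_num),
    hd 4 (by norm_num), hd 5 (by norm_num), hd 6 (by norm_num), hd 7 (by norm_num)]

theorem orth_iff (T : IsRootTable n N) {i j : ℕ} (hi : i < N) (hj : j < N) :
    orthB i j = true ↔ form (cartanE n T.le) (eRoot n i) (eRoot n j) = 0 := by
  rw [orthB, Nat.beq_eq, T.form_eq hi hj, sub_eq_zero, Nat.cast_inj]

/-- Inner product 2 would make the two roots equal, and -2 would make them opposite, which is
impossible for positive roots. -/
theorem abs_form (T : IsRootTable n N) {i j : ℕ} (hi : i < N) (hj : j < N) (hij : i ≠ j)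
    (h : orthB i j = false) : |form (cartanE n T.le) (eRoot n i) (eRoot n j)| = 1 := by
  have h0 : form (cartanE n T.le) (eRoot n i) (eRoot n j) ≠ 0 := by
    rw [Ne, ← T.orth_iff hi hj, h]; simp
  have h1 := T.isSL.abs_le (T.form_self hi) (T.form_self hj)
  have h2 : form (cartanE n T.le) (eRoot n i) (eRoot n j) ≠ 2 := fun h2 =>
    hij (T.injective hi hj (T.isSL.eq_of_form_eq_two (T.form_self hi) (T.form_self hj) h2))
  have h3 : form (cartanE n T.le) (eRoot n i) (eRoot n j) ≠ -2 := fun h3 => by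
    have := T.isSL.eq_neg_of_form_eq_neg_two (T.form_self hi) (T.form_self hj) h3
    exact neg_notMem_posRoots T.isSL (T.mem hj) (this ▸ T.mem hi)
  rw [abs_le] at h1
  rw [abs_eq (by norm_num)]
  omega

theorem orth_of_abs_form (T : IsRootTable n N) {i j : ℕ} (hi : i < N) (hj : j < N)
    (h : |form (cartanE n T.le) (eRoot n i) (eRoot n j)| = 1) : orthB i j = false := by
  rw [← Bool.not_eq_true, T.orth_iff hi hj]
  intro h0
  rw [h0] at h
  simp at h

theorem exists_root_index (T : IsRootTable n N) {α : Fin n → ℤ}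
    (hα : form (cartanE n T.le) α α = 2) : ∃ i < N, α = eRoot n i ∨ α = -eRoot n i := by
  rcases pos_or_neg_mem T.isSL hα with h | h
  · obtain ⟨i, hi, h⟩ := T.exists_index h
    exact ⟨i, hi, Or.inl h⟩
  · obtain ⟨i, hi, h⟩ := T.exists_index h
    exact ⟨i, hi, Or.inr (neg_eq_iff_eq_neg.mp h)⟩

end IsRootTable

/-- The set of roots with indices in a list. -/
def eSet (n : ℕ) (l : List ℕ) : Set (Fin n → ℤ) := {β | ∃ i ∈ l, β = eRoot n i}

/-- The `j`-th root is orthogonal to all roots with indices in `l`. -/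
def perpB (l : List ℕ) (j : ℕ) : Bool := l.all fun i => orthB i j

theorem perpB_iff {l : List ℕ} {j : ℕ} : perpB l j = true ↔ ∀ i ∈ l, orthB i j = true := by
  simp [perpB]

/-- A list of distinct indices of mutually orthogonal roots. -/
def IsOrthList (N : ℕ) (l : List ℕ) : Prop :=
  (∀ i ∈ l, i < N) ∧ l.Pairwise fun i j => orthB i j = true

instance (N : ℕ) (l : List ℕ) : Decidable (IsOrthList N l) := by unfold IsOrthList; infer_instance

namespace IsRootTable

theorem not_orth_self (T : IsRootTable n N) {i : ℕ} (hi : i < N) : orthB i i = false := by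
  rw [← Bool.not_eq_true, T.orth_iff hi hi, T.form_self hi]; norm_num

theorem orth_comm (T : IsRootTable n N) {i j : ℕ} (hi : i < N) (hj : j < N)
    (h : orthB i j = true) : orthB j i = true := by
  rw [T.orth_iff hj hi, T.isSL.comm, ← T.orth_iff hi hj, h]

theorem nodup (T : IsRootTable n N) {l : List ℕ} (hl : IsOrthList N l) : l.Nodup := by
  refine List.Pairwise.imp_of_mem (fun {i j} hi hj h => ?_) hl.2
  rintro rfl
  rw [T.not_orth_self (hl.1 i hi)] at h
  simp at h

theorem orth_of_mem (T : IsRootTable n N) {l : List ℕ} (hl : IsOrthList N l) {i j : ℕ} (hi : i ∈ l)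
    (hj : j ∈ l) (hij : i ≠ j) : orthB i j = true := by
  have h : l.Pairwise fun a b => orthB a b = true ∧ orthB b a = true :=
    List.Pairwise.imp_of_mem
      (fun {a b} ha hb h => ⟨h, T.orth_comm (hl.1 a ha) (hl.1 b hb) h⟩) hl.2
  have : Std.Symm fun a b => orthB a b = true ∧ orthB b a = true := ⟨fun a b h => ⟨h.2, h.1⟩⟩
  exact (h.forall hi hj hij).1

theorem isOrthogonalSet (T : IsRootTable n N) {l : List ℕ} (hl : IsOrthList N l) :
    IsOrthogonalSet (cartanE n T.le) (eSet n l) := by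
  refine ⟨?_, ?_⟩
  · rintro _ ⟨i, hi, rfl⟩
    exact T.mem (hl.1 i hi)
  · rintro _ ⟨i, hi, rfl⟩ _ ⟨j, hj, rfl⟩ hne
    rw [← T.orth_iff (hl.1 i hi) (hl.1 j hj)]
    exact T.orth_of_mem hl hi hj fun h => hne (by rw [h])

theorem ncard_eSet (T : IsRootTable n N) {l : List ℕ} (hl : IsOrthList N l) :
    (eSet n l).ncard = l.length := by
  have h : eSet n l = eRoot n '' (l.toFinset : Set ℕ) := by
    ext β
    simp [eSet, eq_comm]
  rw [h, Set.InjOn.ncard_image, Set.ncard_coe_finset, List.toFinset_card_of_nodup (T.nodup hl)]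
  intro i hi j hj
  exact T.injective (hl.1 i (by simpa using hi)) (hl.1 j (by simpa using hj))

/-- No root is non-orthogonal to exactly three roots of the set. -/
theorem isAdmissible (T : IsRootTable n N) {l : List ℕ} (hl : IsOrthList N l)
    (h : ∀ d < N, (l.filter fun i => !orthB d i).length ≠ 3) :
    IsAdmissible (cartanE n T.le) (eSet n l) := by
  refine isAdmissible_of_exists_fourth T.isSL (T.isOrthogonalSet hl) ?_
  rintro _ ⟨i, hi, rfl⟩ _ ⟨j, hj, rfl⟩ _ ⟨k, hk, rfl⟩ hij hik hjk α hα h1 h2 h3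
  have hij' : i ≠ j := fun h => hij (by rw [h])
  have hik' : i ≠ k := fun h => hik (by rw [h])
  have hjk' : j ≠ k := fun h => hjk (by rw [h])
  obtain ⟨d, hd, hα'⟩ := T.exists_root_index hα
  have e : ∀ β, |form (cartanE n T.le) α β| = |form (cartanE n T.le) (eRoot n d) β| := by
    rcases hα' with rfl | rfl
    · exact fun _ => rfl
    · intro β; rw [form_neg_left, abs_neg]
  rw [e] at h1 h2 h3
  simp only [e]
  have mi : i ∈ l.filter fun i => !orthB d i :=
    List.mem_filter.mpr ⟨hi, by rw [T.orth_of_abs_form hd (hl.1 i hi) h1]; rfl⟩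
  have mj : j ∈ l.filter fun i => !orthB d i :=
    List.mem_filter.mpr ⟨hj, by rw [T.orth_of_abs_form hd (hl.1 j hj) h2]; rfl⟩
  have mk : k ∈ l.filter fun i => !orthB d i :=
    List.mem_filter.mpr ⟨hk, by rw [T.orth_of_abs_form hd (hl.1 k hk) h3]; rfl⟩
  have hnd := (T.nodup hl).filter fun i => !orthB d i
  have hcard := List.toFinset_card_of_nodup hnd
  have hsub : ({i, j, k} : Finset ℕ) ⊆ (l.filter fun i => !orthB d i).toFinset := by
    intro x hx
    simp only [Finset.mem_insert, Finset.mem_singleton] at hx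
    rw [List.mem_toFinset]
    rcases hx with rfl | rfl | rfl <;> assumption
  have h3c : ({i, j, k} : Finset ℕ).card = 3 := Finset.card_eq_three.mpr
    ⟨i, j, k, hij', hik', hjk', rfl⟩
  obtain ⟨m, hm, hm'⟩ : ∃ m ∈ (l.filter fun i => !orthB d i).toFinset,
      m ∉ ({i, j, k} : Finset ℕ) := by
    -- The members not orthogonal to the `d`-th root include the three given ones, and their number
    -- is not 3, so there is a fourth.
    refine Finset.exists_mem_notMem_of_card_lt_card ?_
    have := Finset.card_le_card hsub
    have := h d hd
    omega
  rw [List.mem_toFinset, List.mem_filter] at hm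
  simp only [Finset.mem_insert, Finset.mem_singleton, not_or] at hm'
  have hml := hl.1 m hm.1
  have inj : ∀ x, x ∈ l → m ≠ x → eRoot n m ≠ eRoot n x :=
    fun x hx hne h => hne (T.injective hml (hl.1 x hx) h)
  refine ⟨eRoot n m, ⟨m, hm.1, rfl⟩, inj i hi hm'.1, inj j hj hm'.2.1, inj k hk hm'.2.2, ?_⟩
  -- The `d`-th root is not itself the fourth one: it would then be a member of the set and
  -- orthogonal to the `i`-th.
  refine T.abs_form hd hml ?_ (by simpa using hm.2)
  rintro rfl
  have := T.orth_of_mem hl hm.1 hi hm'.1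
  rw [T.orth_of_abs_form hd (hl.1 i hi) h1] at this
  simp at this

/-- A root non-orthogonal to exactly three roots of the list is non-orthogonal to a fourth member
of an admissible set that contains them. -/
theorem exists_fourth_index (T : IsRootTable n N) {X : Set (Fin n → ℤ)}
    (hX : IsAdmissible (cartanE n T.le) X) {l : List ℕ} (hl : IsOrthList N l)
    (hlX : eSet n l ⊆ X) {d : ℕ} (hd : d < N) (h3 : (l.filter fun i => !orthB d i).length = 3) :
    ∃ m < N, eRoot n m ∈ X ∧ m ∉ l ∧ orthB d m = false := by
  obtain ⟨i, j, k, hijk⟩ := List.length_eq_three.mp h3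
  have hmem : ∀ x, x ∈ l ∧ orthB d x = false ↔ x = i ∨ x = j ∨ x = k := by
    intro x
    have := congrArg (x ∈ ·) hijk
    simpa using this
  have hnd := hijk ▸ (T.nodup hl).filter fun i => !orthB d i
  simp only [List.nodup_cons, List.mem_cons, List.not_mem_nil, or_false, not_or] at hnd
  have hi := (hmem i).mpr (Or.inl rfl)
  have hj := (hmem j).mpr (Or.inr (Or.inl rfl))
  have hk := (hmem k).mpr (Or.inr (Or.inr rfl))
  have hdl : d ∉ l := fun hdl => by
    have key : ∀ x, x = i ∨ x = j ∨ x = k → d = x := fun x hx => by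
      by_contra hne
      have h1 := (hmem x).mpr hx
      rw [T.orth_of_mem hl hdl h1.1 hne] at h1
      simp at h1
    exact hnd.1.1 ((key i (Or.inl rfl)).symm.trans (key j (Or.inr (Or.inl rfl))))
  have ab : ∀ x, x ∈ l ∧ orthB d x = false →
      |form (cartanE n T.le) (eRoot n d) (eRoot n x)| = 1 := fun x hx =>
    T.abs_form hd (hl.1 x hx.1) (fun h => hdl (h ▸ hx.1)) hx.2
  have ne : ∀ x y, x ∈ l → y ∈ l → x ≠ y → eRoot n x ≠ eRoot n y :=
    fun x y hx hy h h' => h (T.injective (hl.1 x hx) (hl.1 y hy) h')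
  obtain ⟨β, hβX, n1, n2, n3, h4⟩ := hX.exists_fourth T.isSL (hlX ⟨i, hi.1, rfl⟩)
    (hlX ⟨j, hj.1, rfl⟩) (hlX ⟨k, hk.1, rfl⟩) (ne i j hi.1 hj.1 hnd.1.1)
    (ne i k hi.1 hk.1 hnd.1.2) (ne j k hj.1 hk.1 hnd.2.1) (T.form_self hd) (ab i hi) (ab j hj)
    (ab k hk)
  obtain ⟨m, hm, rfl⟩ := T.exists_index (hX.1.1 hβX)
  have hdm := T.orth_of_abs_form hd hm h4
  refine ⟨m, hm, hβX, fun hml => ?_, hdm⟩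
  rcases (hmem m).mp ⟨hml, hdm⟩ with rfl | rfl | rfl
  exacts [n1 rfl, n2 rfl, n3 rfl]

/-- The fourth root that admissibility provides is orthogonal to all of `l` and not orthogonal to
the `d`-th root; the hypothesis `hc` leaves `c` as the only candidate. -/
theorem mem_of_closure (T : IsRootTable n N) {X : Set (Fin n → ℤ)}
    (hX : IsAdmissible (cartanE n T.le) X) {l : List ℕ} (hl : IsOrthList N l)
    (hlX : eSet n l ⊆ X) (d c : ℕ) (hd : d < N)
    (h3 : (l.filter fun i => !orthB d i).length = 3)
    (hc : ∀ j < N, perpB l j = true → orthB d j = false → j = c) : eRoot n c ∈ X := by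
  obtain ⟨m, hm, hmX, hml, hdm⟩ := T.exists_fourth_index hX hl hlX hd h3
  rwa [← hc m hm (perpB_iff.mpr fun x hx => ?_) hdm]
  rw [T.orth_iff (hl.1 x hx) hm]
  exact hX.1.2 _ (hlX ⟨x, hx, rfl⟩) _ hmX fun h => hml (T.injective (hl.1 x hx) hm h ▸ hx)

end IsRootTable

/-- The `j`-th and the `a`-th root are equal, non-orthogonal, or both non-orthogonal to a third root
orthogonal to the roots with indices in `l`. -/
def linkB (N : ℕ) (l : List ℕ) (a j : ℕ) : Bool :=
  Nat.beq j a || !orthB j a ||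
    (List.range N).any fun d => !orthB j d && (!orthB d a && perpB l d)

namespace IsRootTable

theorem linked (T : IsRootTable n N) {l : List ℕ} (hl : ∀ i ∈ l, i < N) {a j : ℕ} (ha : a < N)
    (hj : j < N) (h : linkB N l a j = true) :
    Linked (cartanE n T.le) (eSet n l) (eRoot n j) (eRoot n a) := by
  have one : ∀ a j, a < N → j < N → orthB j a = false → eRoot n j = eRoot n a ∨
      |form (cartanE n T.le) (eRoot n j) (eRoot n a)| = 1 := by
    intro a j ha hj h
    by_cases hja : j = a
    · exact Or.inl (by rw [hja])
    · exact Or.inr (T.abs_form hj ha hja h)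
  rw [linkB, Bool.or_eq_true, Bool.or_eq_true] at h
  rcases h with (h | h) | h
  · rw [Nat.beq_eq] at h
    exact Or.inl (by rw [h])
  · rcases one a j ha hj (by simpa using h) with h | h
    · exact Or.inl h
    · exact Or.inr (Or.inr (Or.inl h))
  · simp only [List.any_eq_true, List.mem_range, Bool.and_eq_true, Bool.not_eq_true'] at h
    obtain ⟨d, hd, h1, h2, h3⟩ := h
    rcases one d j hd hj h1 with k1 | k1
    · rcases one a d ha hd h2 with k2 | k2
      · exact Or.inl (k1.trans k2)
      · rw [← k1] at k2
        exact Or.inr (Or.inr (Or.inl k2))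
    · rcases one a d ha hd h2 with k2 | k2
      · rw [k2] at k1
        exact Or.inr (Or.inr (Or.inl k1))
      · refine Or.inr (Or.inr (Or.inr ⟨_, T.form_self hd, ?_, k1, k2⟩))
        rintro _ ⟨i, hi, rfl⟩
        rw [T.isSL.comm, ← T.orth_iff (hl i hi) hd]
        exact perpB_iff.mp h3 i hi

/-- An admissible set containing the roots of `l` either has a conjugate containing the roots of
`a :: l`, or its further elements are not linked to the `a`-th root. -/
theorem step (T : IsRootTable n N) {X : Set (Fin n → ℤ)} (hX : IsAdmissible (cartanE n T.le) X)
    {l : List ℕ} (hl : IsOrthList N l) (hlX : eSet n l ⊆ X) (a : ℕ) (ha : a < N)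
    (hpa : perpB l a = true) :
    (∀ β ∈ X, ∃ i, β = eRoot n i ∧
      (i ∈ l ∨ (i < N ∧ perpB l i = true ∧ linkB N l a i = false))) ∨
    ∃ X' ∈ orbit (cartanE n T.le) X, IsAdmissible (cartanE n T.le) X' ∧ eSet n (a :: l) ⊆ X' := by
  by_cases hex : ∃ j < N, eRoot n j ∈ X ∧ j ∉ l ∧ linkB N l a j = true
  · right
    obtain ⟨j, hj, hjX, hjl, hlink⟩ := hex
    obtain ⟨w, hw, -, -, h⟩ := exists_mem_orbit_of_linked T.isSL hX.1.1 hlX hjX (T.mem ha)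
      (T.linked hl.1 ha hj hlink) (fun β hβ => hX.1.2 _ hjX _ (hlX hβ) (by
        rintro rfl
        obtain ⟨i, hi, h⟩ := hβ
        exact hjl (T.injective hj (hl.1 i hi) h ▸ hi))) (by
        rintro _ ⟨i, hi, rfl⟩
        rw [T.isSL.comm, ← T.orth_iff (hl.1 i hi) ha]
        exact perpB_iff.mp hpa i hi)
    have hmem : act (cartanE n T.le) w X ∈ orbit (cartanE n T.le) X := ⟨w, hw, rfl⟩
    refine ⟨_, hmem, isAdmissible_of_mem_orbit T.isSL hX hmem, ?_⟩
    rintro _ ⟨i, hi, rfl⟩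
    rcases List.mem_cons.mp hi with rfl | hi
    · exact h (Set.mem_insert _ _)
    · exact h (Set.mem_insert_of_mem _ ⟨i, hi, rfl⟩)
  · left
    intro β hβ
    obtain ⟨j, hj, rfl⟩ := T.exists_index (hX.1.1 hβ)
    refine ⟨j, rfl, ?_⟩
    by_cases hjl : j ∈ l
    · exact Or.inl hjl
    · refine Or.inr ⟨hj, perpB_iff.mpr fun i hi => ?_, ?_⟩
      · rw [T.orth_iff (hl.1 i hi) hj]
        exact hX.1.2 _ (hlX ⟨i, hi, rfl⟩) _ hβ
          fun h => hjl (T.injective (hl.1 i hi) hj h ▸ hi)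
      · by_contra h
        exact hex ⟨j, hj, hβ, hjl, by simpa using h⟩

/-- If every root orthogonal to `l` is linked to `a`, the exceptional case of `step` leaves no room
for further members of `X`. -/
theorem step_all (T : IsRootTable n N) {X : Set (Fin n → ℤ)}
    (hX : IsAdmissible (cartanE n T.le) X) {l : List ℕ} (hl : IsOrthList N l)
    (hlX : eSet n l ⊆ X) (a : ℕ) (ha : a < N) (hpa : perpB l a = true)
    (h : ∀ j < N, perpB l j = true → linkB N l a j = true) : X = eSet n l ∨
    ∃ X' ∈ orbit (cartanE n T.le) X, IsAdmissible (cartanE n T.le) X' ∧ eSet n (a :: l) ⊆ X' := by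
  refine (T.step hX hl hlX a ha hpa).imp (fun h' => Set.Subset.antisymm (fun β hβ => ?_) hlX) id
  obtain ⟨i, rfl, hi | ⟨hi, hp, hn⟩⟩ := h' β hβ
  · exact ⟨i, hi, rfl⟩
  · rw [h i hi hp] at hn
    simp at hn

theorem eSet_cons_subset {X : Set (Fin n → ℤ)} {c : ℕ} {l : List ℕ} (hc : eRoot n c ∈ X)
    (hl : eSet n l ⊆ X) : eSet n (c :: l) ⊆ X := by
  rintro _ ⟨i, hi, rfl⟩
  rcases List.mem_cons.mp hi with rfl | hi
  · exact hc
  · exact hl ⟨i, hi, rfl⟩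

end IsRootTable

end Table

/-! ### Verifying one line of the table for types E -/

section TableLines

/-- Every element of the list, together with the later elements, passes the test. -/
def allTails (f : ℕ → List ℕ → Bool) : List ℕ → Bool
  | [] => true
  | c :: cs => f c cs && allTails f cs

/-- Every sublist of `k` pairwise orthogonal roots, adjoined to `acc`, passes the test. -/
def allCliques (test : List ℕ → Bool) : ℕ → List ℕ → List ℕ → Bool
  | 0, _, acc => test acc
  | k + 1, L, acc => allTails (fun c cs =>
      (fun L' => Nat.blt L'.length k || allCliques test k L' (c :: acc)) (cs.filter (orthB c))) L

theorem allTails_spec {f : ℕ → List ℕ → Bool} {L : List ℕ} (h : allTails f L = true) {c : ℕ}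
    {s : List ℕ} (hs : (c :: s).Sublist L) : ∃ cs, s.Sublist cs ∧ f c cs = true := by
  induction L with
  | nil => cases hs
  | cons d ds ih =>
    rw [allTails, Bool.and_eq_true] at h
    cases hs with
    | cons _ hs => exact ih h.2 hs
    | cons_cons _ hs => exact ⟨ds, hs, h.1⟩

/-- Soundness of the search. A branch is cut off only if fewer candidates remain than are still to
be chosen; the selected roots accumulate in reverse order. -/
theorem allCliques_spec {test : List ℕ → Bool} {k : ℕ} : ∀ {L acc : List ℕ},
    allCliques test k L acc = true → ∀ s : List ℕ, s.Sublist L → s.length = k →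
      s.Pairwise (fun c d => orthB c d = true) → test (s.reverse ++ acc) = true := by
  induction k with
  | zero =>
    intro L acc h s _ hk _
    rw [List.length_eq_zero_iff.mp hk]
    exact h
  | succ k ih =>
    intro L acc h s hs hk hp
    obtain ⟨c, s, rfl⟩ := List.exists_cons_of_length_eq_add_one hk
    obtain ⟨cs, hcs, hf⟩ := allTails_spec h hs
    rw [List.pairwise_cons] at hp
    have hsub : s.Sublist (cs.filter (orthB c)) := by
      have := hcs.filter (orthB c)
      rwa [List.filter_eq_self.mpr hp.1] at this
    rw [Bool.or_eq_true] at hf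
    have hlen : s.length = k := by simpa using hk
    rcases hf with hf | hf
    · have h1 : (cs.filter (orthB c)).length < k := Nat.ble_eq.mp hf
      have := hsub.length_le
      omega
    · have := ih hf s hsub hlen hp.2
      simpa using this

/-- The roots of height at least `h₀`, highest first. -/
def highRoots (N h₀ : ℕ) : List ℕ :=
  ((List.range N).filter fun i => Nat.ble h₀ (digitSum (rootCode i))).reverse

/-- Every member of `l` is in `B`, or some root is non-orthogonal to exactly three members. -/
def highTest (N : ℕ) (B l : List ℕ) : Bool :=
  (l.all fun i => B.elem i) ||
    (List.range N).any fun d => Nat.beq (l.filter fun i => !orthB d i).length 3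

variable {n N : ℕ}

namespace IsRootTable

/-- If no member of `X` were below the threshold, `X` would be one of the orthogonal sets of high
roots examined by the search. Such a set either lies in `B`, hence equals `B` by cardinality, or
some root is not orthogonal to exactly three of its members, contradicting admissibility. -/
theorem highest (T : IsRootTable n N) {B : List ℕ} (hB : IsOrthList N B)
    (hadm : IsAdmissible (cartanE n T.le) (eSet n B)) (h₀ : ℕ)
    (h : allCliques (highTest N B) B.length (highRoots N h₀) [] = true)
    {X : Set (Fin n → ℤ)} (hX : X ∈ orbit (cartanE n T.le) (eSet n B)) (hne : X ≠ eSet n B) :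
    ∃ β ∈ X, height β < h₀ := by
  classical
  by_contra hlow
  push Not at hlow
  have hXa := isAdmissible_of_mem_orbit T.isSL hadm hX
  have hXo := hXa.1
  set p : ℕ → Bool := fun i => decide (eRoot n i ∈ X) with hp
  set s := (highRoots N h₀).filter p with hs
  have hXs : ∀ i, i ∈ s ↔ i < N ∧ eRoot n i ∈ X := by
    intro i
    simp only [hs, hp, highRoots, List.mem_filter, List.mem_reverse, List.mem_range,
      decide_eq_true_eq]
    refine ⟨fun h => ⟨h.1.1, h.2⟩, fun ⟨hi, h⟩ => ⟨⟨hi, ?_⟩, h⟩⟩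
    have := hlow _ h
    rw [T.height_eq hi] at this
    exact Nat.ble_eq.mpr (by exact_mod_cast this)
  have hpair : s.Pairwise fun c d => orthB c d = true := by
    have hnd : s.Nodup := (List.nodup_reverse.mpr (List.nodup_range.filter _)).filter _
    refine List.Pairwise.imp_of_mem (fun {c d} hc hd h => ?_) hnd
    obtain ⟨hc1, hc2⟩ := (hXs c).mp hc
    obtain ⟨hd1, hd2⟩ := (hXs d).mp hd
    rw [T.orth_iff hc1 hd1]
    exact hXo.2 _ hc2 _ hd2 fun h' => h (T.injective hc1 hd1 h')
  have hol : IsOrthList N s := ⟨fun i hi => ((hXs i).mp hi).1, hpair⟩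
  have hXeq : X = eSet n s := by
    ext β
    constructor
    · intro hβ
      obtain ⟨i, hi, rfl⟩ := T.exists_index (hXo.1 hβ)
      exact ⟨i, (hXs i).mpr ⟨hi, hβ⟩, rfl⟩
    · rintro ⟨i, hi, rfl⟩
      exact ((hXs i).mp hi).2
  have hcard : s.length = B.length := by
    rw [← T.ncard_eSet hol, ← hXeq, ← T.ncard_eSet hB]
    obtain ⟨w, hw, rfl⟩ := hX
    exact ncard_act T.isSL (weylGroup_le_isometries T.isSL hw) (T.isOrthogonalSet hB).1
  have htest := allCliques_spec h s List.filter_sublist (by simpa using hcard) hpair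
  rw [List.append_nil, highTest, Bool.or_eq_true] at htest
  rcases htest with ht | ht
  · apply hne
    have hsub : X ⊆ eSet n B := by
      rw [hXeq]
      rintro _ ⟨i, hi, rfl⟩
      refine ⟨i, ?_, rfl⟩
      have := List.all_eq_true.mp ht i (List.mem_reverse.mpr hi)
      simpa using this
    refine Set.eq_of_subset_of_ncard_le hsub ?_ ((posRoots_finite T.isSL).subset
      (T.isOrthogonalSet hB).1)
    rw [hXeq, T.ncard_eSet hB, T.ncard_eSet hol, hcard]
  · obtain ⟨d, hd, h3⟩ := List.any_eq_true.mp ht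
    rw [List.mem_range] at hd
    rw [Nat.beq_eq, List.filter_reverse, List.length_reverse] at h3
    obtain ⟨m, hm, hmX, hms, -⟩ := T.exists_fourth_index hXa hol hXeq.ge hd h3
    exact hms ((hXs m).mpr ⟨hm, hmX⟩)

/-- The roots `g k` form a base of the orthogonal system. Any other positive root there has inner
product 1 with a lower base root, and the difference is again a positive root of the system;
induction on the height puts it in their span. -/
theorem hasCartanType_perp (T : IsRootTable n N) {B : List ℕ} {κ : Type} [Fintype κ]
    [DecidableEq κ] {P : Matrix κ κ ℤ} (hP : IsSL P) (g : κ → ℕ)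
    (hB : IsOrthList N B := by decide +kernel)
    (hg : ∀ k, g k < N ∧ perpB B (g k) = true := by decide +kernel)
    (hgP : (Matrix.of fun k l => (ipPos (rootCode (g k)) (rootCode (g l)) : ℤ) -
      ipNeg (rootCode (g k)) (rootCode (g l))) = P := by decide +kernel)
    (h : ∀ i < N, perpB B i = true → ∃ k, g k = i ∨ (digitSum (rootCode (g k)) <
      digitSum (rootCode i) ∧ ipPos (rootCode i) (rootCode (g k)) =
        ipNeg (rootCode i) (rootCode (g k)) + 1) := by decide +kernel) :
    HasCartanType (cartanE n T.le) (perpRoots (cartanE n T.le) (eSet n B)) P := by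
  have perp : ∀ i < N, perpB B i = true → ∀ β ∈ eSet n B,
      form (cartanE n T.le) (eRoot n i) β = 0 := by
    rintro i hi hp _ ⟨j, hj, rfl⟩
    rw [T.isSL.comm, ← T.orth_iff (hB.1 j hj) hi]
    exact perpB_iff.mp hp j hj
  refine hasCartanType_of_family T.isSL hP (fun k => eRoot n (g k)) (fun k l => ?_)
    (fun k => perp _ (hg k).1 (hg k).2) fun δ hδ => ?_
  · rw [T.form_eq (hg k).1 (hg l).1, ← hgP, Matrix.of_apply]
  · have key : ∀ m : ℕ, ∀ i < N, perpB B i = true → digitSum (rootCode i) ≤ m →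
        eRoot n i ∈ Submodule.span ℤ (Set.range fun k => eRoot n (g k)) := by
      intro m
      induction m with
      | zero =>
        intro i hi _ h0
        have := ((mem_posRoots_iff T.isSL).mp (T.mem hi)).2
        rw [T.height_eq hi] at this
        omega
      | succ m ih =>
        intro i hi hp hm
        obtain ⟨k, rfl | ⟨h1, h2⟩⟩ := h i hi hp
        · exact Submodule.subset_span ⟨k, rfl⟩
        · have hf : form (cartanE n T.le) (eRoot n i) (eRoot n (g k)) = 1 := by
            rw [T.form_eq hi (hg k).1, h2]; push_cast; ring
          have hpos : eRoot n i - eRoot n (g k) ∈ posRoots (cartanE n T.le) := by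
            rw [mem_posRoots_iff T.isSL, T.isSL.form_sub_self, T.form_self hi,
              T.form_self (hg k).1, hf, height_sub, T.height_eq hi, T.height_eq (hg k).1]
            omega
          obtain ⟨j, hj, he⟩ := T.exists_index hpos
          have hjp : perpB B j = true := perpB_iff.mpr fun x hx => by
            rw [T.orth_iff (hB.1 x hx) hj, ← he, form_sub_right, T.isSL.comm, perp i hi hp _
              ⟨x, hx, rfl⟩, T.isSL.comm, perp _ (hg k).1 (hg k).2 _ ⟨x, hx, rfl⟩, sub_zero]
          have hpg := ((mem_posRoots_iff T.isSL).mp (T.mem (hg k).1)).2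
          have hh : height (eRoot n i) - height (eRoot n (g k)) = height (eRoot n j) := by
            rw [← height_sub, he]
          rw [T.height_eq hi, T.height_eq hj] at hh
          have hmem := ih j hj hjp (by omega)
          rw [← he] at hmem
          have := Submodule.add_mem _ hmem (Submodule.subset_span ⟨k, rfl⟩)
          rwa [sub_add_cancel] at this
    rw [perpRoots, Set.mem_ofPred_eq, mem_roots_iff T.isSL] at hδ
    obtain ⟨i, hi, hor⟩ := T.exists_root_index hδ.1
    have hp : perpB B i = true := perpB_iff.mpr fun j hj => by
      rw [T.orth_iff (hB.1 j hj) hi, T.isSL.comm]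
      have := hδ.2 _ ⟨j, hj, rfl⟩
      rcases hor with rfl | rfl
      · exact this
      · rwa [form_neg_left, neg_eq_zero] at this
    have := key _ i hi hp le_rfl
    rcases hor with rfl | rfl
    · exact this
    · exact Submodule.neg_mem _ this

theorem nodesHaveType (T : IsRootTable n N) {B : List ℕ} {κ : Type} [Fintype κ] [DecidableEq κ]
    {D : Matrix κ κ ℤ} (f : κ → Fin n) (hB : IsOrthList N B := by decide +kernel)
    (hf : Function.Injective f := by decide +kernel)
    (hD : (cartanE n T.le).submatrix f f = D := by decide +kernel)
    (h : ∀ i : Fin n, (∃ k, f k = i) ↔ ∀ b ∈ B, ipPos (10 ^ (i : ℕ)) (rootCode b) =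
      ipNeg (10 ^ (i : ℕ)) (rootCode b) := by decide +kernel) :
    NodesHaveType (cartanE n T.le)
      {i | ∀ β ∈ eSet n B, form (cartanE n T.le) (Pi.single i 1) β = 0} D := by
  refine NodesHaveType.of_injective f hf ?_ fun k l => congrFun₂ hD k l
  ext i
  rw [Set.mem_range, h i, Set.mem_ofPred_eq]
  constructor
  · rintro h _ ⟨b, hb, rfl⟩
    rw [T.form_single_eq i (hB.1 b hb), h b hb, sub_self]
  · intro h b hb
    have := h _ ⟨b, hb, rfl⟩
    rw [T.form_single_eq i (hB.1 b hb), sub_eq_zero] at this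
    exact_mod_cast this

end IsRootTable

/-- The `k`-th root of a list of roots. -/
def eFamily (n : ℕ) (l : List ℕ) (k : Fin l.length) : Fin n → ℤ := eRoot n l[k]

theorem range_eFamily (n : ℕ) (l : List ℕ) : Set.range (eFamily n l) = eSet n l := by
  ext β
  constructor
  · rintro ⟨k, rfl⟩
    exact ⟨_, List.getElem_mem _, rfl⟩
  · rintro ⟨i, hi, rfl⟩
    obtain ⟨k, hk, rfl⟩ := List.getElem_of_mem hi
    exact ⟨⟨k, hk⟩, rfl⟩

/-- Up to sign, the root with index `a` has inner products `1` and `-1` with the roots with indices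
`i` and `j`, and is orthogonal to the other roots of `l`. -/
def swapRoot (l : List ℕ) (i j a : ℕ) : Bool :=
  !orthB a i && (Nat.beq (ipPos (rootCode a) (rootCode i) + ipPos (rootCode a) (rootCode j))
    (ipNeg (rootCode a) (rootCode i) + ipNeg (rootCode a) (rootCode j)) &&
    l.all fun k => Nat.beq k i || (Nat.beq k j || orthB a k))

/-- Any two roots of the list are interchanged by a product of two reflections. -/
def allSwaps (N : ℕ) (l : List ℕ) : Bool :=
  l.all fun i => l.all fun j => Nat.beq i j ||
    (fun A : List ℕ => A.any fun a => A.any fun c => orthB a c)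
      ((List.range N).filter fun a => swapRoot l i j a)

namespace IsRootTable

theorem eFamily_injective (T : IsRootTable n N) {l : List ℕ} (hl : IsOrthList N l) :
    Function.Injective (eFamily n l) := by
  intro a b h
  have := T.injective (hl.1 _ (List.getElem_mem _)) (hl.1 _ (List.getElem_mem _)) h
  exact Fin.ext ((T.nodup hl).getElem_inj_iff.mp this)

theorem eFamily_mem (T : IsRootTable n N) {l : List ℕ} (hl : IsOrthList N l) (k : Fin l.length) :
    eFamily n l k ∈ posRoots (cartanE n T.le) :=
  T.mem (hl.1 _ (List.getElem_mem _))

theorem exists_swapRoot (T : IsRootTable n N) {l : List ℕ} (hl : IsOrthList N l) {i j : ℕ}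
    (hi : i ∈ l) (hj : j ∈ l) (hij : i ≠ j) {a : ℕ} (ha : a < N) (h : swapRoot l i j a = true) :
    ∃ γ, (γ = eRoot n a ∨ γ = -eRoot n a) ∧ form (cartanE n T.le) γ (eRoot n i) = 1 ∧
      form (cartanE n T.le) γ (eRoot n j) = -1 ∧
      ∀ k ∈ l, k ≠ i → k ≠ j → form (cartanE n T.le) γ (eRoot n k) = 0 := by
  simp only [swapRoot, Bool.and_eq_true, Bool.not_eq_true', Nat.beq_eq, List.all_eq_true,
    Bool.or_eq_true] at h
  obtain ⟨h1, h2, h3⟩ := h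
  have hai : a ≠ i := by
    rintro rfl
    have hself := T.norm a ha
    have := T.form_eq ha (hl.1 j hj)
    rw [(T.orth_iff ha (hl.1 j hj)).mp (T.orth_of_mem hl hi hj hij)] at this
    omega
  have hs : form (cartanE n T.le) (eRoot n a) (eRoot n i) +
      form (cartanE n T.le) (eRoot n a) (eRoot n j) = 0 := by
    rw [T.form_eq ha (hl.1 i hi), T.form_eq ha (hl.1 j hj)]
    omega
  have h0 : ∀ k ∈ l, k ≠ i → k ≠ j → form (cartanE n T.le) (eRoot n a) (eRoot n k) = 0 := by
    intro k hk hki hkj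
    rw [← T.orth_iff ha (hl.1 k hk)]
    rcases h3 k hk with h | h | h
    · exact absurd h hki
    · exact absurd h hkj
    · exact h
  have habs := T.abs_form ha (hl.1 i hi) hai h1
  rcases (abs_eq (by norm_num : (0 : ℤ) ≤ 1)).mp habs with h | h
  · exact ⟨_, Or.inl rfl, h, by omega, h0⟩
  · refine ⟨_, Or.inr rfl, ?_, ?_, fun k hk hki hkj => ?_⟩
    · rw [form_neg_left]; omega
    · rw [form_neg_left]; omega
    · rw [form_neg_left, h0 k hk hki hkj, neg_zero]

/-- For each pair of members there are two orthogonal roots with inner products 1 and -1 with them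
and 0 with the others. The product of the two reflections is a transposition, and transpositions
generate. -/
theorem quotient_perm (T : IsRootTable n N) {l : List ℕ}
    (hl : IsOrthList N l := by decide +kernel) (h : allSwaps N l = true := by decide +kernel) :
    Nonempty (QuotientNC (cartanE n T.le) (eSet n l) ≃* Equiv.Perm (Fin l.length)) := by
  rw [← range_eFamily]
  refine quotientNC_perm_of_swaps T.isSL (T.eFamily_injective hl) (T.eFamily_mem hl) ?_
  intro i j hij
  have hi : l[i] ∈ l := List.getElem_mem _
  have hj : l[j] ∈ l := List.getElem_mem _
  have inj : ∀ k i : Fin l.length, k ≠ i → l[k] ≠ l[i] := fun k i h h' =>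
    h (Fin.ext ((T.nodup hl).getElem_inj_iff.mp h'))
  have h' := List.all_eq_true.mp (List.all_eq_true.mp h _ hi) _ hj
  rw [Bool.or_eq_true, Nat.beq_eq] at h'
  have h' := h'.resolve_left (inj i j hij)
  simp only [List.any_eq_true, List.mem_filter, List.mem_range] at h'
  obtain ⟨a, ⟨ha, ha'⟩, c, ⟨hc, hc'⟩, hac⟩ := h'
  obtain ⟨γ, hγ, g1, g2, g3⟩ := T.exists_swapRoot hl hi hj (inj i j hij) ha ha'
  obtain ⟨δ, hδ, d1, d2, d3⟩ := T.exists_swapRoot hl hi hj (inj i j hij) hc hc'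
  have hγn : form (cartanE n T.le) γ γ = 2 := by
    rcases hγ with rfl | rfl
    · exact T.form_self ha
    · rw [form_neg_left, form_neg_right, T.form_self ha]; rfl
  have hδn : form (cartanE n T.le) δ δ = 2 := by
    rcases hδ with rfl | rfl
    · exact T.form_self hc
    · rw [form_neg_left, form_neg_right, T.form_self hc]; rfl
  have hγδ : form (cartanE n T.le) γ δ = 0 := by
    rw [T.orth_iff ha hc] at hac
    rcases hγ with rfl | rfl <;> rcases hδ with rfl | rfl <;>
      simp only [form_neg_left, form_neg_right, hac, neg_zero]
  have hbij := (T.orth_iff (hl.1 _ hi) (hl.1 _ hj)).mp (T.orth_of_mem hl hi hj (inj i j hij))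
  refine exists_induces_swap T.isSL γ δ hγn hδn hγδ ?_ g1 d1 fun k hki hkj =>
    ⟨g3 _ (List.getElem_mem _) (inj k i hki) (inj k j hkj),
      d3 _ (List.getElem_mem _) (inj k i hki) (inj k j hkj)⟩
  -- Both `γ + δ` and the difference of the two members have norm 4, and so is their inner product
  -- 4; hence they are equal.
  rw [← sub_eq_zero]
  apply T.isSL.eq_zero
  have hni := T.form_self (hl.1 _ hi)
  have hnj := T.form_self (hl.1 _ hj)
  simp only [eFamily, form_sub_left, form_sub_right, form_add_left, form_add_right, hγn, hδn, hγδ,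
    g1, g2, d1, d2, hni, hnj, hbij, T.isSL.comm δ γ, T.isSL.comm (eRoot n l[i]) γ,
    T.isSL.comm (eRoot n l[i]) δ, T.isSL.comm (eRoot n l[j]) γ, T.isSL.comm (eRoot n l[j]) δ,
    T.isSL.comm (eRoot n l[j]) (eRoot n l[i])]
  norm_num

theorem isTableLine (T : IsRootTable n N) {B : List ℕ} (h₀ : ℕ)
    {κ₁ κ₂ : Type} [Fintype κ₁] [DecidableEq κ₁] [Fintype κ₂] [DecidableEq κ₂]
    {P : Matrix κ₁ κ₁ ℤ} {D : Matrix κ₂ κ₂ ℤ} {G : Type} [Group G]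
    (hP : HasCartanType (cartanE n T.le) (perpRoots (cartanE n T.le) (eSet n B)) P)
    (hD : NodesHaveType (cartanE n T.le)
      {i | ∀ β ∈ eSet n B, form (cartanE n T.le) (Pi.single i 1) β = 0} D)
    (hG : Nonempty (QuotientNC (cartanE n T.le) (eSet n B) ≃* G))
    (hB : IsOrthList N B := by decide +kernel)
    (hlow : ∀ i ∈ B, h₀ ≤ digitSum (rootCode i) := by decide +kernel)
    (hadm : ∀ d < N, (B.filter fun i => !orthB d i).length ≠ 3 := by decide +kernel)
    (hhigh : allCliques (highTest N B) B.length (highRoots N h₀) [] = true := by decide +kernel) :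
    IsTableLine (cartanE n T.le) (orbit (cartanE n T.le) (eSet n B)) B.length P D G := by
  refine isTableLine_of_rep T.isSL (T.isOrthogonalSet hB) (T.ncard_eSet hB) h₀ ?_
    (fun X hX hne => T.highest hB (T.isAdmissible hB hadm) h₀ hhigh hX hne) hP hD hG
  rintro _ ⟨i, hi, rfl⟩
  rw [T.height_eq (hB.1 i hi)]
  exact_mod_cast hlow i hi

end IsRootTable

end TableLines

/-! ### Weyl groups acting in an ambient coordinate lattice -/

section Ambient

variable {ι m : Type} [Fintype ι] [DecidableEq ι] [Fintype m] [DecidableEq m] {C : Matrix ι ι ℤ}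

/-- Pairing with `ω k` reads off the coefficient of the `k`-th simple root, up to the nonzero factor
`c k`. -/
theorem latticeMap_injective_of_dual {a : ι → m → ℤ} (ω : ι → m → ℤ) (c : ι → ℤ)
    (hc : ∀ k, c k ≠ 0) (h : ∀ k j, ω k ⬝ᵥ a j = if k = j then c k else 0) (x : ι → ℤ)
    (hx : latticeMap a x = 0) : x = 0 := by
  funext k
  have h1 : ω k ⬝ᵥ latticeMap a x = c k * x k := by
    rw [latticeMap_apply, dotProduct_sum]
    simp only [dotProduct_smul, h, smul_eq_mul]
    rw [Finset.sum_eq_single k] <;> simp +contextual [mul_comm, eq_comm]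
  rw [hx, dotProduct_zero] at h1
  exact (mul_eq_zero.mp h1.symm).resolve_left (hc k)

/-- Here `ρ` plays the role of the half sum of positive roots: in coordinates the height becomes a
linear functional. -/
theorem dotProduct_latticeMap_of_one {a : ι → m → ℤ} {ρ : m → ℤ} (h : ∀ i, ρ ⬝ᵥ a i = 1)
    (x : ι → ℤ) : ρ ⬝ᵥ latticeMap a x = height x := by
  rw [latticeMap_apply, dotProduct_sum, height]
  exact Finset.sum_congr rfl fun k _ => by rw [dotProduct_smul, h, smul_eq_mul, mul_one]

variable {G : Type} [Group G]

/-- `w` acts on the image of the lattice as `g`. -/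
def ActsAs (a : ι → m → ℤ) (ρ : G →* Module.End ℤ (m → ℤ)) (w : LatticeAut ι) (g : G) :
    Prop :=
  ∀ x, latticeMap a (w x) = ρ g (latticeMap a x)

theorem ActsAs.mul {a : ι → m → ℤ} {ρ : G →* Module.End ℤ (m → ℤ)}
    {w u : LatticeAut ι} {g h : G} (hw : ActsAs a ρ w g) (hu : ActsAs a ρ u h) :
    ActsAs a ρ (w * u) (g * h) := fun x => by
  rw [LinearEquiv.mul_apply, hw, hu, map_mul, Module.End.mul_apply]

theorem actsAs_one (a : ι → m → ℤ) (ρ : G →* Module.End ℤ (m → ℤ)) : ActsAs a ρ 1 1 := fun x => by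
  rw [map_one, LinearEquiv.coe_one, Module.End.one_apply, id]

theorem ActsAs.inv {a : ι → m → ℤ} {ρ : G →* Module.End ℤ (m → ℤ)}
    {w : LatticeAut ι} {g : G} (hw : ActsAs a ρ w g) : ActsAs a ρ w⁻¹ g⁻¹ := fun x => by
  have h := hw (w⁻¹ x)
  rw [apply_inv_self'] at h
  rw [h, ← Module.End.mul_apply, ← map_mul, inv_mul_cancel, map_one, Module.End.one_apply]

/-- The elements of `G` by which `W` acts. -/
def actingSubgroup (C : Matrix ι ι ℤ) (a : ι → m → ℤ) (ρ : G →* Module.End ℤ (m → ℤ)) :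
    Subgroup G where
  carrier := {g | ∃ w ∈ weylGroup C, ActsAs a ρ w g}
  mul_mem' := by
    rintro g h ⟨w, hw, hwg⟩ ⟨u, hu, huh⟩
    exact ⟨w * u, mul_mem hw hu, hwg.mul huh⟩
  one_mem' := ⟨1, one_mem _, actsAs_one a ρ⟩
  inv_mem' := by
    rintro g ⟨w, hw, h⟩
    exact ⟨w⁻¹, inv_mem hw, h.inv⟩

/-- The simple reflection as a linear map, for any matrix with diagonal entries `2`. -/
def simpleReflection (C : Matrix ι ι ℤ) (hC : ∀ i, C i i = 2) (i : ι) :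
    LatticeAut ι :=
  LinearEquiv.ofInvolutive
    { toFun := fun x => x - (C.mulVec x i) • (Pi.single i 1 : ι → ℤ)
      map_add' := fun x y => by rw [Matrix.mulVec_add, Pi.add_apply]; module
      map_smul' := fun c x => by
        rw [Matrix.mulVec_smul, Pi.smul_apply, RingHom.id_apply, smul_eq_mul]; module }
    (fun x => by
      have h : C.mulVec (Pi.single i 1 : ι → ℤ) i = 2 := by simp [hC]
      simp only [LinearMap.coe_mk, AddHom.coe_mk]
      rw [Matrix.mulVec_sub, Matrix.mulVec_smul, Pi.sub_apply, Pi.smul_apply, h, smul_eq_mul]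
      module)

theorem simpleReflection_apply (hC : ∀ i, C i i = 2) (i : ι) (x : ι → ℤ) :
    simpleReflection C hC i x = x - (C.mulVec x i) • (Pi.single i 1 : ι → ℤ) := rfl

/-- The two families `a` and `c` are kept apart, as roots and coroots are, so that the non-symmetric
matrices of type B are covered. -/
theorem mulVec_eq_dotProduct {a c : ι → m → ℤ} (h : ∀ i j, c i ⬝ᵥ a j = C i j) (x : ι → ℤ)
    (i : ι) : C.mulVec x i = c i ⬝ᵥ latticeMap a x := by
  rw [latticeMap_apply, dotProduct_sum, Matrix.mulVec, dotProduct]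
  exact Finset.sum_congr rfl fun k _ => by rw [dotProduct_smul, h, smul_eq_mul, mul_comm]

variable {a c : ι → m → ℤ} {ρ : G →* Module.End ℤ (m → ℤ)} {s : ι → G}

theorem mem_actingSubgroup_of_simple (hC : ∀ i, C i i = 2) (h : ∀ i j, c i ⬝ᵥ a j = C i j)
    (hs : ∀ i y, ρ (s i) y = y - (c i ⬝ᵥ y) • a i) (i : ι) : s i ∈ actingSubgroup C a ρ := by
  refine ⟨simpleReflection C hC i, Subgroup.subset_closure ⟨i, trivial, fun _ => rfl⟩, fun x => ?_⟩
  rw [simpleReflection_apply, map_sub, map_smul, latticeMap_single, hs, mulVec_eq_dotProduct h]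

theorem exists_actsAs (h : ∀ i j, c i ⬝ᵥ a j = C i j)
    (hs : ∀ i y, ρ (s i) y = y - (c i ⬝ᵥ y) • a i) {w : LatticeAut ι}
    (hw : w ∈ weylGroup C) : ∃ g ∈ Subgroup.closure (Set.range s), ActsAs a ρ w g := by
  induction hw using Subgroup.closure_induction with
  | mem w hw =>
    obtain ⟨i, -, hi⟩ := hw
    refine ⟨s i, Subgroup.subset_closure ⟨i, rfl⟩, fun x => ?_⟩
    rw [hi, map_sub, map_smul, latticeMap_single, hs, mulVec_eq_dotProduct h]
  | one => exact ⟨1, one_mem _, actsAs_one a ρ⟩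
  | mul u v _ _ hu hv =>
    obtain ⟨g, hg, h1⟩ := hu
    obtain ⟨k, hk, h2⟩ := hv
    exact ⟨g * k, mul_mem hg hk, h1.mul h2⟩
  | inv u _ hu =>
    obtain ⟨g, hg, h1⟩ := hu
    exact ⟨g⁻¹, inv_mem hg, h1.inv⟩

/-- `W` is isomorphic to the group by which it acts. -/
theorem weylGroup_mulEquiv (hinj : Function.Injective (latticeMap a)) (H : Subgroup G)
    (tot : ∀ w ∈ weylGroup C, ∃ g ∈ H, ActsAs a ρ w g) (surj : H ≤ actingSubgroup C a ρ)
    (faithful : ∀ g, (∀ x, ρ g (latticeMap a x) = latticeMap a x) → g = 1) :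
    Nonempty (weylGroup C ≃* H) := by
  refine mulEquiv_of_rel (fun w g => ActsAs a ρ w.1 g.1) ?_ ?_ ?_ ?_ ?_
  · rintro ⟨w, hw⟩
    obtain ⟨g, hg, h⟩ := tot w hw
    exact ⟨⟨g, hg⟩, h⟩
  · rintro ⟨g, hg⟩
    obtain ⟨w, hw, h⟩ := surj hg
    exact ⟨⟨w, hw⟩, h⟩
  · intro w u g k hg hk
    exact hg.mul hk
  · intro w g k hg hk
    have h1 := hg.mul hk.inv
    rw [mul_inv_cancel] at h1
    exact Subtype.ext (mul_inv_eq_one.mp (faithful _ fun x => (h1 x).symm))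
  · intro w u g hw hu
    refine Subtype.ext (LinearEquiv.ext fun x => hinj ?_)
    rw [hw, hu]

end Ambient

/-! ### Signed permutations -/

section SignedPerm

variable {m : Type} [Fintype m] [DecidableEq m]

/-- The group of signed permutations. -/
abbrev SignedPerm (m : Type) : Type :=
  (m → ℤˣ) ⋊[mulAutArrow (G := Equiv.Perm m) (A := m) (M := ℤˣ)] Equiv.Perm m

theorem perm_apply_inv (σ : Equiv.Perm m) (i : m) : σ (σ⁻¹ i) = i := Equiv.apply_symm_apply σ i

theorem perm_inv_apply (σ : Equiv.Perm m) (i : m) : σ⁻¹ (σ i) = i := Equiv.symm_apply_apply σ i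

namespace SignedPerm

/-- The action on `ℤᵐ`. -/
def toEnd : SignedPerm m →* Module.End ℤ (m → ℤ) where
  toFun g :=
    { toFun := fun y i => (g.left i : ℤ) * y (g.right⁻¹ i)
      map_add' := fun x y => by funext i; simp only [Pi.add_apply]; ring
      map_smul' := fun c x => by
        funext i; simp only [Pi.smul_apply, smul_eq_mul, RingHom.id_apply]; ring }
  map_one' := by ext y i; simp
  map_mul' g h := by
    refine LinearMap.ext fun y => funext fun i => ?_
    simp only [LinearMap.coe_mk, AddHom.coe_mk, Module.End.mul_apply, SemidirectProduct.mul_left,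
      SemidirectProduct.mul_right, Pi.mul_apply, Units.val_mul, mul_inv_rev,
      Equiv.Perm.mul_apply, mul_assoc]
    rfl

theorem toEnd_apply (g : SignedPerm m) (y : m → ℤ) (i : m) :
    toEnd g y i = (g.left i : ℤ) * y (g.right⁻¹ i) := rfl

theorem toEnd_single (g : SignedPerm m) (p : m) (z : ℤ) :
    toEnd g (Pi.single p z) = Pi.single (g.right p) ((g.left (g.right p) : ℤ) * z) := by
  funext i
  rw [toEnd_apply, Pi.single_apply, Pi.single_apply]
  by_cases h : i = g.right p
  · subst h; simp
  · rw [if_neg h, if_neg, mul_zero]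
    intro h'
    exact h (by rw [← h', perm_apply_inv])

/-- The product of the signs. -/
def sgn : SignedPerm m →* ℤˣ where
  toFun g := ∏ i, g.left i
  map_one' := by simp
  map_mul' g h := by
    rw [SemidirectProduct.mul_left]
    simp only [Pi.mul_apply, Finset.prod_mul_distrib]
    congr 1
    exact Equiv.prod_comp g.right⁻¹ h.left

/-- The action on pairs of an element and a sign. -/
def toPerm : SignedPerm m →* Equiv.Perm (m × ℤˣ) where
  toFun g :=
    { toFun := fun x => (g.right x.1, g.left (g.right x.1) * x.2)
      invFun := fun x => (g.right⁻¹ x.1, g.left x.1 * x.2)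
      left_inv := fun x => by
        ext
        · simp
        · simp [← mul_assoc]
      right_inv := fun x => by
        ext
        · simp
        · simp [← mul_assoc] }
  map_one' := by ext x <;> simp
  map_mul' g h := by
    refine Equiv.ext fun x => Prod.ext ?_ ?_
    · simp
    · simp only [Equiv.coe_fn_mk, Equiv.Perm.mul_apply, SemidirectProduct.mul_left,
        SemidirectProduct.mul_right, Pi.mul_apply, mul_assoc]
      congr 2
      change h.left (g.right⁻¹ _) = _
      rw [perm_inv_apply]

theorem toPerm_apply (g : SignedPerm m) (i : m) (δ : ℤˣ) :
    toPerm g (i, δ) = (g.right i, g.left (g.right i) * δ) := rfl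

theorem toPerm_injective : Function.Injective (toPerm (m := m)) := by
  intro g h hgh
  have h1 : ∀ i, g.right i = h.right i ∧ g.left (g.right i) = h.left (h.right i) := fun i => by
    have := congrFun (congrArg DFunLike.coe hgh) (i, 1)
    rw [toPerm_apply, toPerm_apply, Prod.mk.injEq, mul_one, mul_one] at this
    exact this
  refine SemidirectProduct.ext ?_ (Equiv.ext fun i => (h1 i).1)
  funext i
  have := (h1 (g.right⁻¹ i)).2
  rwa [← (h1 _).1, perm_apply_inv] at this

/-- The permutations of `m × ℤˣ` that preserve the pairs are signed permutations. -/
theorem exists_toPerm_eq (π : Equiv.Perm (m × ℤˣ))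
    (h : ∀ i, (π (i, 1)).1 = (π (i, -1)).1) : ∃ g : SignedPerm m, toPerm g = π := by
  have hneg : ∀ i, (π (i, -1)).2 = -(π (i, 1)).2 := by
    intro i
    have hne : (π (i, -1)).2 ≠ (π (i, 1)).2 := fun h' => by
      have := π.injective (Prod.ext (h i) h'.symm)
      simp at this
    rcases Int.units_eq_one_or (π (i, 1)).2 with h1 | h1 <;>
      rcases Int.units_eq_one_or (π (i, -1)).2 with h2 | h2 <;> rw [h1, h2] at hne ⊢ <;>
      simp at hne ⊢
  have hfst : ∀ i δ, (π (i, δ)).1 = (π (i, 1)).1 := by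
    intro i δ
    rcases Int.units_eq_one_or δ with rfl | rfl
    · rfl
    · exact (h i).symm
  have hinj : Function.Injective fun i => (π (i, 1)).1 := by
    intro i j hij
    simp only at hij
    rcases Int.units_eq_one_or ((π (i, 1)).2 * (π (j, 1)).2) with h1 | h1
    · have : (π (i, 1)).2 = (π (j, 1)).2 := by
        rw [mul_eq_one_iff_eq_inv, Int.units_inv_eq_self] at h1
        exact h1
      exact congrArg Prod.fst (π.injective (Prod.ext hij this))
    · have : (π (i, 1)).2 = (π (j, -1)).2 := by
        have h2 : (π (i, 1)).2 * (π (j, -1)).2 = 1 := by rw [hneg, mul_neg, h1, neg_neg]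
        rw [mul_eq_one_iff_eq_inv, Int.units_inv_eq_self] at h2
        exact h2
      exact congrArg Prod.fst (π.injective (Prod.ext (hij.trans (h j)) this))
  let σ : Equiv.Perm m := Equiv.ofBijective _ (Finite.injective_iff_bijective.mp hinj)
  have hσ : ∀ i, σ i = (π (i, 1)).1 := fun _ => rfl
  refine ⟨⟨fun k => (π (σ⁻¹ k, 1)).2, σ⟩, Equiv.ext fun ⟨i, δ⟩ => Prod.ext ?_ ?_⟩
  · rw [hfst]; rfl
  · rw [toPerm_apply]
    simp only [perm_inv_apply]
    rcases Int.units_eq_one_or δ with rfl | rfl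
    · rw [mul_one]
    · rw [hneg, mul_neg, mul_one]

/-- The reflection in `e_p - e_q`. -/
theorem toEnd_swap {p q : m} (h : p ≠ q) (y : m → ℤ) :
    toEnd (SemidirectProduct.inr (Equiv.swap p q)) y =
      y - ((Pi.single p 1 - Pi.single q 1 : m → ℤ) ⬝ᵥ y) • (Pi.single p 1 - Pi.single q 1) := by
  funext i
  rw [toEnd_apply]
  simp only [SemidirectProduct.left_inr, SemidirectProduct.right_inr, Equiv.swap_inv, Pi.one_apply,
    Units.val_one, one_mul, sub_dotProduct, single_one_dotProduct, Pi.sub_apply, Pi.smul_apply,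
    Pi.single_apply, smul_eq_mul]
  by_cases hp : i = p
  · subst hp; rw [Equiv.swap_apply_left]; simp [h]
  · by_cases hq : i = q
    · subst hq; rw [Equiv.swap_apply_right]; simp [hp]
    · rw [Equiv.swap_apply_of_ne_of_ne hp hq]; simp [hp, hq]

/-- The sign change of the `p`-th coordinate. -/
def flip (p : m) : SignedPerm m := SemidirectProduct.inl (Pi.mulSingle p (-1))

theorem toEnd_flip (p : m) (y : m → ℤ) :
    toEnd (flip p) y = y - ((Pi.single p 1 : m → ℤ) ⬝ᵥ y) • (Pi.single p 2 : m → ℤ) := by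
  funext i
  rw [toEnd_apply, single_one_dotProduct]
  simp only [flip, SemidirectProduct.left_inl, SemidirectProduct.right_inl, inv_one,
    Equiv.Perm.one_apply, Pi.sub_apply, Pi.smul_apply, Pi.single_apply, smul_eq_mul,
    Pi.mulSingle_apply]
  by_cases hp : i = p
  · subst hp; simp; ring
  · simp [hp]

theorem sgn_flip (p : m) : sgn (flip p) = -1 := by
  simp [sgn, flip, Finset.prod_pi_mulSingle']

theorem sgn_inr (σ : Equiv.Perm m) : sgn (SemidirectProduct.inr σ : SignedPerm m) = 1 := by
  simp [sgn]

/-- The reflection in `e_p + e_q`. -/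
def swapNeg (p q : m) : SignedPerm m :=
  flip p * flip q * SemidirectProduct.inr (Equiv.swap p q)

theorem sgn_swapNeg (p q : m) : sgn (swapNeg p q) = 1 := by
  rw [swapNeg, map_mul, map_mul, sgn_flip, sgn_flip, sgn_inr]; rfl

theorem toEnd_swapNeg {p q : m} (h : p ≠ q) (y : m → ℤ) :
    toEnd (swapNeg p q) y =
      y - ((Pi.single p 1 + Pi.single q 1 : m → ℤ) ⬝ᵥ y) • (Pi.single p 1 + Pi.single q 1) := by
  rw [swapNeg, map_mul, map_mul, Module.End.mul_apply, Module.End.mul_apply, toEnd_swap h,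
    toEnd_flip, toEnd_flip]
  funext i
  simp only [sub_dotProduct, add_dotProduct, single_one_dotProduct, Pi.sub_apply, Pi.add_apply,
    Pi.smul_apply, Pi.single_apply, smul_eq_mul, h, h.symm, if_true, if_false]
  split_ifs with h1 h2
  · exact absurd (h1.symm.trans h2) h
  · subst h1; ring
  · ring
  · ring

theorem card_eq (m : Type) [Fintype m] [DecidableEq m] :
    Nat.card (SignedPerm m) = 2 ^ Fintype.card m * (Fintype.card m).factorial := by
  rw [SemidirectProduct.card, Nat.card_eq_fintype_card, Nat.card_eq_fintype_card,
    Fintype.card_perm, Fintype.card_fun]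
  simp

theorem card_ker_sgn [Nonempty m] : Nat.card (sgn (m := m)).ker * 2 =
    2 ^ Fintype.card m * (Fintype.card m).factorial := by
  rw [← card_eq, ← Subgroup.card_mul_index (sgn (m := m)).ker, Subgroup.index_ker]
  congr 1
  have : (sgn (m := m)).range = ⊤ := by
    rw [MonoidHom.range_eq_top]
    intro u
    rcases Int.units_eq_one_or u with rfl | rfl
    · exact ⟨1, map_one _⟩
    · exact ⟨flip (Classical.arbitrary m), sgn_flip _⟩
  rw [this]
  simp

theorem inl_eq_prod_flip (s : Finset m) (ε : m → ℤˣ) (hε : ∀ i, i ∉ s → ε i = 1)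
    (H : Subgroup (SignedPerm m)) (h : ∀ p ∈ s, flip p ∈ H) :
    (SemidirectProduct.inl ε : SignedPerm m) ∈ H := by
  induction s using Finset.induction_on generalizing ε with
  | empty =>
    have : ε = 1 := funext fun i => hε i (by simp)
    rw [this, map_one]
    exact one_mem _
  | insert p s hp ih =>
    have h1 := ih (Function.update ε p 1) (fun i hi => by
      by_cases hip : i = p
      · subst hip; simp
      · rw [Function.update_of_ne hip]; exact hε i (by simp [hip, hi]))
      fun q hq => h q (Finset.mem_insert_of_mem hq)
    rcases Int.units_eq_one_or (ε p) with h2 | h2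
    · rwa [← h2, Function.update_eq_self] at h1
    · have : ε = Pi.mulSingle p (-1) * Function.update ε p 1 := by
        funext i
        by_cases hip : i = p
        · subst hip; simp [h2]
        · simp [hip]
      rw [this, map_mul]
      exact mul_mem (h p (Finset.mem_insert_self _ _)) h1

theorem eq_top_of_mem (H : Subgroup (SignedPerm m))
    (h1 : ∀ σ, (SemidirectProduct.inr σ : SignedPerm m) ∈ H) (h2 : ∀ p, flip p ∈ H) : H = ⊤ := by
  rw [eq_top_iff]
  intro g _
  rw [← SemidirectProduct.inl_left_mul_inr_right g]
  exact mul_mem (inl_eq_prod_flip Finset.univ _ (by simp) H fun p _ => h2 p) (h1 _)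

theorem conj_flip (σ : Equiv.Perm m) (p : m) :
    (SemidirectProduct.inr σ : SignedPerm m) * flip p * (SemidirectProduct.inr σ)⁻¹ =
      flip (σ p) := by
  rw [flip, flip, ← map_inv, ← SemidirectProduct.inl_aut]
  congr 1
  funext i
  change (Pi.mulSingle p (-1) : m → ℤˣ) (σ⁻¹ i) = _
  rw [Pi.mulSingle_apply, Pi.mulSingle_apply]
  have : σ⁻¹ i = p ↔ i = σ p := by
    rw [Equiv.Perm.inv_eq_iff_eq]
  simp only [this]

/-- Swaps give all permutations. Dividing the reflection in `e_p + e_q` by a swap gives the sign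
change of two coordinates, and such pairs generate the even sign changes. -/
theorem ker_sgn_le (H : Subgroup (SignedPerm m))
    (h1 : ∀ p q, p ≠ q → (SemidirectProduct.inr (Equiv.swap p q) : SignedPerm m) ∈ H)
    (h2 : ∀ p q, p ≠ q → swapNeg p q ∈ H) : (sgn (m := m)).ker ≤ H := by
  have hperm : ∀ σ, (SemidirectProduct.inr σ : SignedPerm m) ∈ H := by
    intro σ
    induction σ using Equiv.Perm.swap_induction_on with
    | one => rw [map_one]; exact one_mem _
    | swap_mul f x y hxy ih => rw [map_mul]; exact mul_mem (h1 x y hxy) ih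
  have hflip : ∀ p q, flip p * flip q ∈ H := by
    intro p q
    by_cases hpq : p = q
    · subst hpq
      have : flip p * flip p = 1 := by
        rw [flip, ← map_mul, ← Pi.mulSingle_mul]; simp
      rw [this]; exact one_mem _
    · have := mul_mem (h2 p q hpq) (inv_mem (hperm (Equiv.swap p q)))
      rwa [swapNeg, mul_inv_cancel_right] at this
  rcases isEmpty_or_nonempty m with hm | ⟨⟨p₀⟩⟩
  · intro g _
    rw [← SemidirectProduct.inl_left_mul_inr_right g]
    refine mul_mem ?_ (hperm _)
    rw [Subsingleton.elim g.left 1, map_one]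
    exact one_mem _
  have hHsgn : ∀ ε : m → ℤˣ, ∏ i, ε i = 1 → (SemidirectProduct.inl ε : SignedPerm m) ∈ H := by
    intro ε hε
    -- The induction over coordinates passes through sign vectors with product -1; an additional
    -- sign change at an arbitrary `q` corrects their parity.
    suffices h : ∀ s : Finset m, ∀ ε : m → ℤˣ, (∀ i, i ∉ s → ε i = 1) → ∀ q,
        (if ∏ i, ε i = 1 then (1 : SignedPerm m) else flip q) * SemidirectProduct.inl ε ∈ H by
      have := h Finset.univ ε (by simp) p₀
      rwa [if_pos hε, one_mul] at this
    intro s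
    induction s using Finset.induction_on with
    | empty =>
      intro ε hε q
      have : ε = 1 := funext fun i => hε i (by simp)
      subst this
      simp [one_mem]
    | insert p s hp ih =>
      intro ε hε q
      have h1 := ih (Function.update ε p 1) (fun i hi => by
        by_cases hip : i = p
        · subst hip; simp
        · rw [Function.update_of_ne hip]; exact hε i (by simp [hip, hi]))
      rcases Int.units_eq_one_or (ε p) with h2 | h2
      · have he : Function.update ε p 1 = ε := by rw [← h2, Function.update_eq_self]
        rw [he] at h1
        exact h1 q
      · have he : ε = Pi.mulSingle p (-1) * Function.update ε p 1 := by
          funext i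
          by_cases hip : i = p
          · subst hip; simp [h2]
          · simp [hip]
        have hprod : ∏ i, ε i = -∏ i, Function.update ε p 1 i := by
          conv_lhs => rw [he]
          simp only [Pi.mul_apply, Finset.prod_mul_distrib, Finset.prod_pi_mulSingle',
            Finset.mem_univ, if_true, neg_one_mul]
        have hinl : (SemidirectProduct.inl ε : SignedPerm m) =
            flip p * SemidirectProduct.inl (Function.update ε p 1) := by
          rw [flip, ← map_mul, ← he]
        have hsq : flip p * flip p = 1 := by
          rw [flip, ← map_mul, ← Pi.mulSingle_mul]; simp
        rcases Int.units_eq_one_or (∏ i, Function.update ε p 1 i) with h3 | h3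
        · have h4 := h1 p
          rw [if_pos h3, one_mul] at h4
          rw [hprod, h3, if_neg (by decide), hinl, ← mul_assoc]
          exact mul_mem (hflip q p) h4
        · have h4 := h1 p
          rw [if_neg (by rw [h3]; decide)] at h4
          rw [hprod, h3, neg_neg, if_pos rfl, one_mul, hinl]
          exact h4
  intro g hg
  rw [← SemidirectProduct.inl_left_mul_inr_right g]
  exact mul_mem (hHsgn _ hg) (hperm _)

end SignedPerm

end SignedPerm

/-! ### Simply laced types in coordinates -/

section AmbientSL

variable {ι m : Type} [Fintype ι] [DecidableEq ι] [Fintype m] [DecidableEq m] {C : Matrix ι ι ℤ}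
  {a : ι → m → ℤ}

theorem dot_latticeMap (h : ∀ i j, a i ⬝ᵥ a j = C i j) (x y : ι → ℤ) :
    latticeMap a x ⬝ᵥ latticeMap a y = form C x y := by
  rw [dotProduct_latticeMap (c := 1) (C := C) (by simpa using h), one_mul]

theorem actsAs_reflE {G : Type} [Group G] {ρ : G →* Module.End ℤ (m → ℤ)}
    (h : ∀ i j, a i ⬝ᵥ a j = C i j) {β : ι → ℤ} (hβ : form C β β = 2) {g : G}
    (hg : ∀ y, ρ g y = y - (latticeMap a β ⬝ᵥ y) • latticeMap a β) :
    ActsAs a ρ (reflE C β hβ) g := fun x => by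
  rw [reflE_apply, map_sub, map_smul, hg, ← dot_latticeMap h, dotProduct_comm]

theorem hasCartanType_of_ambient (hC : IsSL C) (h : ∀ i j, a i ⬝ᵥ a j = C i j)
    (hinj : Function.Injective (latticeMap a)) {X : Set (ι → ℤ)} {κ : Type} [Fintype κ]
    [DecidableEq κ] {P : Matrix κ κ ℤ} (hP : IsSL P) (c : κ → m → ℤ)
    (hc : ∀ k l, c k ⬝ᵥ c l = P k l) (hcr : ∀ k, c k ∈ LinearMap.range (latticeMap a))
    (hX : ∀ k, ∀ β ∈ X, c k ⬝ᵥ latticeMap a β = 0)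
    (hspan : ∀ δ, form C δ δ = 2 → (∀ β ∈ X, form C δ β = 0) →
      latticeMap a δ ∈ Submodule.span ℤ (Set.range c)) :
    HasCartanType C (perpRoots C X) P := by
  choose γ hγ using hcr
  refine hasCartanType_of_family hC hP γ (fun k l => ?_) (fun k β hβ => ?_) fun δ hδ => ?_
  · rw [← dot_latticeMap h, hγ, hγ, hc]
  · rw [← dot_latticeMap h, hγ, hX k β hβ]
  · have h1 := hspan δ ((mem_roots_iff hC).mp hδ.1) hδ.2
    have h2 : Set.range c = latticeMap a '' Set.range γ := by
      rw [← Set.range_comp]; congr 1; funext k; exact (hγ k).symm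
    rw [h2, Submodule.span_image] at h1
    obtain ⟨y, hy, he⟩ := h1
    rwa [← hinj he]

theorem exists_single_add_single {y : m → ℤ} (h : y ⬝ᵥ y = 2) :
    ∃ p q : m, p ≠ q ∧ ∃ δ ε : ℤˣ, y = Pi.single p (δ : ℤ) + Pi.single q (ε : ℤ) := by
  have hle : ∀ i, y i * y i ≤ 2 := fun i => by
    rw [← h]
    exact Finset.single_le_sum (f := fun i => y i * y i) (fun j _ => mul_self_nonneg _)
      (Finset.mem_univ i)
  have hval : ∀ i, y i = 0 ∨ y i = 1 ∨ y i = -1 := fun i => by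
    have := hle i
    have h1 : y i ≤ 1 := by nlinarith
    have h2 : -1 ≤ y i := by nlinarith
    omega
  have hcard : (Finset.univ.filter fun i => y i ≠ 0).card = 2 := by
    have h1 : ∀ i, y i * y i = if y i ≠ 0 then 1 else 0 := fun i => by
      rcases hval i with h | h | h <;> simp [h]
    have h2 : ∑ i, y i * y i = 2 := h
    rw [Finset.sum_congr rfl fun i _ => h1 i, Finset.sum_boole] at h2
    exact_mod_cast h2
  obtain ⟨p, q, hpq, hs⟩ := Finset.card_eq_two.mp hcard
  have hmem : ∀ i, y i ≠ 0 ↔ i = p ∨ i = q := fun i => by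
    have := congrArg (i ∈ ·) hs
    simpa using this
  have hunit : ∀ i, y i ≠ 0 → ∃ δ : ℤˣ, (δ : ℤ) = y i := fun i hi => by
    rcases hval i with h | h | h
    · exact absurd h hi
    · exact ⟨1, by rw [h]; rfl⟩
    · exact ⟨-1, by rw [h]; rfl⟩
  obtain ⟨δ, hδ⟩ := hunit p ((hmem p).mpr (Or.inl rfl))
  obtain ⟨ε, hε⟩ := hunit q ((hmem q).mpr (Or.inr rfl))
  refine ⟨p, q, hpq, δ, ε, funext fun i => ?_⟩
  rw [Pi.add_apply, Pi.single_apply, Pi.single_apply, hδ, hε]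
  by_cases hp : i = p
  · subst hp; simp [hpq]
  · by_cases hq : i = q
    · subst hq; simp [hp]
    · rw [if_neg hp, if_neg hq, add_zero]
      by_contra h0
      exact ((hmem i).mp h0).elim hp hq

theorem eq_one_of_fix_single {g : SignedPerm m}
    (h : ∀ p, SignedPerm.toEnd g (Pi.single p 1) = Pi.single p 1) : g = 1 := by
  have h1 : ∀ p, g.right p = p ∧ g.left (g.right p) = 1 := fun p => by
    have h2 := h p
    rw [SignedPerm.toEnd_single, mul_one] at h2
    have h3 := congrFun h2 (g.right p)
    rw [Pi.single_eq_same, Pi.single_apply] at h3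
    split_ifs at h3 with h4
    · exact ⟨h4, Units.ext h3⟩
    · exact absurd h3 (Units.ne_zero _)
  have hr : g.right = 1 := Equiv.ext fun p => (h1 p).1
  refine SemidirectProduct.ext (funext fun p => ?_) hr
  have := (h1 p).2
  rw [(h1 p).1] at this
  exact this

end AmbientSL

/-! ### Type A: differences of coordinates and the symmetric group -/

section TypeA

variable {n : ℕ}

/-- The simple roots of type `A` in coordinates. -/
def aA (n : ℕ) (k : Fin n) : Fin (n + 1) → ℤ := Pi.single k.castSucc 1 - Pi.single k.succ 1

theorem dot_aA (n : ℕ) (i j : Fin n) : aA n i ⬝ᵥ aA n j = A n i j := by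
  simp only [aA, sub_dotProduct, single_one_dotProduct, Pi.sub_apply, Pi.single_apply,
    A, Matrix.of_apply, Fin.ext_iff, Fin.val_castSucc, Fin.val_succ]
  split_ifs <;> omega

theorem aA_dual (n : ℕ) (k j : Fin n) :
    (fun p : Fin (n + 1) => if (p : ℕ) ≤ k then (1 : ℤ) else 0) ⬝ᵥ aA n j =
      if k = j then 1 else 0 := by
  simp only [aA, dotProduct_sub, dotProduct_single_one, Fin.val_castSucc, Fin.val_succ, Fin.ext_iff]
  split_ifs <;> omega

theorem aA_eq_zero (x : Fin n → ℤ) (hx : latticeMap (aA n) x = 0) : x = 0 :=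
  latticeMap_injective_of_dual _ (fun _ => 1) (fun _ => one_ne_zero) (aA_dual n) x hx

theorem aA_injective (n : ℕ) : Function.Injective (latticeMap (aA n)) :=
  (injective_iff_map_eq_zero _).mpr aA_eq_zero

theorem isSL_A (n : ℕ) : IsSL (A n) :=
  isSL_of_gram (a := aA n) (c := 1) one_pos (by simpa using dot_aA n) aA_eq_zero
    (fun i => by simp [A]) (A_apply_le_zero_of_ne n)

theorem height_A (x : Fin n → ℤ) :
    height x = (fun p : Fin (n + 1) => -((p : ℕ) : ℤ)) ⬝ᵥ latticeMap (aA n) x := by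
  symm
  refine dotProduct_latticeMap_of_one (fun i => ?_) x
  simp only [aA, dotProduct_sub, dotProduct_single_one, Fin.val_castSucc, Fin.val_succ]
  push_cast; ring

theorem sum_latticeMap_aA (x : Fin n → ℤ) : (1 : Fin (n + 1) → ℤ) ⬝ᵥ latticeMap (aA n) x = 0 := by
  rw [latticeMap_apply, dotProduct_sum]
  refine Finset.sum_eq_zero fun k _ => ?_
  rw [dotProduct_smul, aA, dotProduct_sub, dotProduct_single_one, dotProduct_single_one]
  simp

theorem aA_mem_range (k : Fin n) : aA n k ∈ LinearMap.range (latticeMap (aA n)) :=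
  ⟨Pi.single k 1, latticeMap_single _ _⟩

theorem sub_mem_range_A (p q : Fin (n + 1)) :
    (Pi.single p 1 - Pi.single q 1 : Fin (n + 1) → ℤ) ∈ LinearMap.range (latticeMap (aA n)) := by
  have key : ∀ k : Fin (n + 1), (Pi.single 0 1 - Pi.single k 1 : Fin (n + 1) → ℤ) ∈
      LinearMap.range (latticeMap (aA n)) := by
    intro k
    induction k using Fin.induction with
    | zero => rw [sub_self]; exact zero_mem _
    | succ k ih =>
      have := add_mem ih (aA_mem_range k)
      rwa [aA, sub_add_sub_cancel] at this
  have := sub_mem (key q) (key p)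
  rwa [sub_sub_sub_cancel_left] at this

theorem exists_sub_of_root_A {x : Fin n → ℤ} (h : form (A n) x x = 2) :
    ∃ p q : Fin (n + 1), p ≠ q ∧ latticeMap (aA n) x = Pi.single p 1 - Pi.single q 1 := by
  rw [← dot_latticeMap (dot_aA n)] at h
  obtain ⟨p, q, hpq, δ, ε, he⟩ := exists_single_add_single h
  have hs := sum_latticeMap_aA x
  rw [he, dotProduct_add, dotProduct_single, dotProduct_single] at hs
  simp only [Pi.one_apply, one_mul] at hs
  rcases Int.units_eq_one_or δ with rfl | rfl
  · refine ⟨p, q, hpq, ?_⟩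
    have : (ε : ℤ) = -1 := by rw [Units.val_one] at hs; omega
    rw [he, this, Pi.single_neg, sub_eq_add_neg]; rfl
  · refine ⟨q, p, hpq.symm, ?_⟩
    have : (ε : ℤ) = 1 := by rw [Units.val_neg, Units.val_one] at hs; omega
    rw [he, this, Units.val_neg, Units.val_one, Pi.single_neg, sub_eq_add_neg]
    exact add_comm _ _

/-- Permutations of the coordinates. -/
def permEnd (m : Type) [Fintype m] [DecidableEq m] :
    Equiv.Perm m →* Module.End ℤ (m → ℤ) :=
  SignedPerm.toEnd.comp SemidirectProduct.inr

theorem permEnd_single {m : Type} [Fintype m] [DecidableEq m] (σ : Equiv.Perm m) (p : m) (z : ℤ) :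
    permEnd m σ (Pi.single p z) = Pi.single (σ p) z := by
  rw [permEnd, MonoidHom.comp_apply, SignedPerm.toEnd_single]
  simp

theorem exists_weyl_A (σ : Equiv.Perm (Fin (n + 1))) :
    ∃ w ∈ weylGroup (A n), ActsAs (aA n) (permEnd _) w σ := by
  suffices h : σ ∈ actingSubgroup (A n) (aA n) (permEnd _) from h
  induction σ using Equiv.Perm.swap_induction_on with
  | one => exact one_mem _
  | swap_mul f p q hpq ih =>
    refine mul_mem ?_ ih
    obtain ⟨β, hβ⟩ := sub_mem_range_A (n := n) p q
    have hn : form (A n) β β = 2 := by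
      rw [← dot_latticeMap (dot_aA n), hβ]
      simp [hpq, hpq.symm]
    refine ⟨_, reflE_mem_weylGroup (isSL_A n) β hn, actsAs_reflE (dot_aA n) hn fun y => ?_⟩
    rw [hβ]
    exact SignedPerm.toEnd_swap hpq y

theorem exists_perm_A {w : LatticeAut (Fin n)}
    (hw : w ∈ weylGroup (A n)) :
    ∃ σ : Equiv.Perm (Fin (n + 1)), ActsAs (aA n) (permEnd _) w σ := by
  obtain ⟨g, -, h⟩ := exists_actsAs (a := aA n) (c := aA n) (ρ := permEnd _)
    (s := fun i => Equiv.swap i.castSucc i.succ) (dot_aA n)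
    (fun i y => SignedPerm.toEnd_swap (by simp [Fin.ext_iff]) y) hw
  exact ⟨g, h⟩

theorem card_weylGroup_A (n : ℕ) : Nat.card (weylGroup (A n)) = (n + 1).factorial := by
  obtain ⟨e⟩ := weylGroup_mulEquiv (C := A n) (ρ := permEnd (Fin (n + 1)))
    (aA_injective n) ⊤
    (fun w hw => (exists_perm_A hw).imp fun σ h => ⟨trivial, h⟩) (fun σ _ => exists_weyl_A σ) (by
      intro σ h
      by_contra hne
      obtain ⟨p, hp⟩ : ∃ p, σ p ≠ p := by
        by_contra hall
        push Not at hall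
        exact hne (Equiv.ext hall)
      -- The image of `e_p - e_{σ p}` has no positive entry at `p`, so it is not the vector itself.
      obtain ⟨x, hx⟩ := sub_mem_range_A (n := n) p (σ p)
      have h1 := h x
      rw [hx, map_sub, permEnd_single, permEnd_single] at h1
      have h2 := congrFun h1 p
      simp only [Pi.sub_apply, Pi.single_apply, hp.symm, if_true, if_false] at h2
      split_ifs at h2 <;> omega)
  rw [Nat.card_congr e.toEquiv, Nat.card_congr Subgroup.topEquiv.toEquiv, Nat.card_eq_fintype_card,
    Fintype.card_perm, Fintype.card_fin]

end TypeA

/-! ### Type D: even signed permutations -/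

section TypeD

variable {n : ℕ}

/-- The simple roots of type `D` in coordinates. -/
def aD (n : ℕ) (k : Fin n) : Fin n → ℤ :=
  if h : (k : ℕ) + 1 < n then Pi.single k 1 - Pi.single ⟨k + 1, h⟩ 1
  else Pi.single ⟨k - 1, by omega⟩ 1 + Pi.single k 1

theorem aD_of_lt {k : Fin n} (h : (k : ℕ) + 1 < n) :
    aD n k = Pi.single k 1 - Pi.single ⟨k + 1, h⟩ 1 := dif_pos h

theorem aD_of_not_lt {k : Fin n} (h : ¬ (k : ℕ) + 1 < n) :
    aD n k = Pi.single ⟨k - 1, by omega⟩ 1 + Pi.single k 1 := dif_neg h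

theorem D_apply (hn : 2 ≤ n) (i j : Fin n) : D n i j =
    if (i : ℕ) = j then 2
    else if (i : ℕ) + 1 = j ∧ (j : ℕ) + 1 < n then -1
    else if (j : ℕ) + 1 = i ∧ (i : ℕ) + 1 < n then -1
    else if (i : ℕ) + 2 = j ∧ (j : ℕ) + 1 = n then -1
    else if (j : ℕ) + 2 = i ∧ (i : ℕ) + 1 = n then -1
    else 0 := by
  have hi := i.2
  have hj := j.2
  simp only [D, Matrix.of_apply, Fin.ext_iff]
  grind (splits := 20)

theorem dot_aD (hn : 2 ≤ n) (i j : Fin n) : aD n i ⬝ᵥ aD n j = D n i j := by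
  have hi := i.2
  have hj := j.2
  rw [D_apply hn]
  by_cases h1 : (i : ℕ) + 1 < n <;> by_cases h2 : (j : ℕ) + 1 < n
  · rw [aD_of_lt h1, aD_of_lt h2]
    simp only [sub_dotProduct, single_one_dotProduct, Pi.sub_apply, Pi.single_apply, Fin.ext_iff]
    grind
  · rw [aD_of_lt h1, aD_of_not_lt h2]
    simp only [sub_dotProduct, single_one_dotProduct, Pi.add_apply, Pi.single_apply, Fin.ext_iff]
    grind
  · rw [aD_of_not_lt h1, aD_of_lt h2]
    simp only [add_dotProduct, single_one_dotProduct, Pi.sub_apply, Pi.single_apply, Fin.ext_iff]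
    grind
  · rw [aD_of_not_lt h1, aD_of_not_lt h2]
    simp only [add_dotProduct, single_one_dotProduct, Pi.add_apply, Pi.single_apply, Fin.ext_iff]
    grind

/-- Multiples of the fundamental weights of type `D`. -/
def dualD (n : ℕ) (k : Fin n) (p : Fin n) : ℤ :=
  if (k : ℕ) + 2 < n then (if (p : ℕ) ≤ k then 1 else 0)
  else if (k : ℕ) + 2 = n then (if (p : ℕ) + 1 = n then -1 else 1) else 1

/-- The two spin weights are half-integral and therefore doubled, hence the factor 2 at the last two
nodes. -/
theorem aD_dual (hn : 2 ≤ n) (k j : Fin n) :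
    dualD n k ⬝ᵥ aD n j = if k = j then (if (k : ℕ) + 2 < n then 1 else 2) else 0 := by
  have hk := k.2
  have hj := j.2
  by_cases h2 : (j : ℕ) + 1 < n
  · rw [aD_of_lt h2, dotProduct_sub, dotProduct_single_one, dotProduct_single_one]
    simp only [dualD, Fin.ext_iff]
    split_ifs <;> omega
  · rw [aD_of_not_lt h2, dotProduct_add, dotProduct_single_one, dotProduct_single_one]
    simp only [dualD, Fin.ext_iff]
    split_ifs <;> omega

theorem aD_eq_zero (hn : 2 ≤ n) (x : Fin n → ℤ) (hx : latticeMap (aD n) x = 0) : x = 0 :=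
  latticeMap_injective_of_dual (dualD n) (fun k => if (k : ℕ) + 2 < n then 1 else 2)
    (fun k => by split_ifs <;> norm_num) (aD_dual hn) x hx

theorem aD_injective (hn : 2 ≤ n) : Function.Injective (latticeMap (aD n)) :=
  (injective_iff_map_eq_zero _).mpr (aD_eq_zero hn)

theorem isSL_D (hn : 2 ≤ n) : IsSL (D n) :=
  isSL_of_gram (a := aD n) (c := 1) one_pos (by simpa using dot_aD hn) (aD_eq_zero hn)
    (D_diag n) (D_off_diag_nonpos n)

/-- The vector `(n - 1, …, 1, 0)` has inner product 1 with every simple root; since its last entry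
is 0, the last sign does not affect heights. -/
theorem height_D (hn : 2 ≤ n) (x : Fin n → ℤ) :
    height x = (fun p : Fin n => (n : ℤ) - 1 - ((p : ℕ) : ℤ)) ⬝ᵥ latticeMap (aD n) x := by
  symm
  refine dotProduct_latticeMap_of_one (fun j => ?_) x
  have hj := j.2
  by_cases h2 : (j : ℕ) + 1 < n
  · rw [aD_of_lt h2, dotProduct_sub, dotProduct_single_one, dotProduct_single_one]
    push_cast; ring
  · rw [aD_of_not_lt h2, dotProduct_add, dotProduct_single_one, dotProduct_single_one]
    simp only
    omega

theorem aD_mem_range (k : Fin n) : aD n k ∈ LinearMap.range (latticeMap (aD n)) :=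
  ⟨Pi.single k 1, latticeMap_single _ _⟩

theorem sub_mem_range_D (p q : Fin n) :
    (Pi.single p 1 - Pi.single q 1 : Fin n → ℤ) ∈ LinearMap.range (latticeMap (aD n)) := by
  have key : ∀ (k : ℕ) (hk : k < n), (Pi.single ⟨0, by omega⟩ 1 - Pi.single ⟨k, hk⟩ 1 :
      Fin n → ℤ) ∈ LinearMap.range (latticeMap (aD n)) := by
    intro k
    induction k with
    | zero => intro hk; rw [sub_self]; exact zero_mem _
    | succ k ih =>
      intro hk
      have := add_mem (ih (by omega)) (aD_mem_range ⟨k, by omega⟩)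
      rwa [aD_of_lt hk, sub_add_sub_cancel] at this
  have := sub_mem (key q q.2) (key p p.2)
  rwa [sub_sub_sub_cancel_left] at this

theorem add_mem_range_D (hn : 2 ≤ n) (p q : Fin n) :
    (Pi.single p 1 + Pi.single q 1 : Fin n → ℤ) ∈ LinearMap.range (latticeMap (aD n)) := by
  have h1 := aD_mem_range (n := n) ⟨n - 1, by omega⟩
  rw [aD_of_not_lt (by simp only; omega)] at h1
  have := add_mem (add_mem (sub_mem_range_D p ⟨n - 1 - 1, by omega⟩)
    (sub_mem_range_D q ⟨n - 1, by omega⟩)) h1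
  convert this using 1
  abel

theorem unit_mem_range_D (hn : 2 ≤ n) (p q : Fin n) (δ ε : ℤˣ) :
    (Pi.single p (δ : ℤ) + Pi.single q (ε : ℤ) : Fin n → ℤ) ∈
      LinearMap.range (latticeMap (aD n)) := by
  rcases Int.units_eq_one_or δ with rfl | rfl <;> rcases Int.units_eq_one_or ε with rfl | rfl <;>
    simp only [Units.val_one, Units.val_neg, Pi.single_neg]
  · exact add_mem_range_D hn p q
  · rw [← sub_eq_add_neg]; exact sub_mem_range_D p q
  · rw [neg_add_eq_sub]; exact sub_mem_range_D q p
  · rw [← neg_add]; exact neg_mem (add_mem_range_D hn p q)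

theorem exists_root_D (hn : 2 ≤ n) {x : Fin n → ℤ} (h : form (D n) x x = 2) :
    ∃ p q : Fin n, p ≠ q ∧ ∃ δ ε : ℤˣ,
      latticeMap (aD n) x = Pi.single p (δ : ℤ) + Pi.single q (ε : ℤ) := by
  rw [← dot_latticeMap (dot_aD hn)] at h
  exact exists_single_add_single h

theorem exists_weyl_D (hn : 2 ≤ n) (g : SignedPerm (Fin n)) (hg : SignedPerm.sgn g = 1) :
    ∃ w ∈ weylGroup (D n), ActsAs (aD n) SignedPerm.toEnd w g := by
  suffices h : SignedPerm.sgn.ker ≤ actingSubgroup (D n) (aD n) SignedPerm.toEnd from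
    h hg
  refine SignedPerm.ker_sgn_le _ (fun p q hpq => ?_) fun p q hpq => ?_
  · obtain ⟨β, hβ⟩ := sub_mem_range_D p q
    have hn' : form (D n) β β = 2 := by
      rw [← dot_latticeMap (dot_aD hn), hβ]
      simp [hpq, hpq.symm]
    refine ⟨_, reflE_mem_weylGroup (isSL_D hn) β hn', actsAs_reflE (dot_aD hn) hn' fun y => ?_⟩
    rw [hβ]
    exact SignedPerm.toEnd_swap hpq y
  · obtain ⟨β, hβ⟩ := add_mem_range_D hn p q
    have hn' : form (D n) β β = 2 := by
      rw [← dot_latticeMap (dot_aD hn), hβ]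
      simp [hpq, hpq.symm]
    refine ⟨_, reflE_mem_weylGroup (isSL_D hn) β hn', actsAs_reflE (dot_aD hn) hn' fun y => ?_⟩
    rw [hβ]
    exact SignedPerm.toEnd_swapNeg hpq y

theorem exists_signedPerm_D (hn : 2 ≤ n) {w : LatticeAut (Fin n)}
    (hw : w ∈ weylGroup (D n)) :
    ∃ g : SignedPerm (Fin n), SignedPerm.sgn g = 1 ∧ ActsAs (aD n) SignedPerm.toEnd w g := by
  obtain ⟨g, hg, h⟩ := exists_actsAs (a := aD n) (c := aD n) (ρ := SignedPerm.toEnd)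
    (s := fun i => if h : (i : ℕ) + 1 < n then SemidirectProduct.inr (Equiv.swap i ⟨i + 1, h⟩)
      else SignedPerm.swapNeg ⟨i - 1, by omega⟩ i) (dot_aD hn)
    (fun i y => by
      split_ifs with hi
      · rw [aD_of_lt hi]
        exact SignedPerm.toEnd_swap (by simp [Fin.ext_iff]) y
      · rw [aD_of_not_lt hi]
        exact SignedPerm.toEnd_swapNeg (by simp only [Ne, Fin.ext_iff]; omega) y) hw
  refine ⟨g, ?_, h⟩
  have hle : Subgroup.closure (Set.range fun i : Fin n => if h : (i : ℕ) + 1 < n then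
      SemidirectProduct.inr (Equiv.swap i ⟨i + 1, h⟩)
      else SignedPerm.swapNeg ⟨i - 1, by omega⟩ i) ≤ SignedPerm.sgn.ker := by
    rw [Subgroup.closure_le]
    rintro _ ⟨i, rfl⟩
    simp only
    split_ifs with hi
    · exact SignedPerm.sgn_inr _
    · exact SignedPerm.sgn_swapNeg _ _
  exact hle hg

theorem weylGroup_D_mulEquiv (hn : 2 ≤ n) :
    Nonempty (weylGroup (D n) ≃* (SignedPerm.sgn (m := Fin n)).ker) := by
  refine weylGroup_mulEquiv (aD_injective hn) _
    (fun w hw => exists_signedPerm_D hn hw) (fun g hg => exists_weyl_D hn g hg) fun g h => ?_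
  refine eq_one_of_fix_single fun p => ?_
  -- The root lattice does not contain `e_p`, but it contains `e_p - e_q` and `e_p + e_q`. Fixing
  -- both fixes their sum `2 e_p`, hence `e_p`.
  obtain ⟨q, hq⟩ : ∃ q : Fin n, p ≠ q := by
    by_cases hp : (p : ℕ) = 0
    · exact ⟨⟨1, by omega⟩, fun h => by rw [h] at hp; simp at hp⟩
    · exact ⟨⟨0, by omega⟩, fun h => hp (by rw [h])⟩
  obtain ⟨x, hx⟩ := sub_mem_range_D p q
  obtain ⟨y, hy⟩ := add_mem_range_D hn p q
  have h1 := h x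
  have h2 := h y
  rw [hx, map_sub] at h1
  rw [hy, map_add] at h2
  funext i
  have h3 := congrFun h1 i
  have h4 := congrFun h2 i
  simp only [Pi.sub_apply, Pi.add_apply] at h3 h4
  omega

theorem card_weylGroup_D (hn : 2 ≤ n) :
    Nat.card (weylGroup (D n)) = 2 ^ (n - 1) * n.factorial := by
  obtain ⟨e⟩ := weylGroup_D_mulEquiv hn
  rw [Nat.card_congr e.toEquiv]
  have : Nonempty (Fin n) := ⟨⟨0, by omega⟩⟩
  have h := SignedPerm.card_ker_sgn (m := Fin n)
  rw [Fintype.card_fin] at h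
  obtain ⟨k, rfl⟩ : ∃ k, n = k + 1 := ⟨n - 1, by omega⟩
  rw [pow_succ] at h
  rw [Nat.add_sub_cancel]
  linarith

theorem isSL_of_isEmpty {κ : Type} [Fintype κ] [DecidableEq κ] [IsEmpty κ]
    (P : Matrix κ κ ℤ) : IsSL P where
  symm := by ext i; exact isEmptyElim i
  diag i := isEmptyElim i
  offDiag i := isEmptyElim i
  pos x hx := absurd (Subsingleton.elim x 0) hx

/-- Existence of a node excludes `k = 0` and `k = 1`, so the coordinate description is available. -/
theorem typeD_two_le {k : ℕ} (i : {_i : Fin k // k ≠ 1}) : 2 ≤ k := by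
  have := i.1.2
  have := i.2
  omega

theorem isSL_typeD (k : ℕ) : IsSL (typeD k) := by
  by_cases hk : 2 ≤ k
  · exact (isSL_D hk).of_injective Subtype.val Subtype.val_injective fun _ _ => rfl
  · have : IsEmpty {_i : Fin k // k ≠ 1} := ⟨fun i => hk (typeD_two_le i)⟩
    exact isSL_of_isEmpty _

theorem card_weylGroup_typeD (k : ℕ) :
    Nat.card (weylGroup (typeD k)) = 2 ^ (k - 1) * k.factorial := by
  by_cases hk : 2 ≤ k
  · rw [← card_weylGroup_D hk]
    exact card_weylGroup_of_equiv (isSL_D hk)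
      (Equiv.subtypeUnivEquiv fun _ => by omega : {_i : Fin k // k ≠ 1} ≃ Fin k) fun _ _ => rfl
  · have : IsEmpty {_i : Fin k // k ≠ 1} := ⟨fun i => hk (typeD_two_le i)⟩
    rw [card_weylGroup_of_isEmpty]
    have : k = 0 ∨ k = 1 := by omega
    rcases this with rfl | rfl <;> rfl

end TypeD

/-! ### Combinatorics of matchings -/

section Matchings

variable {m : Type} [Fintype m] [DecidableEq m]

theorem exists_perm_extending {κ : Type} {f g : κ → m} (hf : Function.Injective f)
    (hg : Function.Injective g) : ∃ σ : Equiv.Perm m, ∀ k, σ (f k) = g k := by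
  classical
  let e : {x // x ∈ Set.range f} ≃ {x // x ∈ Set.range g} :=
    (Equiv.ofInjective f hf).symm.trans (Equiv.ofInjective g hg)
  refine ⟨e.extendSubtype, fun k => ?_⟩
  rw [Equiv.extendSubtype_apply_of_mem e (f k) ⟨k, rfl⟩]
  have : (Equiv.ofInjective f hf).symm ⟨f k, ⟨k, rfl⟩⟩ = k := by
    rw [Equiv.symm_apply_eq]; rfl
  change ((Equiv.ofInjective g hg) ((Equiv.ofInjective f hf).symm ⟨f k, ⟨k, rfl⟩⟩) : m) = g k
  rw [this]; rfl

/-- A vector supported on two points is orthogonal to one of three vectors with disjoint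
supports. -/
theorem not_three_disjoint {a b : m} {z y₁ y₂ y₃ : m → ℤ} (hz : ∀ p, p ≠ a → p ≠ b → z p = 0)
    (h12 : ∀ p, y₁ p * y₂ p = 0) (h13 : ∀ p, y₁ p * y₃ p = 0) (h23 : ∀ p, y₂ p * y₃ p = 0)
    (h1 : z ⬝ᵥ y₁ ≠ 0) (h2 : z ⬝ᵥ y₂ ≠ 0) (h3 : z ⬝ᵥ y₃ ≠ 0) : False := by
  have key : ∀ y : m → ℤ, z ⬝ᵥ y ≠ 0 → y a ≠ 0 ∨ y b ≠ 0 := by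
    intro y hy
    by_contra h
    push Not at h
    refine hy (Finset.sum_eq_zero fun p _ => ?_)
    by_cases ha : p = a
    · rw [ha, h.1, mul_zero]
    · by_cases hb : p = b
      · rw [hb, h.2, mul_zero]
      · rw [hz p ha hb, zero_mul]
  have e1 := h12 a
  have e2 := h12 b
  have e3 := h13 a
  have e4 := h13 b
  have e5 := h23 a
  have e6 := h23 b
  rw [mul_eq_zero] at e1 e2 e3 e4 e5 e6
  have k1 := key y₁ h1
  have k2 := key y₂ h2
  have k3 := key y₃ h3
  tauto

/-- The gap forces `p i < t` and `q i ≥ N - t`, so both `p` and `q - (N - t)` are bijections onto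
the numbers below `t`. Their sums agree, hence all the inequalities `p i ≤ q i - (N - t)` are
equalities. -/
theorem matching_shift {N t : ℕ} (ht : t ≤ N) (p q : Fin t → Fin N) (hp : Function.Injective p)
    (hq : Function.Injective q) (h : ∀ i, (p i : ℕ) + (N - t) ≤ q i) (i : Fin t) :
    (q i : ℕ) = p i + (N - t) ∧ (p i : ℕ) < t := by
  have hp' : ∀ i, (p i : ℕ) < t := fun i => by have := h i; have := (q i).2; omega
  have hq' : ∀ i, (q i : ℕ) - (N - t) < t := fun i => by
    have := h i; have := (q i).2; have := i.2; omega
  have b1 : Function.Bijective fun i => (⟨p i, hp' i⟩ : Fin t) :=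
    Finite.injective_iff_bijective.mp fun a b hab => hp (Fin.ext (by simpa using hab))
  have b2 : Function.Bijective fun i => (⟨q i - (N - t), hq' i⟩ : Fin t) :=
    Finite.injective_iff_bijective.mp fun a b hab => hq (Fin.ext (by
      have h1 := h a
      have h2 := h b
      simp only [Fin.mk.injEq] at hab
      omega))
  have s1 : ∑ i, (p i : ℕ) = ∑ i : Fin t, (i : ℕ) :=
    Equiv.sum_comp (Equiv.ofBijective _ b1) fun i : Fin t => (i : ℕ)
  have s2 : ∑ i, ((q i : ℕ) - (N - t)) = ∑ i : Fin t, (i : ℕ) :=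
    Equiv.sum_comp (Equiv.ofBijective _ b2) fun i : Fin t => (i : ℕ)
  have h3 := (Finset.sum_eq_sum_iff_of_le (s := Finset.univ)
    (f := fun i => (p i : ℕ)) (g := fun i => (q i : ℕ) - (N - t)) fun i _ => by
      have := h i
      omega).mp (s1.trans s2.symm) i (Finset.mem_univ i)
  have h4 : (p i : ℕ) = (q i : ℕ) - (N - t) := h3
  have := h i
  exact ⟨by omega, hp' i⟩

variable {ι : Type} [Fintype ι] [DecidableEq ι] {C : Matrix ι ι ℤ}

theorem exists_family {X : Set (ι → ℤ)} (hX : X.Finite) {t : ℕ} (ht : X.ncard = t) :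
    ∃ b : Fin t → ι → ℤ, Function.Injective b ∧ Set.range b = X := by
  have := hX.fintype
  have e : Fin t ≃ X := (Fintype.equivFinOfCardEq (by
    rw [← ht, ← Nat.card_coe_set_eq, Nat.card_eq_fintype_card])).symm
  exact ⟨fun i => e i, Subtype.val_injective.comp e.injective, by
    ext x; exact ⟨by rintro ⟨i, rfl⟩; exact (e i).2, fun hx => ⟨e.symm ⟨x, hx⟩, by simp⟩⟩⟩

theorem act_range (hC : IsSL C) {κ : Type} {b b' : κ → ι → ℤ} (hb' : ∀ k, b' k ∈ posRoots C)
    {w : LatticeAut ι} (h : ∀ k, w (b k) = b' k ∨ w (b k) = -b' k) :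
    act C w (Set.range b) = Set.range b' := by
  ext γ
  constructor
  · rintro ⟨hγ, _, ⟨k, rfl⟩, hor⟩
    refine ⟨k, (eq_of_eq_or_eq_neg hC hγ (hb' _) ?_).symm⟩
    rcases h k with h1 | h1 <;> rw [h1] at hor <;> simpa [or_comm] using hor
  · rintro ⟨k, rfl⟩
    refine ⟨hb' k, b k, ⟨_, rfl⟩, ?_⟩
    rcases h k with h1 | h1 <;> rw [h1] <;> simp

theorem nonempty_of_one_le_ncard {X : Set (ι → ℤ)} {t : ℕ} (h : X.ncard = t) (ht : 1 ≤ t) :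
    X.Nonempty := by
  by_contra h'
  rw [Set.not_nonempty_iff_eq_empty.mp h', Set.ncard_empty] at h
  omega

end Matchings

/-! ### The orbits in type A -/

section OrbitsA

variable {n : ℕ}

/-- The root `e_p - e_q`. -/
noncomputable def rootA (p q : Fin (n + 1)) : Fin n → ℤ := (sub_mem_range_A p q).choose

theorem latticeMap_rootA (p q : Fin (n + 1)) :
    latticeMap (aA n) (rootA p q) = Pi.single p 1 - Pi.single q 1 :=
  (sub_mem_range_A p q).choose_spec

theorem form_rootA (p q r s : Fin (n + 1)) : form (A n) (rootA p q) (rootA r s) =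
    ((if p = r then 1 else 0) - if p = s then 1 else 0) -
      ((if q = r then 1 else 0) - if q = s then 1 else 0) := by
  rw [← dot_latticeMap (dot_aA n), latticeMap_rootA, latticeMap_rootA]
  simp only [sub_dotProduct, single_one_dotProduct, Pi.sub_apply, Pi.single_apply]

theorem form_single_rootA (i : Fin n) (r s : Fin (n + 1)) :
    form (A n) (Pi.single i 1) (rootA r s) =
    ((if i.castSucc = r then 1 else 0) - if i.castSucc = s then 1 else 0) -
      ((if i.succ = r then 1 else 0) - if i.succ = s then 1 else 0) := by
  rw [← dot_latticeMap (dot_aA n), latticeMap_single, latticeMap_rootA, aA]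
  simp only [sub_dotProduct, single_one_dotProduct, Pi.sub_apply, Pi.single_apply]

theorem height_rootA (p q : Fin (n + 1)) : height (rootA p q) = (q : ℤ) - p := by
  rw [height_A, latticeMap_rootA, dotProduct_sub, dotProduct_single_one, dotProduct_single_one]
  ring

theorem rootA_mem_posRoots {p q : Fin (n + 1)} (h : p < q) :
    rootA p q ∈ posRoots (A n) := by
  rw [mem_posRoots_iff (isSL_A n), form_rootA, height_rootA]
  have := Fin.lt_def.mp h
  have hne := h.ne
  simp only [hne, hne.symm, if_true, if_false]
  omega

theorem exists_rootA {β : Fin n → ℤ} (h : form (A n) β β = 2) :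
    ∃ p q, p ≠ q ∧ β = rootA p q := by
  obtain ⟨p, q, hpq, he⟩ := exists_sub_of_root_A h
  exact ⟨p, q, hpq, aA_injective n (by rw [he, latticeMap_rootA])⟩

theorem exists_rootA_of_pos {β : Fin n → ℤ} (h : β ∈ posRoots (A n)) :
    ∃ p q, p < q ∧ β = rootA p q := by
  rw [mem_posRoots_iff (isSL_A n)] at h
  obtain ⟨p, q, -, rfl⟩ := exists_rootA h.1
  rw [height_rootA] at h
  exact ⟨p, q, Fin.lt_def.mpr (by omega), rfl⟩

theorem disjoint_of_orth_A {p q r s : Fin (n + 1)} (hpq : p ≠ q) (hrs : r ≠ s)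
    (h : form (A n) (rootA p q) (rootA r s) = 0) :
    p ≠ r ∧ p ≠ s ∧ q ≠ r ∧ q ≠ s := by
  rw [form_rootA] at h
  grind

/-- An orthogonal set is a matching. -/
theorem IsOrthogonalSet.exists_matching_A {X : Set (Fin n → ℤ)}
    (hX : IsOrthogonalSet (A n) X) : ∃ p q : Fin X.ncard → Fin (n + 1),
      (∀ i, p i < q i) ∧ Function.Injective (Sum.elim p q) ∧
      X = Set.range fun i => rootA (p i) (q i) := by
  obtain ⟨b, hb, hr⟩ := exists_family ((posRoots_finite (isSL_A n)).subset hX.1) rfl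
  have hbX : ∀ i, b i ∈ X := fun i => hr ▸ ⟨i, rfl⟩
  choose p q hpq he using fun i => exists_rootA_of_pos (hX.1 (hbX i))
  have hd : ∀ i j, i ≠ j → p i ≠ p j ∧ p i ≠ q j ∧ q i ≠ p j ∧ q i ≠ q j := by
    intro i j hij
    refine disjoint_of_orth_A (hpq i).ne (hpq j).ne ?_
    rw [← he, ← he]
    exact hX.2 _ (hbX i) _ (hbX j) fun h => hij (hb h)
  refine ⟨p, q, hpq, ?_, ?_⟩
  · rintro (i | i) (j | j) h <;> by_cases hij : i = j
    · rw [hij]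
    · exact absurd h (hd i j hij).1
    · subst hij; exact absurd h (hpq i).ne
    · exact absurd h (hd i j hij).2.1
    · subst hij; exact absurd h (hpq i).ne'
    · exact absurd h (hd i j hij).2.2.1
    · rw [hij]
    · exact absurd h (hd i j hij).2.2.2
  · exact hr.symm.trans (congrArg Set.range (funext he))

/-- The closure condition is vacuous: members have disjoint supports, and a root supported on two
coordinates meets at most two of them. -/
theorem isAdmissible_A {X : Set (Fin n → ℤ)} (hX : IsOrthogonalSet (A n) X) :
    IsAdmissible (A n) X := by
  refine isAdmissible_of_exists_fourth (isSL_A n) hX ?_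
  intro β₁ m1 β₂ m2 β₃ m3 h12 h13 h23 α hα h1 h2 h3
  exfalso
  obtain ⟨a, b, -, rfl⟩ := exists_rootA hα
  have hd : ∀ β ∈ X, ∀ γ ∈ X, β ≠ γ →
      ∀ x, latticeMap (aA n) β x * latticeMap (aA n) γ x = 0 := by
    intro β hβ γ hγ hne x
    obtain ⟨p, q, hpq, rfl⟩ := exists_rootA_of_pos (hX.1 hβ)
    obtain ⟨r, s, hrs, rfl⟩ := exists_rootA_of_pos (hX.1 hγ)
    obtain ⟨d1, d2, d3, d4⟩ := disjoint_of_orth_A hpq.ne hrs.ne (hX.2 _ hβ _ hγ hne)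
    rw [latticeMap_rootA, latticeMap_rootA]
    simp only [Pi.sub_apply, Pi.single_apply]
    grind
  have ne : ∀ β, |form (A n) (rootA a b) β| = 1 →
      latticeMap (aA n) (rootA a b) ⬝ᵥ latticeMap (aA n) β ≠ 0 := by
    intro β h h0
    rw [dot_latticeMap (dot_aA n)] at h0
    rw [h0] at h
    simp at h
  refine not_three_disjoint (a := a) (b := b) (fun p ha hb => ?_) (hd _ m1 _ m2 h12)
    (hd _ m1 _ m3 h13) (hd _ m2 _ m3 h23) (ne _ h1) (ne _ h2) (ne _ h3)
  rw [latticeMap_rootA, Pi.sub_apply, Pi.single_eq_of_ne ha, Pi.single_eq_of_ne hb, sub_zero]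

theorem exists_weyl_rootA {κ : Type} {p q r s : κ → Fin (n + 1)}
    (h : Function.Injective (Sum.elim p q)) (h' : Function.Injective (Sum.elim r s)) :
    ∃ w ∈ weylGroup (A n), ∀ i, w (rootA (p i) (q i)) = rootA (r i) (s i) := by
  obtain ⟨σ, hσ⟩ := exists_perm_extending h h'
  obtain ⟨w, hw, hwσ⟩ := exists_weyl_A σ
  refine ⟨w, hw, fun i => aA_injective n ?_⟩
  have h1 := hσ (Sum.inl i)
  have h2 := hσ (Sum.inr i)
  simp only [Sum.elim_inl, Sum.elim_inr] at h1 h2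
  rw [hwσ, latticeMap_rootA, latticeMap_rootA, map_sub, permEnd_single, permEnd_single, h1, h2]

/-- The highest matching `{e_i - e_{i + n + 1 - t} | i < t}`. -/
def matchA (n t : ℕ) : Set (Fin n → ℤ) :=
  {β | ∃ p q : Fin (n + 1), (p : ℕ) < t ∧ (q : ℕ) = p + (n + 1 - t) ∧ β = rootA p q}

variable {t : ℕ}

theorem matchA_eq_range (ht : 2 * t ≤ n + 1) : matchA n t = Set.range fun i : Fin t =>
    rootA (⟨i, by omega⟩ : Fin (n + 1)) ⟨i + (n + 1 - t), by omega⟩ := by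
  ext β
  constructor
  · rintro ⟨p, q, hp, hq, rfl⟩
    exact ⟨⟨p, hp⟩, congrArg (rootA p) (Fin.ext hq.symm)⟩
  · rintro ⟨i, rfl⟩
    exact ⟨_, _, i.2, rfl, rfl⟩

theorem matchA_injective (ht : 2 * t ≤ n + 1) :
    Function.Injective (Sum.elim (fun i : Fin t => (⟨i, by omega⟩ : Fin (n + 1)))
      fun i : Fin t => ⟨i + (n + 1 - t), by omega⟩) := by
  rintro (i | i) (j | j) h <;> simp only [Sum.elim_inl, Sum.elim_inr, Fin.mk.injEq] at h
  · rw [Fin.ext h]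
  · omega
  · omega
  · rw [show i = j from Fin.ext (by omega)]

theorem rootA_injective {p q r s : Fin (n + 1)} (hpq : p ≠ q) (h : rootA p q = rootA r s) :
    p = r := by
  have h1 := congrArg (latticeMap (aA n)) h
  rw [latticeMap_rootA, latticeMap_rootA] at h1
  have h2 := congrFun h1 p
  simp only [Pi.sub_apply, Pi.single_apply, hpq, if_true, if_false] at h2
  by_contra hne
  rw [if_neg hne] at h2
  split_ifs at h2 <;> omega

theorem isOrthogonalSet_matchA (ht : 2 * t ≤ n + 1) :
    IsOrthogonalSet (A n) (matchA n t) := by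
  constructor
  · rintro _ ⟨p, q, hp, hq, rfl⟩
    exact rootA_mem_posRoots (Fin.lt_def.mpr (by omega))
  · rintro _ ⟨p, q, hp, hq, rfl⟩ _ ⟨r, s, hr, hs, rfl⟩ hne
    have hpr : p ≠ r := by
      rintro rfl
      exact hne (by rw [show q = s from Fin.ext (by omega)])
    have hpr' := Fin.val_ne_of_ne hpr
    rw [form_rootA]
    simp only [Fin.ext_iff]
    split_ifs <;> omega

theorem ncard_matchA (ht : 2 * t ≤ n + 1) : (matchA n t).ncard = t := by
  rw [matchA_eq_range ht, ← Set.image_univ, Set.ncard_image_of_injective, Set.ncard_univ,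
    Nat.card_eq_fintype_card, Fintype.card_fin]
  intro i j h
  have := rootA_injective (by simp only [Ne, Fin.mk.injEq]; omega) h
  exact Fin.ext (by simpa using this)

/-- The symmetric group acts transitively on matchings of a given size, and a matching with `t`
pairs uses `2t` of the `n + 1` coordinates. -/
theorem mem_orbit_matchA {X : Set (Fin n → ℤ)} (hX : IsOrthogonalSet (A n) X) :
    2 * X.ncard ≤ n + 1 ∧ X ∈ orbit (A n) (matchA n X.ncard) := by
  obtain ⟨p, q, hpq, hinj, he⟩ := hX.exists_matching_A
  have ht : 2 * X.ncard ≤ n + 1 := by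
    have := Fintype.card_le_of_injective _ hinj
    rw [Fintype.card_sum, Fintype.card_fin, Fintype.card_fin] at this
    omega
  refine ⟨ht, ?_⟩
  obtain ⟨w, hw, h⟩ := exists_weyl_rootA (matchA_injective ht) hinj
  refine ⟨w, hw, ?_⟩
  conv_lhs => rw [he]
  rw [matchA_eq_range ht]
  exact (act_range (isSL_A n) (fun k => rootA_mem_posRoots (hpq k)) fun k => Or.inl (h k)).symm

theorem perp_matchA {p q : Fin (n + 1)} (hpq : p ≠ q) (ht : 2 * t ≤ n + 1)
    (h : ∀ β ∈ matchA n t, form (A n) (rootA p q) β = 0) :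
    (t ≤ (p : ℕ) ∧ (p : ℕ) + t ≤ n) ∧ (t ≤ (q : ℕ) ∧ (q : ℕ) + t ≤ n) := by
  have key : ∀ r s : Fin (n + 1), (r : ℕ) < t → (s : ℕ) = r + (n + 1 - t) →
      p ≠ r ∧ p ≠ s ∧ q ≠ r ∧ q ≠ s := fun r s hr hs =>
    disjoint_of_orth_A hpq (fun hrs => by rw [hrs] at hs; omega) (h _ ⟨r, s, hr, hs, rfl⟩)
  have hp := p.2
  have hq := q.2
  refine ⟨⟨?_, ?_⟩, ?_, ?_⟩ <;> by_contra hlt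
  · exact (key p ⟨p + (n + 1 - t), by omega⟩ (by omega) rfl).1 rfl
  · exact (key ⟨p - (n + 1 - t), by omega⟩ p (by simp only; omega) (by simp only; omega)).2.1 rfl
  · exact (key q ⟨q + (n + 1 - t), by omega⟩ (by omega) rfl).2.2.1 rfl
  · exact (key ⟨q - (n + 1 - t), by omega⟩ q (by simp only; omega) (by simp only; omega)).2.2.2 rfl

theorem A_shift (t : ℕ) (k l : Fin (n - 2 * t)) : A n ⟨t + k, by omega⟩
    ⟨t + l, by omega⟩ = A (n - 2 * t) k l := by
  simp only [A, Matrix.of_apply, Fin.ext_iff]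
  split_ifs <;> omega

/-- Differences of coordinates lie in the span of the differences of consecutive coordinates. -/
theorem sub_mem_of_succ_sub_mem {m : Type} {N : ℕ} {S : Submodule ℤ (m → ℤ)} (e : Fin N → m → ℤ)
    {lo hi : ℕ} (h : ∀ (k : ℕ) (hk : k + 1 < N), lo ≤ k → k < hi →
      e ⟨k, by omega⟩ - e ⟨k + 1, hk⟩ ∈ S) {p q : Fin N} (hp : lo ≤ (p : ℕ) ∧ (p : ℕ) ≤ hi)
    (hq : lo ≤ (q : ℕ) ∧ (q : ℕ) ≤ hi) : e p - e q ∈ S := by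
  have hlo : lo < N := by omega
  have key : ∀ (k : ℕ) (hk : lo + k < N), lo + k ≤ hi → e ⟨lo, hlo⟩ - e ⟨lo + k, hk⟩ ∈ S := by
    intro k
    induction k with
    | zero => intro _ _; simp
    | succ k ih =>
      intro hk hk'
      have := add_mem (ih (by omega) (by omega)) (h (lo + k) hk (by omega) (by omega))
      rwa [sub_add_sub_cancel] at this
  have hp' := key (p - lo) (by omega) (by omega)
  have hq' := key (q - lo) (by omega) (by omega)
  have e1 : (⟨lo + (p - lo), by omega⟩ : Fin N) = p := Fin.ext (by simp only; omega)
  have e2 : (⟨lo + (q - lo), by omega⟩ : Fin N) = q := Fin.ext (by simp only; omega)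
  rw [e1] at hp'
  rw [e2] at hq'
  have := sub_mem hq' hp'
  rwa [sub_sub_sub_cancel_left] at this

theorem hasCartanType_matchA (ht : 2 * t ≤ n + 1) : HasCartanType (A n)
    (perpRoots (A n) (matchA n t)) (A (n - 2 * t)) := by
  refine hasCartanType_of_ambient (isSL_A n) (dot_aA n) (aA_injective n) (isSL_A _)
    (fun k => aA n ⟨t + k, by omega⟩) (fun k l => ?_) (fun k => aA_mem_range _) ?_ ?_
  · rw [dot_aA, A_shift]
  · rintro k _ ⟨p, q, hp, hq, rfl⟩
    rw [← latticeMap_single (aA n), dot_latticeMap (dot_aA n), form_single_rootA]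
    simp only [Fin.ext_iff, Fin.val_castSucc, Fin.val_succ]
    split_ifs <;> omega
  · intro δ hδ hperp
    obtain ⟨p, q, hpq, rfl⟩ := exists_rootA hδ
    obtain ⟨hp, hq⟩ := perp_matchA hpq ht hperp
    rw [latticeMap_rootA]
    refine sub_mem_of_succ_sub_mem (fun p : Fin (n + 1) => (Pi.single p 1 : Fin (n + 1) → ℤ))
      (lo := t) (hi := n - t) (fun k hk h1 h2 => ?_) (by omega) (by omega)
    refine Submodule.subset_span ⟨⟨k - t, by omega⟩, ?_⟩
    change (Pi.single (Fin.castSucc _) 1 - Pi.single (Fin.succ _) 1 : Fin (n + 1) → ℤ) = _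
    congr 3 <;> simp only [Fin.ext_iff, Fin.val_castSucc, Fin.val_succ] <;> omega

theorem nodesHaveType_matchA (ht : 1 ≤ t) (ht' : 2 * t ≤ n + 1) : NodesHaveType (A n)
    {i | ∀ β ∈ matchA n t, form (A n) (Pi.single i 1) β = 0}
    (A (n - 2 * t)) := by
  refine NodesHaveType.of_injective (fun k : Fin (n - 2 * t) => (⟨t + k, by omega⟩ : Fin n))
    (fun k l h => Fin.ext (by simp only [Fin.mk.injEq] at h; omega)) ?_ (A_shift t)
  ext i
  constructor
  · rintro ⟨k, rfl⟩ _ ⟨p, q, hp, hq, rfl⟩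
    rw [form_single_rootA]
    simp only [Fin.ext_iff, Fin.val_castSucc, Fin.val_succ]
    split_ifs <;> omega
  · intro h
    have h1 : (Pi.single i 1 : Fin n → ℤ) = rootA i.castSucc i.succ :=
      aA_injective n (by rw [latticeMap_single, latticeMap_rootA, aA])
    rw [Set.mem_ofPred_eq, h1] at h
    obtain ⟨hp, hq⟩ := perp_matchA (by simp [Fin.ext_iff]) ht' h
    simp only [Fin.val_castSucc, Fin.val_succ] at hp hq
    exact ⟨⟨i - t, by omega⟩, Fin.ext (by simp only; omega)⟩

theorem quotient_matchA (ht : 2 * t ≤ n + 1) :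
    Nonempty (QuotientNC (A n) (matchA n t) ≃* Equiv.Perm (Fin t)) := by
  rw [matchA_eq_range ht]
  refine quotientNC_of_perm (isSL_A n) (fun i j h => ?_)
    (fun k => rootA_mem_posRoots (Fin.lt_def.mpr (by simp only; omega))) (MonoidHom.id _)
    Function.injective_id (fun w _ π _ => ⟨π, rfl⟩) fun σ => ?_
  · have := rootA_injective (by simp only [Ne, Fin.mk.injEq]; omega) h
    exact Fin.ext (by simpa using this)
  · have hinj := matchA_injective ht
    obtain ⟨w, hw, h⟩ := exists_weyl_rootA hinj
      (r := fun i => (⟨σ i, by omega⟩ : Fin (n + 1)))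
      (s := fun i => ⟨σ i + (n + 1 - t), by omega⟩) (by
        convert hinj.comp (Equiv.sumCongr σ σ).injective using 1
        ext (i | i) <;> rfl)
    exact ⟨w, hw, fun k => Or.inl (h k)⟩

theorem isTableLine_matchA (ht : 1 ≤ t) (ht' : 2 * t ≤ n + 1) :
    IsTableLine (A n) (orbit (A n) (matchA n t)) t
      (A (n - 2 * t)) (A (n - 2 * t)) (Equiv.Perm (Fin t)) := by
  have hO := isOrthogonalSet_matchA ht'
  -- Every member of `matchA n t` has height `n + 1 - t`; conversely `matching_shift` identifies any
  -- matching with all heights at least this.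
  refine isTableLine_of_rep (isSL_A n) hO (ncard_matchA ht') ((n + 1 - t : ℕ) : ℤ) ?_ ?_
    (hasCartanType_matchA ht') (nodesHaveType_matchA ht ht') (quotient_matchA ht')
  · rintro _ ⟨p, q, hp, hq, rfl⟩
    rw [height_rootA]
    omega
  · intro X hX hne
    by_contra hlow
    push Not at hlow
    have hXO : IsOrthogonalSet (A n) X :=
      (isAdmissible_of_mem_orbit (isSL_A n) (isAdmissible_A hO) hX).1
    have hcard : X.ncard = t := by
      obtain ⟨w, hw, rfl⟩ := hX
      rw [ncard_act (isSL_A n) (weylGroup_le_isometries (isSL_A n) hw) hO.1, ncard_matchA ht']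
    obtain ⟨p, q, hpq, hinj, he⟩ := hXO.exists_matching_A
    apply hne
    refine Set.eq_of_subset_of_ncard_le ?_ (by rw [ncard_matchA ht', hcard])
      ((posRoots_finite (isSL_A n)).subset hO.1)
    rw [he]
    rintro _ ⟨i, rfl⟩
    have hs := matching_shift (by omega) p q (hinj.comp Sum.inl_injective)
      (hinj.comp Sum.inr_injective) (fun i => by
        have := hlow (rootA (p i) (q i)) (he ▸ ⟨i, rfl⟩)
        rw [height_rootA] at this
        rw [hcard]
        omega) i
    rw [hcard] at hs
    exact ⟨_, _, hs.2, hs.1, rfl⟩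

theorem nonemptyAdmissibleOrbits_A (n : ℕ) : nonemptyAdmissibleOrbits (A n) =
    {S | ∃ t, 1 ≤ t ∧ 2 * t ≤ n + 1 ∧ S = orbit (A n) (matchA n t)} := by
  ext S
  constructor
  · rintro ⟨X, hX, hne, rfl⟩
    obtain ⟨h1, h2⟩ := mem_orbit_matchA hX.1
    refine ⟨X.ncard, ?_, h1, ?_⟩
    · exact (Set.ncard_pos ((posRoots_finite (isSL_A n)).subset hX.1.1)).mpr hne
    · exact orbit_eq_of_mem (isSL_A n) (isOrthogonalSet_matchA h1).1 h2
  · rintro ⟨t, ht, ht', rfl⟩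
    exact ⟨matchA n t, isAdmissible_A (isOrthogonalSet_matchA ht'),
      nonempty_of_one_le_ncard (ncard_matchA ht') ht, rfl⟩

end OrbitsA

/-! ### Roots in type D and their images under the Weyl group -/

section RootsD

variable {n : ℕ}

theorem unit_cases (ε : ℤˣ) : (ε : ℤ) = 1 ∨ (ε : ℤ) = -1 := by
  rcases Int.units_eq_one_or ε with rfl | rfl
  · exact Or.inl rfl
  · exact Or.inr rfl

theorem unit_mul_self (ε : ℤˣ) : (ε : ℤ) * ε = 1 := by
  rcases unit_cases ε with h | h <;> rw [h] <;> rfl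

/-- The vector `e_p + ε e_q`. -/
def vecD (p q : Fin n) (ε : ℤˣ) : Fin n → ℤ := Pi.single p 1 + Pi.single q (ε : ℤ)

/-- The root `e_p + ε e_q`. -/
noncomputable def rootD (p q : Fin n) (ε : ℤˣ) : Fin n → ℤ :=
  Function.invFun (latticeMap (aD n)) (vecD p q ε)

theorem latticeMap_rootD (hn : 2 ≤ n) (p q : Fin n) (ε : ℤˣ) :
    latticeMap (aD n) (rootD p q ε) = vecD p q ε := by
  obtain ⟨x, hx⟩ := unit_mem_range_D hn p q 1 ε
  exact Function.invFun_eq ⟨x, hx⟩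

theorem form_rootD (hn : 2 ≤ n) (p q r s : Fin n) (ε η : ℤˣ) :
    form (D n) (rootD p q ε) (rootD r s η) =
      ((if p = r then 1 else 0) + if p = s then (η : ℤ) else 0) +
        ε * ((if q = r then 1 else 0) + if q = s then (η : ℤ) else 0) := by
  rw [← dot_latticeMap (dot_aD hn), latticeMap_rootD hn, latticeMap_rootD hn]
  simp only [vecD, add_dotProduct, single_dotProduct, Pi.add_apply, Pi.single_apply, one_mul]

theorem height_rootD (hn : 2 ≤ n) (p q : Fin n) (ε : ℤˣ) :
    height (rootD p q ε) = ((n : ℤ) - 1 - p) + ε * ((n : ℤ) - 1 - q) := by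
  rw [height_D hn, latticeMap_rootD hn, vecD, dotProduct_add, dotProduct_single_one,
    dotProduct_single]
  ring

theorem rootD_mem_posRoots (hn : 2 ≤ n) {p q : Fin n} (h : p < q) (ε : ℤˣ) :
    rootD p q ε ∈ posRoots (D n) := by
  rw [mem_posRoots_iff (isSL_D hn), form_rootD hn, height_rootD hn]
  have := Fin.lt_def.mp h
  have hne := h.ne
  have hq := q.2
  simp only [hne, hne.symm, if_true, if_false]
  refine ⟨by rw [zero_add, unit_mul_self]; rfl, ?_⟩
  rcases unit_cases ε with h | h <;> rw [h] <;> omega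

theorem exists_rootD (hn : 2 ≤ n) {β : Fin n → ℤ} (h : form (D n) β β = 2) :
    ∃ p q, p < q ∧ ∃ ε, β = rootD p q ε ∨ β = -rootD p q ε := by
  have key : ∀ (p q : Fin n) (δ ε : ℤˣ), p < q →
      latticeMap (aD n) β = Pi.single p (δ : ℤ) + Pi.single q (ε : ℤ) →
      ∃ p q, p < q ∧ ∃ ε, β = rootD p q ε ∨ β = -rootD p q ε := by
    intro p q δ ε hpq he
    refine ⟨p, q, hpq, δ * ε, ?_⟩
    rcases Int.units_eq_one_or δ with rfl | rfl
    · left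
      apply aD_injective hn
      rw [he, latticeMap_rootD hn, vecD, one_mul]; rfl
    · right
      apply aD_injective hn
      rw [he, map_neg, latticeMap_rootD hn, vecD, neg_one_mul]
      simp only [Units.val_neg, Units.val_one, Pi.single_neg]
      abel
  obtain ⟨p, q, hpq, δ, ε, he⟩ := exists_root_D hn h
  rcases lt_or_gt_of_ne hpq with hlt | hlt
  · exact key p q δ ε hlt he
  · exact key q p ε δ hlt (by rw [he, add_comm])

theorem exists_rootD_of_pos (hn : 2 ≤ n) {β : Fin n → ℤ} (h : β ∈ posRoots (D n)) :
    ∃ p q, p < q ∧ ∃ ε, β = rootD p q ε := by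
  obtain ⟨p, q, hpq, ε, rfl | rfl⟩ := exists_rootD hn (norm_of_mem_posRoots (isSL_D hn) h)
  · exact ⟨p, q, hpq, ε, rfl⟩
  · exact absurd h (neg_notMem_posRoots (isSL_D hn) (rootD_mem_posRoots hn hpq ε))

theorem rootD_inj (hn : 2 ≤ n) {p q r s : Fin n} (hpq : p < q) (hrs : r < s) {ε η : ℤˣ}
    (h : rootD p q ε = rootD r s η) : p = r ∧ q = s ∧ ε = η := by
  have h1 := form_rootD hn p q r s ε η
  rw [h] at h1
  rw [← h, norm_of_mem_posRoots (isSL_D hn) (rootD_mem_posRoots hn hpq ε)] at h1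
  rcases Int.units_eq_one_or ε with rfl | rfl <;> rcases Int.units_eq_one_or η with rfl | rfl <;>
    simp only [Units.val_one, Units.val_neg] at h1 <;> grind

/-- Orthogonal roots have disjoint supports, or the same support and opposite signs. -/
theorem disjoint_of_orth_D (hn : 2 ≤ n) {p q r s : Fin n} (hpq : p < q) (hrs : r < s) {ε η : ℤˣ}
    (h : form (D n) (rootD p q ε) (rootD r s η) = 0) :
    (p ≠ r ∧ p ≠ s ∧ q ≠ r ∧ q ≠ s) ∨ (p = r ∧ q = s ∧ η = -ε) := by
  rw [form_rootD hn] at h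
  rcases Int.units_eq_one_or ε with rfl | rfl <;> rcases Int.units_eq_one_or η with rfl | rfl <;>
    simp only [Units.val_one, Units.val_neg, neg_neg] at h ⊢ <;> grind

theorem form_disjoint_D (hn : 2 ≤ n) {p q r s : Fin n} {ε η : ℤˣ}
    (h : p ≠ r ∧ p ≠ s ∧ q ≠ r ∧ q ≠ s) :
    form (D n) (rootD p q ε) (rootD r s η) = 0 := by
  rw [form_rootD hn, if_neg h.1, if_neg h.2.1, if_neg h.2.2.1, if_neg h.2.2.2]
  ring

theorem form_opposite_D (hn : 2 ≤ n) {p q : Fin n} (hpq : p ≠ q) {ε η : ℤˣ} (h : η = -ε) :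
    form (D n) (rootD p q ε) (rootD p q η) = 0 := by
  rw [form_rootD hn, h]
  simp only [hpq, hpq.symm, if_true, if_false, Units.val_neg]
  linarith [unit_mul_self ε]

theorem toEnd_vecD (g : SignedPerm (Fin n)) (p q : Fin n) (ε : ℤˣ) :
    SignedPerm.toEnd g (vecD p q ε) =
      Pi.single (g.right p) ((g.left (g.right p) : ℤ)) +
        Pi.single (g.right q) ((g.left (g.right q) : ℤ) * ε) := by
  rw [vecD, map_add, SignedPerm.toEnd_single, SignedPerm.toEnd_single, mul_one]

theorem prod_extend {κ m : Type} [Fintype κ] [Fintype m] [DecidableEq m] {f : κ → m}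
    (hf : Function.Injective f) (ℓ : κ → ℤˣ) : ∏ x, Function.extend f ℓ 1 x = ∏ k, ℓ k := by
  classical
  rw [← Finset.prod_subset (Finset.subset_univ (Finset.univ.image f)),
    Finset.prod_image fun a _ b _ h => hf h]
  · exact Finset.prod_congr rfl fun k _ => hf.extend_apply _ _ _
  · intro x _ hx
    rw [Function.extend_apply' _ _ _ fun ⟨k, hk⟩ => hx (by simp [← hk])]
    rfl

/-- An injective family of coordinates can be moved to another one with prescribed signs, if there
is a spare coordinate or the number of sign changes is even. -/
theorem exists_weyl_coord (hn : 2 ≤ n) {κ : Type} [Fintype κ] {f f' : κ → Fin n}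
    (hf : Function.Injective f) (hf' : Function.Injective f') (ℓ : κ → ℤˣ)
    (h : ∏ k, ℓ k = 1 ∨ Fintype.card κ < n) : ∃ w ∈ weylGroup (D n),
      ∃ g : SignedPerm (Fin n), ActsAs (aD n) SignedPerm.toEnd w g ∧
        ∀ k z, SignedPerm.toEnd g (Pi.single (f k) z) = Pi.single (f' k) (ℓ k * z) := by
  obtain ⟨σ, hσ⟩ := exists_perm_extending hf hf'
  suffices hL : ∃ L : Fin n → ℤˣ, ∏ x, L x = 1 ∧ ∀ k, L (f' k) = ℓ k by
    obtain ⟨L, hL, hL'⟩ := hL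
    obtain ⟨w, hw, hg⟩ := exists_weyl_D hn ⟨L, σ⟩ hL
    refine ⟨w, hw, _, hg, fun k z => ?_⟩
    rw [SignedPerm.toEnd_single]
    simp only [hσ, hL']
  rcases h with h | h
  · exact ⟨_, (prod_extend hf' ℓ).trans h, fun k => hf'.extend_apply _ _ _⟩
  · obtain ⟨x₀, hx₀⟩ : ∃ x₀, ∀ k, f' k ≠ x₀ := by
      by_contra hall
      push Not at hall
      have := Fintype.card_le_of_surjective f' hall
      rw [Fintype.card_fin] at this
      omega
    -- The sign of a spare coordinate is chosen to make the total number of sign changes even.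
    refine ⟨Pi.mulSingle x₀ (∏ k, ℓ k) * Function.extend f' ℓ 1, ?_, fun k => ?_⟩
    · simp only [Pi.mul_apply, Finset.prod_mul_distrib, prod_extend hf', Finset.prod_pi_mulSingle',
        Finset.mem_univ, if_true, Int.units_mul_self]
    · rw [Pi.mul_apply, Pi.mulSingle_eq_of_ne (hx₀ k), one_mul, hf'.extend_apply]

theorem exists_weyl_rootD (hn : 2 ≤ n) {t : ℕ} {p q r s : Fin t → Fin n} (ε η : Fin t → ℤˣ)
    (hf : Function.Injective (Sum.elim p q)) (hf' : Function.Injective (Sum.elim r s))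
    (h : ∏ k, ε k = ∏ k, η k ∨ 2 * t < n) : ∃ w ∈ weylGroup (D n),
      ∀ k, w (rootD (p k) (q k) (ε k)) = rootD (r k) (s k) (η k) := by
  obtain ⟨w, hw, g, hg, h'⟩ := exists_weyl_coord hn hf hf'
    -- Only second coordinates change sign, exactly where the old sign and the new one differ.
    (Sum.elim (fun _ => 1) fun k => η k * ε k) (by
      rw [Fintype.prod_sum_type, Fintype.card_sum, Fintype.card_fin]
      simp only [Sum.elim_inl, Sum.elim_inr, Finset.prod_const_one, one_mul,
        Finset.prod_mul_distrib]
      rcases h with h | h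
      · left; rw [h, Int.units_mul_self]
      · right; omega)
  refine ⟨w, hw, fun k => aD_injective hn ?_⟩
  have h1 := h' (Sum.inl k) 1
  have h2 := h' (Sum.inr k) (ε k)
  simp only [Sum.elim_inl, Sum.elim_inr] at h1 h2
  rw [hg, latticeMap_rootD hn, latticeMap_rootD hn, vecD, vecD, map_add, h1, h2]
  congr 2
  rw [Units.val_mul, mul_assoc, unit_mul_self, mul_one]

/-- The action of `W` on roots in coordinates. -/
theorem exists_image_rootD (hn : 2 ≤ n) {w : LatticeAut (Fin n)}
    (hw : w ∈ weylGroup (D n)) : ∃ g : SignedPerm (Fin n), ∏ i, g.left i = 1 ∧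
      ∀ p q ε, p ≠ q → min (g.right p) (g.right q) < max (g.right p) (g.right q) ∧
        (w (rootD p q ε) = rootD (min (g.right p) (g.right q)) (max (g.right p) (g.right q))
          (g.left (g.right p) * g.left (g.right q) * ε) ∨
        w (rootD p q ε) = -rootD (min (g.right p) (g.right q)) (max (g.right p) (g.right q))
          (g.left (g.right p) * g.left (g.right q) * ε)) := by
  obtain ⟨g, hg1, hg⟩ := exists_signedPerm_D hn hw
  refine ⟨g, hg1, fun p q ε hpq => ?_⟩
  have hne : g.right p ≠ g.right q := fun h => hpq (g.right.injective h)
  refine ⟨min_lt_max.mpr hne, ?_⟩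
  have e1 : latticeMap (aD n) (w (rootD p q ε)) = _ :=
    (hg _).trans ((congrArg _ (latticeMap_rootD hn p q ε)).trans (toEnd_vecD g p q ε))
  have e2 : ∀ (x y : ℤˣ) (a b : Fin n), (Pi.single a (x : ℤ) + Pi.single b ((y : ℤ) * ε) =
      vecD a b (x * y * ε) ∨ Pi.single a (x : ℤ) + Pi.single b ((y : ℤ) * ε) =
      -vecD a b (x * y * ε)) ∧ (Pi.single a (x : ℤ) + Pi.single b ((y : ℤ) * ε) =
      vecD b a (x * y * ε) ∨ Pi.single a (x : ℤ) + Pi.single b ((y : ℤ) * ε) =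
      -vecD b a (x * y * ε)) := by
    intro x y a b
    rcases Int.units_eq_one_or x with rfl | rfl <;> rcases Int.units_eq_one_or y with rfl | rfl <;>
      rcases Int.units_eq_one_or ε with rfl | rfl <;>
      simp [vecD, Pi.single_neg, add_comm]
  have e3 := e2 (g.left (g.right p)) (g.left (g.right q)) (g.right p) (g.right q)
  rw [← e1] at e3
  rcases lt_or_gt_of_ne hne with h | h
  · rw [min_eq_left h.le, max_eq_right h.le]
    exact e3.1.imp (fun h => aD_injective hn (h.trans (latticeMap_rootD hn _ _ _).symm))
      fun h => aD_injective hn (h.trans (by rw [map_neg, latticeMap_rootD hn]))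
  · rw [min_eq_right h.le, max_eq_left h.le]
    exact e3.2.imp (fun h => aD_injective hn (h.trans (latticeMap_rootD hn _ _ _).symm))
      fun h => aD_injective hn (h.trans (by rw [map_neg, latticeMap_rootD hn]))

/-- The image of a matching under `W`.  If the pairs exhaust the coordinates, the number of sign
changes is even. -/
theorem exists_image_matching_D (hn : 2 ≤ n) {t : ℕ} {p q : Fin t → Fin n}
    (hf : Function.Injective (Sum.elim p q)) {w : LatticeAut (Fin n)}
    (hw : w ∈ weylGroup (D n)) : ∃ r s : Fin t → Fin n, ∃ θ : Fin t → ℤˣ,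
      (∀ k, r k < s k) ∧ Function.Injective (Sum.elim r s) ∧ (2 * t = n → ∏ k, θ k = 1) ∧
      ∀ k ε, w (rootD (p k) (q k) ε) = rootD (r k) (s k) (θ k * ε) ∨
        w (rootD (p k) (q k) ε) = -rootD (r k) (s k) (θ k * ε) := by
  obtain ⟨g, hg, h⟩ := exists_image_rootD hn hw
  have hpq : ∀ i j, p i ≠ q j := fun i j h => by
    have := @hf (Sum.inl i) (Sum.inr j) h
    simp at this
  have hp : Function.Injective p := hf.comp Sum.inl_injective
  have hq : Function.Injective q := hf.comp Sum.inr_injective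
  have hσ := g.right.injective
  refine ⟨_, _, fun k => g.left (g.right (p k)) * g.left (g.right (q k)),
    fun k => (h (p k) (q k) 1 (hpq k k)).1, ?_, fun ht => ?_, fun k ε => (h _ _ ε (hpq k k)).2⟩
  · have key : ∀ i j, i ≠ j → ∀ x y, (x = g.right (p i) ∨ x = g.right (q i)) →
        (y = g.right (p j) ∨ y = g.right (q j)) → x ≠ y := by
      rintro i j hij x y (rfl | rfl) (rfl | rfl) h
      · exact hij (hp (hσ h))
      · exact hpq _ _ (hσ h)
      · exact hpq _ _ (hσ h).symm
      · exact hij (hq (hσ h))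
    rintro (i | i) (j | j) hij <;> by_cases hne : i = j
    · rw [hne]
    · exact absurd hij (key i j hne _ _ (min_choice _ _) (min_choice _ _))
    · subst hne; exact absurd hij (h (p i) (q i) 1 (hpq i i)).1.ne
    · exact absurd hij (key i j hne _ _ (min_choice _ _) (max_choice _ _))
    · subst hne; exact absurd hij (h (p i) (q i) 1 (hpq i i)).1.ne'
    · exact absurd hij (key i j hne _ _ (max_choice _ _) (min_choice _ _))
    · rw [hne]
    · exact absurd hij (key i j hne _ _ (max_choice _ _) (max_choice _ _))
  -- If the pairs exhaust the coordinates, the product of the sign changes over all pairs is the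
  -- product over all coordinates, which is 1 in `W`.
  · have hb : Function.Bijective (Sum.elim p q) := by
      rw [Fintype.bijective_iff_injective_and_card]
      refine ⟨hf, ?_⟩
      rw [Fintype.card_sum, Fintype.card_fin, Fintype.card_fin]
      omega
    rw [Finset.prod_mul_distrib]
    have h2 := Fintype.prod_sum_type fun k => g.left (g.right (Sum.elim p q k))
    simp only [Sum.elim_inl, Sum.elim_inr] at h2
    rw [← h2, hb.prod_comp fun x => g.left (g.right x), Equiv.prod_comp g.right]
    exact hg

end RootsD

/-! ### Admissible sets in type D -/

section AdmissibleD

variable {n : ℕ}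

/-- A set containing a pair `e_p ± e_q` contains such a pair for each of its elements. -/
theorem IsAdmissible.neg_mem_D (hn : 2 ≤ n) {X : Set (Fin n → ℤ)}
    (hX : IsAdmissible (D n) X) {p q : Fin n} (hpq : p < q)
    (hd : ∀ ε, rootD p q ε ∈ X) {r s : Fin n} (hrs : r < s) {η : ℤˣ} (h : rootD r s η ∈ X) :
    rootD r s (-η) ∈ X := by
  have hC := isSL_D hn
  by_cases hsame : p = r ∧ q = s
  · rw [← hsame.1, ← hsame.2]; exact hd _
  have hdis : p ≠ r ∧ p ≠ s ∧ q ≠ r ∧ q ≠ s := by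
    by_cases hne : rootD p q 1 = rootD r s η
    · have := rootD_inj hn hpq hrs hne
      exact absurd ⟨this.1, this.2.1⟩ hsame
    · rcases disjoint_of_orth_D hn hpq hrs (hX.1.2 _ (hd 1) _ h hne) with h' | h'
      · exact h'
      · exact absurd ⟨h'.1, h'.2.1⟩ hsame
  -- The test root `e_p - e_r` meets `e_p + e_q`, `e_p - e_q` and `e_r + η e_s`. A fourth member
  -- meeting it cannot involve `p`, so it involves `r` and must be `e_r - η e_s`.
  have hα : form (D n) (rootD p r (-1)) (rootD p r (-1)) = 2 := by
    rw [form_rootD hn]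
    simp [hdis.1, hdis.1.symm]
  have hα' : ∀ u v θ, form (D n) (rootD p r (-1)) (rootD u v θ) =
      ((if p = u then 1 else 0) + if p = v then (θ : ℤ) else 0) -
        ((if r = u then 1 else 0) + if r = v then (θ : ℤ) else 0) := fun u v θ => by
    rw [form_rootD hn, Units.val_neg, Units.val_one, neg_one_mul, sub_eq_add_neg]
  have f1 : ∀ ε, |form (D n) (rootD p r (-1)) (rootD p q ε)| = 1 := fun ε => by
    rw [hα']
    simp [hpq.ne, hdis.1.symm, hdis.2.2.1.symm]
  have f2 : |form (D n) (rootD p r (-1)) (rootD r s η)| = 1 := by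
    rw [hα']
    simp [hrs.ne, hdis.1, hdis.2.1]
  have ne1 : rootD p q 1 ≠ rootD p q (-1) := fun h => by
    have := (rootD_inj hn hpq hpq h).2.2
    exact absurd this (by decide)
  have ne2 : ∀ ε, rootD p q ε ≠ rootD r s η := fun ε h =>
    hdis.1 (rootD_inj hn hpq hrs h).1
  obtain ⟨β, hβ, n1, n2, n3, h4⟩ := hX.exists_fourth hC (hd 1) (hd (-1)) h ne1 (ne2 1) (ne2 (-1))
    hα (f1 1) (f1 (-1)) f2
  obtain ⟨u, v, huv, θ, rfl⟩ := exists_rootD_of_pos hn (hX.1.1 hβ)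
  have d1 : p ≠ u ∧ p ≠ v := by
    rcases disjoint_of_orth_D hn hpq huv (hX.1.2 _ (hd 1) _ hβ n1.symm) with h' | h'
    · exact ⟨h'.1, h'.2.1⟩
    · obtain ⟨rfl, rfl, rfl⟩ := h'
      exact absurd rfl n2
  have d2 : r = u ∨ r = v := by
    by_contra hne
    push Not at hne
    rw [hα', if_neg d1.1, if_neg d1.2, if_neg hne.1, if_neg hne.2] at h4
    simp at h4
  rcases disjoint_of_orth_D hn hrs huv (hX.1.2 _ h _ hβ n3.symm) with h' | h'
  · rcases d2 with rfl | rfl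
    · exact absurd rfl h'.1
    · exact absurd rfl h'.2.1
  · obtain ⟨rfl, rfl, rfl⟩ := h'
    exact hβ

/-- The pairs of coordinates supporting an orthogonal set without pairs `e_p ± e_q`. -/
theorem IsOrthogonalSet.exists_matching_D (hn : 2 ≤ n) {X : Set (Fin n → ℤ)}
    (hX : IsOrthogonalSet (D n) X)
    (hd : ∀ p q ε, p < q → rootD p q ε ∈ X → rootD p q (-ε) ∉ X) :
    ∃ p q : Fin X.ncard → Fin n, ∃ ε : Fin X.ncard → ℤˣ,
      (∀ i, p i < q i) ∧ Function.Injective (Sum.elim p q) ∧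
      X = Set.range fun i => rootD (p i) (q i) (ε i) := by
  obtain ⟨b, hb, hr⟩ := exists_family ((posRoots_finite (isSL_D hn)).subset hX.1) rfl
  have hbX : ∀ i, b i ∈ X := fun i => hr ▸ ⟨i, rfl⟩
  choose p q hpq ε he using fun i => exists_rootD_of_pos hn (hX.1 (hbX i))
  have hdis : ∀ i j, i ≠ j → p i ≠ p j ∧ p i ≠ q j ∧ q i ≠ p j ∧ q i ≠ q j := by
    intro i j hij
    have h0 := hX.2 _ (hbX i) _ (hbX j) fun h => hij (hb h)
    rw [he, he] at h0
    rcases disjoint_of_orth_D hn (hpq i) (hpq j) h0 with h | h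
    · exact h
    · exfalso
      have h1 := hbX i
      have h2 := hbX j
      rw [he] at h1 h2
      rw [← h.1, ← h.2.1, h.2.2] at h2
      exact hd _ _ _ (hpq i) h1 h2
  refine ⟨p, q, ε, hpq, ?_, ?_⟩
  · rintro (i | i) (j | j) h <;> by_cases hij : i = j
    · rw [hij]
    · exact absurd h (hdis i j hij).1
    · subst hij; exact absurd h (hpq i).ne
    · exact absurd h (hdis i j hij).2.1
    · subst hij; exact absurd h (hpq i).ne'
    · exact absurd h (hdis i j hij).2.2.1
    · rw [hij]
    · exact absurd h (hdis i j hij).2.2.2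
  · exact hr.symm.trans (congrArg Set.range (funext he))

/-- One pair `e_p ± e_q` in the set forces every member to occur with both signs, so the set is a
matching of coordinates with both signs attached. -/
theorem IsAdmissible.exists_doubles (hn : 2 ≤ n) {X : Set (Fin n → ℤ)}
    (hX : IsAdmissible (D n) X) {p q : Fin n} (hpq : p < q) {ε : ℤˣ}
    (h1 : rootD p q ε ∈ X) (h2 : rootD p q (-ε) ∈ X) :
    ∃ t : ℕ, 1 ≤ t ∧ ∃ p q : Fin t → Fin n, (∀ i, p i < q i) ∧ Function.Injective (Sum.elim p q) ∧
      X = Set.range fun k : Fin t × ℤˣ => rootD (p k.1) (q k.1) k.2 := by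
  have hd : ∀ ε, rootD p q ε ∈ X := by
    intro δ
    rcases Int.units_eq_one_or (δ * ε) with h | h
    · rw [mul_eq_one_iff_eq_inv, Int.units_inv_eq_self] at h
      rwa [h]
    · have : δ = -ε := by
        rw [← mul_one δ, ← Int.units_mul_self ε, ← mul_assoc, h, neg_one_mul]
      rwa [this]
  -- Keeping only the members `e_p + e_q` gives one root for each pair of coordinates, so the
  -- description of matchings applies to `Y`.
  set Y := {β | β ∈ X ∧ ∃ p q, p < q ∧ β = rootD p q 1} with hY
  have hYO : IsOrthogonalSet (D n) Y :=
    ⟨fun β hβ => hX.1.1 hβ.1, fun β hβ γ hγ hne => hX.1.2 β hβ.1 γ hγ.1 hne⟩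
  have hYone : ∀ p q ε, p < q → rootD p q ε ∈ Y → ε = 1 := by
    rintro p q ε hpq ⟨-, r, s, hrs, h⟩
    exact (rootD_inj hn hpq hrs h).2.2
  obtain ⟨a, b, e, hab, hinj, he⟩ := hYO.exists_matching_D hn fun p q ε hpq h h' => by
    have k1 := hYone _ _ _ hpq h
    have k2 := hYone _ _ _ hpq h'
    rw [k1] at k2
    exact absurd k2 (by decide)
  have hmem : ∀ i, rootD (a i) (b i) (e i) ∈ Y := fun i => by
    have : rootD (a i) (b i) (e i) ∈ Set.range fun i => rootD (a i) (b i) (e i) := ⟨i, rfl⟩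
    rwa [← he] at this
  have he1 : ∀ i, e i = 1 := fun i => hYone _ _ _ (hab i) (hmem i)
  refine ⟨Y.ncard, ?_, a, b, hab, hinj, ?_⟩
  · exact (Set.ncard_pos ((posRoots_finite (isSL_D hn)).subset hYO.1)).mpr
      ⟨_, hd 1, p, q, hpq, rfl⟩
  · ext β
    constructor
    · intro hβ
      obtain ⟨r, s, hrs, η, rfl⟩ := exists_rootD_of_pos hn (hX.1.1 hβ)
      have h1 : rootD r s 1 ∈ Y := by
        refine ⟨?_, r, s, hrs, rfl⟩
        rcases Int.units_eq_one_or η with rfl | rfl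
        · exact hβ
        · have := hX.neg_mem_D hn hpq hd hrs hβ
          rwa [neg_neg] at this
      rw [he] at h1
      obtain ⟨i, hi⟩ := h1
      obtain ⟨k1, k2, -⟩ := rootD_inj hn (hab i) hrs hi
      exact ⟨(i, η), by simp only [k1, k2]⟩
    · rintro ⟨⟨i, δ⟩, rfl⟩
      have h1 := (hmem i).1
      rw [he1] at h1
      rcases Int.units_eq_one_or δ with rfl | rfl
      · exact h1
      · exact hX.neg_mem_D hn hpq hd (hab i) h1

/-- A set of roots with disjoint supports is admissible. -/
theorem isAdmissible_of_disjoint (hn : 2 ≤ n) {X : Set (Fin n → ℤ)}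
    (hX : IsOrthogonalSet (D n) X)
    (hd : ∀ p q ε, p < q → rootD p q ε ∈ X → rootD p q (-ε) ∉ X) :
    IsAdmissible (D n) X := by
  refine isAdmissible_of_exists_fourth (isSL_D hn) hX ?_
  intro β₁ m1 β₂ m2 β₃ m3 h12 h13 h23 α hα h1 h2 h3
  exfalso
  obtain ⟨a, b, hab, θ, hor⟩ := exists_rootD hn hα
  have hdis : ∀ β ∈ X, ∀ γ ∈ X, β ≠ γ →
      ∀ x, latticeMap (aD n) β x * latticeMap (aD n) γ x = 0 := by
    intro β hβ γ hγ hne x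
    obtain ⟨p, q, hpq, ε, rfl⟩ := exists_rootD_of_pos hn (hX.1 hβ)
    obtain ⟨r, s, hrs, η, rfl⟩ := exists_rootD_of_pos hn (hX.1 hγ)
    rcases disjoint_of_orth_D hn hpq hrs (hX.2 _ hβ _ hγ hne) with ⟨d1, d2, d3, d4⟩ | ⟨rfl, rfl, rfl⟩
    · rw [latticeMap_rootD hn, latticeMap_rootD hn]
      simp only [vecD, Pi.add_apply, Pi.single_apply]
      grind
    · exact absurd hγ (hd _ _ _ hpq hβ)
  have ne : ∀ β, |form (D n) α β| = 1 →
      latticeMap (aD n) α ⬝ᵥ latticeMap (aD n) β ≠ 0 := by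
    intro β h h0
    rw [dot_latticeMap (dot_aD hn)] at h0
    rw [h0] at h
    simp at h
  refine not_three_disjoint (a := a) (b := b) (fun p ha hb => ?_) (hdis _ m1 _ m2 h12)
    (hdis _ m1 _ m3 h13) (hdis _ m2 _ m3 h23) (ne _ h1) (ne _ h2) (ne _ h3)
  have h0 : vecD a b θ p = 0 := by
    rw [vecD, Pi.add_apply, Pi.single_eq_of_ne ha, Pi.single_eq_of_ne hb, add_zero]
  rcases hor with rfl | rfl
  · rw [latticeMap_rootD hn, h0]
  · rw [map_neg, latticeMap_rootD hn, Pi.neg_apply, h0, neg_zero]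

/-- Inner product `±1` means that the supports share exactly one coordinate, which does not depend
on the signs. -/
theorem abs_form_neg_D (hn : 2 ≤ n) {a b p q : Fin n} (hab : a < b) (hpq : p < q) {θ ε : ℤˣ}
    (h : |form (D n) (rootD a b θ) (rootD p q ε)| = 1) :
    |form (D n) (rootD a b θ) (rootD p q (-ε))| = 1 := by
  rw [form_rootD hn] at h ⊢
  rcases Int.units_eq_one_or ε with rfl | rfl <;> rcases Int.units_eq_one_or θ with rfl | rfl <;>
    simp only [Units.val_one, Units.val_neg, neg_neg] at h ⊢ <;> grind

/-- Opposites come in pairs, so among three distinct roots there is one whose opposite is not among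
them; that opposite is the fourth root. -/
theorem isAdmissible_of_doubles (hn : 2 ≤ n) {X : Set (Fin n → ℤ)}
    (hX : IsOrthogonalSet (D n) X)
    (hd : ∀ p q ε, p < q → rootD p q ε ∈ X → rootD p q (-ε) ∈ X) :
    IsAdmissible (D n) X := by
  refine isAdmissible_of_exists_fourth (isSL_D hn) hX ?_
  intro β₁ m1 β₂ m2 β₃ m3 h12 h13 h23 α hα h1 h2 h3
  obtain ⟨a, b, hab, θ, hor⟩ := exists_rootD hn hα
  have e : ∀ β, |form (D n) α β| = |form (D n) (rootD a b θ) β| := by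
    rcases hor with rfl | rfl
    · exact fun _ => rfl
    · intro β; rw [form_neg_left, abs_neg]
  rw [e] at h1 h2 h3
  simp only [e]
  obtain ⟨p₁, q₁, hpq₁, ε₁, rfl⟩ := exists_rootD_of_pos hn (hX.1 m1)
  obtain ⟨p₂, q₂, hpq₂, ε₂, rfl⟩ := exists_rootD_of_pos hn (hX.1 m2)
  obtain ⟨p₃, q₃, hpq₃, ε₃, rfl⟩ := exists_rootD_of_pos hn (hX.1 m3)
  have ne : ∀ {p q : Fin n} {ε : ℤˣ}, p < q → rootD p q (-ε) ≠ rootD p q ε := by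
    intro p q ε hpq h
    have := (rootD_inj hn hpq hpq h).2.2
    rcases Int.units_eq_one_or ε with rfl | rfl <;> exact absurd this (by decide)
  -- the opposite of one of the three roots is different from the other two
  by_cases c1 : rootD p₁ q₁ (-ε₁) = rootD p₂ q₂ ε₂
  · refine ⟨_, hd _ _ _ hpq₃ m3, ?_, ?_, ne hpq₃, abs_form_neg_D hn hab hpq₃ h3⟩
    · intro h
      obtain ⟨rfl, rfl, k1⟩ := rootD_inj hn hpq₁ hpq₂ c1
      obtain ⟨rfl, rfl, k2⟩ := rootD_inj hn hpq₃ hpq₁ h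
      exact h23 (by rw [← k1, ← k2, neg_neg])
    · intro h
      obtain ⟨rfl, rfl, k1⟩ := rootD_inj hn hpq₁ hpq₂ c1
      obtain ⟨rfl, rfl, k2⟩ := rootD_inj hn hpq₃ hpq₁ h
      exact h13 (by rw [← k1] at k2; rw [neg_injective k2])
  · by_cases c2 : rootD p₁ q₁ (-ε₁) = rootD p₃ q₃ ε₃
    · refine ⟨_, hd _ _ _ hpq₂ m2, ?_, ne hpq₂, ?_, abs_form_neg_D hn hab hpq₂ h2⟩
      · intro h
        obtain ⟨rfl, rfl, k1⟩ := rootD_inj hn hpq₂ hpq₁ h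
        exact c1 (by rw [← k1, neg_neg])
      · intro h
        obtain ⟨rfl, rfl, k1⟩ := rootD_inj hn hpq₁ hpq₃ c2
        obtain ⟨rfl, rfl, k2⟩ := rootD_inj hn hpq₂ hpq₁ h
        exact h12 (by rw [← k1] at k2; rw [neg_injective k2])
    · exact ⟨_, hd _ _ _ hpq₁ m1, ne hpq₁, c1, c2, abs_form_neg_D hn hab hpq₁ h1⟩

end AdmissibleD

/-! ### Representatives and highest elements in type D -/

section SetsD

variable {n t : ℕ} {η : ℤˣ}

/-- The sign in the sum `e_p ± e_q` of a highest matching. -/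
def signD (n : ℕ) (η : ℤˣ) (q : Fin n) : ℤˣ := if (q : ℕ) + 1 = n then η else 1

/-- The matching `{e_i + e_{2t-1-i} | i < t}`, with the sign `η` for the last coordinate. -/
def matchD (n t : ℕ) (η : ℤˣ) : Set (Fin n → ℤ) :=
  {β | ∃ p q : Fin n, (p : ℕ) < t ∧ (p : ℕ) + q + 1 = 2 * t ∧ β = rootD p q (signD n η q)}

/-- The set `{e_i ± e_{i + n - t} | i < t}`. -/
def doubleD (n t : ℕ) : Set (Fin n → ℤ) :=
  {β | ∃ p q : Fin n, ∃ ε, (p : ℕ) < t ∧ (q : ℕ) = p + (n - t) ∧ β = rootD p q ε}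

theorem matchD_eq_range (ht : 2 * t ≤ n) : matchD n t η = Set.range fun i : Fin t =>
    rootD (⟨i, by omega⟩ : Fin n) ⟨2 * t - 1 - i, by omega⟩
      (signD n η ⟨2 * t - 1 - i, by omega⟩) := by
  ext β
  constructor
  · rintro ⟨p, q, hp, hq, rfl⟩
    refine ⟨⟨p, hp⟩, ?_⟩
    rw [show q = ⟨2 * t - 1 - p, by omega⟩ from Fin.ext (by simp only; omega)]
  · rintro ⟨i, rfl⟩
    exact ⟨_, _, i.2, by simp only; omega, rfl⟩

theorem doubleD_eq_range (ht : 2 * t ≤ n) : doubleD n t = Set.range fun k : Fin t × ℤˣ =>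
    rootD (⟨k.1, by omega⟩ : Fin n) ⟨k.1 + (n - t), by omega⟩ k.2 := by
  ext β
  constructor
  · rintro ⟨p, q, ε, hp, hq, rfl⟩
    exact ⟨(⟨p, hp⟩, ε), congrArg (fun q => rootD p q ε) (Fin.ext hq.symm)⟩
  · rintro ⟨⟨i, ε⟩, rfl⟩
    exact ⟨_, _, ε, i.2, rfl, rfl⟩

theorem matchD_injective (ht : 2 * t ≤ n) :
    Function.Injective (Sum.elim (fun i : Fin t => (⟨i, by omega⟩ : Fin n))
      fun i : Fin t => ⟨2 * t - 1 - i, by omega⟩) := by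
  rintro (i | i) (j | j) h <;> simp only [Sum.elim_inl, Sum.elim_inr, Fin.mk.injEq] at h
  · rw [Fin.ext h]
  · omega
  · omega
  · rw [show i = j from Fin.ext (by omega)]

theorem doubleD_injective (ht : 2 * t ≤ n) :
    Function.Injective (Sum.elim (fun i : Fin t => (⟨i, by omega⟩ : Fin n))
      fun i : Fin t => ⟨i + (n - t), by omega⟩) := by
  rintro (i | i) (j | j) h <;> simp only [Sum.elim_inl, Sum.elim_inr, Fin.mk.injEq] at h
  · rw [Fin.ext h]
  · omega
  · omega
  · rw [show i = j from Fin.ext (by omega)]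

theorem matchD_family_injective (hn : 2 ≤ n) (ht : 2 * t ≤ n) :
    Function.Injective fun i : Fin t => rootD (⟨i, by omega⟩ : Fin n) ⟨2 * t - 1 - i, by omega⟩
      (signD n η ⟨2 * t - 1 - i, by omega⟩) := by
  intro i j h
  have := (rootD_inj hn (by simp only [Fin.lt_def]; omega) (by simp only [Fin.lt_def]; omega) h).1
  exact Fin.ext (by simpa using this)

theorem doubleD_family_injective (hn : 2 ≤ n) (ht : 2 * t ≤ n) :
    Function.Injective fun k : Fin t × ℤˣ =>
      rootD (⟨k.1, by omega⟩ : Fin n) ⟨k.1 + (n - t), by omega⟩ k.2 := by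
  rintro ⟨i, δ⟩ ⟨j, ε⟩ h
  obtain ⟨h1, -, h2⟩ :=
    rootD_inj hn (by simp only [Fin.lt_def]; omega) (by simp only [Fin.lt_def]; omega) h
  exact Prod.ext (Fin.ext (by simpa using h1)) h2

theorem isOrthogonalSet_matchD (hn : 2 ≤ n) :
    IsOrthogonalSet (D n) (matchD n t η) := by
  constructor
  · rintro _ ⟨p, q, hp, hq, rfl⟩
    exact rootD_mem_posRoots hn (Fin.lt_def.mpr (by omega)) _
  · rintro _ ⟨p, q, hp, hq, rfl⟩ _ ⟨r, s, hr, hs, rfl⟩ hne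
    have hpr : (p : ℕ) ≠ r := fun h => by
      obtain rfl := Fin.ext h
      exact hne (by rw [show q = s from Fin.ext (by omega)])
    exact form_disjoint_D hn (by simp only [Ne, Fin.ext_iff]; omega)

theorem isOrthogonalSet_doubleD (hn : 2 ≤ n) (ht : 2 * t ≤ n) :
    IsOrthogonalSet (D n) (doubleD n t) := by
  constructor
  · rintro _ ⟨p, q, ε, hp, hq, rfl⟩
    exact rootD_mem_posRoots hn (Fin.lt_def.mpr (by omega)) _
  · rintro _ ⟨p, q, ε, hp, hq, rfl⟩ _ ⟨r, s, δ, hr, hs, rfl⟩ hne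
    by_cases hpr : p = r
    · subst hpr
      obtain rfl : q = s := Fin.ext (by omega)
      refine form_opposite_D hn (by simp only [Ne, Fin.ext_iff]; omega) ?_
      rcases Int.units_eq_one_or ε with rfl | rfl <;> rcases Int.units_eq_one_or δ with rfl | rfl <;>
        first | rfl | exact absurd rfl hne
    · have hpr' := Fin.val_ne_of_ne hpr
      exact form_disjoint_D hn (by simp only [Ne, Fin.ext_iff]; omega)

theorem isAdmissible_matchD (hn : 2 ≤ n) (ht : 2 * t ≤ n) :
    IsAdmissible (D n) (matchD n t η) := by
  refine isAdmissible_of_disjoint hn (isOrthogonalSet_matchD hn) ?_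
  rintro p q ε hpq ⟨r, s, hr, hs, h⟩ ⟨r', s', hr', hs', h'⟩
  obtain ⟨rfl, rfl, h1⟩ := rootD_inj hn hpq (Fin.lt_def.mpr (by omega)) h
  obtain ⟨rfl, rfl, h2⟩ := rootD_inj hn hpq (Fin.lt_def.mpr (by omega)) h'
  rw [← h1] at h2
  rcases Int.units_eq_one_or ε with rfl | rfl <;> exact absurd h2 (by decide)

theorem isAdmissible_doubleD (hn : 2 ≤ n) (ht : 2 * t ≤ n) :
    IsAdmissible (D n) (doubleD n t) := by
  refine isAdmissible_of_doubles hn (isOrthogonalSet_doubleD hn ht) ?_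
  rintro p q ε hpq ⟨r, s, δ, hr, hs, h⟩
  obtain ⟨rfl, rfl, h1⟩ := rootD_inj hn hpq (Fin.lt_def.mpr (by omega)) h
  exact ⟨_, _, _, hr, hs, rfl⟩

theorem ncard_matchD (hn : 2 ≤ n) (ht : 2 * t ≤ n) : (matchD n t η).ncard = t := by
  rw [matchD_eq_range ht, ← Set.image_univ,
    Set.ncard_image_of_injective _ (matchD_family_injective hn ht), Set.ncard_univ,
    Nat.card_eq_fintype_card, Fintype.card_fin]

theorem ncard_doubleD (hn : 2 ≤ n) (ht : 2 * t ≤ n) : (doubleD n t).ncard = 2 * t := by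
  rw [doubleD_eq_range ht, ← Set.image_univ,
    Set.ncard_image_of_injective _ (doubleD_family_injective hn ht), Set.ncard_univ,
    Nat.card_eq_fintype_card, Fintype.card_prod, Fintype.card_fin, Fintype.card_units_int, mul_comm]

theorem matchD_eq_of_lt (ht : 2 * t < n) (η : ℤˣ) : matchD n t η = matchD n t 1 := by
  ext β
  refine exists_congr fun p => exists_congr fun q => and_congr_right fun _ =>
    and_congr_right fun hq => ?_
  rw [signD, signD, if_neg (by omega), if_neg (by omega)]

/-- The product of the signs of a matching with signs `1` except at the last coordinate. -/
theorem prod_signD {q : Fin t → Fin n} (hq : Function.Injective q) {i₀ : Fin t}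
    (h : (q i₀ : ℕ) + 1 = n) (η : ℤˣ) : ∏ i, signD n η (q i) = η := by
  rw [Finset.prod_eq_single i₀]
  · exact if_pos h
  · intro i _ hi
    refine if_neg fun h' => hi (hq (Fin.ext (by omega)))
  · exact fun h => absurd (Finset.mem_univ _) h

/-- A matching with the right number of negative signs lies in the orbit of `matchD`. -/
theorem mem_orbit_matchD (hn : 2 ≤ n) {r s : Fin t → Fin n} {ε : Fin t → ℤˣ} (ht : 1 ≤ t)
    (hrs : ∀ i, r i < s i) (hinj : Function.Injective (Sum.elim r s))
    (h : 2 * t < n ∨ ∏ i, ε i = η) : 2 * t ≤ n ∧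
      (Set.range fun i => rootD (r i) (s i) (ε i)) ∈ orbit (D n) (matchD n t η) := by
  have ht' : 2 * t ≤ n := by
    have := Fintype.card_le_of_injective _ hinj
    rw [Fintype.card_sum, Fintype.card_fin, Fintype.card_fin] at this
    omega
  refine ⟨ht', ?_⟩
  obtain ⟨w, hw, h'⟩ := exists_weyl_rootD hn
    (fun i : Fin t => signD n η ⟨2 * t - 1 - i, by omega⟩) ε (matchD_injective ht') hinj (by
      rcases lt_or_eq_of_le ht' with h1 | h1
      · exact Or.inr h1
      · left
        rw [h.resolve_left (by omega)]
        exact prod_signD (i₀ := ⟨0, ht⟩) ((matchD_injective ht').comp Sum.inr_injective)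
          (by simp only [Function.comp, Sum.elim_inr]; omega) η)
  refine ⟨w, hw, ?_⟩
  rw [matchD_eq_range ht']
  exact (act_range (isSL_D hn) (fun k => rootD_mem_posRoots hn (hrs k) _)
    fun k => Or.inl (h' k)).symm

/-- Both signs are present in each pair, so no parity obstruction arises: a permutation of the
coordinates suffices. -/
theorem mem_orbit_doubleD (hn : 2 ≤ n) {r s : Fin t → Fin n} (hrs : ∀ i, r i < s i)
    (hinj : Function.Injective (Sum.elim r s)) : 2 * t ≤ n ∧
      (Set.range fun k : Fin t × ℤˣ => rootD (r k.1) (s k.1) k.2) ∈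
        orbit (D n) (doubleD n t) := by
  have ht' : 2 * t ≤ n := by
    have := Fintype.card_le_of_injective _ hinj
    rw [Fintype.card_sum, Fintype.card_fin, Fintype.card_fin] at this
    omega
  refine ⟨ht', ?_⟩
  obtain ⟨w, hw, g, hg, h'⟩ := exists_weyl_coord hn (doubleD_injective ht') hinj 1
    (Or.inl (by simp))
  refine ⟨w, hw, ?_⟩
  rw [doubleD_eq_range ht']
  refine (act_range (isSL_D hn) (fun k => rootD_mem_posRoots hn (hrs _) _)
    fun k => Or.inl (aD_injective hn ?_)).symm
  have h1 := h' (Sum.inl k.1) 1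
  have h2 := h' (Sum.inr k.1) (k.2 : ℤ)
  simp only [Sum.elim_inl, Sum.elim_inr, Pi.one_apply, Units.val_one, one_mul] at h1 h2
  rw [hg, latticeMap_rootD hn, latticeMap_rootD hn, vecD, vecD, map_add, h1, h2]

/-- The members of the orbit of `matchD`. -/
theorem exists_of_mem_orbit_matchD (hn : 2 ≤ n) (ht : 1 ≤ t) (ht' : 2 * t ≤ n)
    {X : Set (Fin n → ℤ)} (hX : X ∈ orbit (D n) (matchD n t η)) :
    ∃ r s : Fin t → Fin n, ∃ ε : Fin t → ℤˣ, (∀ i, r i < s i) ∧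
      Function.Injective (Sum.elim r s) ∧ (2 * t = n → ∏ i, ε i = η) ∧
      X = Set.range fun i => rootD (r i) (s i) (ε i) := by
  obtain ⟨w, hw, rfl⟩ := hX
  obtain ⟨r, s, θ, hrs, hinj, hθ, h⟩ := exists_image_matching_D hn (matchD_injective ht') hw
  refine ⟨r, s, fun i => θ i * signD n η ⟨2 * t - 1 - i, by omega⟩, hrs, hinj, fun h2 => ?_, ?_⟩
  · rw [Finset.prod_mul_distrib, hθ h2, one_mul]
    exact prod_signD (i₀ := ⟨0, ht⟩) ((matchD_injective ht').comp Sum.inr_injective)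
          (by simp only [Function.comp, Sum.elim_inr]; omega) η
  · rw [matchD_eq_range ht']
    exact act_range (isSL_D hn) (fun k => rootD_mem_posRoots hn (hrs k) _) fun k => h k _

theorem exists_of_mem_orbit_doubleD (hn : 2 ≤ n) (ht' : 2 * t ≤ n)
    {X : Set (Fin n → ℤ)} (hX : X ∈ orbit (D n) (doubleD n t)) :
    ∃ r s : Fin t → Fin n, (∀ i, r i < s i) ∧ Function.Injective (Sum.elim r s) ∧
      X = Set.range fun k : Fin t × ℤˣ => rootD (r k.1) (s k.1) k.2 := by
  obtain ⟨w, hw, rfl⟩ := hX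
  obtain ⟨r, s, θ, hrs, hinj, -, h⟩ := exists_image_matching_D hn (doubleD_injective ht') hw
  refine ⟨r, s, hrs, hinj, ?_⟩
  rw [doubleD_eq_range ht']
  refine (act_range (isSL_D hn) (b' := fun k => rootD (r k.1) (s k.1) (θ k.1 * k.2))
    (fun k => rootD_mem_posRoots hn (hrs _) _) fun k => h k.1 k.2).trans ?_
  ext β
  constructor
  · rintro ⟨k, rfl⟩; exact ⟨(k.1, θ k.1 * k.2), rfl⟩
  · rintro ⟨k, rfl⟩
    refine ⟨(k.1, θ k.1 * k.2), ?_⟩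
    simp only [← mul_assoc, Int.units_mul_self, one_mul]

/-- An admissible set is in one of the listed orbits. -/
theorem IsAdmissible.exists_orbit_D (hn : 2 ≤ n) {X : Set (Fin n → ℤ)}
    (hX : IsAdmissible (D n) X) (hne : X.Nonempty) :
    ∃ t, 1 ≤ t ∧ 2 * t ≤ n ∧ ((∃ η, X ∈ orbit (D n) (matchD n t η)) ∨
      X ∈ orbit (D n) (doubleD n t)) := by
  by_cases hd : ∀ p q ε, p < q → rootD p q ε ∈ X → rootD p q (-ε) ∉ X
  · obtain ⟨p, q, ε, hpq, hinj, he⟩ := hX.1.exists_matching_D hn hd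
    have h1 : 1 ≤ X.ncard := (Set.ncard_pos ((posRoots_finite (isSL_D hn)).subset hX.1.1)).mpr hne
    obtain ⟨h2, h3⟩ := mem_orbit_matchD hn h1 hpq hinj (Or.inr rfl)
    rw [← he] at h3
    exact ⟨_, h1, h2, Or.inl ⟨_, h3⟩⟩
  · push Not at hd
    obtain ⟨p, q, ε, hpq, h1, h2⟩ := hd
    obtain ⟨t, ht, p, q, hpq, hinj, he⟩ := hX.exists_doubles hn hpq h1 h2
    obtain ⟨h2, h3⟩ := mem_orbit_doubleD hn hpq hinj
    rw [← he] at h3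
    exact ⟨t, ht, h2, Or.inr h3⟩

/-- The height bound gives `r i + s i + 1 ≤ 2t` for each pair, and allows a negative sign only for
`e_0 - e_{n-1}`. The `2t` coordinates used are then distinct and below `2t`, so their sum is known
and equality holds for every pair. -/
theorem eq_matchD_of_height (hn : 4 ≤ n) (ht : 1 ≤ t) (ht' : 2 * t ≤ n) {X : Set (Fin n → ℤ)}
    (hX : X ∈ orbit (D n) (matchD n t η))
    (h : ∀ β ∈ X, 2 * (n : ℤ) - 2 * t - 1 ≤ height β) : X = matchD n t η := by
  have hn2 : 2 ≤ n := by omega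
  obtain ⟨r, s, ε, hrs, hinj, hε, rfl⟩ := exists_of_mem_orbit_matchD hn2 ht ht' hX
  have hle : ∀ i, (r i : ℕ) + s i + 1 ≤ 2 * t ∧ (ε i = 1 ∨ (s i : ℕ) + 1 = n ∧ (r i : ℕ) = 0) := by
    intro i
    have h1 := h _ ⟨i, rfl⟩
    rw [height_rootD hn2] at h1
    have hs := (s i).2
    have hlt := Fin.lt_def.mp (hrs i)
    rcases Int.units_eq_one_or (ε i) with h2 | h2 <;> rw [h2] at h1 ⊢
    · rw [Units.val_one] at h1
      exact ⟨by omega, Or.inl rfl⟩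
    · rw [Units.val_neg, Units.val_one] at h1
      exact ⟨by omega, Or.inr (by omega)⟩
  have hlt : ∀ x, ((Sum.elim r s x : Fin n) : ℕ) < t + t := by
    rintro (i | i) <;> have := (hle i).1 <;> simp only [Sum.elim_inl, Sum.elim_inr] <;> omega
  have hb : Function.Bijective fun x => (⟨(Sum.elim r s x : Fin n), hlt x⟩ : Fin (t + t)) := by
    rw [Fintype.bijective_iff_injective_and_card]
    refine ⟨fun x y hxy => hinj (Fin.ext (by simpa using hxy)), by simp⟩
  have s1 : ∑ x, ((Sum.elim r s x : Fin n) : ℕ) = ∑ x : Fin (t + t), (x : ℕ) :=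
    Equiv.sum_comp (Equiv.ofBijective _ hb) fun x : Fin (t + t) => (x : ℕ)
  have s2 : (∑ x : Fin (t + t), (x : ℕ)) + t = t * (2 * t) := by
    have h2 := Finset.sum_range_id_mul_two (t + t)
    rw [Fin.sum_univ_eq_sum_range fun x => x]
    obtain ⟨k, rfl⟩ : ∃ k, t = k + 1 := ⟨t - 1, by omega⟩
    have : k + 1 + (k + 1) - 1 = 2 * k + 1 := by omega
    rw [this] at h2
    nlinarith
  have s3 : ∑ i, ((r i : ℕ) + s i + 1) = ∑ i : Fin t, 2 * t := by
    rw [Finset.sum_const, Finset.card_univ, Fintype.card_fin, smul_eq_mul, ← s2, ← s1,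
      Fintype.sum_sum_type, Finset.sum_add_distrib, Finset.sum_add_distrib]
    simp
  have heq : ∀ i, (r i : ℕ) + s i + 1 = 2 * t := fun i =>
    (Finset.sum_eq_sum_iff_of_le fun i _ => (hle i).1).mp s3 i (Finset.mem_univ i)
  have hεs : ∀ i, ε i = signD n η (s i) := by
    intro i
    rw [signD]
    split_ifs with hi
    · have hn' : 2 * t = n := by have := (hle i).1; omega
      -- A negative sign requires the last coordinate, which occurs in one pair only. The sign of
      -- that pair is therefore the product of all signs, which is `η` when no coordinate is spare.
      rw [← hε hn', Finset.prod_eq_single i]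
      · intro j _ hj
        refine (hle j).2.resolve_right fun h' => hj ?_
        have : s j = s i := Fin.ext (by omega)
        simpa using @hinj (Sum.inr j) (Sum.inr i) this
      · exact fun h => absurd (Finset.mem_univ _) h
    · exact (hle i).2.resolve_right fun h' => hi h'.1
  have hfin := (posRoots_finite (isSL_D hn2)).subset (isOrthogonalSet_matchD (t := t) (η := η) hn2).1
  refine Set.eq_of_subset_of_ncard_le ?_ ?_ hfin
  · rintro _ ⟨i, rfl⟩
    have := Fin.lt_def.mp (hrs i)
    have := heq i
    exact ⟨r i, s i, by omega, this, by simp only [hεs]⟩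
  · rw [ncard_matchD hn2 ht', ← Set.image_univ, Set.ncard_image_of_injective, Set.ncard_univ,
      Nat.card_eq_fintype_card, Fintype.card_fin]
    intro i j hij
    simpa using @hinj (Sum.inl i) (Sum.inl j) (rootD_inj hn2 (hrs i) (hrs j) hij).1

/-- Of the two roots of a pair, `e_r - e_s` carries the constraint: its height is `s - r`, so the
pairs have gap at least `n - t` and `matching_shift` applies. -/
theorem eq_doubleD_of_height (hn : 2 ≤ n) (ht' : 2 * t ≤ n) {X : Set (Fin n → ℤ)}
    (hX : X ∈ orbit (D n) (doubleD n t))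
    (h : ∀ β ∈ X, (n : ℤ) - t ≤ height β) : X = doubleD n t := by
  obtain ⟨r, s, hrs, hinj, rfl⟩ := exists_of_mem_orbit_doubleD hn ht' hX
  have hs := matching_shift (by omega) r s (hinj.comp Sum.inl_injective)
    (hinj.comp Sum.inr_injective) fun i => by
      have : (n : ℤ) - t ≤ height (rootD (r i) (s i) (-1)) := h _ ⟨(i, -1), rfl⟩
      rw [height_rootD hn, Units.val_neg, Units.val_one] at this
      omega
  have hfin := (posRoots_finite (isSL_D hn)).subset (isOrthogonalSet_doubleD hn ht').1
  refine Set.eq_of_subset_of_ncard_le ?_ ?_ hfin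
  · rintro _ ⟨⟨i, ε⟩, rfl⟩
    exact ⟨r i, s i, ε, (hs i).2, (hs i).1, rfl⟩
  · rw [ncard_doubleD hn ht', ← Set.image_univ, Set.ncard_image_of_injective, Set.ncard_univ,
      Nat.card_eq_fintype_card, Fintype.card_prod, Fintype.card_fin, Fintype.card_units_int,
      mul_comm]
    rintro ⟨i, δ⟩ ⟨j, ε⟩ hij
    obtain ⟨h1, -, h2⟩ := rootD_inj hn (hrs i) (hrs j) hij
    exact Prod.ext (by simpa using @hinj (Sum.inl i) (Sum.inl j) h1) h2

end SetsD

/-! ### Orthogonal subsystems and orthogonal nodes in type D -/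

section PerpD

variable {n t : ℕ} {η : ℤˣ}

theorem perp_matchD (hn : 2 ≤ n) (ht' : 2 * t ≤ n) {p q : Fin n} (hpq : p < q) {ε : ℤˣ}
    (h : ∀ β ∈ matchD n t η, form (D n) (rootD p q ε) β = 0) :
    (2 * t ≤ (p : ℕ) ∧ 2 * t ≤ (q : ℕ)) ∨
      ((p : ℕ) < t ∧ (p : ℕ) + q + 1 = 2 * t ∧ ε = -signD n η q) := by
  have key : ∀ r s : Fin n, (r : ℕ) < t → (r : ℕ) + s + 1 = 2 * t → (p ≠ r ∧ p ≠ s ∧ q ≠ r ∧ q ≠ s) ∨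
      (p = r ∧ q = s ∧ signD n η s = -ε) := fun r s hr hs =>
    disjoint_of_orth_D hn hpq (Fin.lt_def.mpr (by omega)) (h _ ⟨r, s, hr, hs, rfl⟩)
  have hlt := Fin.lt_def.mp hpq
  by_cases h1 : 2 * t ≤ (p : ℕ)
  · left; omega
  right
  by_cases h2 : (p : ℕ) < t
  · rcases key p ⟨2 * t - 1 - p, by omega⟩ h2 (by simp only; omega) with h' | ⟨-, h', h''⟩
    · exact absurd rfl h'.1
    · rw [← h'] at h''
      exact ⟨h2, by rw [h']; simp only; omega, by rw [h'', neg_neg]⟩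
  · rcases key ⟨2 * t - 1 - p, by omega⟩ p (by simp only; omega) (by simp only; omega) with
      h' | ⟨-, h', -⟩
    · exact absurd rfl h'.2.1
    · exact absurd h' hpq.ne'

theorem perp_doubleD (hn : 2 ≤ n) (ht' : 2 * t ≤ n) {p q : Fin n} (hpq : p < q) {ε : ℤˣ}
    (h : ∀ β ∈ doubleD n t, form (D n) (rootD p q ε) β = 0) :
    t ≤ (p : ℕ) ∧ (q : ℕ) + t < n := by
  have key : ∀ r s : Fin n, (r : ℕ) < t → (s : ℕ) = r + (n - t) → p ≠ r ∧ p ≠ s ∧ q ≠ r ∧ q ≠ s := by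
    intro r s hr hs
    have h1 := fun ε' => disjoint_of_orth_D hn hpq (Fin.lt_def.mpr (by omega))
      (h _ ⟨r, s, ε', hr, hs, rfl⟩)
    rcases h1 ε with h1 | ⟨-, -, h1⟩
    · exact h1
    · rcases Int.units_eq_one_or ε with rfl | rfl <;> exact absurd h1 (by decide)
  have hlt := Fin.lt_def.mp hpq
  refine ⟨?_, ?_⟩ <;> by_contra hlt'
  · exact (key p ⟨p + (n - t), by omega⟩ (by omega) rfl).1 rfl
  · exact (key ⟨q - (n - t), by omega⟩ q (by simp only; omega) (by simp only; omega)).2.2.2 rfl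

/-- The map of coordinate lattices given by a map of coordinates. -/
def push {m : ℕ} (f : Fin m → Fin n) : (Fin m → ℤ) →ₗ[ℤ] (Fin n → ℤ) :=
  latticeMap fun j => Pi.single (f j) 1

theorem push_single {m : ℕ} (f : Fin m → Fin n) (p : Fin m) (z : ℤ) :
    push f (Pi.single p z) = Pi.single (f p) z := by
  have : (Pi.single p z : Fin m → ℤ) = z • Pi.single p 1 := by
    rw [← Pi.single_smul, smul_eq_mul, mul_one]
  rw [this, map_smul, push, latticeMap_single, ← Pi.single_smul, smul_eq_mul, mul_one]

theorem push_vecD {m : ℕ} (f : Fin m → Fin n) (p q : Fin m) (ε : ℤˣ) :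
    push f (vecD p q ε) = vecD (f p) (f q) ε := by
  rw [vecD, map_add, push_single, push_single]; rfl

theorem push_dot {m : ℕ} {f : Fin m → Fin n} (hf : Function.Injective f) (x y : Fin m → ℤ) :
    push f x ⬝ᵥ push f y = x ⬝ᵥ y := by
  rw [push, dot_latticeMap (C := 1), form, Matrix.one_mulVec]
  intro i j
  rw [single_one_dotProduct, Pi.single_apply, Matrix.one_apply]
  simp only [hf.eq_iff]

theorem push_apply_eq_zero {m : ℕ} {f : Fin m → Fin n} {q : Fin n} (h : ∀ p, f p ≠ q)
    (x : Fin m → ℤ) : push f x q = 0 := by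
  rw [push, latticeMap_apply, Finset.sum_apply]
  refine Finset.sum_eq_zero fun i _ => ?_
  rw [Pi.smul_apply, Pi.single_eq_of_ne (h i).symm, smul_zero]

theorem push_dot_vecD {m : ℕ} {f : Fin m → Fin n} {p q : Fin n} (hp : ∀ k, f k ≠ p)
    (hq : ∀ k, f k ≠ q) (x : Fin m → ℤ) (ε : ℤˣ) : push f x ⬝ᵥ vecD p q ε = 0 := by
  rw [vecD, dotProduct_add, dotProduct_single_one, dotProduct_single, push_apply_eq_zero hp,
    push_apply_eq_zero hq, zero_mul, add_zero]

theorem push_aD_mem_range (hn : 2 ≤ n) {m : ℕ} (f : Fin m → Fin n) (k : Fin m) :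
    push f (aD m k) ∈ LinearMap.range (latticeMap (aD n)) := by
  rw [aD]
  split_ifs with h
  · rw [map_sub, push_single, push_single]
    exact sub_mem_range_D _ _
  · rw [map_add, push_single, push_single]
    exact add_mem_range_D hn _ _

/-- The vectors `e_p + ε e_q` supported on a set of coordinates are spanned by the simple roots of
the corresponding subsystem. -/
theorem vecD_mem_span {m : ℕ} (hm : 2 ≤ m) (f : Fin m → Fin n) (p q : Fin m) (ε : ℤˣ)
    {S : Submodule ℤ (Fin n → ℤ)} (hS : ∀ k : {_i : Fin m // m ≠ 1}, push f (aD m k) ∈ S) :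
    vecD (f p) (f q) ε ∈ S := by
  obtain ⟨x, hx⟩ := unit_mem_range_D hm p q 1 ε
  have hx' : latticeMap (aD m) x = vecD p q ε := hx
  rw [← push_vecD, ← hx', latticeMap_apply, map_sum]
  exact Submodule.sum_mem _ fun k _ => by
    rw [map_smul]
    exact Submodule.smul_mem _ _ (hS ⟨k, by omega⟩)

theorem push_aD_dot {m : ℕ} {f : Fin m → Fin n} (hf : Function.Injective f)
    (k l : {_i : Fin m // m ≠ 1}) : push f (aD m k) ⬝ᵥ push f (aD m l) = typeD m k l := by
  rw [push_dot hf, dot_aD (typeD_two_le k)]; rfl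

/-- The factors of type `A₁` are the opposites of the members, with the same coordinates and the
other sign. The remaining `n - 2t` coordinates carry the factor of type D. -/
theorem hasCartanType_matchD (hn : 2 ≤ n) (ht' : 2 * t ≤ n) : HasCartanType (D n)
    (perpRoots (D n) (matchD n t η))
    (sumType (typeA1Pow t) (typeD (n - 2 * t))) := by
  let f : Fin (n - 2 * t) → Fin n := fun k => ⟨2 * t + k, by omega⟩
  have hf : Function.Injective f := fun a b h => Fin.ext (by simpa [f] using h)
  have hfv : ∀ {k} {x : Fin n}, (x : ℕ) < 2 * t → f k ≠ x := fun hx h => by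
    have := congrArg Fin.val h; simp only [f] at this; omega
  let c : Fin t → Fin n → ℤ := fun i => vecD ⟨i, by omega⟩ ⟨2 * t - 1 - i, by omega⟩
    (-signD n η ⟨2 * t - 1 - i, by omega⟩)
  refine hasCartanType_of_ambient (isSL_D hn) (dot_aD hn) (aD_injective hn)
    (isSL_sumType (isSL_typeA1Pow t) (isSL_typeD _))
    (Sum.elim c fun k => push f (aD _ k)) ?_ ?_ ?_ ?_
  · rintro (i | i) (j | j)
    · simp only [Sum.elim_inl, c, sumType, Matrix.fromBlocks_apply₁₁, typeA1Pow,
        Matrix.diagonal_apply]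
      rw [← latticeMap_rootD hn, ← latticeMap_rootD hn, dot_latticeMap (dot_aD hn)]
      by_cases hij : i = j
      · subst hij
        rw [norm_of_mem_posRoots (isSL_D hn)
          (rootD_mem_posRoots hn (by simp only [Fin.lt_def]; omega) _), if_pos rfl]
      · have := Fin.val_ne_of_ne hij
        rw [if_neg hij, form_disjoint_D hn (by simp only [Ne, Fin.ext_iff]; omega)]
    · simp only [Sum.elim_inl, Sum.elim_inr, sumType, Matrix.fromBlocks_apply₁₂, Matrix.zero_apply]
      rw [dotProduct_comm]
      exact push_dot_vecD (fun k => hfv (by simp only; omega)) (fun k => hfv (by simp only; omega))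
        _ _
    · simp only [Sum.elim_inl, Sum.elim_inr, sumType, Matrix.fromBlocks_apply₂₁, Matrix.zero_apply]
      exact push_dot_vecD (fun k => hfv (by simp only; omega)) (fun k => hfv (by simp only; omega))
        _ _
    · simp only [Sum.elim_inr, sumType, Matrix.fromBlocks_apply₂₂]
      exact push_aD_dot hf i j
  · rintro (i | k)
    · exact ⟨_, latticeMap_rootD hn _ _ _⟩
    · exact push_aD_mem_range hn f _
  · rintro (i | k) _ ⟨p, q, hp, hq, rfl⟩
    · simp only [Sum.elim_inl, c]
      rw [← latticeMap_rootD hn, dot_latticeMap (dot_aD hn)]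
      by_cases hip : (i : ℕ) = p
      · have e1 : (⟨i, by omega⟩ : Fin n) = p := Fin.ext hip
        have e2 : (⟨2 * t - 1 - i, by omega⟩ : Fin n) = q := Fin.ext (by simp only; omega)
        rw [e1, e2]
        exact form_opposite_D hn (by simp only [Ne, Fin.ext_iff]; omega) (neg_neg _).symm
      · exact form_disjoint_D hn (by simp only [Ne, Fin.ext_iff]; omega)
    · rw [latticeMap_rootD hn]
      exact push_dot_vecD (fun k => hfv (by omega)) (fun k => hfv (by omega)) _ _
  · intro δ hδ hperp
    obtain ⟨p, q, hpq, ε, hor⟩ := exists_rootD hn hδ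
    have hp' : ∀ β ∈ matchD n t η, form (D n) (rootD p q ε) β = 0 := by
      rcases hor with rfl | rfl
      · exact hperp
      · intro β hβ
        have := hperp β hβ
        rwa [form_neg_left, neg_eq_zero] at this
    suffices h : vecD p q ε ∈ Submodule.span ℤ (Set.range (Sum.elim c fun k :
        {_i : Fin (n - 2 * t) // n - 2 * t ≠ 1} => push f (aD (n - 2 * t) k))) by
      rcases hor with rfl | rfl
      · rwa [latticeMap_rootD hn]
      · rw [map_neg, latticeMap_rootD hn]; exact neg_mem h
    have hlt := Fin.lt_def.mp hpq
    rcases perp_matchD hn ht' hpq hp' with ⟨h1, h2⟩ | ⟨h1, h2, h3⟩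
    · have e1 : p = f ⟨p - 2 * t, by omega⟩ := Fin.ext (by simp only [f]; omega)
      have e2 : q = f ⟨q - 2 * t, by omega⟩ := Fin.ext (by simp only [f]; omega)
      rw [e1, e2]
      exact vecD_mem_span (by omega) f _ _ _ fun k => Submodule.subset_span ⟨Sum.inr k, rfl⟩
    · refine Submodule.subset_span ⟨Sum.inl ⟨p, h1⟩, ?_⟩
      have e2 : (⟨2 * t - 1 - p, by omega⟩ : Fin n) = q := Fin.ext (by simp only; omega)
      simp only [Sum.elim_inl, c]
      rw [e2, h3]

/-- With both signs present, no root on the coordinates of a pair is left; only the `n - 2t` middle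
coordinates, starting at `t`, contribute. -/
theorem hasCartanType_doubleD (hn : 2 ≤ n) (ht' : 2 * t ≤ n) : HasCartanType (D n)
    (perpRoots (D n) (doubleD n t)) (typeD (n - 2 * t)) := by
  let f : Fin (n - 2 * t) → Fin n := fun k => ⟨t + k, by omega⟩
  have hf : Function.Injective f := fun a b h => Fin.ext (by simpa [f] using h)
  refine hasCartanType_of_ambient (isSL_D hn) (dot_aD hn) (aD_injective hn) (isSL_typeD _)
    (fun k => push f (aD _ k)) (push_aD_dot hf) (fun k => push_aD_mem_range hn f _) ?_ ?_
  · rintro k _ ⟨p, q, ε, hp, hq, rfl⟩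
    rw [latticeMap_rootD hn]
    refine push_dot_vecD (fun k h => ?_) (fun k h => ?_) _ _ <;>
    · have := congrArg Fin.val h
      simp only [f] at this
      omega
  · intro δ hδ hperp
    obtain ⟨p, q, hpq, ε, hor⟩ := exists_rootD hn hδ
    have hp' : ∀ β ∈ doubleD n t, form (D n) (rootD p q ε) β = 0 := by
      rcases hor with rfl | rfl
      · exact hperp
      · intro β hβ
        have := hperp β hβ
        rwa [form_neg_left, neg_eq_zero] at this
    suffices h : vecD p q ε ∈ Submodule.span ℤ (Set.range fun k :
        {_i : Fin (n - 2 * t) // n - 2 * t ≠ 1} => push f (aD (n - 2 * t) k)) by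
      rcases hor with rfl | rfl
      · rwa [latticeMap_rootD hn]
      · rw [map_neg, latticeMap_rootD hn]; exact neg_mem h
    have hlt := Fin.lt_def.mp hpq
    obtain ⟨h1, h2⟩ := perp_doubleD hn ht' hpq hp'
    have e1 : p = f ⟨p - t, by omega⟩ := Fin.ext (by simp only [f]; omega)
    have e2 : q = f ⟨q - t, by omega⟩ := Fin.ext (by simp only [f]; omega)
    have h0 := vecD_mem_span (by omega) f ⟨p - t, by omega⟩ ⟨q - t, by omega⟩ ε fun k =>
      Submodule.subset_span (s := Set.range fun k : {_i : Fin (n - 2 * t) // n - 2 * t ≠ 1} =>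
        push f (aD (n - 2 * t) k)) ⟨k, rfl⟩
    rwa [← e1, ← e2] at h0

theorem single_eq_rootD_of_lt (hn : 2 ≤ n) {i : Fin n} (h : (i : ℕ) + 1 < n) :
    (Pi.single i 1 : Fin n → ℤ) = rootD i ⟨i + 1, h⟩ (-1) :=
  aD_injective hn (by
    rw [latticeMap_single, latticeMap_rootD hn, aD_of_lt h, vecD, Units.val_neg, Units.val_one,
      Pi.single_neg, sub_eq_add_neg])

theorem single_eq_rootD_of_not_lt (hn : 2 ≤ n) {i : Fin n} (h : ¬ (i : ℕ) + 1 < n) :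
    (Pi.single i 1 : Fin n → ℤ) = rootD ⟨i - 1, by omega⟩ i 1 :=
  aD_injective hn (by
    rw [latticeMap_single, latticeMap_rootD hn, aD_of_not_lt h, vecD, Units.val_one])

/-- The pairs are nested around the gap between `t - 1` and `t`. Of the simple roots on the first
`2t` coordinates only `e_{t-1} - e_t`, the opposite of the innermost member, is orthogonal to all.
-/
theorem nodesHaveType_matchD (hn : 4 ≤ n) (ht : 1 ≤ t) (ht' : 2 * t ≤ n) :
    NodesHaveType (D n)
      {i | ∀ β ∈ matchD n t η, form (D n) (Pi.single i 1) β = 0}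
      (sumType (A 1) (typeD (n - 2 * t))) := by
  have hn2 : 2 ≤ n := by omega
  refine NodesHaveType.of_injective (Sum.elim (fun _ => ⟨t - 1, by omega⟩)
    fun k => ⟨2 * t + k.1, by omega⟩) ?_ ?_ ?_
  · rintro (i | i) (j | j) h <;> simp only [Sum.elim_inl, Sum.elim_inr, Fin.mk.injEq] at h
    · rw [Subsingleton.elim i j]
    · omega
    · omega
    · rw [show i = j from Subtype.ext (Fin.ext (by omega))]
  · ext i
    constructor
    · rintro ⟨k | k, rfl⟩ _ ⟨p, q, hp, hq, rfl⟩
      · simp only [Sum.elim_inl]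
        rw [single_eq_rootD_of_lt hn2 (by simp only; omega)]
        by_cases hpt : (p : ℕ) = t - 1
        · have e1 : (⟨t - 1, by omega⟩ : Fin n) = p := Fin.ext hpt.symm
          have e2 : (⟨t - 1 + 1, by omega⟩ : Fin n) = q := Fin.ext (by simp only; omega)
          simp only [e1, e2]
          refine form_opposite_D hn2 (Fin.ne_of_val_ne (by omega)) ?_
          -- The second coordinate of the innermost pair is `t`, which is not the last one since `2t
          -- ≤ n` and `n ≥ 4`.
          rw [neg_neg, signD, if_neg (by omega)]
        · exact form_disjoint_D hn2 (by simp only [Ne, Fin.ext_iff]; omega)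
      · simp only [Sum.elim_inr]
        have := typeD_two_le k
        by_cases hk : 2 * t + (k : ℕ) + 1 < n
        · rw [single_eq_rootD_of_lt hn2 (by simpa using hk)]
          exact form_disjoint_D hn2 (by simp only [Ne, Fin.ext_iff]; omega)
        · rw [single_eq_rootD_of_not_lt hn2 (by simpa using hk)]
          exact form_disjoint_D hn2 (by simp only [Ne, Fin.ext_iff]; omega)
    · intro h
      have hi := i.2
      by_cases h1 : (i : ℕ) + 1 < n
      · rw [Set.mem_ofPred_eq, single_eq_rootD_of_lt hn2 h1] at h
        rcases perp_matchD hn2 ht' (Fin.lt_def.mpr (by simp only; omega)) h with h2 | h2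
        · have h2' := h2.1
          exact ⟨Sum.inr ⟨⟨i - 2 * t, by omega⟩, by omega⟩, Fin.ext (by simp only [Sum.elim_inr]; omega)⟩
        · have h2' := h2.2.1
          simp only at h2'
          exact ⟨Sum.inl 0, Fin.ext (by simp only [Sum.elim_inl]; omega)⟩
      · rw [Set.mem_ofPred_eq, single_eq_rootD_of_not_lt hn2 h1] at h
        rcases perp_matchD hn2 ht' (Fin.lt_def.mpr (by simp only; omega)) h with h2 | h2
        · have h2' := h2.1
          simp only at h2'
          exact ⟨Sum.inr ⟨⟨i - 2 * t, by omega⟩, by omega⟩, Fin.ext (by simp only [Sum.elim_inr]; omega)⟩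
        · have h2' := h2.2.1
          simp only at h2'
          omega
  · rintro (i | i) (j | j)
    · rw [Subsingleton.elim i j]
      simp only [Sum.elim_inl, sumType, Matrix.fromBlocks_apply₁₁, D_apply hn2, if_true]
      rw [Subsingleton.elim j 0]; rfl
    · have := typeD_two_le j
      simp only [Sum.elim_inl, Sum.elim_inr, sumType, Matrix.fromBlocks_apply₁₂, D_apply hn2,
        Matrix.zero_apply]
      split_ifs <;> omega
    · have := typeD_two_le i
      simp only [Sum.elim_inl, Sum.elim_inr, sumType, Matrix.fromBlocks_apply₂₁, D_apply hn2,
        Matrix.zero_apply]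
      split_ifs <;> omega
    · have h2 := typeD_two_le i
      simp only [Sum.elim_inr, sumType, Matrix.fromBlocks_apply₂₂, D_apply hn2, typeD,
        Matrix.submatrix_apply, D_apply h2]
      split_ifs <;> omega

/-- The branch node `e_{n-2} + e_{n-1}` is lost because the last coordinate belongs to a pair. The
differences of consecutive middle coordinates remain, a chain with `n - 2t - 1` nodes. -/
theorem nodesHaveType_doubleD (hn : 4 ≤ n) (ht : 1 ≤ t) (ht' : 2 * t ≤ n) :
    NodesHaveType (D n)
      {i | ∀ β ∈ doubleD n t, form (D n) (Pi.single i 1) β = 0}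
      (A (n - 2 * t - 1)) := by
  have hn2 : 2 ≤ n := by omega
  refine NodesHaveType.of_injective (fun k => ⟨t + k, by omega⟩)
    (fun k l h => Fin.ext (by simp only [Fin.mk.injEq] at h; omega)) ?_ ?_
  · ext i
    constructor
    · rintro ⟨k, rfl⟩ _ ⟨p, q, ε, hp, hq, rfl⟩
      rw [single_eq_rootD_of_lt hn2 (by simp only; omega)]
      exact form_disjoint_D hn2 (by simp only [Ne, Fin.ext_iff]; omega)
    · intro h
      have hi := i.2
      by_cases h1 : (i : ℕ) + 1 < n
      · rw [Set.mem_ofPred_eq, single_eq_rootD_of_lt hn2 h1] at h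
        have h2 := perp_doubleD hn2 ht' (Fin.lt_def.mpr (by simp only; omega)) h
        simp only at h2
        exact ⟨⟨i - t, by omega⟩, Fin.ext (by simp only; omega)⟩
      · rw [Set.mem_ofPred_eq, single_eq_rootD_of_not_lt hn2 h1] at h
        have h2 := perp_doubleD hn2 ht' (Fin.lt_def.mpr (by simp only; omega)) h
        omega
  · intro k l
    simp only [D_apply hn2, A, Matrix.of_apply, Fin.ext_iff]
    split_ifs <;> omega

end PerpD

/-! ### Type B: all signed permutations -/

section TypeB

variable {n : ℕ}

/-- The simple roots of `C_n`, which are the simple coroots of `B_n`, in coordinates. -/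
def aB (n : ℕ) (k : Fin n) : Fin n → ℤ :=
  if h : (k : ℕ) + 1 < n then Pi.single k 1 - Pi.single ⟨k + 1, h⟩ 1 else Pi.single k 2

/-- The simple roots of `B_n` in coordinates. -/
def cB (n : ℕ) (k : Fin n) : Fin n → ℤ :=
  if h : (k : ℕ) + 1 < n then Pi.single k 1 - Pi.single ⟨k + 1, h⟩ 1 else Pi.single k 1

theorem dot_cB_aB (i j : Fin n) : cB n i ⬝ᵥ aB n j = B n i j := by
  have hi := i.2
  have hj := j.2
  unfold cB aB
  split_ifs with h1 h2 h2 <;>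
  · simp only [dotProduct_sub, dotProduct_single, Pi.sub_apply, Pi.single_apply, B, Matrix.of_apply, Fin.ext_iff]
    split_ifs <;> omega

theorem aB_injective (n : ℕ) : Function.Injective (latticeMap (aB n)) := by
  refine (injective_iff_map_eq_zero _).mpr (latticeMap_injective_of_dual
    (fun k p => if (p : ℕ) ≤ k then 1 else 0) (fun k => if (k : ℕ) + 1 < n then 1 else 2)
    (fun k => by split_ifs <;> norm_num) fun k j => ?_)
  have hj := j.2
  have hk := k.2
  unfold aB
  split_ifs with h1 h2 h2 h3 h3 <;>
    simp only [dotProduct_sub, dotProduct_single, Fin.ext_iff] at * <;> split_ifs <;> omega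

theorem toEnd_simpleB (i : Fin n) (y : Fin n → ℤ) :
    SignedPerm.toEnd (if h : (i : ℕ) + 1 < n then SemidirectProduct.inr (Equiv.swap i ⟨i + 1, h⟩)
      else SignedPerm.flip i) y = y - (cB n i ⬝ᵥ y) • aB n i := by
  unfold cB aB
  split_ifs with h
  · exact SignedPerm.toEnd_swap (by simp [Fin.ext_iff]) y
  · exact SignedPerm.toEnd_flip i y

theorem subgroup_eq_top_of_adjacent {H : Subgroup (Equiv.Perm (Fin n))}
    (h : ∀ (i : Fin n) (hi : (i : ℕ) + 1 < n), Equiv.swap i ⟨i + 1, hi⟩ ∈ H) : H = ⊤ := by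
  rw [eq_top_iff]
  cases n with
  | zero => intro σ _; rw [Subsingleton.elim σ 1]; exact one_mem _
  | succ n =>
    have h1 := Equiv.Perm.mclosure_swap_castSucc_succ n
    have h2 : Submonoid.closure (Set.range fun i : Fin n => Equiv.swap i.castSucc i.succ) ≤
        H.toSubmonoid := by
      rw [Submonoid.closure_le]
      rintro _ ⟨i, rfl⟩
      exact h i.castSucc (by simp)
    rw [h1] at h2
    exact fun σ _ => h2 trivial

/-- Adjacent swaps and the sign change of the last coordinate are the simple reflections, and they
generate all signed permutations. -/
theorem weylGroup_B_mulEquiv (n : ℕ) :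
    Nonempty (weylGroup (B n) ≃* SignedPerm (Fin n)) := by
  suffices h : Nonempty (weylGroup (B n) ≃* (⊤ : Subgroup (SignedPerm (Fin n)))) from
    h.map fun e => e.trans Subgroup.topEquiv
  refine weylGroup_mulEquiv (C := B n) (ρ := SignedPerm.toEnd)
    (aB_injective n) ⊤
    (fun w hw => (exists_actsAs dot_cB_aB toEnd_simpleB hw).imp fun g hg => ⟨trivial, hg.2⟩)
    (top_le_iff.mpr ?_) fun g h => ?_
  · have hmem := mem_actingSubgroup_of_simple (C := B n) (ρ := SignedPerm.toEnd)
      (fun i => by simp [B]) dot_cB_aB toEnd_simpleB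
    have hperm : ∀ σ, (SemidirectProduct.inr σ : SignedPerm (Fin n)) ∈
        actingSubgroup (B n) (aB n) SignedPerm.toEnd := by
      have := subgroup_eq_top_of_adjacent (H := (actingSubgroup (B n) (aB n)
        SignedPerm.toEnd).comap SemidirectProduct.inr) fun i hi => by
          have := hmem i
          rw [dif_pos hi] at this
          exact this
      intro σ
      have hσ : σ ∈ (⊤ : Subgroup (Equiv.Perm (Fin n))) := trivial
      rwa [← this] at hσ
    refine SignedPerm.eq_top_of_mem _ hperm fun p => ?_
    have hpos : 0 < n := by have := p.2; omega
    have h1 := hmem ⟨n - 1, by omega⟩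
    rw [dif_neg (by simp only; omega)] at h1
    -- Conjugation by a swap carries the sign change of the last coordinate to that of any other.
    have h2 := mul_mem (mul_mem (hperm (Equiv.swap ⟨n - 1, by omega⟩ p)) h1)
      (inv_mem (hperm (Equiv.swap ⟨n - 1, by omega⟩ p)))
    rwa [SignedPerm.conj_flip, Equiv.swap_apply_left] at h2
  -- The image of the lattice contains `2 e_p` but in general not `e_p`; fixing the double is
  -- enough, as the ambient lattice has no torsion.
  · have hker : ∀ y : Fin n → ℤ, (2 : ℤ) • y ∈ LinearMap.range (latticeMap (aB n)) →
        SignedPerm.toEnd g y = y := by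
      rintro y ⟨x, hx⟩
      have := h x
      rw [hx, map_smul] at this
      exact smul_right_injective _ (two_ne_zero : (2 : ℤ) ≠ 0) this
    have hr : ∀ k, aB n k ∈ LinearMap.range (latticeMap (aB n)) := fun k =>
      ⟨Pi.single k 1, latticeMap_single _ _⟩
    have key : ∀ (d : ℕ) (p : Fin n), (p : ℕ) + 1 + d = n →
        (2 : ℤ) • (Pi.single p 1 : Fin n → ℤ) ∈ LinearMap.range (latticeMap (aB n)) := by
      intro d
      induction d with
      | zero =>
        intro p hp
        have := hr p
        rw [aB, dif_neg (by omega)] at this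
        rwa [← Pi.single_smul, smul_eq_mul, mul_one]
      | succ d ih =>
        intro p hp
        have h1 := hr p
        rw [aB, dif_pos (by omega)] at h1
        have h2 := add_mem (Submodule.smul_mem _ (2 : ℤ) h1) (ih ⟨p + 1, by omega⟩ (by simp only; omega))
        rwa [smul_sub, sub_add_cancel] at h2
    exact eq_one_of_fix_single fun p => hker _ (key (n - 1 - p) p (by omega))

end TypeB

/-! ### Outer automorphisms from isometries of the lattice -/

section OuterConjugation

variable {ι : Type} [Fintype ι] [DecidableEq ι] {C : Matrix ι ι ℤ}

/-- If conjugation by `g` agreed with conjugation by some `u` in `W`, then `g` and `u` would carry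
`X` to the same set, which would put the image of `X` in its own orbit. -/
theorem outerConjugate_of_isometry (hC : IsSL C) {g : LatticeAut ι}
    (hg : g ∈ isometries C) {X : Set (ι → ℤ)} (hX : X ⊆ posRoots C)
    (hne : act C g X ∉ orbit C X) : OuterConjugate C (orbit C X) (orbit C (act C g X)) := by
  refine ⟨conjW hC g hg, ?_, ?_⟩
  · rintro ⟨u, hu⟩
    refine hne ⟨u.1, u.2, reflections_injective hC (act_subset _ _) (act_subset _ _) ?_⟩
    rw [reflections_act hC hg hX, reflections_act hC (weylGroup_le_isometries hC u.2) hX, ← hu]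
    rfl
  · have key : ∀ w ∈ weylGroup C, (conjW hC g hg) '' reflections C (act C w X) =
        reflections C (act C (g * w * g⁻¹) (act C g X)) := by
      intro w hw
      have hwi := weylGroup_le_isometries hC hw
      rw [← reflections_act hC hg (act_subset _ _), ← act_mul hC _ hwi hX,
        ← act_mul hC _ hg hX, inv_mul_cancel_right]
    ext S
    constructor
    · rintro ⟨_, ⟨w, hw, rfl⟩, rfl⟩
      exact ⟨_, ⟨_, conj_mem_weylGroup hC hg hw, rfl⟩, (key w hw).symm⟩
    · rintro ⟨_, ⟨w, hw, rfl⟩, rfl⟩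
      refine ⟨_, ⟨_, conj_mem_weylGroup hC (inv_mem hg) hw, rfl⟩, ?_⟩
      simp only
      rw [key _ (conj_mem_weylGroup hC (inv_mem hg) hw)]
      congr 2
      group

end OuterConjugation

/-! ### The lines of the table in type D -/

section LinesD

variable {n t : ℕ} {η : ℤˣ}

theorem height_matchD (hn : 2 ≤ n) {β : Fin n → ℤ} (hβ : β ∈ matchD n t η) :
    2 * (n : ℤ) - 2 * t - 1 ≤ height β := by
  obtain ⟨p, q, hp, hq, rfl⟩ := hβ
  rw [height_rootD hn, signD]
  split_ifs with h
  · have : (n : ℤ) - 1 - q = 0 := by omega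
    rw [this, mul_zero]
    omega
  · rw [Units.val_one]
    omega

theorem height_doubleD (hn : 2 ≤ n) {β : Fin n → ℤ} (hβ : β ∈ doubleD n t) :
    (n : ℤ) - t ≤ height β := by
  obtain ⟨p, q, ε, hp, hq, rfl⟩ := hβ
  rw [height_rootD hn]
  rcases unit_cases ε with h | h <;> rw [h] <;> omega

/-- Both sets reach the height threshold, and an orbit contains only one such set. They differ in
the sign of the pair using the last coordinate. -/
theorem matchD_neg_notMem_orbit (hn : 4 ≤ n) (ht' : 2 * t = n) :
    matchD n t (-1) ∉ orbit (D n) (matchD n t 1) := by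
  intro h
  have hn2 : 2 ≤ n := by omega
  have h1 := eq_matchD_of_height hn (by omega) ht'.le h fun β hβ => height_matchD hn2 hβ
  have h2 : rootD ⟨0, by omega⟩ ⟨n - 1, by omega⟩ (-1) ∈ matchD n t (-1) :=
    ⟨⟨0, by omega⟩, ⟨n - 1, by omega⟩, show 0 < t by omega, show 0 + (n - 1) + 1 = 2 * t by omega,
      by rw [signD, if_pos (show n - 1 + 1 = n by omega)]⟩
  rw [h1] at h2
  obtain ⟨p, q, hp, hq, he⟩ := h2
  have h3 := (rootD_inj hn2 (by simp only [Fin.lt_def]; omega) (Fin.lt_def.mpr (by omega)) he).2.2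
  rw [signD, ite_self] at h3
  exact absurd h3 (by decide)

/-- Cardinality does not separate these orbits. What does is that members of the second contain some
`e_p + e_q` together with `e_p - e_q`, while a matching has one sign for each pair. -/
theorem orbit_matchD_ne_orbit_doubleD (hn : 2 ≤ n) {s : ℕ} (ht' : 2 * t ≤ n) (hs : 1 ≤ s)
    (hs' : 2 * s ≤ n) : orbit (D n) (matchD n t η) ≠
      orbit (D n) (doubleD n s) := by
  intro h
  have h1 := mem_orbit_self (isSL_D hn) (isOrthogonalSet_matchD (t := t) (η := η) hn).1
  rw [h] at h1
  obtain ⟨p, q, hpq, -, he⟩ := exists_of_mem_orbit_doubleD hn hs' h1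
  have h2 : ∀ ε, rootD (p ⟨0, hs⟩) (q ⟨0, hs⟩) ε ∈ matchD n t η := fun ε => by
    rw [he]; exact ⟨(_, ε), rfl⟩
  obtain ⟨a, b, ha, hb, e1⟩ := h2 1
  obtain ⟨a', b', ha', hb', e2⟩ := h2 (-1)
  obtain ⟨-, h3, h4⟩ := rootD_inj hn (hpq _) (Fin.lt_def.mpr (by omega)) e1
  obtain ⟨-, h5, h6⟩ := rootD_inj hn (hpq _) (Fin.lt_def.mpr (by omega)) e2
  rw [← h3] at h4
  rw [← h5, ← h4] at h6
  exact absurd h6 (by decide)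

theorem nonemptyAdmissibleOrbits_D (hn : 2 ≤ n) : nonemptyAdmissibleOrbits (D n) =
    {S | ∃ t, 1 ≤ t ∧ 2 * t ≤ n ∧ (S = orbit (D n) (matchD n t 1) ∨
      S = orbit (D n) (matchD n t (-1)) ∨
      S = orbit (D n) (doubleD n t))} := by
  have hC := isSL_D hn
  ext S
  constructor
  · rintro ⟨X, hX, hne, rfl⟩
    obtain ⟨t, ht, ht', ⟨η, h⟩ | h⟩ := hX.exists_orbit_D hn hne
    · refine ⟨t, ht, ht', ?_⟩
      rw [orbit_eq_of_mem hC (isOrthogonalSet_matchD hn).1 h]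
      rcases Int.units_eq_one_or η with rfl | rfl
      · exact Or.inl rfl
      · exact Or.inr (Or.inl rfl)
    · exact ⟨t, ht, ht', Or.inr (Or.inr (orbit_eq_of_mem hC (isOrthogonalSet_doubleD hn ht').1 h))⟩
  · rintro ⟨t, ht, ht', rfl | rfl | rfl⟩
    · exact ⟨_, isAdmissible_matchD hn ht', nonempty_of_one_le_ncard (ncard_matchD hn ht') ht, rfl⟩
    · exact ⟨_, isAdmissible_matchD hn ht', nonempty_of_one_le_ncard (ncard_matchD hn ht') ht, rfl⟩
    · exact ⟨_, isAdmissible_doubleD hn ht',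
        nonempty_of_one_le_ncard (ncard_doubleD hn ht') (by omega), rfl⟩

/-- Permuting the pairs together with their signs does not change the product of the signs, so there
is no parity obstruction even for `n = 2t`. -/
theorem quotient_matchD (hn : 2 ≤ n) (ht' : 2 * t ≤ n) :
    Nonempty (QuotientNC (D n) (matchD n t η) ≃* Equiv.Perm (Fin t)) := by
  rw [matchD_eq_range ht']
  refine quotientNC_of_perm (isSL_D hn) (matchD_family_injective hn ht')
    (fun k => rootD_mem_posRoots hn (Fin.lt_def.mpr (by simp only; omega)) _) (MonoidHom.id _)
    Function.injective_id (fun w _ π _ => ⟨π, rfl⟩) fun σ => ?_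
  have hinj := matchD_injective ht'
  obtain ⟨w, hw, h⟩ := exists_weyl_rootD hn
    (r := fun i => (⟨σ i, by omega⟩ : Fin n)) (s := fun i => ⟨2 * t - 1 - σ i, by omega⟩)
    (fun i : Fin t => signD n η ⟨2 * t - 1 - i, by omega⟩)
    (fun i : Fin t => signD n η ⟨2 * t - 1 - σ i, by omega⟩) hinj (by
      convert hinj.comp (Equiv.sumCongr σ σ).injective using 1
      ext (i | i) <;> rfl)
    (Or.inl (Equiv.prod_comp σ fun i : Fin t => signD n η ⟨2 * t - 1 - i, by omega⟩).symm)
  exact ⟨w, hw, fun k => Or.inl (h k)⟩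

theorem isTableLine_matchD (hn : 4 ≤ n) (ht : 1 ≤ t) (ht' : 2 * t ≤ n) :
    IsTableLine (D n) (orbit (D n) (matchD n t η)) t
      (sumType (typeA1Pow t) (typeD (n - 2 * t)))
      (sumType (A 1) (typeD (n - 2 * t))) (Equiv.Perm (Fin t)) := by
  have hn2 : 2 ≤ n := by omega
  refine isTableLine_of_rep (isSL_D hn2) (isOrthogonalSet_matchD hn2) (ncard_matchD hn2 ht')
    (2 * (n : ℤ) - 2 * t - 1) (fun β hβ => height_matchD hn2 hβ) (fun X hX hne => ?_)
    (hasCartanType_matchD hn2 ht') (nodesHaveType_matchD hn ht ht') (quotient_matchD hn2 ht')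
  by_contra hlow
  push Not at hlow
  exact hne (eq_matchD_of_height hn ht ht' hX hlow)

theorem exists_induces_doubleD (hn : 2 ≤ n) (ht' : 2 * t ≤ n) (g : SignedPerm (Fin t))
    (hg : SignedPerm.sgn g = 1 ∨ 2 * t < n) : ∃ w ∈ weylGroup (D n),
      Induces (fun k : Fin t × ℤˣ => rootD (⟨k.1, by omega⟩ : Fin n) ⟨k.1 + (n - t), by omega⟩ k.2)
        w (SignedPerm.toPerm g) := by
  have hinj := doubleD_injective ht'
  obtain ⟨w, hw, u, hu, h⟩ := exists_weyl_coord hn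
    (f' := Sum.elim (fun i => (⟨g.right i, by omega⟩ : Fin n))
      fun i => ⟨g.right i + (n - t), by omega⟩) hinj (by
      convert hinj.comp (Equiv.sumCongr g.right g.right).injective using 1
      ext (i | i) <;> rfl)
    (Sum.elim (fun _ => 1) fun i => g.left (g.right i)) (by
      rw [Fintype.prod_sum_type, Fintype.card_sum, Fintype.card_fin]
      simp only [Sum.elim_inl, Sum.elim_inr, Finset.prod_const_one, one_mul]
      rw [Equiv.prod_comp g.right g.left]
      refine hg.imp id fun h => by omega)
  refine ⟨w, hw, fun k => Or.inl (aD_injective hn ?_)⟩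
  have h1 := h (Sum.inl k.1) 1
  have h2 := h (Sum.inr k.1) (k.2 : ℤ)
  simp only [Sum.elim_inl, Sum.elim_inr, Units.val_one, one_mul] at h1 h2
  rw [hu, latticeMap_rootD hn, latticeMap_rootD hn, vecD, vecD, map_add, h1, h2]
  rfl

/-- Every induced permutation respects the pairs, hence is signed. The parity condition for `n = 2t`
is what cuts `W(B_t)` down to `W(D_t)`. -/
theorem exists_toPerm_of_induces (hn : 2 ≤ n) (ht' : 2 * t ≤ n)
    {w : LatticeAut (Fin n)} (hw : w ∈ weylGroup (D n))
    {π : Equiv.Perm (Fin t × ℤˣ)} (hπ : Induces (fun k : Fin t × ℤˣ =>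
      rootD (⟨k.1, by omega⟩ : Fin n) ⟨k.1 + (n - t), by omega⟩ k.2) w π) :
    ∃ g : SignedPerm (Fin t), (2 * t = n → SignedPerm.sgn g = 1) ∧ SignedPerm.toPerm g = π := by
  obtain ⟨r, s, θ, hrs, -, hθ, h⟩ := exists_image_matching_D hn (doubleD_injective ht') hw
  have key : ∀ i ε, ((π (i, ε)).1 : ℕ) = r i ∧ (π (i, ε)).2 = θ i * ε := by
    intro i ε
    have h1 := h i ε
    have h2 := hπ (i, ε)
    have hlt : (⟨(π (i, ε)).1, by omega⟩ : Fin n) < ⟨(π (i, ε)).1 + (n - t), by omega⟩ := by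
      simp only [Fin.lt_def]; omega
    have h3 := eq_of_eq_or_eq_neg (isSL_D hn) (rootD_mem_posRoots hn hlt (π (i, ε)).2)
      (rootD_mem_posRoots hn (hrs i) (θ i * ε)) (by
        rcases h1 with h1 | h1 <;> rcases h2 with h2 | h2 <;> simp only [h2] at h1
        · exact Or.inl h1
        · exact Or.inr (by rw [← h1, neg_neg])
        · exact Or.inr h1
        · exact Or.inl (neg_injective h1))
    obtain ⟨h4, -, h5⟩ := rootD_inj hn hlt (hrs i) h3
    exact ⟨congrArg Fin.val h4, h5⟩
  obtain ⟨g, hg⟩ := SignedPerm.exists_toPerm_eq π fun i =>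
    Fin.ext ((key i 1).1.trans (key i (-1)).1.symm)
  refine ⟨g, fun h2 => ?_, hg⟩
  have h3 : ∀ i, g.left (g.right i) = θ i := fun i => by
    have := (key i 1).2
    rw [← hg, SignedPerm.toPerm_apply] at this
    simpa using this
  rw [← hθ h2]
  exact (Equiv.prod_comp g.right g.left).symm.trans (Finset.prod_congr rfl fun i _ => h3 i)

theorem quotient_doubleD_of_lt (hn : 2 ≤ n) (ht' : 2 * t < n) :
    Nonempty (QuotientNC (D n) (doubleD n t) ≃* weylGroup (B t)) := by
  obtain ⟨e⟩ := weylGroup_B_mulEquiv t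
  rw [doubleD_eq_range ht'.le]
  obtain ⟨e'⟩ := quotientNC_of_perm (isSL_D hn) (doubleD_family_injective hn ht'.le)
    (fun k => rootD_mem_posRoots hn (Fin.lt_def.mpr (by simp only; omega)) _) SignedPerm.toPerm
    SignedPerm.toPerm_injective
    (fun w hw π hπ => (exists_toPerm_of_induces hn ht'.le hw hπ).imp fun g hg => hg.2)
    fun g => exists_induces_doubleD hn ht'.le g (Or.inr ht')
  exact ⟨e'.trans e.symm⟩

theorem quotient_doubleD_of_eq (hn : 4 ≤ n) (ht' : 2 * t = n) :
    Nonempty (QuotientNC (D n) (doubleD n t) ≃* weylGroup (D t)) := by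
  have hn2 : 2 ≤ n := by omega
  obtain ⟨e⟩ := weylGroup_D_mulEquiv (n := t) (by omega)
  rw [doubleD_eq_range ht'.le]
  obtain ⟨e'⟩ := quotientNC_of_perm (isSL_D hn2) (doubleD_family_injective hn2 ht'.le)
    (fun k => rootD_mem_posRoots hn2 (Fin.lt_def.mpr (by simp only; omega)) _)
    (SignedPerm.toPerm.comp (SignedPerm.sgn (m := Fin t)).ker.subtype)
    (SignedPerm.toPerm_injective.comp Subtype.val_injective)
    (fun w hw π hπ => by
      obtain ⟨g, h1, h2⟩ := exists_toPerm_of_induces hn2 ht'.le hw hπ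
      exact ⟨⟨g, h1 ht'⟩, h2⟩)
    fun g => exists_induces_doubleD hn2 ht'.le g.1 (Or.inl g.2)
  exact ⟨e'.trans e.symm⟩

theorem isTableLine_doubleD (hn : 4 ≤ n) (ht : 1 ≤ t) (ht' : 2 * t ≤ n) {G : Type} [Group G]
    (hG : Nonempty (QuotientNC (D n) (doubleD n t) ≃* G)) :
    IsTableLine (D n) (orbit (D n) (doubleD n t)) (2 * t)
      (typeD (n - 2 * t)) (A (n - 2 * t - 1)) G := by
  have hn2 : 2 ≤ n := by omega
  refine isTableLine_of_rep (isSL_D hn2) (isOrthogonalSet_doubleD hn2 ht') (ncard_doubleD hn2 ht')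
    ((n : ℤ) - t) (fun β hβ => height_doubleD hn2 hβ) (fun X hX hne => ?_)
    (hasCartanType_doubleD hn2 ht') (nodesHaveType_doubleD hn ht ht') hG
  by_contra hlow
  push Not at hlow
  exact hne (eq_doubleD_of_height hn2 ht' hX hlow)

/-- The automorphism of the lattice given by the symmetry of the Dynkin diagram. -/
def diagramSymm (hn : 2 ≤ n) : LatticeAut (Fin n) :=
  LinearEquiv.funCongrLeft ℤ ℤ (Equiv.swap ⟨n - 2, by omega⟩ ⟨n - 1, by omega⟩)

/-- Changing the sign of the last coordinate exchanges `e_{n-2} - e_{n-1}` and `e_{n-2} + e_{n-1}`,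
the two end nodes, and fixes the other simple roots. -/
theorem actsAs_diagramSymm (hn : 2 ≤ n) :
    ActsAs (aD n) SignedPerm.toEnd (diagramSymm hn) (SignedPerm.flip ⟨n - 1, by omega⟩) := by
  intro x
  have ha : ∀ i, aD n (Equiv.swap ⟨n - 2, by omega⟩ ⟨n - 1, by omega⟩ i) =
      SignedPerm.toEnd (SignedPerm.flip ⟨n - 1, by omega⟩) (aD n i) := by
    intro i
    have hi := i.2
    rw [SignedPerm.toEnd_flip, single_one_dotProduct]
    by_cases h1 : i = ⟨n - 2, by omega⟩
    · have h1' := congrArg Fin.val h1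
      rw [← h1, Equiv.swap_apply_left, aD_of_not_lt (by simp only; omega),
        aD_of_lt (k := i) (by simp only at h1'; omega)]
      funext x
      simp only [Pi.add_apply, Pi.sub_apply, Pi.smul_apply, Pi.single_apply, Fin.ext_iff,
        smul_eq_mul] at h1' ⊢
      split_ifs <;> omega
    · by_cases h2 : i = ⟨n - 1, by omega⟩
      · have h2' := congrArg Fin.val h2
        rw [← h2, Equiv.swap_apply_right, aD_of_lt (by simp only; omega),
          aD_of_not_lt (k := i) (by simp only at h2'; omega)]
        funext x
        simp only [Pi.add_apply, Pi.sub_apply, Pi.smul_apply, Pi.single_apply, Fin.ext_iff,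
          smul_eq_mul] at h2' ⊢
        split_ifs <;> omega
      · rw [Equiv.swap_apply_of_ne_of_ne h1 h2]
        simp only [Fin.ext_iff] at h1 h2
        rw [aD_of_lt (by omega)]
        funext x
        simp only [Pi.sub_apply, Pi.smul_apply, Pi.single_apply, Fin.ext_iff, smul_eq_mul]
        split_ifs <;> omega
  rw [latticeMap_apply, latticeMap_apply, map_sum]
  rw [← Equiv.sum_comp (Equiv.swap (⟨n - 2, by omega⟩ : Fin n) ⟨n - 1, by omega⟩)]
  refine Finset.sum_congr rfl fun i _ => ?_
  rw [ha, map_smul]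
  congr 1
  change x (Equiv.swap _ _ (Equiv.swap _ _ i)) = _
  rw [Equiv.swap_apply_self]

theorem diagramSymm_mem_isometries (hn : 2 ≤ n) : diagramSymm hn ∈ isometries (D n) := by
  rw [mem_isometries]
  intro x y
  rw [← dot_latticeMap (dot_aD hn), ← dot_latticeMap (dot_aD hn), actsAs_diagramSymm hn,
    actsAs_diagramSymm hn]
  refine Finset.sum_congr rfl fun i _ => ?_
  rw [SignedPerm.toEnd_apply, SignedPerm.toEnd_apply]
  simp only [SignedPerm.flip, SemidirectProduct.left_inl, SemidirectProduct.right_inl, inv_one,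
    Equiv.Perm.one_apply]
  rw [mul_mul_mul_comm, unit_mul_self, one_mul]

theorem act_diagramSymm_matchD (hn : 2 ≤ n) (ht' : 2 * t ≤ n) :
    act (D n) (diagramSymm hn) (matchD n t 1) = matchD n t (-1) := by
  rw [matchD_eq_range ht', matchD_eq_range ht']
  refine act_range (isSL_D hn) (fun k => rootD_mem_posRoots hn (by simp only [Fin.lt_def]; omega) _)
    fun k => Or.inl (aD_injective hn ?_)
  rw [actsAs_diagramSymm hn, latticeMap_rootD hn, latticeMap_rootD hn, SignedPerm.toEnd_flip,
    single_one_dotProduct]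
  funext x
  have hk := k.2
  simp only [vecD, signD, Pi.add_apply, Pi.sub_apply, Pi.smul_apply, Pi.single_apply, Fin.ext_iff,
    smul_eq_mul, ite_self, Units.val_one]
  by_cases h : 2 * t - 1 - (k : ℕ) + 1 = n
  · simp only [h, if_true, Units.val_neg, Units.val_one]
    split_ifs <;> omega
  · simp only [h, if_false, Units.val_one]
    split_ifs <;> omega

theorem outerConjugate_matchD (hn : 4 ≤ n) (ht' : 2 * t = n) :
    OuterConjugate (D n) (orbit (D n) (matchD n t 1))
      (orbit (D n) (matchD n t (-1))) := by
  have hn2 : 2 ≤ n := by omega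
  rw [← act_diagramSymm_matchD hn2 ht'.le]
  refine outerConjugate_of_isometry (isSL_D hn2) (diagramSymm_mem_isometries hn2)
    (isOrthogonalSet_matchD hn2).1 ?_
  rw [act_diagramSymm_matchD hn2 ht'.le]
  exact matchD_neg_notMem_orbit hn ht'

end LinesD

/-! ### The sums for types A and D -/

section Sums

/-- `n!² / (4ᵗ t!² (n - 2t)!)`, the square of the number of `t`-matchings of `n` points times
`(n - 2t)!`. -/
def matchTerm (n t : ℕ) : ℚ :=
  if 2 * t ≤ n then (n.factorial : ℚ) ^ 2 / (4 ^ t * (t.factorial : ℚ) ^ 2 * (n - 2 * t).factorial)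
  else 0

theorem matchTerm_zero (n : ℕ) : matchTerm n 0 = n.factorial := by
  rw [matchTerm, if_pos (by omega)]
  have : (n.factorial : ℚ) ≠ 0 := by exact_mod_cast n.factorial_ne_zero
  simp
  field_simp

/-- A telescoping identity: the difference of consecutive right-hand sides is the next summand,
after cancelling factorials. The cases `2(t + 1) > n` are separate, because some of the terms are
then 0 by definition. -/
theorem sum_matchTerm_succ (n M : ℕ) :
    ∑ t ∈ Finset.range (M + 1), (matchTerm (n + 1) t - (2 * n + 1) * matchTerm n t) =
      -(((n : ℚ) - 2 * M) * matchTerm n M) := by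
  induction M with
  | zero =>
    rw [Finset.sum_range_one, matchTerm_zero, matchTerm_zero, Nat.factorial_succ]
    push_cast
    ring
  | succ t ih =>
    rw [Finset.sum_range_succ, ih]
    have hfac : ∀ k : ℕ, (k.factorial : ℚ) ≠ 0 := fun k => by exact_mod_cast k.factorial_ne_zero
    by_cases h : 2 * (t + 1) ≤ n
    · obtain ⟨u, rfl⟩ : ∃ u, n = 2 * (t + 1) + u := ⟨n - 2 * (t + 1), by omega⟩
      rw [matchTerm, matchTerm, matchTerm, if_pos (by omega), if_pos (by omega), if_pos (by omega),
        show 2 * (t + 1) + u + 1 - 2 * (t + 1) = u + 1 by omega,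
        show 2 * (t + 1) + u - 2 * t = u + 2 by omega,
        show 2 * (t + 1) + u - 2 * (t + 1) = u by omega,
        Nat.factorial_succ (2 * (t + 1) + u), Nat.factorial_succ (u + 1), Nat.factorial_succ u,
        Nat.factorial_succ t]
      have h1 := hfac (2 * (t + 1) + u)
      have h2 := hfac u
      have h3 := hfac t
      have h4 : ((u : ℚ) + 1) ≠ 0 := by positivity
      have h5 : ((u : ℚ) + 1 + 1) ≠ 0 := by positivity
      have h6 : ((t : ℚ) + 1) ≠ 0 := by positivity
      push_cast
      field_simp
      ring
    · rw [matchTerm, matchTerm, matchTerm, if_neg h]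
      by_cases h' : 2 * (t + 1) = n + 1
      · obtain rfl : n = 2 * t + 1 := by omega
        rw [if_pos (by omega), if_pos (by omega), show 2 * t + 1 + 1 - 2 * (t + 1) = 0 by omega,
          show 2 * t + 1 - 2 * t = 1 by omega, Nat.factorial_succ (2 * t + 1), Nat.factorial_succ t]
        have h1 := hfac (2 * t + 1)
        have h3 := hfac t
        have h6 : ((t : ℚ) + 1) ≠ 0 := by positivity
        push_cast
        simp only [Nat.factorial_zero, Nat.factorial_one, Nat.cast_one]
        field_simp
        ring
      · rw [if_neg (show ¬2 * (t + 1) ≤ n + 1 by omega)]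
        by_cases h'' : 2 * t ≤ n
        · obtain rfl : n = 2 * t := by omega
          push_cast
          ring
        · rw [if_neg h'']
          ring

theorem sum_matchTerm (n M : ℕ) (h : n < 2 * M) :
    ∑ t ∈ Finset.range M, matchTerm n t = oddFactorial n := by
  induction n generalizing M with
  | zero =>
    obtain ⟨M, rfl⟩ : ∃ k, M = k + 1 := ⟨M - 1, by omega⟩
    rw [Finset.sum_range_succ', Finset.sum_eq_zero fun t _ => by rw [matchTerm, if_neg (by omega)],
      matchTerm_zero]
    simp [oddFactorial]
  | succ n ih =>
    obtain ⟨M, rfl⟩ : ∃ k, M = k + 1 := ⟨M - 1, by omega⟩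
    have h1 := sum_matchTerm_succ n M
    -- The boundary term vanishes: either `n = 2M`, or `2M > n` and the last factor is 0. Hence
    -- passing from `n` to `n + 1` multiplies the sum by `2n + 1`.
    have h2 : ((n : ℚ) - 2 * M) * matchTerm n M = 0 := by
      rw [matchTerm]
      split_ifs with h3
      · obtain rfl : n = 2 * M := by omega
        push_cast
        ring
      · ring
    rw [Finset.sum_sub_distrib, ← Finset.mul_sum, ih _ (by omega), h2, neg_zero, sub_eq_zero] at h1
    rw [h1, show oddFactorial (n + 1) = oddFactorial n * (2 * n + 1) from Finset.prod_range_succ _ _]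
    push_cast
    ring

theorem sum_matchTerm_Icc (n : ℕ) :
    ∑ t ∈ Finset.Icc 1 (n / 2), matchTerm n t = oddFactorial n - n.factorial := by
  have h := sum_matchTerm n (n / 2 + 1) (by omega)
  rw [Finset.sum_range_succ', matchTerm_zero] at h
  rw [← h, add_sub_cancel_right, show Finset.Icc 1 (n / 2) = Finset.Ico 1 (n / 2 + 1) by ext; simp,
    Finset.sum_Ico_eq_sum_range, Nat.add_sub_cancel]
  exact Finset.sum_congr rfl fun k _ => by rw [add_comm]

variable {ι : Type} [Fintype ι] [DecidableEq ι] {C : Matrix ι ι ℤ}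

theorem ncard_eq_of_orbit_eq (hC : IsSL C) {X Y : Set (ι → ℤ)} (hX : X ⊆ posRoots C)
    (hY : Y ⊆ posRoots C) (h : orbit C X = orbit C Y) : X.ncard = Y.ncard := by
  have h1 := mem_orbit_self hC hX
  rw [h] at h1
  obtain ⟨w, hw, rfl⟩ := h1
  exact ncard_act hC (weylGroup_le_isometries hC hw) hY

theorem orbitTerm_matchA {n t : ℕ} (ht : 1 ≤ t) (ht' : 2 * t ≤ n + 1) :
    (orbitTerm (A n) (orbit (A n) (matchA n t)) : ℚ) =
      matchTerm (n + 1) t := by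
  obtain ⟨m, h1, -, h2⟩ := (isTableLine_matchA ht ht').orbitTerm_eq (isSL_A n)
    (isOrthogonalSet_matchA ht') (isSL_A _)
  rw [card_weylGroup_A, card_weylGroup_A, Nat.card_eq_fintype_card, Fintype.card_perm,
    Fintype.card_fin] at h1
  rw [card_weylGroup_A] at h2
  -- For `2t = n + 1` the subtraction `n - 2t` is truncated to 0, and both factorials are 1.
  have e : (n - 2 * t + 1).factorial = (n + 1 - 2 * t).factorial := by
    by_cases h : 2 * t ≤ n
    · congr 1; omega
    · rw [show n - 2 * t = 0 by omega, show n + 1 - 2 * t = 0 by omega]; rfl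
  rw [e] at h1 h2
  rw [h2, matchTerm, if_pos ht', ← h1]
  have hfac : ∀ k : ℕ, (k.factorial : ℚ) ≠ 0 := fun k => by exact_mod_cast k.factorial_ne_zero
  have h3 := hfac t
  have h4 := hfac (n + 1 - 2 * t)
  have h5 : (4 : ℚ) ^ t = 2 ^ t * 2 ^ t := by rw [← mul_pow]; norm_num
  rw [h5]
  push_cast
  field_simp

theorem orbitSum_A (n : ℕ) : orbitSum (A n) = oddFactorial (n + 1) := by
  classical
  have hC := isSL_A n
  rw [orbitSum_eq hC ((Finset.Icc 1 ((n + 1) / 2)).image fun t =>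
    orbit (A n) (matchA n t)) (by
      rw [nonemptyAdmissibleOrbits_A]
      ext S
      simp only [Set.mem_ofPred_eq, Finset.coe_image, Finset.coe_Icc, Set.mem_image, Set.mem_Icc]
      constructor
      · rintro ⟨t, h1, h2, rfl⟩; exact ⟨t, ⟨h1, by omega⟩, rfl⟩
      · rintro ⟨t, ⟨h1, h2⟩, rfl⟩; exact ⟨t, h1, by omega, rfl⟩)]
  rw [Finset.sum_image]
  · have h := sum_matchTerm_Icc (n + 1)
    have h' : ∑ t ∈ Finset.Icc 1 ((n + 1) / 2), (orbitTerm (A n)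
        (orbit (A n) (matchA n t)) : ℚ) = _ :=
      (Finset.sum_congr rfl fun t ht => by
        rw [Finset.mem_Icc] at ht
        exact orbitTerm_matchA ht.1 (by omega)).trans h
    rw [eq_sub_iff_add_eq, add_comm] at h'
    rw [card_weylGroup_A]
    exact_mod_cast h'
  · intro t ht s hs h
    rw [Finset.coe_Icc, Set.mem_Icc] at ht hs
    have := ncard_eq_of_orbit_eq hC (isOrthogonalSet_matchA (by omega)).1
      (isOrthogonalSet_matchA (by omega)).1 h
    rwa [ncard_matchA (by omega), ncard_matchA (by omega)] at this

theorem card_weylGroup_B (n : ℕ) :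
    Nat.card (weylGroup (B n)) = 2 ^ n * n.factorial := by
  obtain ⟨e⟩ := weylGroup_B_mulEquiv n
  rw [Nat.card_congr e.toEquiv, SignedPerm.card_eq, Fintype.card_fin]

/-- The factor 2 for `n = 2t` accounts for the two orbits of half size, so in every case the
matchings of size `t` contribute `2ⁿ` times the common term. -/
theorem orbitTerm_matchD {n t : ℕ} {η : ℤˣ} (hn : 4 ≤ n) (ht : 1 ≤ t) (ht' : 2 * t ≤ n) :
    (if 2 * t = n then 2 else 1) *
      (orbitTerm (D n) (orbit (D n) (matchD n t η)) : ℚ) =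
      2 ^ n * matchTerm n t := by
  have hn2 : 2 ≤ n := by omega
  obtain ⟨m, h1, -, h2⟩ := (isTableLine_matchD (η := η) hn ht ht').orbitTerm_eq (isSL_D hn2)
    (isOrthogonalSet_matchD hn2) (isSL_sumType (isSL_typeA1Pow t) (isSL_typeD _))
  rw [card_weylGroup_D hn2, card_weylGroup_sumType (isSL_typeA1Pow t) (isSL_typeD _),
    card_weylGroup_typeA1Pow, card_weylGroup_typeD, Nat.card_eq_fintype_card, Fintype.card_perm,
    Fintype.card_fin] at h1
  rw [card_weylGroup_sumType (isSL_A 1) (isSL_typeD _), card_weylGroup_A,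
    card_weylGroup_typeD] at h2
  rw [h2, matchTerm, if_pos ht']
  have hfac : ∀ k : ℕ, (k.factorial : ℚ) ≠ 0 := fun k => by exact_mod_cast k.factorial_ne_zero
  have h3 := hfac t
  have h5 : (4 : ℚ) ^ t = 2 ^ t * 2 ^ t := by rw [← mul_pow]; norm_num
  have hq : (m : ℚ) * (t.factorial * (2 ^ t * (2 ^ t * (2 ^ (n - 2 * t - 1) *
      (n - 2 * t).factorial)))) = 2 ^ (n - 1) * n.factorial := by exact_mod_cast h1
  rw [h5]
  rcases eq_or_lt_of_le ht' with h | h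
  · subst h
    obtain ⟨k, rfl⟩ : ∃ k, t = k + 1 := ⟨t - 1, by omega⟩
    rw [if_pos rfl]
    simp only [Nat.sub_self, Nat.factorial_zero, Nat.cast_one, Nat.zero_sub, pow_zero, mul_one,
      show 2 * (k + 1) - 1 = 2 * k + 1 by omega] at hq ⊢
    have h6 : ((2 * (k + 1)).factorial : ℚ) = 2 * m * (k + 1).factorial := by
      have h7 : (2 : ℚ) ^ (2 * k + 1) ≠ 0 := by positivity
      apply mul_left_cancel₀ h7
      rw [← hq]
      ring
    rw [h6]
    push_cast
    field_simp
    ring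
  · obtain ⟨u, rfl⟩ : ∃ u, n = 2 * t + (u + 1) := ⟨n - 2 * t - 1, by omega⟩
    rw [if_neg (by omega)]
    simp only [show 2 * t + (u + 1) - 2 * t = u + 1 by omega, Nat.add_sub_cancel,
      show 2 * t + (u + 1) - 1 = 2 * t + u by omega] at hq ⊢
    have h4 := hfac (u + 1)
    have h6 : ((2 * t + (u + 1)).factorial : ℚ) = m * t.factorial * (u + 1).factorial := by
      have h7 : (2 : ℚ) ^ (2 * t + u) ≠ 0 := by positivity
      apply mul_left_cancel₀ h7
      rw [← hq]
      ring
    rw [h6]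
    push_cast
    simp only [Nat.factorial_succ 1, Nat.factorial_one]
    field_simp
    ring

theorem orbitTerm_doubleD {n t : ℕ} (hn : 4 ≤ n) (ht : 1 ≤ t) (ht' : 2 * t ≤ n) :
    (orbitTerm (D n) (orbit (D n) (doubleD n t)) : ℚ) =
      matchTerm n t := by
  have hn2 : 2 ≤ n := by omega
  have hfac : ∀ k : ℕ, (k.factorial : ℚ) ≠ 0 := fun k => by exact_mod_cast k.factorial_ne_zero
  have h3 := hfac t
  have h5 : (4 : ℚ) ^ t = 2 ^ t * 2 ^ t := by rw [← mul_pow]; norm_num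
  rw [matchTerm, if_pos ht', h5]
  rcases eq_or_lt_of_le ht' with h | h
  · obtain ⟨m, h1, -, h2⟩ := (isTableLine_doubleD hn ht ht'
      (quotient_doubleD_of_eq hn h)).orbitTerm_eq (isSL_D hn2) (isOrthogonalSet_doubleD hn2 ht')
      (isSL_typeD _)
    rw [card_weylGroup_D hn2, card_weylGroup_typeD, card_weylGroup_D (by omega)] at h1
    rw [card_weylGroup_A] at h2
    rw [h2]
    have hq : (m : ℚ) * (2 ^ (t - 1) * t.factorial * (2 ^ (2 * t) * (2 ^ (n - 2 * t - 1) *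
      (n - 2 * t).factorial))) = 2 ^ (n - 1) * n.factorial := by exact_mod_cast h1
    subst h
    obtain ⟨k, rfl⟩ : ∃ k, t = k + 1 := ⟨t - 1, by omega⟩
    simp only [Nat.sub_self, Nat.factorial_zero, Nat.cast_one, Nat.zero_sub, pow_zero, mul_one,
      show 2 * (k + 1) - 1 = 2 * k + 1 by omega, Nat.add_sub_cancel] at hq ⊢
    have h6 : ((2 * (k + 1)).factorial : ℚ) = 2 ^ (k + 1) * m * (k + 1).factorial := by
      have h7 : (2 : ℚ) ^ (2 * k + 1) ≠ 0 := by positivity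
      apply mul_left_cancel₀ h7
      rw [← hq]
      ring
    rw [h6]
    push_cast
    simp only [Nat.factorial_one, Nat.cast_one]
    field_simp
  · obtain ⟨m, h1, -, h2⟩ := (isTableLine_doubleD hn ht ht'
      (quotient_doubleD_of_lt hn2 h)).orbitTerm_eq (isSL_D hn2) (isOrthogonalSet_doubleD hn2 ht')
      (isSL_typeD _)
    rw [card_weylGroup_D hn2, card_weylGroup_typeD, card_weylGroup_B] at h1
    rw [card_weylGroup_A] at h2
    rw [h2]
    have hq : (m : ℚ) * (2 ^ t * t.factorial * (2 ^ (2 * t) * (2 ^ (n - 2 * t - 1) *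
      (n - 2 * t).factorial))) = 2 ^ (n - 1) * n.factorial := by exact_mod_cast h1
    obtain ⟨u, rfl⟩ : ∃ u, n = 2 * t + (u + 1) := ⟨n - 2 * t - 1, by omega⟩
    simp only [show 2 * t + (u + 1) - 2 * t = u + 1 by omega, Nat.add_sub_cancel,
      show 2 * t + (u + 1) - 1 = 2 * t + u by omega] at hq ⊢
    have h4 := hfac (u + 1)
    have h6 : ((2 * t + (u + 1)).factorial : ℚ) = 2 ^ t * m * t.factorial * (u + 1).factorial := by
      have h7 : (2 : ℚ) ^ (2 * t + u) ≠ 0 := by positivity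
      apply mul_left_cancel₀ h7
      rw [← hq]
      ring
    rw [h6]
    push_cast
    field_simp

theorem orbitSum_D {n : ℕ} (hn : 4 ≤ n) : (orbitSum (D n) : ℤ) =
    (2 ^ n + 1) * (oddFactorial n : ℤ) - (2 ^ (n - 1) + 1) * (n.factorial : ℤ) := by
  classical
  have hn2 : 2 ≤ n := by omega
  have hC := isSL_D hn2
  let O : ℕ → ℤˣ → Set (Set (Fin n → ℤ)) := fun t η => orbit (D n) (matchD n t η)
  let O₂ : ℕ → Set (Set (Fin n → ℤ)) := fun t => orbit (D n) (doubleD n t)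
  have hterm : ∀ t ∈ Finset.Icc 1 (n / 2),
      ((∑ S ∈ ({O t 1, O t (-1), O₂ t} : Finset _), orbitTerm (D n) S : ℕ) : ℚ) =
        (2 ^ n + 1) * matchTerm n t := by
    intro t ht
    rw [Finset.mem_Icc] at ht
    have ht' : 2 * t ≤ n := by omega
    have h1 := fun η => orbitTerm_matchD (η := η) hn ht.1 ht'
    have h2 := orbitTerm_doubleD hn ht.1 ht'
    have hne : ∀ η, O t η ≠ O₂ t := fun η => orbit_matchD_ne_orbit_doubleD hn2 ht' ht.1 ht'
    rcases eq_or_lt_of_le ht' with h | h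
    · have hne' : O t 1 ≠ O t (-1) := fun he => matchD_neg_notMem_orbit hn h (by
        have := mem_orbit_self hC (isOrthogonalSet_matchD (t := t) (η := -1) hn2).1
        rwa [show orbit (D n) (matchD n t (-1)) = _ from he.symm] at this)
      rw [Finset.sum_insert (by simp [hne, hne']), Finset.sum_pair (hne _)]
      have h3 := h1 1
      have h4 := h1 (-1)
      rw [if_pos h] at h3 h4
      push_cast
      linarith
    -- For `2t < n` the two signs give the same orbit, and the listed set of three orbits has only
    -- two elements.
    · have he : O t (-1) = O t 1 := by
        simp only [O]; rw [matchD_eq_of_lt h]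
      rw [he, Finset.insert_eq_of_mem (by simp), Finset.sum_pair (hne _)]
      have h3 := h1 1
      rw [if_neg (by omega), one_mul] at h3
      push_cast
      linarith
  rw [orbitSum_eq hC ((Finset.Icc 1 (n / 2)).biUnion fun t => {O t 1, O t (-1), O₂ t}) (by
      rw [nonemptyAdmissibleOrbits_D hn2]
      ext S
      simp only [Set.mem_ofPred_eq, Finset.coe_biUnion, Set.mem_iUnion, Finset.mem_coe,
        Finset.mem_Icc, Finset.mem_insert, Finset.mem_singleton]
      constructor
      · rintro ⟨t, h1, h2, h⟩; exact ⟨t, ⟨h1, by omega⟩, h⟩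
      · rintro ⟨t, ⟨h1, h2⟩, h⟩; exact ⟨t, h1, by omega, h⟩), Finset.sum_biUnion]
  · have h := sum_matchTerm_Icc n
    have h' : ((∑ t ∈ Finset.Icc 1 (n / 2), ∑ S ∈ ({O t 1, O t (-1), O₂ t} : Finset _),
        orbitTerm (D n) S : ℕ) : ℚ) =
        (2 ^ n + 1) * ((oddFactorial n : ℚ) - n.factorial) := by
      rw [← h, Finset.mul_sum]
      push_cast
      refine Finset.sum_congr rfl fun t ht => ?_
      rw [← hterm t ht]
      push_cast
      rfl
    have h'' : ((∑ t ∈ Finset.Icc 1 (n / 2), ∑ S ∈ ({O t 1, O t (-1), O₂ t} : Finset _),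
        orbitTerm (D n) S : ℕ) : ℤ) =
        (2 ^ n + 1) * ((oddFactorial n : ℤ) - n.factorial) := by exact_mod_cast h'
    -- The empty set contributes `2ⁿ⁻¹ n!`, which combines with `-(2ⁿ + 1) n!` to the stated
    -- subtraction.
    rw [Nat.cast_add, h'', card_weylGroup_D hn2]
    obtain ⟨k, rfl⟩ : ∃ k, n = k + 1 := ⟨n - 1, by omega⟩
    push_cast
    rw [pow_succ]
    ring
  · intro t ht s hs hts
    rw [Finset.coe_Icc, Set.mem_Icc] at ht hs
    have k1 : ∀ η δ, O t η ≠ O s δ := fun η δ h => by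
      have := ncard_eq_of_orbit_eq hC (isOrthogonalSet_matchD hn2).1
        (isOrthogonalSet_matchD hn2).1 h
      rw [ncard_matchD hn2 (by omega), ncard_matchD hn2 (by omega)] at this
      exact hts this
    have k2 : O₂ t ≠ O₂ s := fun h => by
      have := ncard_eq_of_orbit_eq hC (isOrthogonalSet_doubleD hn2 (by omega)).1
        (isOrthogonalSet_doubleD hn2 (by omega)).1 h
      rw [ncard_doubleD hn2 (by omega), ncard_doubleD hn2 (by omega)] at this
      omega
    have k3 : ∀ η, O t η ≠ O₂ s := fun η =>
      orbit_matchD_ne_orbit_doubleD hn2 (by omega) hs.1 (by omega)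
    have k4 : ∀ η, O s η ≠ O₂ t := fun η =>
      orbit_matchD_ne_orbit_doubleD hn2 (by omega) ht.1 (by omega)
    rw [Function.onFun, Finset.disjoint_left]
    intro S h1 h2
    simp only [Finset.mem_insert, Finset.mem_singleton] at h1 h2
    rcases h1 with rfl | rfl | rfl <;> rcases h2 with h2 | h2 | h2
    · exact k1 _ _ h2
    · exact k1 _ _ h2
    · exact k3 _ h2
    · exact k1 _ _ h2
    · exact k1 _ _ h2
    · exact k3 _ h2
    · exact k4 _ h2.symm
    · exact k4 _ h2.symm
    · exact k2 h2

end Sums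

/-! ### Classification of the orbits in types E -/

section OrbitsE

variable {n N : ℕ}

theorem mem_orbit_trans {ι : Type} [Fintype ι] [DecidableEq ι] {C : Matrix ι ι ℤ} (hC : IsSL C)
    {X Y Z : Set (ι → ℤ)} (hX : X ⊆ posRoots C) (h : Y ∈ orbit C X) (h' : Z ∈ orbit C Y) :
    Z ∈ orbit C X := orbit_eq_of_mem hC hX h ▸ h'

namespace IsRootTable

/-- Every nonempty admissible set has a conjugate given by one of the lists. -/
def Represents (T : IsRootTable n N) (R : List (List ℕ)) : Prop :=
  ∀ X, IsAdmissible (cartanE n T.le) X → X.Nonempty →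
    ∃ l ∈ R, eSet n l ∈ orbit (cartanE n T.le) X

/-- The representing lists have different lengths, so two admissible sets of the same size reach the
same list. -/
theorem orbit_eq (T : IsRootTable n N) {R : List (List ℕ)} (hR : T.Represents R)
    (hRl : ∀ l ∈ R, IsOrthList N l)
    (hRi : ∀ l ∈ R, ∀ l' ∈ R, l.length = l'.length → l = l') {X Y : Set (Fin n → ℤ)}
    (hX : IsAdmissible (cartanE n T.le) X) (hY : IsAdmissible (cartanE n T.le) Y)
    (hne : X.Nonempty) (h : X.ncard = Y.ncard) :
    orbit (cartanE n T.le) X = orbit (cartanE n T.le) Y := by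
  have hne' : Y.Nonempty := nonempty_of_one_le_ncard h.symm
    ((Set.ncard_pos ((posRoots_finite T.isSL).subset hX.1.1)).mpr hne)
  have key : ∀ {Z : Set (Fin n → ℤ)} {l : List ℕ}, Z ⊆ posRoots (cartanE n T.le) →
      IsOrthList N l → eSet n l ∈ orbit (cartanE n T.le) Z → l.length = Z.ncard := by
    intro Z l hZ hl h
    rw [← T.ncard_eSet hl]
    obtain ⟨w, hw, h⟩ := h
    rw [h, ncard_act T.isSL (weylGroup_le_isometries T.isSL hw) hZ]
  obtain ⟨l, hl, h1⟩ := hR X hX hne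
  obtain ⟨l', hl', h2⟩ := hR Y hY hne'
  have := hRi l hl l' hl' (by
    rw [key hX.1.1 (hRl l hl) h1, key hY.1.1 (hRl l' hl') h2, h])
  subst this
  rw [← orbit_eq_of_mem T.isSL hX.1.1 h1, orbit_eq_of_mem T.isSL hY.1.1 h2]

theorem nonemptyAdmissibleOrbits_eq (T : IsRootTable n N) {R : List (List ℕ)}
    (hR : T.Represents R) (S : List (List ℕ))
    (hRl : ∀ l ∈ R, IsOrthList N l := by decide +kernel)
    (hRi : ∀ l ∈ R, ∀ l' ∈ R, l.length = l'.length → l = l' := by decide +kernel)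
    (hS : ∀ B ∈ S, B ≠ [] ∧ IsOrthList N B ∧ ∀ d < N,
      (B.filter fun i => !orthB d i).length ≠ 3 := by decide +kernel)
    (hRS : ∀ l ∈ R, ∃ B ∈ S, B.length = l.length := by decide +kernel) :
    nonemptyAdmissibleOrbits (cartanE n T.le) =
      {O | O ∈ S.map fun B => orbit (cartanE n T.le) (eSet n B)} := by
  ext O
  rw [Set.mem_ofPred_eq, List.mem_map]
  constructor
  · rintro ⟨X, hX, hne, rfl⟩
    obtain ⟨l, hl, w, hw, h1⟩ := hR X hX hne
    obtain ⟨B, hB, h2⟩ := hRS l hl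
    refine ⟨B, hB, (T.orbit_eq hR hRl hRi hX (T.isAdmissible (hS B hB).2.1 (hS B hB).2.2) hne ?_).symm⟩
    rw [T.ncard_eSet (hS B hB).2.1, h2, ← T.ncard_eSet (hRl l hl), h1,
      ncard_act T.isSL (weylGroup_le_isometries T.isSL hw) hX.1.1]
  · rintro ⟨B, hB, rfl⟩
    obtain ⟨h1, h2, h3⟩ := hS B hB
    obtain ⟨b, hb⟩ := List.exists_mem_of_ne_nil B h1
    exact ⟨_, T.isAdmissible h2 h3, ⟨_, b, hb, rfl⟩, rfl⟩

theorem orbitSum_eq (T : IsRootTable n N) {S : List (List ℕ)}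
    (h : nonemptyAdmissibleOrbits (cartanE n T.le) =
      {O | O ∈ S.map fun B => orbit (cartanE n T.le) (eSet n B)})
    (hS : ∀ B ∈ S, IsOrthList N B := by decide +kernel)
    (hSi : S.Pairwise fun B B' => B.length ≠ B'.length := by decide +kernel) :
    orbitSum (cartanE n T.le) = Nat.card (weylGroup (cartanE n T.le)) +
      (S.map fun B => orbitTerm (cartanE n T.le) (orbit (cartanE n T.le) (eSet n B))).sum := by
  classical
  rw [ADE.orbitSum_eq T.isSL (S.map fun B => orbit (cartanE n T.le) (eSet n B)).toFinset
    (by rw [h, List.coe_toFinset]), List.sum_toFinset, List.map_map]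
  · rfl
  · rw [List.Nodup, List.pairwise_map]
    refine hSi.imp_of_mem fun {B B'} hB hB' hne he => hne ?_
    have := ncard_eq_of_orbit_eq T.isSL (T.isOrthogonalSet (hS B hB)).1
      (T.isOrthogonalSet (hS B' hB')).1 he
    rwa [T.ncard_eSet (hS B hB), T.ncard_eSet (hS B' hB')] at this

/-- There are as many conjugates of a root as there are positive roots. -/
theorem ncard_orbit_root (T : IsRootTable n N) {R : List (List ℕ)} (hR : T.Represents R) {b : ℕ}
    (hRl : ∀ l ∈ R, IsOrthList N l := by decide +kernel)
    (hRi : ∀ l ∈ R, ∀ l' ∈ R, l.length = l'.length → l = l' := by decide +kernel)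
    (hb : b < N := by decide +kernel) :
    (orbit (cartanE n T.le) (eSet n [b])).ncard = N := by
  have hl : ∀ i < N, IsOrthList N [i] := fun i hi => ⟨by simpa using hi, List.pairwise_singleton _ _⟩
  have hadm : ∀ i < N, IsAdmissible (cartanE n T.le) (eSet n [i]) := fun i hi =>
    T.isAdmissible (hl i hi) fun d _ => by
      have := List.length_filter_le (fun i => !orthB d i) [i]
      simp only [List.length_singleton] at this
      omega
  have h : orbit (cartanE n T.le) (eSet n [b]) = (fun i => eSet n [i]) '' (Set.Iio N) := by
    ext X
    constructor
    · rintro ⟨w, hw, rfl⟩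
      have h1 := ncard_act T.isSL (weylGroup_le_isometries T.isSL hw) (hadm b hb).1.1
      rw [T.ncard_eSet (hl b hb), List.length_singleton, Set.ncard_eq_one] at h1
      obtain ⟨β, hβ⟩ := h1
      have h2 : β ∈ act (cartanE n T.le) w (eSet n [b]) := by rw [hβ]; rfl
      obtain ⟨i, hi, rfl⟩ := T.exists_index (act_subset _ _ h2)
      refine ⟨i, hi, ?_⟩
      rw [hβ]
      ext γ
      simp [eSet]
    · rintro ⟨i, hi, rfl⟩
      have h1 := T.orbit_eq hR hRl hRi (hadm i hi) (hadm b hb) ⟨_, i, by simp, rfl⟩ (by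
        rw [T.ncard_eSet (hl i hi), T.ncard_eSet (hl b hb)]; rfl)
      rw [← h1]
      exact mem_orbit_self T.isSL (hadm i hi).1.1
  rw [h, Set.InjOn.ncard_image, ← Nat.card_coe_set_eq, Nat.card_eq_fintype_card]
  · simp
  · intro i hi j hj hij
    have : eRoot n i ∈ eSet n [j] := by rw [← show eSet n [i] = eSet n [j] from hij]; exact ⟨i, by simp, rfl⟩
    obtain ⟨k, hk, he⟩ := this
    rw [List.mem_singleton] at hk
    subst hk
    exact T.injective hi hj he

/-- `X` has a conjugate given by one of the lists of `R`, if this holds for every conjugate that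
contains the roots of `l`. -/
def Covers (T : IsRootTable n N) (R : List (List ℕ)) (l : List ℕ) : Prop :=
  ∀ X, IsAdmissible (cartanE n T.le) X → eSet n l ⊆ X →
    ∃ l' ∈ R, eSet n l' ∈ orbit (cartanE n T.le) X

/-- Either `X` consists of the roots of `l` alone, and `l` must be on the list, or a conjugate of
`X` contains `a` as well. -/
theorem Covers.of_step (T : IsRootTable n N) {R : List (List ℕ)} {l : List ℕ} {a : ℕ}
    (h : T.Covers R (a :: l)) (hl : IsOrthList N l := by decide +kernel)
    (hlR : l ∈ R := by decide +kernel) (ha : a < N := by decide +kernel)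
    (hpa : perpB l a = true := by decide +kernel)
    (hlink : ∀ j < N, perpB l j = true → linkB N l a j = true := by decide +kernel) :
    T.Covers R l := by
  intro X hX hlX
  rcases T.step_all hX hl hlX a ha hpa hlink with rfl | ⟨X', hX', hadm, hsub⟩
  · exact ⟨l, hlR, mem_orbit_self T.isSL hX.1.1⟩
  · obtain ⟨l', hl', h'⟩ := h X' hadm hsub
    exact ⟨l', hl', mem_orbit_trans T.isSL hX.1.1 hX' h'⟩

/-- Here `l` itself need not be on the list: the root `d` meets exactly three of its members, so `l`
alone is not admissible and `c` is forced. -/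
theorem Covers.of_closure (T : IsRootTable n N) {R : List (List ℕ)} {l : List ℕ} {c : ℕ}
    (h : T.Covers R (c :: l)) (d : ℕ) (hl : IsOrthList N l := by decide +kernel)
    (hd : d < N := by decide +kernel)
    (h3 : (l.filter fun i => !orthB d i).length = 3 := by decide +kernel)
    (hc : ∀ j < N, perpB l j = true → orthB d j = false → j = c := by decide +kernel) : T.Covers R l :=
  fun X hX hlX => h X hX (eSet_cons_subset (T.mem_of_closure hX hl hlX d c hd h3 hc) hlX)

theorem Covers.mono {T : IsRootTable n N} {R : List (List ℕ)} {l l' : List ℕ} (h : T.Covers R l)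
    (hl : ∀ i ∈ l, i ∈ l' := by decide +kernel) : T.Covers R l' :=
  fun X hX hX' => h X hX fun _ ⟨i, hi, e⟩ => hX' ⟨i, hl i hi, e⟩

theorem Covers.of_cons (T : IsRootTable n N) {R : List (List ℕ)} {l : List ℕ}
    (h : ∀ j < N, perpB l j = true → T.Covers R (j :: l)) (hl : IsOrthList N l := by decide +kernel)
    (hlR : l ∈ R := by decide +kernel) : T.Covers R l := by
  intro X hX hlX
  by_cases hXl : X ⊆ eSet n l
  · rw [Set.Subset.antisymm hXl hlX]
    exact ⟨l, hlR, mem_orbit_self T.isSL (T.isOrthogonalSet hl).1⟩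
  · obtain ⟨β, hβ, hne⟩ := Set.not_subset.mp hXl
    obtain ⟨j, hj, rfl⟩ := T.exists_index (hX.1.1 hβ)
    refine h j hj (perpB_iff.mpr fun i hi => ?_) X hX (eSet_cons_subset hβ hlX)
    rw [T.orth_iff (hl.1 i hi) hj]
    exact hX.1.2 _ (hlX ⟨i, hi, rfl⟩) _ hβ fun h => hne ⟨i, hi, h.symm⟩

theorem Covers.of_perp (T : IsRootTable n N) {R : List (List ℕ)} {l : List ℕ}
    (hl : IsOrthList N l := by decide +kernel) (hlR : l ∈ R := by decide +kernel)
    (h : ∀ j < N, perpB l j = false := by decide +kernel) : T.Covers R l :=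
  of_cons T (fun j hj hp => absurd (h j hj) (by simp [hp])) hl hlR

theorem Covers.represents (T : IsRootTable n N) {R : List (List ℕ)} {a : ℕ}
    (h : T.Covers R [a]) (ha : a < N := by decide +kernel)
    (hlink : ∀ j < N, linkB N [] a j = true := by decide +kernel) :
    T.Represents R := by
  intro X hX hne
  rcases T.step_all hX (l := []) ⟨by simp, List.Pairwise.nil⟩ (by rintro _ ⟨i, hi, -⟩; simp at hi) a
    ha rfl (fun j hj _ => hlink j hj) with rfl | ⟨X', hX', hadm, hsub⟩
  · obtain ⟨_, i, hi, -⟩ := hne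
    simp at hi
  · obtain ⟨l', hl', h'⟩ := h X' hadm hsub
    exact ⟨l', hl', mem_orbit_trans T.isSL hX.1.1 hX' h'⟩

end IsRootTable

open IsRootTable

/-- The roots 0, 2 and 5 are added by conjugation. Root 18 meets all three and forces 35, after
which no orthogonal root is left. -/
theorem represents_six : table_six.Represents [[0], [2, 0], [35, 5, 2, 0]] :=
  Covers.represents _ (a := 0) (Covers.of_step _ (a := 2) (Covers.of_step _ (a := 5)
    (Covers.of_closure _ (c := 35) (Covers.of_perp _) 18)))

/-- After 0, 2, 5 and the forced root 35, root 41 can be added by conjugation; it then forces 50, 57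
and 119 in turn, through the roots 3, 1 and 63. -/
theorem represents_eight : table_eight.Represents
    [[0], [2, 0], [35, 5, 2, 0], [119, 57, 50, 41, 35, 5, 2, 0]] :=
  Covers.represents _ (a := 0) (Covers.of_step _ (a := 2) (Covers.of_step _ (a := 5)
    (Covers.of_closure _ (c := 35) (Covers.of_step _ (a := 41) (Covers.of_closure _ (c := 50)
    (Covers.of_closure _ (c := 57) (Covers.of_closure _ (c := 119) (Covers.of_perp _) 63) 1) 3))
    18)))

/-- Two orthogonal roots can be extended to three in inequivalent ways: root 41 is not linked to 5
over them. This is the source of the additional orbit of sets with three elements. -/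
theorem represents_seven : table_seven.Represents
    [[0], [2, 0], [41, 2, 0], [35, 5, 2, 0], [57, 50, 41, 35, 5, 2, 0]] := by
  have h41 : table_seven.Covers [[0], [2, 0], [41, 2, 0], [35, 5, 2, 0],
      [57, 50, 41, 35, 5, 2, 0]] [41, 35, 5, 2, 0] := Covers.of_closure _ (c := 50)
    (Covers.of_closure _ (c := 57) (Covers.of_perp _) 1) 3
  have h5 := Covers.of_closure (l := [5, 2, 0]) _ (c := 35) (Covers.of_cons _ fun j hj hp => by
      -- Only three roots are orthogonal to the four already present, and any one of them forces all
      -- three.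
      rcases (by decide +kernel : ∀ j < 63, perpB [35, 5, 2, 0] j = true →
        j = 41 ∨ j = 50 ∨ j = 57) j hj hp with rfl | rfl | rfl
      · exact h41
      · exact Covers.of_closure _ (c := 41) h41.mono 3
      · exact Covers.of_closure _ (c := 41) h41.mono 4) 18
  refine Covers.represents _ (a := 0) (Covers.of_step _ (a := 2) ?_)
  intro X hX hlX
  rcases table_seven.step hX (by decide +kernel) hlX 5 (by norm_num) (by decide +kernel)
    with h | ⟨X', hX', hadm, hsub⟩
  -- Nothing in `X` beyond 2 and 0 is linked to 5, which leaves only 41 as a possible further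
  -- member.
  · have h' : ∀ β ∈ X, ∃ i ∈ [41, 2, 0], β = eRoot 7 i := by
      intro β hβ
      obtain ⟨i, rfl, hi | ⟨hi, hp, hn⟩⟩ := h β hβ
      · exact ⟨i, List.mem_cons_of_mem _ hi, rfl⟩
      · exact ⟨41, by simp, by rw [(by decide +kernel : ∀ i < 63, perpB [2, 0] i = true →
          linkB 63 [2, 0] 5 i = false → i = 41) i hi hp hn]⟩
    by_cases h41 : eRoot 7 41 ∈ X
    · refine ⟨[41, 2, 0], by simp, ?_⟩
      rw [← show X = eSet 7 [41, 2, 0] from Set.Subset.antisymm h' (eSet_cons_subset h41 hlX)]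
      exact mem_orbit_self table_seven.isSL hX.1.1
    · refine ⟨[2, 0], by simp, ?_⟩
      have : X = eSet 7 [2, 0] := Set.Subset.antisymm (fun β hβ => by
        obtain ⟨i, hi, rfl⟩ := h' β hβ
        rcases List.mem_cons.mp hi with rfl | hi
        · exact absurd hβ h41
        · exact ⟨i, hi, rfl⟩) hlX
      rw [← this]
      exact mem_orbit_self table_seven.isSL hX.1.1
  · obtain ⟨l', hl', h'⟩ := h5 X' hadm hsub
    exact ⟨l', hl', mem_orbit_trans table_seven.isSL hX.1.1 hX' h'⟩

end OrbitsE

/-! ### The lines with symmetric quotient in types E -/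

section LinesE

theorem isSL_E₇ : IsSL E₇ := cartanE_seven ▸ isSL_cartanE 7 (by norm_num)

/-- In this and the following lines the numeral is the height threshold of the highest set; the
first vector lists a base of the orthogonal system by indices in the table, and the second lists the
orthogonal nodes. -/
theorem isTableLine_six_one : IsTableLine (cartanE 6 table_six.le)
    (orbit (cartanE 6 table_six.le) (eSet 6 [35])) 1 (A 5) (A 5) (Equiv.Perm (Fin 1)) :=
  table_six.isTableLine 11 (table_six.hasCartanType_perp (isSL_A 5)
    ![0, 1, 2, 3, 5]) (table_six.nodesHaveType ![0, 2, 3, 4, 5]) table_six.quotient_perm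

theorem isTableLine_six_two : IsTableLine (cartanE 6 table_six.le)
    (orbit (cartanE 6 table_six.le) (eSet 6 [31, 32])) 2 (A 3) (A 2) (Equiv.Perm (Fin 2)) :=
  table_six.isTableLine 8 (table_six.hasCartanType_perp (isSL_A 3)
    ![2, 4, 12]) (table_six.nodesHaveType ![1, 3]) table_six.quotient_perm

theorem isTableLine_six_four : IsTableLine (cartanE 6 table_six.le)
    (orbit (cartanE 6 table_six.le) (eSet 6 [21, 22, 24, 29])) 4 (A 0) (A 0) (Equiv.Perm (Fin 4)) :=
  table_six.isTableLine 5 (table_six.hasCartanType_perp (isSL_A 0)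
    ![]) (table_six.nodesHaveType ![]) table_six.quotient_perm

theorem isTableLine_seven_one : IsTableLine (cartanE 7 table_seven.le)
    (orbit (cartanE 7 table_seven.le) (eSet 7 [62])) 1 (D 6) (D 6) (Equiv.Perm (Fin 1)) :=
  table_seven.isTableLine 17 (table_seven.hasCartanType_perp (isSL_D (by norm_num))
    ![36, 0, 1, 2, 3, 4]) (table_seven.nodesHaveType ![6, 5, 4, 3, 1, 2]) table_seven.quotient_perm

theorem isTableLine_seven_two : IsTableLine (cartanE 7 table_seven.le)
    (orbit (cartanE 7 table_seven.le) (eSet 7 [57, 58])) 2 (sumType (A 1) (D 4)) (sumType (A 1) (A 3)) (Equiv.Perm (Fin 2)) :=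
  table_seven.isTableLine 13 (table_seven.hasCartanType_perp (isSL_sumType (isSL_A 1) (isSL_D (by norm_num)))
    (Sum.elim ![36] ![2, 3, 5, 13])) (table_seven.nodesHaveType (Sum.elim ![6] ![0, 2, 3])) table_seven.quotient_perm

theorem isTableLine_seven_three : IsTableLine (cartanE 7 table_seven.le)
    (orbit (cartanE 7 table_seven.le) (eSet 7 [48, 49, 50])) 3 (D 4) (A 2) (Equiv.Perm (Fin 3)) :=
  table_seven.isTableLine 9 (table_seven.hasCartanType_perp (isSL_D (by norm_num))
    ![2, 4, 12, 23]) (table_seven.nodesHaveType ![1, 3]) table_seven.quotient_perm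

theorem isTableLine_seven_four : IsTableLine (cartanE 7 table_seven.le)
    (orbit (cartanE 7 table_seven.le) (eSet 7 [47, 31, 32, 52])) 4 (typeA1Pow 3) (A 1) (Equiv.Perm (Fin 4)) :=
  table_seven.isTableLine 8 (table_seven.hasCartanType_perp (isSL_typeA1Pow 3)
    ![4, 22, 48]) (table_seven.nodesHaveType ![1]) table_seven.quotient_perm

theorem isTableLine_eight_one : IsTableLine (cartanE 8 table_eight.le)
    (orbit (cartanE 8 table_eight.le) (eSet 8 [119])) 1 E₇ E₇ (Equiv.Perm (Fin 1)) :=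
  table_eight.isTableLine 29 (table_eight.hasCartanType_perp isSL_E₇
    ![5, 4, 3, 2, 1, 0, 36]) (table_eight.nodesHaveType ![0, 1, 2, 3, 4, 5, 6]) table_eight.quotient_perm

theorem isTableLine_eight_two : IsTableLine (cartanE 8 table_eight.le)
    (orbit (cartanE 8 table_eight.le) (eSet 8 [112, 113])) 2 (D 6) (A 5) (Equiv.Perm (Fin 2)) :=
  table_eight.isTableLine 23 (table_eight.hasCartanType_perp (isSL_D (by norm_num))
    ![63, 36, 0, 1, 2, 14]) (table_eight.nodesHaveType ![3, 4, 5, 6, 7]) table_eight.quotient_perm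

theorem isTableLine_eight_four : IsTableLine (cartanE 8 table_eight.le)
    (orbit (cartanE 8 table_eight.le) (eSet 8 [88, 89, 90, 95])) 4 (D 4) (A 2) (Equiv.Perm (Fin 4)) :=
  table_eight.isTableLine 14 (table_eight.hasCartanType_perp (isSL_D (by norm_num))
    ![3, 5, 22, 48]) (table_eight.nodesHaveType ![0, 2]) table_eight.quotient_perm

end LinesE

/-! ### Shears generate the linear and affine groups of the cube -/

section Shears

/-- The vector space of dimension `3` over the field with two elements. -/
abbrev Cube := Fin 3 → ZMod 2

/-- A permutation that preserves sums of three vectors. -/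
def IsAffinePerm (σ : Equiv.Perm Cube) : Prop := ∀ x y z, σ (x + y + z) = σ x + σ y + σ z

theorem IsAffinePerm.mul {σ τ : Equiv.Perm Cube} (h : IsAffinePerm σ) (h' : IsAffinePerm τ) :
    IsAffinePerm (σ * τ) := fun x y z => by
  simp only [Equiv.Perm.mul_apply]; rw [h', h]

/-- The permutation `x ↦ x + (a ⬝ᵥ x + c) • u`. -/
def shear (a : Cube) (c : ZMod 2) (u : Cube) (h : a ⬝ᵥ u = 0) : Equiv.Perm Cube :=
  Function.Involutive.toPerm (fun x => x + (a ⬝ᵥ x + c) • u) fun x => by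
    simp only [dotProduct_add, dotProduct_smul, h, smul_zero, add_zero, add_assoc,
      CharTwo.add_self_eq_zero]

theorem shear_apply (a : Cube) (c : ZMod 2) (u : Cube) (h : a ⬝ᵥ u = 0) (x : Cube) :
    shear a c u h x = x + (a ⬝ᵥ x + c) • u := rfl

theorem isAffinePerm_shear (a : Cube) (c : ZMod 2) (u : Cube) (h : a ⬝ᵥ u = 0) :
    IsAffinePerm (shear a c u h) := fun x y z => by
  have h2 : c + c = 0 := CharTwo.add_self_eq_zero c
  simp only [shear_apply, dotProduct_add]
  rw [show a ⬝ᵥ x + a ⬝ᵥ y + a ⬝ᵥ z + c = (a ⬝ᵥ x + c) + (a ⬝ᵥ y + c) + (a ⬝ᵥ z + c) by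
    linear_combination -h2]
  simp only [add_smul]
  abel

/-- One step down a chain of pointwise stabilizers. Either `π e = e`, or a shear in `H` fixing `F`
carries `π e` back to `e`. The corrected permutation fixes `e` and `F`, hence by affinity the sums
of three of these points, and the next step applies. -/
theorem mem_of_fixed_step {H : Subgroup (Equiv.Perm Cube)} {F F' : List Cube} {e : Cube}
    (hF : ∀ x ∈ F', ∃ a ∈ e :: F, ∃ b ∈ e :: F, ∃ c ∈ e :: F, x = a + b + c) (he : e ∉ F)
    (C : List (ZMod 2))
    (hH : ∀ a u (h : a ⬝ᵥ u = 0), a ≠ 0 → u ≠ 0 → ∀ c ∈ C, shear a c u h ∈ H)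
    (hmove : ∀ y, y ∉ F → y = e ∨ ∃ a u, a ≠ 0 ∧ u ≠ 0 ∧ a ⬝ᵥ u = 0 ∧ ∃ c ∈ C,
      (∀ x ∈ F, a ⬝ᵥ x + c = 0) ∧ y + (a ⬝ᵥ y + c) • u = e)
    (ih : ∀ π, IsAffinePerm π → (∀ x ∈ F', π x = x) → π ∈ H) (π : Equiv.Perm Cube)
    (hπ : IsAffinePerm π) (hπF : ∀ x ∈ F, π x = x) : π ∈ H := by
  have key : ∀ ρ, IsAffinePerm ρ → (∀ x ∈ F, ρ x = x) → ρ e = e → ρ ∈ H := fun ρ h1 h2 h3 => by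
    have h4 : ∀ x ∈ e :: F, ρ x = x := fun x hx => by
      rcases List.mem_cons.mp hx with rfl | hx
      exacts [h3, h2 x hx]
    refine ih ρ h1 fun x hx => ?_
    obtain ⟨a, ha, b, hb, c, hc, rfl⟩ := hF x hx
    rw [h1, h4 a ha, h4 b hb, h4 c hc]
  rcases hmove (π e) (fun h => he (π.injective (hπF _ h) ▸ h)) with h | ⟨a, u, ha, hu, h, c, hc, h1, h2⟩
  · exact key π hπ hπF h
  · refine (Subgroup.mul_mem_cancel_left H (hH a u h ha hu c hc)).mp
      (key _ ((isAffinePerm_shear a c u h).mul hπ) (fun x hx => ?_) h2)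
    rw [Equiv.Perm.mul_apply, hπF x hx, shear_apply, h1 x hx, zero_smul, add_zero]

-- The chain fixes 0 and then the three unit vectors one after another; only shears without a
-- constant term are needed, as the origin stays fixed.
set_option synthInstance.maxHeartbeats 400000 in
set_option synthInstance.maxSize 1000 in
theorem mem_of_linear_shears {H : Subgroup (Equiv.Perm Cube)}
    (hH : ∀ a u (h : a ⬝ᵥ u = 0), a ≠ 0 → u ≠ 0 → shear a 0 u h ∈ H) {π : Equiv.Perm Cube}
    (hπ : IsAffinePerm π) (h0 : π 0 = 0) : π ∈ H := by
  have hH' : ∀ a u (h : a ⬝ᵥ u = 0), a ≠ 0 → u ≠ 0 → ∀ c ∈ [(0 : ZMod 2)],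
      shear a c u h ∈ H := by
    intro a u h ha hu c hc
    rw [List.mem_singleton.mp hc]
    exact hH a u h ha hu
  refine mem_of_fixed_step (F := [0]) (F' := [0, ![1, 0, 0]]) (e := ![1, 0, 0]) ?_ ?_ [0] hH' ?_
    (mem_of_fixed_step (F' := [0, ![1, 0, 0], ![0, 1, 0], ![1, 1, 0]]) (e := ![0, 1, 0]) ?_ ?_ [0]
      hH' ?_ (mem_of_fixed_step (F' := [0, ![1, 0, 0], ![0, 1, 0], ![1, 1, 0], ![0, 0, 1],
        ![1, 0, 1], ![0, 1, 1], ![1, 1, 1]]) (e := ![0, 0, 1]) ?_ ?_ [0] hH' ?_ ?_)) π hπ (by simpa)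
  -- At the end of the chain all eight points are fixed.
  case refine_10 =>
    intro ρ _ h
    have : ρ = 1 := Equiv.ext fun x => h x (by revert x; decide +kernel)
    rw [this]
    exact one_mem H
  all_goals decide +kernel

set_option synthInstance.maxHeartbeats 400000 in
set_option synthInstance.maxSize 1000 in
theorem mem_of_affine_shears {H : Subgroup (Equiv.Perm Cube)}
    (hH : ∀ a c u (h : a ⬝ᵥ u = 0), a ≠ 0 → u ≠ 0 → shear a c u h ∈ H) {π : Equiv.Perm Cube}
    (hπ : IsAffinePerm π) : π ∈ H := by
  refine mem_of_fixed_step (F := []) (F' := [0]) (e := 0) ?_ ?_ [0, 1]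
    (fun a u h ha hu c _ => hH a c u h ha hu) ?_
    (fun ρ h1 h2 => mem_of_linear_shears (fun a u => hH a 0 u) h1 (h2 0 (by simp))) π hπ (by simp)
  all_goals decide +kernel

/-- Taking one of the three points to be 0 makes `x ↦ σ x - σ 0` additive, and additive maps are
linear over the field with two elements. -/
theorem exists_linearEquiv {σ : Equiv.Perm Cube} (hσ : IsAffinePerm σ) :
    ∃ L : Cube ≃ₗ[ZMod 2] Cube, ∀ x, L x = σ x - σ 0 := by
  let f : Cube →+ Cube := AddMonoidHom.mk' (fun x => σ x - σ 0) fun x y => by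
    have := hσ x y 0
    rw [add_zero] at this
    rw [this]
    abel_nf
    simp [two_smul, CharTwo.add_self_eq_zero]
  have hf : Function.Injective (f.toZModLinearMap 2) := fun x y h => by
    have : σ x - σ 0 = σ y - σ 0 := h
    exact σ.injective (sub_left_injective this)
  exact ⟨LinearEquiv.ofInjectiveEndo _ hf, fun x => rfl⟩

end Shears

/-! ### Induced permutations modulo 2 -/

section Induced

variable {ι κ : Type} [Fintype ι] [DecidableEq ι] {C : Matrix ι ι ℤ}

/-- The permutations of a family induced, up to signs, by elements of the Weyl group. -/
def inducedPerms (C : Matrix ι ι ℤ) (b : κ → ι → ℤ) : Subgroup (Equiv.Perm κ) where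
  carrier := {σ | ∃ w ∈ weylGroup C, Induces b w σ}
  mul_mem' := fun ⟨_, hw, h⟩ ⟨_, hw', h'⟩ => ⟨_, mul_mem hw hw', h.mul h'⟩
  one_mem' := ⟨1, one_mem _, induces_one b⟩
  inv_mem' := fun ⟨_, hw, h⟩ => ⟨_, inv_mem hw, h.inv⟩

/-- Two orthogonal reflections interchange two orthogonal roots, up to signs, if their roots have
the same nonzero inner products with both. -/
theorem reflE_reflE_eq_neg (hC : IsSL C) {β β' γ δ : ι → ℤ} (hβ : form C β β = 2)
    (hβ' : form C β' β' = 2) (hγ : form C γ γ = 2) (hδ : form C δ δ = 2) (h : form C β β' = 0)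
    (hγδ : form C γ δ = 0) (h1 : form C γ β * form C γ β = 1) (h2 : form C δ β * form C δ β = 1)
    (h3 : form C γ β = form C γ β') (h4 : form C δ β = form C δ β') :
    (reflE C γ hγ * reflE C δ hδ) β = -β' := by
  -- The norm of this vector is `4 + 4 - 8 = 0`.
  have key : β + β' - form C γ β • γ - form C δ β • δ = 0 := by
    apply hC.eq_zero
    simp only [form_sub_left, form_sub_right, form_add_left, form_add_right, form_smul_left,
      form_smul_right, hβ, hβ', hγ, hδ, h, hγδ, hC.comm β' β, hC.comm β γ, hC.comm β' γ,
      hC.comm β δ, hC.comm β' δ, hC.comm δ γ, ← h3, ← h4]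
    linear_combination -2 * h1 - 2 * h2
  rw [LinearEquiv.mul_apply, reflE_apply, reflE_apply, form_sub_left, form_smul_left,
    hC.comm δ γ, hγδ, hC.comm β γ, hC.comm β δ]
  simp only [mul_zero, sub_zero]
  linear_combination (exp := 1) key

theorem intCast_form (x y : ι → ℤ) :
    (form C x y : ZMod 2) = ∑ i, (x i : ZMod 2) * (form C (Pi.single i 1) y : ZMod 2) := by
  rw [form_eq_sum]
  push_cast
  rfl

/-- If modulo `2` a family is affine and injective, as functionals on the root lattice, then the
induced permutations are affine. -/
theorem isAffinePerm_of_induces {b : Cube → ι → ℤ}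
    (haff : ∀ x y z i, (form C (Pi.single i 1) (b (x + y + z)) : ZMod 2) =
      form C (Pi.single i 1) (b x) + form C (Pi.single i 1) (b y) + form C (Pi.single i 1) (b z))
    (hinj : ∀ x y, (∀ i, (form C (Pi.single i 1) (b x) : ZMod 2) =
      form C (Pi.single i 1) (b y)) → x = y)
    {w : LatticeAut ι} (hw : w ∈ isometries C) {σ : Equiv.Perm Cube}
    (h : Induces b w σ) : IsAffinePerm σ := by
  have h1 : ∀ v x y z, (form C v (b (x + y + z)) : ZMod 2) =
      form C v (b x) + form C v (b y) + form C v (b z) := fun v x y z => by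
    simp only [intCast_form (C := C) v, haff, mul_add, Finset.sum_add_distrib]
  have h2 : ∀ v x, (form C v (b (σ x)) : ZMod 2) = form C (w⁻¹ v) (b x) := fun v x => by
    have : form C (w⁻¹ v) (b x) = form C v (w (b x)) := by
      rw [← hw, ← LinearEquiv.mul_apply, mul_inv_cancel]; rfl
    rw [this]
    -- The sign ambiguity of an induced permutation disappears modulo 2.
    rcases h x with h | h
    · rw [h]
    · rw [h, form_neg_right, Int.cast_neg, CharTwo.neg_eq]
  refine fun x y z => hinj _ _ fun i => ?_
  rw [h2, h1, haff, h2, h2, h2]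

end Induced

/-! ### Realizing shears by pairs of reflections -/

section Moves

variable {n N : ℕ}

/-- The vector with the given binary digits. -/
def cubeIndex (v : Cube) : ℕ := (v 0).val + 2 * (v 1).val + 4 * (v 2).val

/-- The parity of the sum of three binary digits. -/
def parity (k : ℕ) : ℕ := (k + k / 2 + k / 4) % 2

theorem cubeIndex_lt : ∀ v, cubeIndex v < 8 := by decide +kernel

theorem cubeIndex_add : ∀ v u, cubeIndex (v + u) = Nat.xor (cubeIndex v) (cubeIndex u) := by
  decide +kernel

theorem dotProduct_add_eq_zero_iff : ∀ (a v : Cube) (c : ZMod 2),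
    a ⬝ᵥ v + c = 0 ↔ parity (Nat.land (cubeIndex a) (cubeIndex v)) = c.val := by decide +kernel

/-- The root with index `p` is orthogonal to the vectors of the list on a plane of the cube, and has
the same inner product `1` or `-1` with any two vectors interchanged by the shear. -/
def moveTest (l : List ℕ) (a c u p : ℕ) : Bool :=
  (List.range 8).all fun i =>
    (fun d e =>
      bif Nat.beq (parity (Nat.land a i)) c then
        Nat.beq (ipPos (rootCode p) d) (ipNeg (rootCode p) d)
      else (Nat.beq (ipPos (rootCode p) d) (ipNeg (rootCode p) d + 1) ||
        Nat.beq (ipNeg (rootCode p) d) (ipPos (rootCode p) d + 1)) &&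
        Nat.beq (ipPos (rootCode p) d + ipNeg (rootCode p) e)
          (ipPos (rootCode p) e + ipNeg (rootCode p) d))
      (rootCode (l.getD i 0)) (rootCode (l.getD (Nat.xor i u) 0))

/-- There are two orthogonal roots that pass `moveTest`. -/
def canMove (N : ℕ) (l : List ℕ) (a c u : ℕ) : Bool :=
  (fun A : List ℕ => A.any fun p => A.any fun q => orthB p q)
    ((List.range N).filter (moveTest l a c u))

/-- The family of vectors indexed by the cube that is given by a list of eight indices. -/
def cubeFamily (n : ℕ) (l : List ℕ) (v : Cube) : Fin n → ℤ := eRoot n (l.getD (cubeIndex v) 0)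

/-- Index 120 is beyond the end of the table and yields the zero vector, placed at the origin of the
cube; the seven roots occupy the nonzero points. -/
theorem canMove_seven : ∀ a < 8, ∀ u < 8, a ≠ 0 → u ≠ 0 → parity (Nat.land a u) = 0 →
    canMove 63 [120, 41, 21, 22, 24, 29, 50, 57] a 0 u = true := by decide +kernel

set_option synthInstance.maxHeartbeats 400000 in
set_option synthInstance.maxSize 1000 in
theorem canMove_eight : ∀ a < 8, ∀ c < 2, ∀ u < 8, a ≠ 0 → u ≠ 0 → parity (Nat.land a u) = 0 →
    canMove 120 [73, 47, 31, 110, 32, 94, 84, 52] a c u = true := by decide +kernel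

/-- The parity of the inner product of the `k`-th simple root and the `i`-th vector of the list. -/
def parityAt (l : List ℕ) (k i : ℕ) : ℕ :=
  (ipPos (10 ^ k) (rootCode (l.getD i 0)) + ipNeg (10 ^ k) (rootCode (l.getD i 0))) % 2

/-- The list gives eight orthogonal vectors that are roots or zero; modulo `2`, as functionals on
the root lattice, they depend on the points of the cube in an affine and injective way. -/
structure IsCubeList (n N : ℕ) (l : List ℕ) : Prop where
  mem : ∀ i < 8, l.getD i 0 < N ∨ l.getD i 0 = 120
  orth : ∀ i < 8, ∀ j < 8, i ≠ j → ipPos (rootCode (l.getD i 0)) (rootCode (l.getD j 0)) =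
    ipNeg (rootCode (l.getD i 0)) (rootCode (l.getD j 0))
  affine : ∀ i < 8, ∀ j < 8, ∀ k < 8, ∀ s < n, parityAt l s (Nat.xor (Nat.xor i j) k) =
    (parityAt l s i + parityAt l s j + parityAt l s k) % 2
  injective : ∀ i < 8, ∀ j < 8, (∀ s < n, parityAt l s i = parityAt l s j) → i = j

theorem isCubeList_seven : IsCubeList 7 63 [120, 41, 21, 22, 24, 29, 50, 57] := by
  constructor <;> decide +kernel

theorem isCubeList_eight : IsCubeList 8 120 [73, 47, 31, 110, 32, 94, 84, 52] := by
  constructor <;> decide +kernel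

theorem cubeIndex_injective : Function.Injective cubeIndex := by
  have : ∀ v u, cubeIndex v = cubeIndex u → v = u := by decide +kernel
  exact fun v u => this v u

namespace IsRootTable

theorem digit_eq_zero' (T : IsRootTable n N) {i : ℕ} (hi : i < N ∨ i = 120) (t : ℕ) (h : n ≤ t)
    (h' : t < 8) : digit (rootCode i) t = 0 := by
  rcases hi with hi | rfl
  · exact T.digit_eq_zero i hi t h' h
  · exact (by decide +kernel : ∀ t < 8, digit (rootCode 120) t = 0) t h'

theorem form_eq' (T : IsRootTable n N) {i j : ℕ} (hi : i < N ∨ i = 120) (hj : j < N ∨ j = 120) :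
    form (cartanE n T.le) (eRoot n i) (eRoot n j) =
      (ipPos (rootCode i) (rootCode j) : ℤ) - ipNeg (rootCode i) (rootCode j) :=
  form_codeVec T.le (T.digit_eq_zero' hi) (T.digit_eq_zero' hj)

theorem form_cubeFamily_self (T : IsRootTable n N) {l : List ℕ} (hl : IsCubeList n N l) {v : Cube}
    {γ : Fin n → ℤ} (h : form (cartanE n T.le) γ (cubeFamily n l v) ≠ 0) :
    form (cartanE n T.le) (cubeFamily n l v) (cubeFamily n l v) = 2 := by
  rcases hl.mem _ (cubeIndex_lt v) with h' | h'
  · exact T.form_self h'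
  · refine absurd ?_ h
    have h0 : eRoot n 120 = 0 := by
      funext t
      simp [eRoot, codeVec, rootCode, rootCodes, digit]
    rw [cubeFamily, h', h0, form_zero_right]

/-- The two roots vanish on the plane that the shear fixes. Off this plane, a point and its image
are orthogonal roots having the same inner product `±1` with each of the two, so the product of the
reflections exchanges them up to sign. -/
theorem shear_mem (T : IsRootTable n N) {l : List ℕ} (hl : IsCubeList n N l) {a u : Cube}
    {c : ZMod 2} (h : a ⬝ᵥ u = 0) (hu : u ≠ 0)
    (hm : canMove N l (cubeIndex a) c.val (cubeIndex u) = true) :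
    shear a c u h ∈ inducedPerms (cartanE n T.le) (cubeFamily n l) := by
  simp only [canMove, List.any_eq_true, List.mem_filter, List.mem_range] at hm
  obtain ⟨p, ⟨hp, hp'⟩, q, ⟨hq, hq'⟩, hpq⟩ := hm
  have key : ∀ p < N, moveTest l (cubeIndex a) c.val (cubeIndex u) p = true → ∀ v,
      (a ⬝ᵥ v + c = 0 → form (cartanE n T.le) (eRoot n p) (cubeFamily n l v) = 0) ∧
      (a ⬝ᵥ v + c ≠ 0 → form (cartanE n T.le) (eRoot n p) (cubeFamily n l v) *
        form (cartanE n T.le) (eRoot n p) (cubeFamily n l v) = 1 ∧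
        form (cartanE n T.le) (eRoot n p) (cubeFamily n l v) =
          form (cartanE n T.le) (eRoot n p) (cubeFamily n l (v + u))) := by
    intro p hp h v
    have h1 := List.all_eq_true.mp h (cubeIndex v) (List.mem_range.mpr (cubeIndex_lt v))
    rw [← cubeIndex_add] at h1
    rw [cubeFamily, cubeFamily, T.form_eq' (Or.inl hp) (hl.mem _ (cubeIndex_lt v)),
      T.form_eq' (Or.inl hp) (hl.mem _ (cubeIndex_lt _)), Ne, dotProduct_add_eq_zero_iff]
    simp only [cond_eq_ite, Nat.beq_eq] at h1
    split_ifs at h1 with hc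
    · rw [Nat.beq_eq] at h1
      exact ⟨fun _ => by omega, fun h => absurd hc h⟩
    · simp only [Bool.and_eq_true, Bool.or_eq_true, Nat.beq_eq] at h1
      refine ⟨fun h => absurd h hc, fun _ => ⟨?_, by omega⟩⟩
      rcases h1.1 with h | h <;> rw [h] <;> push_cast <;> ring
  refine ⟨reflE _ _ (T.form_self hp) * reflE _ _ (T.form_self hq),
    mul_mem (reflE_mem_weylGroup T.isSL _ _) (reflE_mem_weylGroup T.isSL _ _), fun v => ?_⟩
  rw [shear_apply]
  by_cases hv : a ⬝ᵥ v + c = 0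
  · left
    rw [hv, zero_smul, add_zero, LinearEquiv.mul_apply,
      reflE_of_orth _ ((T.isSL.comm _ _).trans ((key q hq hq' v).1 hv)),
      reflE_of_orth _ ((T.isSL.comm _ _).trans ((key p hp hp' v).1 hv))]
  · right
    have hv1 : a ⬝ᵥ v + c = 1 := (by decide : ∀ x : ZMod 2, x ≠ 0 → x = 1) _ hv
    obtain ⟨p1, p2⟩ := (key p hp hp' v).2 hv
    obtain ⟨q1, q2⟩ := (key q hq hq' v).2 hv
    rw [hv1, one_smul]
    have hne : form (cartanE n T.le) (eRoot n p) (cubeFamily n l v) ≠ 0 := fun h => by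
      rw [h] at p1; simp at p1
    refine reflE_reflE_eq_neg T.isSL (T.form_cubeFamily_self hl hne)
      (T.form_cubeFamily_self hl (p2 ▸ hne)) _ _ ?_ ((T.orth_iff hp hq).mp hpq) p1 q1 p2 q2
    rw [cubeFamily, cubeFamily, T.form_eq' (hl.mem _ (cubeIndex_lt _)) (hl.mem _ (cubeIndex_lt _)),
      hl.orth _ (cubeIndex_lt _) _ (cubeIndex_lt _), sub_self]
    exact fun h => hu (by simpa using cubeIndex_injective h)

theorem isAffinePerm (T : IsRootTable n N) {l : List ℕ} (hl : IsCubeList n N l)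
    {σ : Equiv.Perm Cube} (hσ : σ ∈ inducedPerms (cartanE n T.le) (cubeFamily n l)) :
    IsAffinePerm σ := by
  obtain ⟨w, hw, h⟩ := hσ
  have key : ∀ v i, (form (cartanE n T.le) (Pi.single i 1) (cubeFamily n l v) : ZMod 2) =
      (parityAt l i (cubeIndex v) : ℕ) := by
    intro v i
    rw [← codeVec_ten_pow T.le i, cubeFamily, eRoot, form_codeVec T.le (digit_ten_pow T.le i)
      (T.digit_eq_zero' (hl.mem _ (cubeIndex_lt v))), parityAt, ZMod.natCast_mod]
    push_cast
    -- Modulo 2 the difference of the positive and negative parts is their sum, which is what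
    -- `parityAt` computes.
    exact CharTwo.sub_eq_add _ _
  refine isAffinePerm_of_induces (fun x y z i => ?_) (fun x y hxy => ?_)
    (weylGroup_le_isometries T.isSL hw) h
  · simp only [key, cubeIndex_add]
    rw [hl.affine _ (cubeIndex_lt x) _ (cubeIndex_lt y) _ (cubeIndex_lt z) i i.2, ZMod.natCast_mod]
    push_cast
    rfl
  · refine cubeIndex_injective (hl.injective _ (cubeIndex_lt x) _ (cubeIndex_lt y) fun s hs => ?_)
    have := hxy ⟨s, hs⟩
    rw [key, key, ZMod.natCast_eq_natCast_iff'] at this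
    simpa [parityAt] using this

end IsRootTable

end Moves

/-! ### The groups `L(3,2)` and `AGL₃(𝔽₂)` -/

section SpecialGroups

/-- Over the field with two elements a nonzero determinant is 1, so the special linear group is the
whole linear group. -/
theorem toLin'_bijective : Function.Bijective
    (Matrix.SpecialLinearGroup.toLin' : Matrix.SpecialLinearGroup (Fin 3) (ZMod 2) →*
      (Cube ≃ₗ[ZMod 2] Cube)) := by
  refine ⟨Matrix.SpecialLinearGroup.toLin'_injective, fun L => ?_⟩
  have hdet : (LinearMap.toMatrix' (L : Cube →ₗ[ZMod 2] Cube)).det = 1 := by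
    have h1 : (LinearMap.toMatrix' (L : Cube →ₗ[ZMod 2] Cube)).det ≠ 0 := by
      rw [LinearMap.det_toMatrix']
      exact (LinearEquiv.isUnit_det' L).ne_zero
    exact (by decide : ∀ x : ZMod 2, x ≠ 0 → x = 1) _ h1
  refine ⟨⟨_, hdet⟩, LinearEquiv.ext fun x => ?_⟩
  change Matrix.toLin' (LinearMap.toMatrix' (L : Cube →ₗ[ZMod 2] Cube)) x = L x
  rw [Matrix.toLin'_toMatrix']
  rfl

/-- A central matrix is a scalar whose cube is 1, hence the identity; the projective quotient
changes nothing. -/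
theorem nonempty_specialLinear_mulEquiv : Nonempty (Matrix.SpecialLinearGroup (Fin 3) (ZMod 2) ≃*
    Matrix.ProjectiveSpecialLinearGroup (Fin 3) (ZMod 2)) := by
  have h : Subgroup.center (Matrix.SpecialLinearGroup (Fin 3) (ZMod 2)) = ⊥ := by
    rw [Subgroup.eq_bot_iff_forall]
    intro A hA
    obtain ⟨r, hr, h⟩ := Matrix.SpecialLinearGroup.mem_center_iff.mp hA
    rw [(by decide : ∀ x : ZMod 2, x ^ 3 = 1 → x = 1) r hr, map_one] at h
    exact Subtype.ext h.symm
  exact ⟨((QuotientGroup.quotientMulEquivOfEq h).trans QuotientGroup.quotientBot).symm⟩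

theorem card_cube_linearEquiv : Nat.card (Cube ≃ₗ[ZMod 2] Cube) = 168 := by
  have h := Matrix.card_GL_field (𝔽 := ZMod 2) 3
  rw [Nat.card_congr ((Matrix.GeneralLinearGroup.toLin (n := Fin 3) (R := ZMod 2)).trans
    (LinearMap.GeneralLinearGroup.generalLinearEquiv _ _)).toEquiv] at h
  rw [h, ZMod.card]
  decide +kernel

theorem card_projectiveSpecialLinear :
    Nat.card (Matrix.ProjectiveSpecialLinearGroup (Fin 3) (ZMod 2)) = 168 := by
  obtain ⟨e⟩ := nonempty_specialLinear_mulEquiv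
  rw [← Nat.card_congr e.toEquiv, Nat.card_congr (Equiv.ofBijective _ toLin'_bijective),
    card_cube_linearEquiv]

theorem card_cube_affineEquiv : Nat.card (Cube ≃ᵃ[ZMod 2] Cube) = 1344 := by
  let e : (Cube ≃ᵃ[ZMod 2] Cube) ≃ Cube × (Cube ≃ₗ[ZMod 2] Cube) :=
    { toFun := fun f => (f 0, f.linear)
      invFun := fun p => p.2.toAffineEquiv.trans (AffineEquiv.constVAdd _ _ p.1)
      left_inv := fun f => by
        ext1 x
        have := f.map_vadd 0 x
        rw [vadd_eq_add, vadd_eq_add, add_zero] at this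
        rw [this, add_comm]
        rfl
      right_inv := fun p => by
        refine Prod.ext ?_ ?_
        · simp
        · ext1 x; rfl }
  rw [Nat.card_congr e, Nat.card_prod, card_cube_linearEquiv]
  simp

end SpecialGroups

/-! ### The quotients for seven roots in `E₇` and eight in `E₈` -/

section SpecialQuotients

theorem range_cubeFamily_eight : Set.range (cubeFamily 8 [73, 47, 31, 110, 32, 94, 84, 52]) =
    eSet 8 [73, 47, 31, 110, 32, 94, 84, 52] := by
  ext β
  constructor
  · rintro ⟨v, rfl⟩
    exact ⟨_, (by decide +kernel : ∀ v : Cube, List.getD [73, 47, 31, 110, 32, 94, 84, 52]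
      (cubeIndex v) 0 ∈ [73, 47, 31, 110, 32, 94, 84, 52]) v, rfl⟩
  · rintro ⟨i, hi, rfl⟩
    obtain ⟨v, hv⟩ := (by decide +kernel : ∀ i ∈ [73, 47, 31, 110, 32, 94, 84, 52],
      ∃ v : Cube, List.getD [73, 47, 31, 110, 32, 94, 84, 52] (cubeIndex v) 0 = i) i hi
    exact ⟨v, by rw [cubeFamily, hv]⟩

theorem cubeFamily_injective_eight :
    Function.Injective (cubeFamily 8 [73, 47, 31, 110, 32, 94, 84, 52]) := by
  have h1 : ∀ v, List.getD [73, 47, 31, 110, 32, 94, 84, 52] (cubeIndex v) 0 < 120 := by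
    decide +kernel
  have h2 : ∀ v u, List.getD [73, 47, 31, 110, 32, 94, 84, 52] (cubeIndex v) 0 =
    List.getD [73, 47, 31, 110, 32, 94, 84, 52] (cubeIndex u) 0 → v = u := by decide +kernel
  exact fun v u h => h2 v u (table_eight.injective (h1 v) (h1 u) h)

/-- Reduction modulo 2 shows that only affine permutations are induced, and the realization of every
shear shows that all of them are. -/
theorem quotient_eight : Nonempty (QuotientNC (cartanE 8 table_eight.le)
    (eSet 8 [73, 47, 31, 110, 32, 94, 84, 52]) ≃* (Cube ≃ᵃ[ZMod 2] Cube)) := by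
  rw [← range_cubeFamily_eight]
  refine quotientNC_of_perm table_eight.isSL cubeFamily_injective_eight
    (fun v => table_eight.mem ((by decide +kernel : ∀ v,
      List.getD [73, 47, 31, 110, 32, 94, 84, 52] (cubeIndex v) 0 < 120) v))
    { toFun := fun g => g.toEquiv, map_one' := rfl, map_mul' := fun _ _ => rfl }
    (fun _ _ h => AffineEquiv.toEquiv_injective h) (fun w hw π h => ?_) fun g => ?_
  · have hπ := table_eight.isAffinePerm isCubeList_eight ⟨w, hw, h⟩
    obtain ⟨L, hL⟩ := exists_linearEquiv hπ
    refine ⟨⟨π, L, fun p v => ?_⟩, rfl⟩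
    have := hπ v p 0
    rw [add_zero] at this
    rw [vadd_eq_add, vadd_eq_add, hL, this, CharTwo.sub_eq_add]
    abel
  · refine mem_of_affine_shears (H := inducedPerms _ _) (fun a c u h ha hu =>
      table_eight.shear_mem isCubeList_eight h hu (canMove_eight _ (cubeIndex_lt a) _
        (ZMod.val_lt c) _ (cubeIndex_lt u) (fun h => ha (cubeIndex_injective h))
        (fun h => hu (cubeIndex_injective h)) ?_)) fun x y z => ?_
    · exact (dotProduct_add_eq_zero_iff a u 0).mp (by rw [h, add_zero])
    · have hg : ∀ v, g v = g.linear v + g 0 := fun v => by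
        simpa using g.map_vadd 0 v
      change g (x + y + z) = g x + g y + g z
      rw [hg (x + y + z), hg x, hg y, hg z, map_add, map_add]
      linear_combination (exp := 1) -CharTwo.add_self_eq_zero (g 0)

theorem range_cubeFamily_seven :
    Set.range (fun v : {v : Cube // v ≠ 0} => cubeFamily 7 [120, 41, 21, 22, 24, 29, 50, 57] v) =
      eSet 7 [41, 21, 22, 24, 29, 50, 57] := by
  ext β
  constructor
  · rintro ⟨v, rfl⟩
    exact ⟨_, (by decide +kernel : ∀ v : Cube, v ≠ 0 → List.getD [120, 41, 21, 22, 24, 29, 50, 57]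
      (cubeIndex v) 0 ∈ [41, 21, 22, 24, 29, 50, 57]) v v.2, rfl⟩
  · rintro ⟨i, hi, rfl⟩
    obtain ⟨v, hv, h⟩ := (by decide +kernel : ∀ i ∈ [41, 21, 22, 24, 29, 50, 57],
      ∃ v : Cube, v ≠ 0 ∧ List.getD [120, 41, 21, 22, 24, 29, 50, 57] (cubeIndex v) 0 = i) i hi
    exact ⟨⟨v, hv⟩, congrArg (eRoot 7) h⟩

theorem lt_of_ne_zero_seven : ∀ v : Cube, v ≠ 0 →
    List.getD [120, 41, 21, 22, 24, 29, 50, 57] (cubeIndex v) 0 < 63 := by decide +kernel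

theorem cubeFamily_injective_seven : Function.Injective
    fun v : {v : Cube // v ≠ 0} => cubeFamily 7 [120, 41, 21, 22, 24, 29, 50, 57] v := by
  have h2 : ∀ v u, List.getD [120, 41, 21, 22, 24, 29, 50, 57] (cubeIndex v) 0 =
    List.getD [120, 41, 21, 22, 24, 29, 50, 57] (cubeIndex u) 0 → v = u := by decide +kernel
  exact fun v u h => Subtype.ext (h2 v u (table_seven.injective
    (lt_of_ne_zero_seven v v.2) (lt_of_ne_zero_seven u u.2) h))

/-- The permutation of the nonzero vectors of the cube given by a linear map. -/
def permNonzero : (Cube ≃ₗ[ZMod 2] Cube) →* Equiv.Perm {v : Cube // v ≠ 0} where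
  toFun L := Equiv.Perm.subtypePerm L.toEquiv fun _ => L.map_ne_zero_iff
  map_one' := rfl
  map_mul' _ _ := rfl

theorem permNonzero_injective : Function.Injective permNonzero := fun L L' h => by
  ext1 x
  by_cases hx : x = 0
  · rw [hx, map_zero, map_zero]
  · exact congrArg Subtype.val (Equiv.congr_fun h ⟨x, hx⟩)

/-- As for eight roots, with the zero vector as eighth point: it is fixed, so the affine
permutations that occur are the linear ones. -/
theorem quotient_seven : Nonempty (QuotientNC (cartanE 7 table_seven.le)
    (eSet 7 [41, 21, 22, 24, 29, 50, 57]) ≃*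
      Matrix.ProjectiveSpecialLinearGroup (Fin 3) (ZMod 2)) := by
  have h0 : cubeFamily 7 [120, 41, 21, 22, 24, 29, 50, 57] 0 = 0 := by decide +kernel
  obtain ⟨e⟩ := nonempty_specialLinear_mulEquiv
  suffices h : Nonempty (QuotientNC (cartanE 7 table_seven.le)
      (eSet 7 [41, 21, 22, 24, 29, 50, 57]) ≃* (Cube ≃ₗ[ZMod 2] Cube)) from
    ⟨h.some.trans ((MulEquiv.ofBijective _ toLin'_bijective).symm.trans e)⟩
  rw [← range_cubeFamily_seven]
  refine quotientNC_of_perm table_seven.isSL cubeFamily_injective_seven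
    (fun v => table_seven.mem (lt_of_ne_zero_seven v v.2)) permNonzero permNonzero_injective
    (fun w hw π h => ?_) fun L => ?_
  -- The permutation of the nonzero points is extended by fixing the origin, where the family is the
  -- zero vector and any element of `W` agrees with it.
  · have hσ0 : Equiv.Perm.ofSubtype π 0 = 0 :=
      Equiv.Perm.ofSubtype_apply_of_not_mem π (by simp)
    have hσ : ∀ v (hv : v ≠ 0), Equiv.Perm.ofSubtype π v = π ⟨v, hv⟩ := fun v hv =>
      Equiv.Perm.ofSubtype_apply_of_mem π hv
    have hπ := table_seven.isAffinePerm isCubeList_seven (σ := Equiv.Perm.ofSubtype π)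
      ⟨w, hw, fun v => by
        by_cases hv : v = 0
        · left; rw [hv, hσ0, h0, map_zero]
        · rw [hσ v hv]; exact h ⟨v, hv⟩⟩
    obtain ⟨L, hL⟩ := exists_linearEquiv hπ
    refine ⟨L, Equiv.ext fun v => Subtype.ext ?_⟩
    change L v = π v
    rw [hL, hσ0, sub_zero, hσ v v.2]
  · obtain ⟨w, hw, h⟩ := mem_of_linear_shears (H := inducedPerms _ _) (fun a u h ha hu =>
      table_seven.shear_mem isCubeList_seven h hu (canMove_seven _ (cubeIndex_lt a)
        _ (cubeIndex_lt u) (fun h => ha (cubeIndex_injective h))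
        (fun h => hu (cubeIndex_injective h))
        ((dotProduct_add_eq_zero_iff a u 0).mp (by rw [h, add_zero]))))
      (π := L.toEquiv) (fun x y z => by
        change L (x + y + z) = L x + L y + L z
        rw [map_add, map_add]) (map_zero L)
    exact ⟨w, hw, fun v => h v⟩

theorem isTableLine_seven_seven : IsTableLine (cartanE 7 table_seven.le)
    (orbit (cartanE 7 table_seven.le) (eSet 7 [41, 21, 22, 24, 29, 50, 57])) 7
    (A 0) (A 0)
    (Matrix.ProjectiveSpecialLinearGroup (Fin 3) (ZMod 2)) :=
  table_seven.isTableLine 5 (table_seven.hasCartanType_perp (isSL_A 0) ![])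
    (table_seven.nodesHaveType ![]) quotient_seven

theorem isTableLine_eight_eight : IsTableLine (cartanE 8 table_eight.le)
    (orbit (cartanE 8 table_eight.le) (eSet 8 [73, 47, 31, 110, 32, 94, 84, 52])) 8
    (A 0) (A 0) (Cube ≃ᵃ[ZMod 2] Cube) :=
  table_eight.isTableLine 8 (table_eight.hasCartanType_perp (isSL_A 0) ![])
    (table_eight.nodesHaveType ![]) quotient_eight

end SpecialQuotients

/-! ### Group orders and the sums for types E -/

section SumsE

theorem nonemptyAdmissibleOrbits_six :
    nonemptyAdmissibleOrbits (cartanE 6 table_six.le) = {O | O ∈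
      [[35], [31, 32], [21, 22, 24, 29]].map
        fun B => orbit (cartanE 6 table_six.le) (eSet 6 B)} :=
  table_six.nonemptyAdmissibleOrbits_eq represents_six _

theorem nonemptyAdmissibleOrbits_seven :
    nonemptyAdmissibleOrbits (cartanE 7 table_seven.le) = {O | O ∈
      [[62], [57, 58], [48, 49, 50], [47, 31, 32, 52], [41, 21, 22, 24, 29, 50, 57]].map
        fun B => orbit (cartanE 7 table_seven.le) (eSet 7 B)} :=
  table_seven.nonemptyAdmissibleOrbits_eq represents_seven _

theorem nonemptyAdmissibleOrbits_eight :
    nonemptyAdmissibleOrbits (cartanE 8 table_eight.le) = {O | O ∈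
      [[119], [112, 113], [88, 89, 90, 95], [73, 47, 31, 110, 32, 94, 84, 52]].map
        fun B => orbit (cartanE 8 table_eight.le) (eSet 8 B)} :=
  table_eight.nonemptyAdmissibleOrbits_eq represents_eight _

/-- All roots are conjugate, so the orbit of one root has 36 elements, and the formula for its table
line determines the order from that of `W(A₅)`. The other two types are handled alike, `E₈` relying
on `E₇`. -/
theorem card_weylGroup_six : Nat.card (weylGroup (cartanE 6 table_six.le)) = 51840 := by
  obtain ⟨m, h1, h2, -⟩ := isTableLine_six_one.orbitTerm_eq table_six.isSL
    (table_six.isOrthogonalSet (by decide +kernel)) (isSL_A 5)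
  rw [table_six.ncard_orbit_root represents_six] at h2
  rw [← h1, ← h2, card_weylGroup_A]
  simp [Nat.card_eq_fintype_card, Nat.factorial]

theorem card_weylGroup_seven : Nat.card (weylGroup (cartanE 7 table_seven.le)) = 2903040 := by
  obtain ⟨m, h1, h2, -⟩ := isTableLine_seven_one.orbitTerm_eq table_seven.isSL
    (table_seven.isOrthogonalSet (by decide +kernel)) (isSL_D (by norm_num))
  rw [table_seven.ncard_orbit_root represents_seven] at h2
  rw [← h1, ← h2, card_weylGroup_D (by norm_num)]
  simp [Nat.card_eq_fintype_card, Nat.factorial]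

theorem card_weylGroup_E₇ : Nat.card (weylGroup E₇) = 2903040 :=
  cartanE_seven ▸ card_weylGroup_seven

theorem card_weylGroup_eight :
    Nat.card (weylGroup (cartanE 8 table_eight.le)) = 696729600 := by
  obtain ⟨m, h1, h2, -⟩ := isTableLine_eight_one.orbitTerm_eq table_eight.isSL
    (table_eight.isOrthogonalSet (by decide +kernel)) isSL_E₇
  rw [table_eight.ncard_orbit_root represents_eight] at h2
  rw [← h1, ← h2, card_weylGroup_E₇]
  simp [Nat.card_eq_fintype_card]

/-- The proposed orbit size `m` is certified by `hm`, since the product of the orbit size and the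
stabilizer order is the order of `W`. -/
theorem IsRootTable.orbitTerm_eq {n N : ℕ} (T : IsRootTable n N) {B : List ℕ} {k : ℕ}
    {κ₁ κ₂ : Type} [Fintype κ₁] [DecidableEq κ₁] [Fintype κ₂] [DecidableEq κ₂]
    {P : Matrix κ₁ κ₁ ℤ} {D : Matrix κ₂ κ₂ ℤ} {G : Type} [Group G] {w g p d : ℕ}
    (h : IsTableLine (cartanE n T.le) (orbit (cartanE n T.le) (eSet n B)) k P D G) (hP : IsSL P)
    (hw : Nat.card (weylGroup (cartanE n T.le)) = w) (hg : Nat.card G = g)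
    (hp : Nat.card (weylGroup P) = p) (hd : Nat.card (weylGroup D) = d) (m : ℕ)
    (hB : IsOrthList N B := by decide +kernel) (hw0 : 0 < w := by decide +kernel)
    (hm : m * (g * (2 ^ k * p)) = w := by decide +kernel) :
    orbitTerm (cartanE n T.le) (orbit (cartanE n T.le) (eSet n B)) = m ^ 2 * d := by
  obtain ⟨m', h1, -, h2⟩ := h.orbitTerm_eq T.isSL (T.isOrthogonalSet hB) hP
  rw [hg, hp, hw, ← hm] at h1
  have h0 : 0 < g * (2 ^ k * p) := Nat.pos_of_mul_pos_left (hm ▸ hw0)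
  rw [h2, hd, Nat.eq_of_mul_eq_mul_right h0 h1]

theorem card_perm_fin (t : ℕ) : Nat.card (Equiv.Perm (Fin t)) = t.factorial := by
  rw [Nat.card_eq_fintype_card, Fintype.card_perm, Fintype.card_fin]

theorem orbitSum_six : orbitSum (cartanE 6 table_six.le) = 1440585 := by
  rw [table_six.orbitSum_eq nonemptyAdmissibleOrbits_six, card_weylGroup_six]
  simp only [List.map_cons, List.map_nil, List.sum_cons, List.sum_nil]
  -- The last numeral given for each line is the size of the orbit.
  rw [table_six.orbitTerm_eq isTableLine_six_one (isSL_A 5) card_weylGroup_six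
    (card_perm_fin 1) (card_weylGroup_A 5) (card_weylGroup_A 5) 36,
    table_six.orbitTerm_eq isTableLine_six_two (isSL_A 3) card_weylGroup_six
    (card_perm_fin 2) (card_weylGroup_A 3) (card_weylGroup_A 2) 270,
    table_six.orbitTerm_eq isTableLine_six_four (isSL_A 0) card_weylGroup_six
    (card_perm_fin 4) (card_weylGroup_A 0) (card_weylGroup_A 0) 135]
  decide +kernel

theorem orbitSum_seven : orbitSum (cartanE 7 table_seven.le) = 139613625 := by
  rw [table_seven.orbitSum_eq nonemptyAdmissibleOrbits_seven, card_weylGroup_seven]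
  simp only [List.map_cons, List.map_nil, List.sum_cons, List.sum_nil]
  rw [table_seven.orbitTerm_eq isTableLine_seven_one (isSL_D (by norm_num)) card_weylGroup_seven
    (card_perm_fin 1) (card_weylGroup_D (by norm_num : 2 ≤ 6)) (card_weylGroup_D (by norm_num : 2 ≤ 6)) 63,
    table_seven.orbitTerm_eq isTableLine_seven_two (isSL_sumType (isSL_A 1) (isSL_D (by norm_num))) card_weylGroup_seven
    (card_perm_fin 2) ((card_weylGroup_sumType (isSL_A 1) (isSL_D (by norm_num))).trans
      (congrArg₂ _ (card_weylGroup_A 1) (card_weylGroup_D (by norm_num : 2 ≤ 4)))) ((card_weylGroup_sumType (isSL_A 1) (isSL_A 3)).trans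
      (congrArg₂ _ (card_weylGroup_A 1) (card_weylGroup_A 3))) 945,
    table_seven.orbitTerm_eq isTableLine_seven_three (isSL_D (by norm_num)) card_weylGroup_seven
    (card_perm_fin 3) (card_weylGroup_D (by norm_num : 2 ≤ 4)) (card_weylGroup_A 2) 315,
    table_seven.orbitTerm_eq isTableLine_seven_four (isSL_typeA1Pow 3) card_weylGroup_seven
    (card_perm_fin 4) (card_weylGroup_typeA1Pow 3) (card_weylGroup_A 1) 945,
    table_seven.orbitTerm_eq isTableLine_seven_seven (isSL_A 0) card_weylGroup_seven
    card_projectiveSpecialLinear (card_weylGroup_A 0) (card_weylGroup_A 0) 135]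
  decide +kernel

theorem orbitSum_eight : orbitSum (cartanE 8 table_eight.le) = 53328069225 := by
  rw [table_eight.orbitSum_eq nonemptyAdmissibleOrbits_eight, card_weylGroup_eight]
  simp only [List.map_cons, List.map_nil, List.sum_cons, List.sum_nil]
  rw [table_eight.orbitTerm_eq isTableLine_eight_one isSL_E₇ card_weylGroup_eight
    (card_perm_fin 1) card_weylGroup_E₇ card_weylGroup_E₇ 120,
    table_eight.orbitTerm_eq isTableLine_eight_two (isSL_D (by norm_num)) card_weylGroup_eight
    (card_perm_fin 2) (card_weylGroup_D (by norm_num : 2 ≤ 6)) (card_weylGroup_A 5) 3780,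
    table_eight.orbitTerm_eq isTableLine_eight_four (isSL_D (by norm_num)) card_weylGroup_eight
    (card_perm_fin 4) (card_weylGroup_D (by norm_num : 2 ≤ 4)) (card_weylGroup_A 2) 9450,
    table_eight.orbitTerm_eq isTableLine_eight_eight (isSL_A 0) card_weylGroup_eight
    card_cube_affineEquiv (card_weylGroup_A 0) (card_weylGroup_A 0) 2025]
  decide +kernel

end SumsE

end ADE

open ADE in
theorem mainTheorem6 :
    -- type `A_n`
    (∀ n : ℕ, 1 ≤ n →
      (ADE.admissibleOrbits (CartanMatrix.A n)).Finite ∧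
      ADE.orbitSum (CartanMatrix.A n) = ADE.oddFactorial (n + 1) ∧
      ∃ O : ℕ → Set (Set (Fin n → ℤ)),
        ADE.nonemptyAdmissibleOrbits (CartanMatrix.A n) = {S | ∃ t, 1 ≤ t ∧ 2 * t ≤ n + 1 ∧ S = O t} ∧
        ∀ t, 1 ≤ t → 2 * t ≤ n + 1 →
          ADE.IsTableLine (CartanMatrix.A n) (O t) t (CartanMatrix.A (n - 2 * t))
            (CartanMatrix.A (n - 2 * t)) (Equiv.Perm (Fin t))) ∧
    -- type `D_n`; the orbits `O₁ t` and `O₁' t` coincide unless `n = 2 * t`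
    (∀ n : ℕ, 4 ≤ n →
      (ADE.admissibleOrbits (CartanMatrix.D n)).Finite ∧
      (ADE.orbitSum (CartanMatrix.D n) : ℤ) =
        (2 ^ n + 1) * (ADE.oddFactorial n : ℤ) - (2 ^ (n - 1) + 1) * (n.factorial : ℤ) ∧
      ∃ O₁ O₁' O₂ : ℕ → Set (Set (Fin n → ℤ)),
        ADE.nonemptyAdmissibleOrbits (CartanMatrix.D n) =
          {S | ∃ t, 1 ≤ t ∧ 2 * t ≤ n ∧ (S = O₁ t ∨ S = O₁' t ∨ S = O₂ t)} ∧
        (∀ t, 1 ≤ t → 2 * t ≤ n → ∀ s, 1 ≤ s → 2 * s ≤ n → O₁ t ≠ O₂ s ∧ O₁' t ≠ O₂ s) ∧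
        ∀ t, 1 ≤ t → 2 * t ≤ n →
          ADE.IsTableLine (CartanMatrix.D n) (O₁ t) t
            (ADE.sumType (ADE.typeA1Pow t) (ADE.typeD (n - 2 * t)))
            (ADE.sumType (CartanMatrix.A 1) (ADE.typeD (n - 2 * t))) (Equiv.Perm (Fin t)) ∧
          ADE.IsTableLine (CartanMatrix.D n) (O₁' t) t
            (ADE.sumType (ADE.typeA1Pow t) (ADE.typeD (n - 2 * t)))
            (ADE.sumType (CartanMatrix.A 1) (ADE.typeD (n - 2 * t))) (Equiv.Perm (Fin t)) ∧
          (2 * t < n → O₁ t = O₁' t) ∧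
          (2 * t = n → O₁ t ≠ O₁' t ∧ ADE.OuterConjugate (CartanMatrix.D n) (O₁ t) (O₁' t)) ∧
          (2 * t < n →
            ADE.IsTableLine (CartanMatrix.D n) (O₂ t) (2 * t) (ADE.typeD (n - 2 * t))
              (CartanMatrix.A (n - 2 * t - 1)) (ADE.weylGroup (CartanMatrix.B t))) ∧
          (2 * t = n →
            ADE.IsTableLine (CartanMatrix.D n) (O₂ t) (2 * t) (ADE.typeD (n - 2 * t))
              (CartanMatrix.A (n - 2 * t - 1)) (ADE.weylGroup (CartanMatrix.D t)))) ∧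
    -- type `E₆`
    ((ADE.admissibleOrbits CartanMatrix.E₆).Finite ∧
      ADE.orbitSum CartanMatrix.E₆ = 1440585 ∧
      ∃ O₁ O₂ O₄ : Set (Set (Fin 6 → ℤ)),
        ADE.nonemptyAdmissibleOrbits CartanMatrix.E₆ = {O₁, O₂, O₄} ∧
        ADE.IsTableLine CartanMatrix.E₆ O₁ 1 (CartanMatrix.A 5) (CartanMatrix.A 5)
          (Equiv.Perm (Fin 1)) ∧
        ADE.IsTableLine CartanMatrix.E₆ O₂ 2 (CartanMatrix.A 3) (CartanMatrix.A 2)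
          (Equiv.Perm (Fin 2)) ∧
        ADE.IsTableLine CartanMatrix.E₆ O₄ 4 (CartanMatrix.A 0) (CartanMatrix.A 0)
          (Equiv.Perm (Fin 4))) ∧
    -- type `E₇`
    ((ADE.admissibleOrbits CartanMatrix.E₇).Finite ∧
      ADE.orbitSum CartanMatrix.E₇ = 139613625 ∧
      ∃ O₁ O₂ O₃ O₄ O₇ : Set (Set (Fin 7 → ℤ)),
        ADE.nonemptyAdmissibleOrbits CartanMatrix.E₇ = {O₁, O₂, O₃, O₄, O₇} ∧
        ADE.IsTableLine CartanMatrix.E₇ O₁ 1 (CartanMatrix.D 6) (CartanMatrix.D 6)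
          (Equiv.Perm (Fin 1)) ∧
        ADE.IsTableLine CartanMatrix.E₇ O₂ 2 (ADE.sumType (CartanMatrix.A 1) (CartanMatrix.D 4))
          (ADE.sumType (CartanMatrix.A 1) (CartanMatrix.A 3)) (Equiv.Perm (Fin 2)) ∧
        ADE.IsTableLine CartanMatrix.E₇ O₃ 3 (CartanMatrix.D 4) (CartanMatrix.A 2)
          (Equiv.Perm (Fin 3)) ∧
        ADE.IsTableLine CartanMatrix.E₇ O₄ 4 (ADE.typeA1Pow 3) (CartanMatrix.A 1)
          (Equiv.Perm (Fin 4)) ∧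
        ADE.IsTableLine CartanMatrix.E₇ O₇ 7 (CartanMatrix.A 0) (CartanMatrix.A 0)
          (Matrix.ProjectiveSpecialLinearGroup (Fin 3) (ZMod 2))) ∧
    -- type `E₈`
    ((ADE.admissibleOrbits CartanMatrix.E₈).Finite ∧
      ADE.orbitSum CartanMatrix.E₈ = 53328069225 ∧
      ∃ O₁ O₂ O₄ O₈ : Set (Set (Fin 8 → ℤ)),
        ADE.nonemptyAdmissibleOrbits CartanMatrix.E₈ = {O₁, O₂, O₄, O₈} ∧
        ADE.IsTableLine CartanMatrix.E₈ O₁ 1 CartanMatrix.E₇ CartanMatrix.E₇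
          (Equiv.Perm (Fin 1)) ∧
        ADE.IsTableLine CartanMatrix.E₈ O₂ 2 (CartanMatrix.D 6) (CartanMatrix.A 5)
          (Equiv.Perm (Fin 2)) ∧
        ADE.IsTableLine CartanMatrix.E₈ O₄ 4 (CartanMatrix.D 4) (CartanMatrix.A 2)
          (Equiv.Perm (Fin 4)) ∧
        ADE.IsTableLine CartanMatrix.E₈ O₈ 8 (CartanMatrix.A 0) (CartanMatrix.A 0)
          ((Fin 3 → ZMod 2) ≃ᵃ[ZMod 2] (Fin 3 → ZMod 2))) := by
  refine ⟨fun n hn => ⟨admissibleOrbits_finite (isSL_A n), orbitSum_A n,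
      fun t => orbit (CartanMatrix.A n) (matchA n t), ?_, fun t ht ht' => isTableLine_matchA ht ht'⟩,
    fun n hn => ⟨admissibleOrbits_finite (isSL_D (by omega)), orbitSum_D hn,
      fun t => orbit (CartanMatrix.D n) (matchD n t 1),
      fun t => orbit (CartanMatrix.D n) (matchD n t (-1)),
      fun t => orbit (CartanMatrix.D n) (doubleD n t), nonemptyAdmissibleOrbits_D (by omega), ?_,
      fun t ht ht' => ⟨isTableLine_matchD hn ht ht', isTableLine_matchD hn ht ht', fun h => ?_,
        fun h => ⟨fun he => ?_, outerConjugate_matchD (by omega) h⟩, fun h => ?_, fun h => ?_⟩⟩,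
    ?_, ?_, ?_⟩
  · exact nonemptyAdmissibleOrbits_A n
  · exact fun t ht ht' s hs hs' => ⟨orbit_matchD_ne_orbit_doubleD (by omega) ht' hs hs',
      orbit_matchD_ne_orbit_doubleD (by omega) ht' hs hs'⟩
  · exact congrArg (orbit _) (matchD_eq_of_lt h (-1)).symm
  · refine matchD_neg_notMem_orbit (by omega) h ?_
    exact (Set.ext_iff.mp he _).mpr (mem_orbit_self (isSL_D (by omega))
      (isOrthogonalSet_matchD (by omega)).1)
  · exact isTableLine_doubleD hn ht ht' (quotient_doubleD_of_lt (by omega) h)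
  · exact isTableLine_doubleD hn ht ht' (quotient_doubleD_of_eq hn h)
  · rw [← cartanE_six]
    refine ⟨admissibleOrbits_finite table_six.isSL, orbitSum_six, _, _, _, ?_,
      isTableLine_six_one, isTableLine_six_two, isTableLine_six_four⟩
    rw [nonemptyAdmissibleOrbits_six]
    ext O
    simp
  · rw [← cartanE_seven]
    refine ⟨admissibleOrbits_finite table_seven.isSL, orbitSum_seven, _, _, _, _, _, ?_,
      isTableLine_seven_one, isTableLine_seven_two, isTableLine_seven_three,
      isTableLine_seven_four, isTableLine_seven_seven⟩
    rw [nonemptyAdmissibleOrbits_seven]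
    ext O
    simp
  · rw [← cartanE_eight]
    refine ⟨admissibleOrbits_finite table_eight.isSL, orbitSum_eight,
      _, _, _, _, ?_, isTableLine_eight_one, isTableLine_eight_two, isTableLine_eight_four, isTableLine_eight_eight⟩
    rw [nonemptyAdmissibleOrbits_eight]
    ext O
    simp
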